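/- **Setting.** Let $\alpha>0$, $\nu>0$, $3<p<\infty$, $1\le q\le\infty$ and $0<a<T^*<\infty$. For a matrix field $M$ write $(\operatorname{div}M)_j=\sum_i\partial_iM_{ij}$, and for a vector field $f$ on $\mathbb R^3$ write $(\nabla f)_{ij}=\partial_i f_j$, $\mathrm{Def}(f)=\nabla f+(\nabla f)^T$, $\mathrm{Rot}(f)=\nabla f-(\nabla f)^T$ and $$\tau^\alpha(f,g)=\frac{\alpha^2}{2}(1-\alpha^2\Delta)^{-1}\big[\mathrm{Def}(f)\,\mathrm{Rot}(g)+\mathrm{Def}(g)\,\mathrm{Rot}(f)\big].$$ For $s>0$ let $B^s_{p,q}=B^s_{p,q}(\mathbb R^3)$ be the inhomogeneous Besov space with norm $\|\Psi*f\|_{L^p}+\big\|\big(2^{js}\|\psi_j*f\|_{L^p}\big)_{j\ge0}\big\|_{\ell^q}$, where $\psi_0$ is any real radial Schwartz function with $\hat\psi_0\ge0$, $\operatorname{supp}\hat\psi_0\subset\{1/2<|\xi|<2\}$ and $\sum_{j\in\mathbb Z}\hat\psi_0(2^{-j}\xi)=1$ for $\xi\ne0$, and where $\psi_j(x)=2^{3j}\psi_0(2^jx)$,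 $\hat\Psi=1-\sum_{k\ge0}\hat\psi_k$. Let $v$ be a divergence free solution on $(0,T^*)\times\mathbb R^3$ of the LANS equation $$\partial_t v+\operatorname{div}(v\otimes v)+\operatorname{div}\tau^\alpha(v,v)=-(1-\alpha^2\Delta)^{-1}\nabla \pi+\nu\Delta v$$ (for some pressure $\pi$) such that $v$ is bounded and continuous from $[0,T^*)$ to $B^{3/p}_{p,q}$ and such that, for every $r>3/p$, $v$ is continuous from $(0,T^*)$ to $B^r_{p,q}$, the quantity $t^{(r-3/p)/2}\|v(t)\|_{B^r_{p,q}}$ is bounded on $(0,T^*)$, and it tends to $0$ as $t\to0^+$. Let $u$ be a divergence free solution on $(0,T^*)\times\mathbb R^3$ of the modified LANS (mLANS) equation $$\partial_t u+\operatorname{div}(u\otimes u+u\otimes v+v\otimes u)+\operatorname{div}\big(\tau^\alpha(u,u)+2\tau^\alpha(u,v)\big)=-(1-\alpha^2\Delta)^{-1}\nabla \pi'+\nu\Delta u$$ (for some pressure $\pi'$) such that, for every $T<T^*$, $u$ is bounded and continuous from $[0,T)$ to $B^{3/2}_{2,q}$. Both equations are understood weakly: after applying $1-\alpha^2\Delta$,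 they are tested with smooth compactly supported divergence free vector fields on $\mathbb R^3$, the time derivative being that of the resulting scalar functions of $t\in(0,T^*)$. **Theorem.** If $u(t)\in H^{3,2}(\mathbb R^3)$ for every $t\in[a,T^*)$, then $$\sup_{t\in[a,T^*)}\|u(t)\|_{B^{3/2}_{2,q}}<\infty .$$ -/

import Mathlib

open MeasureTheory Set Filter Topology
open scoped ENNReal ContDiff SchwartzMap FourierTransform Laplacian

noncomputable section

namespace MLANS

/-- Three dimensional Euclidean space. -/
abbrev R3 : Type := EuclideanSpace ℝ (Fin 3)

/-- 3 × 3 real matrices. -/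
abbrev Mat3 : Type := Matrix (Fin 3) (Fin 3) ℝ

/-! ### Littlewood-Paley decomposition and Besov spaces -/

/-- The Fourier transform of the real-valued Schwartz function `ψ`. -/
def symbol (ψ : 𝓢(R3, ℝ)) (ξ : R3) : ℂ := 𝓕 (fun x : R3 => (ψ x : ℂ)) ξ

/-- `ψ` generates a homogeneous dyadic partition of unity: `ψ` is radial (hence even), its Fourier
transform is nonnegative (it is real-valued because `ψ` is real and even), is supported in the
annulus `1/2 < |ξ| < 2`, and its dyadic dilates sum to `1` away from the origin. -/
structure IsLittlewoodPaley (ψ : 𝓢(R3, ℝ)) : Prop where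
  radial : ∀ x y : R3, ‖x‖ = ‖y‖ → ψ x = ψ y
  symbol_nonneg : ∀ ξ : R3, 0 ≤ (symbol ψ ξ).re
  symbol_support : tsupport (symbol ψ) ⊆ {ξ : R3 | 1 / 2 < ‖ξ‖ ∧ ‖ξ‖ < 2}
  symbol_sum : ∀ ξ : R3, ξ ≠ 0 → HasSum (fun j : ℤ => symbol ψ ((2 : ℝ) ^ (-j) • ξ)) 1

/-- The kernel `ψ_j(x) = 2^{3j} ψ(2^j x)` of the `j`-th Littlewood-Paley operator, `j ≥ 0`. -/
def dyadicKernel (ψ : 𝓢(R3, ℝ)) (j : ℕ) (x : R3) : ℝ :=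
  (2 : ℝ) ^ (3 * j) * ψ ((2 : ℝ) ^ j • x)

/-- The low frequency kernel `Ψ`, whose Fourier transform is `1 - ∑_{k ≥ 0} ψ̂(2^{-k} ξ)`. The
inverse Fourier transform is real-valued, since the symbol is real and even; taking the real part
only changes the codomain. -/
def lowKernel (ψ : 𝓢(R3, ℝ)) (x : R3) : ℝ :=
  (𝓕⁻ (fun ξ : R3 => 1 - ∑' k : ℕ, symbol ψ (((2 : ℝ) ^ k)⁻¹ • ξ)) x).re

/-- Convolution `K * f` of a scalar kernel and a vector field. -/
def conv (K : R3 → ℝ) (f : R3 → R3) : R3 → R3 :=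
  convolution K f (ContinuousLinearMap.lsmul ℝ ℝ) volume

/-- The `ℓ^q` norm of a sequence in `[0, ∞]`. -/
def seqNorm (q : ℝ≥0∞) (c : ℕ → ℝ≥0∞) : ℝ≥0∞ :=
  if q = ⊤ then ⨆ j, c j else (∑' j, c j ^ q.toReal) ^ (1 / q.toReal)

/-- The norm of the inhomogeneous Besov space `B^s_{p,q}(ℝ³)`, `s > 0`:
`‖Ψ * f‖_{L^p} + ‖(2^{js} ‖ψ_j * f‖_{L^p})_{j ≥ 0}‖_{ℓ^q}`, with values in `[0, ∞]`. -/
def besovNorm (ψ : 𝓢(R3, ℝ)) (s : ℝ) (p q : ℝ≥0∞) (f : R3 → R3) : ℝ≥0∞ :=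
  eLpNorm (conv (lowKernel ψ) f) p volume +
    seqNorm q (fun j => ENNReal.ofReal ((2 : ℝ) ^ ((j : ℝ) * s)) *
      eLpNorm (conv (dyadicKernel ψ j) f) p volume)

/-- Membership in `B^s_{p,q}(ℝ³)`, `s > 0`; as `s > 0`, the elements of this space belong to
`L^p`. -/
def MemBesov (ψ : 𝓢(R3, ℝ)) (s : ℝ) (p q : ℝ≥0∞) (f : R3 → R3) : Prop :=
  MemLp f p volume ∧ besovNorm ψ s p q f < ⊤

/-- `u ∈ C(I : B^s_{p,q}(ℝ³))`. -/
def ContBesov (ψ : 𝓢(R3, ℝ)) (s : ℝ) (p q : ℝ≥0∞) (I : Set ℝ) (u : ℝ → R3 → R3) : Prop :=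
  (∀ t ∈ I, MemBesov ψ s p q (u t)) ∧
    ∀ t ∈ I, Tendsto (fun τ => besovNorm ψ s p q (u τ - u t)) (𝓝[I] t) (𝓝 0)

/-- `u ∈ BC([0,T) : B^s_{p,q}(ℝ³))`. -/
def BCBesov (ψ : 𝓢(R3, ℝ)) (s : ℝ) (p q : ℝ≥0∞) (T : ℝ) (u : ℝ → R3 → R3) : Prop :=
  ContBesov ψ s p q (Ico 0 T) u ∧ (⨆ t ∈ Ico (0 : ℝ) T, besovNorm ψ s p q (u t)) < ⊤

/-- The space of `u ∈ C((0,T) : B^s_{p,q}(ℝ³))` such that `t^a ‖u(t)‖_{B^s_{p,q}}` is bounded on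
`(0,T)` and tends to zero as `t → 0+`. -/
def WeightedBesov (ψ : 𝓢(R3, ℝ)) (a s : ℝ) (p q : ℝ≥0∞) (T : ℝ) (u : ℝ → R3 → R3) : Prop :=
  ContBesov ψ s p q (Ioo 0 T) u ∧
    (⨆ t ∈ Ioo (0 : ℝ) T, ENNReal.ofReal (t ^ a) * besovNorm ψ s p q (u t)) < ⊤ ∧
    Tendsto (fun t => ENNReal.ofReal (t ^ a) * besovNorm ψ s p q (u t)) (𝓝[>] 0) (𝓝 0)

/-- Membership of a real vector field in the Sobolev (Bessel potential) space `H^{s,2}(ℝ³)`,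
`s ≥ 0`, component by component. -/
def MemH (s : ℝ) (f : R3 → R3) : Prop :=
  ∀ i : Fin 3, ∃ hf : MemLp (fun x => (f x i : ℂ)) 2 (volume : Measure R3),
    TemperedDistribution.MemSobolev s 2 (Lp.toTemperedDistribution (hf.toLp _))

/-! ### Weak derivatives and tensors -/

/-- The classical partial derivative `∂_i ζ`. -/
def partialD (i : Fin 3) (ζ : R3 → ℝ) (x : R3) : ℝ :=
  fderiv ℝ ζ x (EuclideanSpace.single i 1)

/-- The gradient of a differentiable vector field, `(∇φ)_{ij} = ∂_i φ_j`. -/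
def grad (φ : R3 → R3) (x : R3) : Mat3 :=
  Matrix.of fun i j => partialD i (fun y => φ y j) x

/-- Smooth compactly supported functions. -/
def IsTest {F : Type*} [NormedAddCommGroup F] [NormedSpace ℝ F] (ζ : R3 → F) : Prop :=
  ContDiff ℝ ∞ ζ ∧ HasCompactSupport ζ

/-- `G` is the weak gradient of `f`, with `G_{ij} = ∂_i f_j`. -/
def IsWeakGrad (f : R3 → R3) (G : R3 → Mat3) : Prop :=
  ∀ i j : Fin 3, LocallyIntegrable (fun x => f x j) volume ∧
    LocallyIntegrable (fun x => G x i j) volume ∧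
    ∀ ζ : R3 → ℝ, IsTest ζ → ∫ x, f x j * partialD i ζ x = -∫ x, G x i j * ζ x

/-- `div f = 0` in the sense of distributions. -/
def IsDivFree (f : R3 → R3) : Prop :=
  LocallyIntegrable f volume ∧
    ∀ ζ : R3 → ℝ, IsTest ζ → ∫ x, ∑ i, f x i * partialD i ζ x = 0

/-- Smooth compactly supported divergence free vector fields. -/
def IsDivFreeTest (φ : R3 → R3) : Prop :=
  IsTest φ ∧ ∀ x, ∑ i, grad φ x i i = 0

/-- `(f ⊗ g)_{ij} = f_i g_j`. -/
def tensor (f g : R3) : Mat3 := Matrix.of fun i j => f i * g j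

/-- The contraction `A : B = ∑_{ij} A_{ij} B_{ij}`. -/
def contract (A B : Mat3) : ℝ := ∑ i, ∑ j, A i j * B i j

/-- `Def = ∇f + (∇f)ᵀ`, for `A = ∇f`. -/
def Deform (A : Mat3) : Mat3 := A + A.transpose

/-- `Rot = ∇f - (∇f)ᵀ`, for `A = ∇f`. -/
def Rot (A : Mat3) : Mat3 := A - A.transpose

/-- `(1 - α² Δ) τ^α(f,g) = (α²/2) (Def f · Rot g + Def g · Rot f)`, for `A = ∇f`, `B = ∇g`. -/
def stress (α : ℝ) (A B : Mat3) : Mat3 :=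
  (α ^ 2 / 2) • (Deform A * Rot B + Deform B * Rot A)

/-- `(1 - α² Δ) φ`. -/
def helm (α : ℝ) (φ : R3 → R3) (x : R3) : R3 := φ x - α ^ 2 • Δ φ x

/-! ### The LANS and mLANS equations -/

/-- `w` solves, for some pressure `p`, the equation
`∂_t w + div M + (1 - α²Δ)⁻¹ div S = ν Δ w - (1 - α²Δ)⁻¹ ∇p`, `(div M)_j = ∑_i ∂_i M_{ij}`,
on `(0,T) × ℝ³`, in the weak sense: the operator `1 - α²Δ` is applied to the equation, and the
result is tested with divergence free vector fields, which removes the pressure. -/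
def WeakEq (α ν T : ℝ) (w : ℝ → R3 → R3) (M S : ℝ → R3 → Mat3) : Prop :=
  ∀ φ : R3 → R3, IsDivFreeTest φ → ∀ t ∈ Ioo (0 : ℝ) T,
    HasDerivAt (fun τ => ∫ x, inner ℝ (w τ x) (helm α φ x))
      (∫ x, (contract (M t x) (grad (helm α φ) x) + contract (S t x) (grad φ x)
        + ν * inner ℝ (w t x) (Δ (helm α φ) x))) t

/-- `v` is a divergence free solution of the LANS equation
`∂_t v + div (v ⊗ v) + div τ^α(v,v) = -(1 - α²Δ)⁻¹ ∇p + ν Δ v` on `(0,T) × ℝ³`. -/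
def IsLANSSolution (α ν T : ℝ) (v : ℝ → R3 → R3) : Prop :=
  (∀ t ∈ Ico (0 : ℝ) T, IsDivFree (v t)) ∧
  ∃ Dv : ℝ → R3 → Mat3, (∀ t ∈ Ioo (0 : ℝ) T, IsWeakGrad (v t) (Dv t)) ∧
    WeakEq α ν T v (fun t x => tensor (v t x) (v t x))
      (fun t x => stress α (Dv t x) (Dv t x))

/-- `u` is a divergence free solution of the modified LANS equation
`∂_t u + div (u ⊗ u + u ⊗ v + v ⊗ u) + div (τ^α(u,u) + 2 τ^α(u,v))
  = -(1 - α²Δ)⁻¹ ∇p + ν Δ u` on `(0,T) × ℝ³`. -/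
def IsMLANSSolution (α ν T : ℝ) (v u : ℝ → R3 → R3) : Prop :=
  (∀ t ∈ Ico (0 : ℝ) T, IsDivFree (u t)) ∧
  ∃ Du Dv : ℝ → R3 → Mat3, (∀ t ∈ Ioo (0 : ℝ) T, IsWeakGrad (u t) (Du t)) ∧
    (∀ t ∈ Ioo (0 : ℝ) T, IsWeakGrad (v t) (Dv t)) ∧
    WeakEq α ν T u
      (fun t x => tensor (u t x) (u t x) + tensor (u t x) (v t x) + tensor (v t x) (u t x))
      (fun t x => stress α (Du t x) (Du t x) + (2 : ℝ) • stress α (Du t x) (Dv t x))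

end MLANS

end

open MLANS

noncomputable section

namespace MLANS


/-! ### The Fourier transform on `L²` in terms of functions -/

/-! Put `κ = (1 + |ξ|²)^(1/6)`, so that the `L²` norm of `κ^m û`, called `sob m`, is a norm of
`H^{m/3}`. Since `4/3 < 3/2 < 5/3`, the norm of `B^{3/2}_{2,q}` dominates `sob 4` and is dominated
by `sob 5`, for every `q ≥ 1` (`sob_le_besovNorm`, `besovNorm_le_sob`). It is therefore enough to
bound `u` in `H^{5/3}` uniformly up to `T*`, knowing that its `H^{4/3}` norm is bounded on each `[0,
T)` with `T < T*`, by a constant that may blow up with `T`.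

Away from the initial time, `v` has smooth representatives whose derivatives of order at most two
are bounded uniformly up to `T*` (`exists_smooth_weighted`, by Bernstein inequalities). The terms
linear in `u` are then of lower order, with a constant `B` that does not depend on `T`
(`exists_energySolution`).

The first energy is `∫ |u|² + α² |∇u|²`, at the level of `H¹`. The quadratic terms contribute
nothing to its balance: as a trilinear form in three waves whose frequencies add up to zero, their
symbol sums to zero over the six permutations of the waves when the amplitudes are divergence free
(`triSym_sum_eq_zero`, `integral_quadE_eq_zero`). Only the linear terms remain, viscosity absorbs
them up to a multiple of the energy, and Grönwall's inequality bounds the `H¹` norm and the time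
integral of the squared `H²` norm, uniformly in `T` (`energy_le`, `exists_energy_bound`).

The second energy `Y` is at the level of `H^{5/3}`. No cancellation is used here. Product estimates
(`tri_pow_le`, resting on `κ^{-5} ∈ L²`) and absorption into the `H^{8/3}` dissipation give `Y' ≤ C
(1 + ‖u‖²_{H^{4/3}}) ‖u‖²_{H²}` (`rate_four_le`). Interpolation bounds `‖u‖²_{H^{4/3}}` by `‖u‖_{H¹}
‖u‖_{H^{5/3}}`, hence by a multiple of `1 + Y`, and Grönwall's inequality with the integrable
coefficient `‖u‖²_{H²}` closes the estimate (`exists_high_energy_bound`). The initial value comes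
from a time shortly before `a` at which `u` is in `H²`. Almost every time is such
(`exists_regular_time`).

As the equation holds only weakly, these balances are derived for energies truncated to frequency
annuli `1/(n+1) < |ξ| < n+1`. Testing with `curl curl (ζ e_l)` and a density argument in a weighted
`L²` space make each truncated energy differentiable in time (`hasDerivAt_energy`). The limit `n →
∞` is taken after integration in time. The cancellation holds only in this limit, so a cruder
non-uniform estimate (`exists_integral_mom_le`) is needed first, to make the dissipation integrable
and provide a dominating function. -/

/-- `F` is the Fourier transform of the square integrable function `f`. -/
structure IsFT (f F : R3 → ℂ) : Prop where
  memLp : MemLp f 2 volume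
  memLp_ft : MemLp F 2 volume
  pair : ∀ g : 𝓢(R3, ℂ), ∫ ξ, F ξ * g ξ = ∫ x, f x * 𝓕 g x

/-- The Fourier transform of a square integrable function (zero for other functions). -/
def ft (f : R3 → ℂ) : R3 → ℂ :=
  open scoped Classical in
  if h : MemLp f 2 volume then ((𝓕 (h.toLp f) : Lp ℂ 2 (volume : Measure R3)) : R3 → ℂ) else 0

theorem stronglyMeasurable_ft (f : R3 → ℂ) : StronglyMeasurable (ft f) := by
  unfold ft
  split_ifs
  · exact Lp.stronglyMeasurable _
  · exact stronglyMeasurable_zero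

theorem measurable_ft (f : R3 → ℂ) : Measurable (ft f) := (stronglyMeasurable_ft f).measurable

theorem isFT_ft {f : R3 → ℂ} (h : MemLp f 2 volume) : IsFT f (ft f) := by
  refine ⟨h, ?_, fun g => ?_⟩
  · rw [ft, dif_pos h]; exact Lp.memLp _
  · rw [ft, dif_pos h]
    have := congrArg (fun T : 𝓢'(R3, ℂ) => T g)
      (Lp.fourier_toTemperedDistribution_eq (h.toLp f))
    simp only [TemperedDistribution.fourier_apply, Lp.toTemperedDistribution_apply,
      smul_eq_mul] at this
    rw [← (integral_congr_ae (by filter_upwards with x; rw [mul_comm]) :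
      ∫ x, g x * (𝓕 (h.toLp f) : Lp ℂ 2 (volume : Measure R3)) x = _), ← this]
    apply integral_congr_ae
    filter_upwards [h.coeFn_toLp] with x hx
    rw [hx, mul_comm]

theorem MemLp.mul_schwartz {f : R3 → ℂ} (hf : MemLp f 2 volume) (g : 𝓢(R3, ℂ)) :
    Integrable (fun x => f x * g x) volume :=
  hf.integrable_mul (g.memLp 2 volume)

theorem ae_eq_of_pair_schwartz {F G : R3 → ℂ} (hF : LocallyIntegrable F volume)
    (hG : LocallyIntegrable G volume)
    (h : ∀ g : 𝓢(R3, ℂ), ∫ ξ, F ξ * g ξ = ∫ ξ, G ξ * g ξ) : F =ᵐ[volume] G := by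
  apply ae_eq_of_integral_contDiff_smul_eq hF hG
  intro g hg hgc
  have hg₁ : HasCompactSupport (Complex.ofRealCLM ∘ g) := hgc.comp_left rfl
  have hg₂ : ContDiff ℝ ∞ (Complex.ofRealCLM ∘ g) := by fun_prop
  have := h (hg₁.toSchwartzMap hg₂)
  simpa [mul_comm] using this

theorem IsFT.unique {f F G : R3 → ℂ} (h : IsFT f F) (h' : IsFT f G) : F =ᵐ[volume] G :=
  ae_eq_of_pair_schwartz (h.memLp_ft.locallyIntegrable (by norm_num))
    (h'.memLp_ft.locallyIntegrable (by norm_num)) fun g => by rw [h.pair, h'.pair]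

theorem IsFT.ae_eq_ft {f F : R3 → ℂ} (h : IsFT f F) : F =ᵐ[volume] ft f :=
  h.unique (isFT_ft h.memLp)

theorem IsFT.congr {f F g G : R3 → ℂ} (h : IsFT f F) (hf : f =ᵐ[volume] g)
    (hF : F =ᵐ[volume] G) : IsFT g G := by
  refine ⟨h.memLp.ae_eq hf, h.memLp_ft.ae_eq hF, fun φ => ?_⟩
  calc _ = ∫ ξ, F ξ * φ ξ := integral_congr_ae (by filter_upwards [hF] with x hx; rw [hx])
    _ = _ := h.pair φ
    _ = _ := integral_congr_ae (by filter_upwards [hf] with x hx; rw [hx])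

theorem IsFT.coe_fourier {f F : R3 → ℂ} (h : IsFT f F) :
    𝓕 (h.memLp.toLp f) = h.memLp_ft.toLp F := by
  apply Lp.ext
  have h1 := h.ae_eq_ft
  rw [ft, dif_pos h.memLp] at h1
  exact h1.symm.trans h.memLp_ft.coeFn_toLp.symm

theorem IsFT.eLpNorm_eq {f F : R3 → ℂ} (h : IsFT f F) :
    eLpNorm F 2 volume = eLpNorm f 2 volume := by
  have := Lp.norm_fourier_eq (h.memLp.toLp f)
  rw [h.coe_fourier, Lp.norm_toLp, Lp.norm_toLp,
    ENNReal.toReal_eq_toReal_iff' h.memLp_ft.2.ne h.memLp.2.ne] at this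
  exact this

theorem IsFT.integral_conj_mul {f F g G : R3 → ℂ} (hf : IsFT f F) (hg : IsFT g G) :
    ∫ ξ, (starRingEnd ℂ) (F ξ) * G ξ = ∫ x, (starRingEnd ℂ) (f x) * g x := by
  have := Lp.inner_fourier_eq (hf.memLp.toLp f) (hg.memLp.toLp g)
  rw [hf.coe_fourier, hg.coe_fourier, L2.inner_def, L2.inner_def] at this
  have key : ∀ {a b : R3 → ℂ} (ha : MemLp a 2 volume) (hb : MemLp b 2 volume),
      ∫ x, inner ℂ (ha.toLp a x) (hb.toLp b x) = ∫ x, (starRingEnd ℂ) (a x) * b x := by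
    intro a b ha hb
    apply integral_congr_ae
    filter_upwards [ha.coeFn_toLp, hb.coeFn_toLp] with x h1 h2
    rw [h1, h2, RCLike.inner_apply, mul_comm]
  rwa [key, key] at this

/-- Composition of a Schwartz function with `x ↦ -x`. -/
def sneg (g : 𝓢(R3, ℂ)) : 𝓢(R3, ℂ) :=
  SchwartzMap.compCLMOfContinuousLinearEquiv ℂ (ContinuousLinearEquiv.neg ℝ (M := R3)) g

@[simp] theorem sneg_apply (g : 𝓢(R3, ℂ)) (x : R3) : sneg g x = g (-x) := by
  simp [sneg]

/-- Complex conjugate of a Schwartz function. -/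
def sconj (g : 𝓢(R3, ℂ)) : 𝓢(R3, ℂ) :=
  SchwartzMap.postcompCLM (𝕜 := ℝ) (Complex.conjCLE : ℂ →L[ℝ] ℂ) g

@[simp] theorem sconj_apply (g : 𝓢(R3, ℂ)) (x : R3) : sconj g x = (starRingEnd ℂ) (g x) := by
  simp [sconj]

theorem fourier_apply_integral (g : R3 → ℂ) (ξ : R3) :
    𝓕 g ξ = ∫ x, Complex.exp (-(2 * Real.pi * inner ℝ x ξ : ℝ) * Complex.I) * g x := by
  rw [Real.fourier_eq']
  simp

theorem fourier_sconj_sneg (g : 𝓢(R3, ℂ)) (x : R3) :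
    𝓕 (sconj (sneg g)) x = (starRingEnd ℂ) (𝓕 g x) := by
  rw [SchwartzMap.fourier_coe, SchwartzMap.fourier_coe, fourier_apply_integral,
    fourier_apply_integral, ← integral_conj, ← integral_neg_eq_self]
  congr 1; ext y
  have e2 : (starRingEnd ℂ) 2 = 2 := Complex.conj_ofNat 2
  simp [← Complex.exp_conj, e2]

theorem fourier_sneg (g : 𝓢(R3, ℂ)) (x : R3) : 𝓕 (sneg g) x = 𝓕 g (-x) := by
  rw [SchwartzMap.fourier_coe, SchwartzMap.fourier_coe, fourier_apply_integral,
    fourier_apply_integral, ← integral_neg_eq_self]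
  congr 1; ext y
  simp

theorem MemLp.comp_neg {F : R3 → ℂ} {p : ℝ≥0∞} (h : MemLp F p volume) :
    MemLp (fun ξ => F (-ξ)) p volume :=
  h.comp_measurePreserving (Measure.measurePreserving_neg volume)

theorem MemLp.conj {F : R3 → ℂ} {p : ℝ≥0∞} (h : MemLp F p volume) :
    MemLp (fun ξ => (starRingEnd ℂ) (F ξ)) p volume := by
  exact h.star

theorem IsFT.conj {f F : R3 → ℂ} (h : IsFT f F) :
    IsFT (fun x => (starRingEnd ℂ) (f x)) (fun ξ => (starRingEnd ℂ) (F (-ξ))) := by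
  refine ⟨MemLp.conj h.memLp, MemLp.conj (MemLp.comp_neg h.memLp_ft), fun g => ?_⟩
  have := congrArg (starRingEnd ℂ) (h.pair (sconj (sneg g)))
  rw [← integral_conj, ← integral_conj, ← integral_neg_eq_self] at this
  simpa [fourier_sconj_sneg] using this

/-- Parseval's formula in bilinear form. -/
theorem IsFT.integral_mul {f F g G : R3 → ℂ} (hf : IsFT f F) (hg : IsFT g G) :
    ∫ x, f x * g x = ∫ ξ, F ξ * G (-ξ) := by
  have := hf.conj.integral_conj_mul hg
  simp only [Complex.conj_conj] at this
  rw [← this, ← integral_neg_eq_self]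
  simp

theorem IsFT.neg_arg {f F : R3 → ℂ} (h : IsFT f F) :
    IsFT (fun x => f (-x)) (fun ξ => F (-ξ)) := by
  refine ⟨MemLp.comp_neg h.memLp, MemLp.comp_neg h.memLp_ft, fun g => ?_⟩
  have := h.pair (sneg g)
  rw [← integral_neg_eq_self, ← integral_neg_eq_self (fun x => f x * _)] at this
  simpa [fourier_sneg] using this

/-- The Fourier transform of a real-valued function is Hermitian. -/
theorem IsFT.hermitian {f : R3 → ℝ} {F : R3 → ℂ} (h : IsFT (fun x => (f x : ℂ)) F) :
    ∀ᵐ ξ, F (-ξ) = (starRingEnd ℂ) (F ξ) := by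
  have h1 := h.conj
  simp only [Complex.conj_ofReal] at h1
  filter_upwards [h1.unique h] with ξ hξ
  rw [← hξ, Complex.conj_conj]

theorem isFT_schwartz (g : 𝓢(R3, ℂ)) : IsFT g (𝓕 g : 𝓢(R3, ℂ)) := by
  refine ⟨g.memLp 2 volume, SchwartzMap.memLp (𝓕 g) 2 volume, fun φ => ?_⟩
  exact SchwartzMap.integral_fourier_mul_eq g φ

theorem IsFT.add {f F g G : R3 → ℂ} (hf : IsFT f F) (hg : IsFT g G) :
    IsFT (fun x => f x + g x) (fun ξ => F ξ + G ξ) := by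
  refine ⟨hf.memLp.add hg.memLp, hf.memLp_ft.add hg.memLp_ft, fun φ => ?_⟩
  simp only [add_mul]
  rw [integral_add (MemLp.mul_schwartz hf.memLp_ft φ) (MemLp.mul_schwartz hg.memLp_ft φ),
    integral_add (MemLp.mul_schwartz hf.memLp _) (MemLp.mul_schwartz hg.memLp _),
    hf.pair, hg.pair]

theorem IsFT.const_mul {f F : R3 → ℂ} (hf : IsFT f F) (c : ℂ) :
    IsFT (fun x => c * f x) (fun ξ => c * F ξ) := by
  refine ⟨hf.memLp.const_mul c, hf.memLp_ft.const_mul c, fun φ => ?_⟩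
  simp only [mul_assoc]
  rw [integral_const_mul, integral_const_mul, hf.pair]

theorem IsFT.neg {f F : R3 → ℂ} (hf : IsFT f F) : IsFT (fun x => - f x) (fun ξ => - F ξ) := by
  simpa using hf.const_mul (-1)

theorem IsFT.sub {f F g G : R3 → ℂ} (hf : IsFT f F) (hg : IsFT g G) :
    IsFT (fun x => f x - g x) (fun ξ => F ξ - G ξ) := by
  simpa [sub_eq_add_neg] using hf.add hg.neg

/-- Every square integrable function is a Fourier transform. -/
theorem exists_isFT {F : R3 → ℂ} (hF : MemLp F 2 volume) : ∃ f, IsFT f F := by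
  refine ⟨fun x => ft F (-x), (MemLp.comp_neg (isFT_ft hF).memLp_ft), hF, fun g => ?_⟩
  rw [← integral_neg_eq_self (fun x => ft F (-x) * _)]
  simp only [neg_neg]
  exact (isFT_ft hF).integral_mul (isFT_schwartz g)

/-- Modulation becomes translation. -/
theorem IsFT.modulate {f F : R3 → ℂ} (h : IsFT f F) (ζ : R3) :
    IsFT (fun x => Complex.exp (-(2 * Real.pi * inner ℝ x ζ : ℝ) * Complex.I) * f x)
      (fun ξ => F (ξ + ζ)) := by
  have hn : ∀ x : R3, ‖Complex.exp (-(2 * Real.pi * inner ℝ x ζ : ℝ) * Complex.I)‖ = 1 := fun x => by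
    rw [← Complex.ofReal_neg, Complex.norm_exp_ofReal_mul_I]
  refine ⟨?_, h.memLp_ft.comp_measurePreserving (measurePreserving_add_right volume ζ),
    fun g => ?_⟩
  · refine h.memLp.of_le (AEStronglyMeasurable.mul ?_ h.memLp.1) ?_
    · exact Continuous.aestronglyMeasurable (by fun_prop)
    · filter_upwards with x
      rw [norm_mul, hn, one_mul]
  · have h1 := h.pair (SchwartzMap.compSubConstCLM ℂ ζ g)
    rw [← integral_add_right_eq_self _ ζ] at h1
    simp only [SchwartzMap.compSubConstCLM_apply, add_sub_cancel_right] at h1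
    rw [h1]
    congr 1; ext x
    rw [mul_assoc, mul_left_comm]
    congr 1
    rw [SchwartzMap.fourier_coe, SchwartzMap.fourier_coe, fourier_apply_integral,
      fourier_apply_integral, ← integral_add_right_eq_self _ ζ, ← integral_const_mul]
    congr 1; ext y
    simp only [SchwartzMap.compSubConstCLM_apply, add_sub_cancel_right]
    rw [← mul_assoc, ← Complex.exp_add]
    congr 2
    rw [inner_add_left, real_inner_comm x ζ]
    push_cast; ring

/-- The Fourier transform of a product of square integrable functions is the convolution of the
Fourier transforms, everywhere. -/
theorem IsFT.fourier_mul {f F g G : R3 → ℂ} (hf : IsFT f F) (hg : IsFT g G) (ζ : R3) :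
    𝓕 (fun x => f x * g x) ζ = ∫ ξ, F ξ * G (ζ - ξ) := by
  rw [fourier_apply_integral]
  have := hf.integral_mul (hg.modulate ζ)
  rw [← (integral_congr_ae (by filter_upwards with x; ring) :
    ∫ x, f x * (Complex.exp (-(2 * Real.pi * inner ℝ x ζ : ℝ) * Complex.I) * g x) = _), this]
  simp only [neg_add_eq_sub]


/-! ### Weights and the trilinear estimate -/

/-- The weight `(1 + |ξ|²)^{1/6}`, so that the norm of `H^{m/3}` is the `L²` norm of `κ^m û`. -/
def κ (ξ : R3) : ℝ := (1 + ‖ξ‖ ^ 2) ^ (1 / 6 : ℝ)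

theorem one_le_κ (ξ : R3) : 1 ≤ κ ξ :=
  Real.one_le_rpow (by nlinarith [sq_nonneg ‖ξ‖]) (by norm_num)

theorem κ_pos (ξ : R3) : 0 < κ ξ := one_pos.trans_le (one_le_κ ξ)

theorem κ_pow_six (ξ : R3) : κ ξ ^ 6 = 1 + ‖ξ‖ ^ 2 := by
  rw [κ, ← Real.rpow_natCast, ← Real.rpow_mul (by positivity)]
  norm_num

@[simp] theorem κ_neg (ξ : R3) : κ (-ξ) = κ ξ := by simp [κ]

@[fun_prop]
theorem continuous_κ : Continuous κ := by
  unfold κ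
  refine Continuous.rpow_const (by fun_prop) fun x => Or.inr (by norm_num)

@[fun_prop]
theorem measurable_κ : Measurable κ := continuous_κ.measurable

theorem norm_le_κ_pow (ξ : R3) : ‖ξ‖ ≤ κ ξ ^ 3 := by
  refine le_of_sq_le_sq ?_ (by have := κ_pos ξ; positivity) |> fun h => h
  rw [← pow_mul, κ_pow_six]; linarith

theorem κ_pow_mono (ξ : R3) {m n : ℕ} (h : m ≤ n) : κ ξ ^ m ≤ κ ξ ^ n :=
  pow_le_pow_right₀ (one_le_κ ξ) h

theorem one_le_κ_pow (ξ : R3) (n : ℕ) : 1 ≤ κ ξ ^ n := one_le_pow₀ (one_le_κ ξ)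

theorem κ_add_le (ξ η : R3) : κ (ξ + η) ≤ 2 * max (κ ξ) (κ η) := by
  have hp : 0 ≤ max (κ ξ) (κ η) := (κ_pos ξ).le.trans (le_max_left _ _)
  refine le_of_pow_le_pow_left₀ (n := 6) (by norm_num) (by positivity) ?_
  rw [κ_pow_six, mul_pow]
  have h1 : κ ξ ^ 6 ≤ max (κ ξ) (κ η) ^ 6 :=
    pow_le_pow_left₀ (κ_pos ξ).le (le_max_left _ _) 6
  have h2 : κ η ^ 6 ≤ max (κ ξ) (κ η) ^ 6 :=
    pow_le_pow_left₀ (κ_pos η).le (le_max_right _ _) 6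
  rw [κ_pow_six] at h1 h2
  have h3 := norm_add_le ξ η
  have : ‖ξ + η‖ ^ 2 ≤ (‖ξ‖ + ‖η‖) ^ 2 := pow_le_pow_left₀ (norm_nonneg _) h3 2
  nlinarith [sq_nonneg (‖ξ‖ - ‖η‖), sq_nonneg ‖ξ‖, sq_nonneg ‖η‖]

theorem κ_add_pow_le (ξ η : R3) (m : ℕ) : κ (ξ + η) ^ m ≤ 2 ^ m * (κ ξ ^ m + κ η ^ m) := by
  calc κ (ξ + η) ^ m ≤ (2 * max (κ ξ) (κ η)) ^ m :=
        pow_le_pow_left₀ (κ_pos _).le (κ_add_le ξ η) m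
    _ = 2 ^ m * max (κ ξ) (κ η) ^ m := mul_pow _ _ _
    _ ≤ _ := by
      have h1 := (κ_pos ξ).le
      have h2 := (κ_pos η).le
      gcongr
      rcases le_total (κ ξ) (κ η) with h | h
      · rw [max_eq_right h]; linarith [pow_nonneg h1 m]
      · rw [max_eq_left h]; linarith [pow_nonneg h2 m]

/-- The weight `κ` with values in `[0, ∞]`. -/
def κe (ξ : R3) : ℝ≥0∞ := ENNReal.ofReal (κ ξ)

@[fun_prop]
theorem measurable_κe : Measurable κe := measurable_κ.ennreal_ofReal

theorem one_le_κe (ξ : R3) : 1 ≤ κe ξ := by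
  rw [κe, ENNReal.one_le_ofReal]; exact one_le_κ ξ

theorem κe_ne_top (ξ : R3) : κe ξ ≠ ⊤ := ENNReal.ofReal_ne_top

theorem κe_ne_zero (ξ : R3) : κe ξ ≠ 0 := (one_pos.trans_le (one_le_κe ξ)).ne'

theorem κe_pow (ξ : R3) (m : ℕ) : κe ξ ^ m = ENNReal.ofReal (κ ξ ^ m) := by
  rw [κe, ENNReal.ofReal_pow (κ_pos ξ).le]

theorem κe_pow_mono (ξ : R3) {m n : ℕ} (h : m ≤ n) : κe ξ ^ m ≤ κe ξ ^ n :=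
  pow_le_pow_right₀ (one_le_κe ξ) h

theorem one_le_κe_pow (ξ : R3) (n : ℕ) : 1 ≤ κe ξ ^ n := one_le_pow₀ (one_le_κe ξ)

theorem κe_add_pow_le (ξ η : R3) (m : ℕ) :
    κe (ξ + η) ^ m ≤ 2 ^ m * (κe ξ ^ m + κe η ^ m) := by
  have h1 := pow_nonneg (κ_pos ξ).le m
  have h2 := pow_nonneg (κ_pos η).le m
  rw [κe_pow, κe_pow, κe_pow, ← ENNReal.ofReal_add h1 h2]
  refine (ENNReal.ofReal_le_ofReal (κ_add_pow_le ξ η m)).trans ?_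
  rw [ENNReal.ofReal_mul (by positivity), ENNReal.ofReal_pow (by norm_num)]
  simp

theorem enorm_le_κe_pow (ξ : R3) : ‖ξ‖ₑ ≤ κe ξ ^ 3 := by
  rw [κe_pow, ← ofReal_norm]
  exact ENNReal.ofReal_le_ofReal (norm_le_κ_pow ξ)

/-- The `L²` norm of a function with values in `[0, ∞]`. -/
def n2 (f : R3 → ℝ≥0∞) : ℝ≥0∞ := (∫⁻ ξ, f ξ ^ 2) ^ (1 / 2 : ℝ)

theorem n2_sq (f : R3 → ℝ≥0∞) : n2 f ^ 2 = ∫⁻ ξ, f ξ ^ 2 := by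
  rw [n2, ← ENNReal.rpow_natCast, ← ENNReal.rpow_mul]
  norm_num

theorem n2_le_iff {f : R3 → ℝ≥0∞} {c : ℝ≥0∞} : n2 f ≤ c ↔ ∫⁻ ξ, f ξ ^ 2 ≤ c ^ 2 := by
  rw [← n2_sq]
  exact (ENNReal.pow_le_pow_left_iff two_ne_zero).symm

theorem n2_mono {f g : R3 → ℝ≥0∞} (h : ∀ᵐ ξ, f ξ ≤ g ξ) : n2 f ≤ n2 g := by
  unfold n2
  gcongr ?_ ^ _
  apply lintegral_mono_ae
  filter_upwards [h] with ξ hξ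
  gcongr

theorem n2_eLpNorm {E : Type*} [NormedAddCommGroup E] (f : R3 → E) :
    n2 (fun ξ => ‖f ξ‖ₑ) = eLpNorm f 2 volume := by
  rw [eLpNorm_eq_lintegral_rpow_enorm_toReal (by norm_num) (by norm_num), n2]
  simp

theorem n2_const_mul (c : ℝ≥0∞) (hc : c ≠ ⊤) (f : R3 → ℝ≥0∞) :
    n2 (fun ξ => c * f ξ) = c * n2 f := by
  unfold n2
  simp only [mul_pow]
  rw [lintegral_const_mul' _ _ (by simp [hc]), ENNReal.mul_rpow_of_nonneg _ _ (by norm_num),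
    ← ENNReal.rpow_natCast, ← ENNReal.rpow_mul]
  norm_num

theorem lintegral_mul_le_n2 {f g : R3 → ℝ≥0∞} (hf : AEMeasurable f volume)
    (hg : AEMeasurable g volume) : ∫⁻ ξ, f ξ * g ξ ≤ n2 f * n2 g := by
  have := ENNReal.lintegral_mul_le_Lp_mul_Lq volume Real.HolderConjugate.two_two hf hg
  simpa [n2] using this

theorem n2_add_le {f g : R3 → ℝ≥0∞} (hf : AEMeasurable f volume)
    (hg : AEMeasurable g volume) : n2 (fun ξ => f ξ + g ξ) ≤ n2 f + n2 g := by
  have := ENNReal.lintegral_Lp_add_le hf hg (p := 2) (by norm_num)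
  simpa [n2] using this

theorem n2_sum_le {ι : Type*} (s : Finset ι) {f : ι → R3 → ℝ≥0∞}
    (hf : ∀ i, AEMeasurable (f i) volume) :
    n2 (fun ξ => ∑ i ∈ s, f i ξ) ≤ ∑ i ∈ s, n2 (f i) := by
  classical
  induction s using Finset.induction_on with
  | empty => simp [n2]
  | insert a s ha ih =>
    simp only [Finset.sum_insert ha]
    exact (n2_add_le (hf a) (Finset.aemeasurable_fun_sum _ fun i _ => hf i)).trans (by gcongr)

theorem n2_comp_sub_right (g : R3 → ℝ≥0∞) (ξ : R3) : n2 (fun ζ => g (ζ - ξ)) = n2 g := by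
  rw [n2, n2, lintegral_sub_right_eq_self (fun ζ => g ζ ^ 2)]

theorem n2_comp_sub_left (g : R3 → ℝ≥0∞) (ξ : R3) : n2 (fun ζ => g (ξ - ζ)) = n2 g := by
  rw [n2, n2, lintegral_sub_left_eq_self (fun ζ => g ζ ^ 2)]

/-- The norm of `κ^{-5}` in `L²`. -/
def Kinv : ℝ≥0∞ := n2 fun ξ => (κe ξ)⁻¹ ^ 5

/-- The square `κ^{-10}` equals `(1 + |ξ|²)^{-5/3}`, which is integrable on `ℝ³` because `10/3 > 3`.
This is the only place where the dimension meets the choice of five powers of `κ`: `5/3` derivatives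
exceed the critical `3/2`. -/
theorem Kinv_lt_top : Kinv < ⊤ := by
  rw [Kinv, n2]
  apply ENNReal.rpow_lt_top_of_nonneg (by norm_num)
  have h := integrable_rpow_neg_one_add_norm_sq (E := R3) (μ := volume) (r := 10 / 3)
    (by simp; norm_num)
  have h2 := h.lintegral_lt_top
  refine ne_of_lt (lt_of_le_of_lt (lintegral_mono fun ξ => ?_) h2)
  rw [← pow_mul, κe, ← ENNReal.ofReal_inv_of_pos (κ_pos ξ), ← ENNReal.ofReal_pow
    (by have := κ_pos ξ; positivity)]
  apply ENNReal.ofReal_le_ofReal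
  apply le_of_eq
  rw [κ, inv_pow, ← Real.rpow_natCast, ← Real.rpow_mul (by positivity), ← Real.rpow_neg
    (by positivity)]
  norm_num

/-- The trilinear form `∫∫ f(ξ) g(ζ - ξ) k(ζ) dξ dζ`. -/
def tri (f g k : R3 → ℝ≥0∞) : ℝ≥0∞ := ∫⁻ ζ, (∫⁻ ξ, f ξ * g (ζ - ξ)) * k ζ

@[fun_prop]
theorem measurable_conv_lintegral {f g : R3 → ℝ≥0∞} (hf : Measurable f) (hg : Measurable g) :
    Measurable fun ζ => ∫⁻ ξ, f ξ * g (ζ - ξ) :=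
  Measurable.lintegral_prod_right' (f := fun p : R3 × R3 => f p.2 * g (p.1 - p.2)) (by fun_prop)

@[fun_prop]
theorem measurable_tri_integrand {f g k : R3 → ℝ≥0∞} (hf : Measurable f) (hg : Measurable g)
    (hk : Measurable k) : Measurable fun ζ => (∫⁻ ξ, f ξ * g (ζ - ξ)) * k ζ :=
  (measurable_conv_lintegral hf hg).mul hk

/-- For fixed `ζ`, Cauchy–Schwarz in `ξ` bounds the convolution uniformly, so the third factor is
needed only in `L¹`. -/
theorem tri_le_right {f g k : R3 → ℝ≥0∞} (hf : Measurable f) (hg : Measurable g)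
    (hk : Measurable k) : tri f g k ≤ n2 f * n2 g * ∫⁻ ζ, k ζ := by
  rw [tri, ← lintegral_const_mul _ hk]
  gcongr with ζ
  rw [← n2_comp_sub_left g ζ]
  exact lintegral_mul_le_n2 (by fun_prop) (by fun_prop)

/-- Tonelli's theorem moves the integral of `f` outside. For fixed `ξ`, Cauchy–Schwarz in `ζ` and
translation invariance handle the other two factors. -/
theorem tri_le_left {f g k : R3 → ℝ≥0∞} (hf : Measurable f) (hg : Measurable g)
    (hk : Measurable k) : tri f g k ≤ (∫⁻ ξ, f ξ) * n2 g * n2 k := by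
  have : tri f g k = ∫⁻ ξ, f ξ * ∫⁻ ζ, g (ζ - ξ) * k ζ := by
    rw [tri]
    calc _ = ∫⁻ ζ, ∫⁻ ξ, f ξ * (g (ζ - ξ) * k ζ) := by
          congr 1; ext ζ
          rw [← lintegral_mul_const _ (by fun_prop)]
          simp only [mul_assoc]
      _ = ∫⁻ ξ, ∫⁻ ζ, f ξ * (g (ζ - ξ) * k ζ) :=
          lintegral_lintegral_swap (by fun_prop)
      _ = _ := by
          congr 1; ext ξ
          rw [lintegral_const_mul _ (by fun_prop)]
  rw [this, mul_assoc, ← lintegral_mul_const _ hf]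
  gcongr with ξ
  rw [← n2_comp_sub_right g ξ]
  exact lintegral_mul_le_n2 (by fun_prop) (by fun_prop)

theorem tri_comm (f g k : R3 → ℝ≥0∞) : tri f g k = tri g f k := by
  unfold tri
  congr 1; ext ζ
  congr 1
  rw [← lintegral_sub_left_eq_self _ ζ]
  simp only [sub_sub_cancel, mul_comm]

theorem lintegral_κe_inv_mul {f : R3 → ℝ≥0∞} (hf : Measurable f) :
    ∫⁻ ξ, (κe ξ)⁻¹ ^ 5 * f ξ ≤ Kinv * n2 f :=
  lintegral_mul_le_n2 ((measurable_κe.inv.pow_const 5).aemeasurable) hf.aemeasurable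

/-- Replacing every base by the largest of the three turns the product into one `n`-th power.
Applied to inverse weights, it lets the whole weight fall on a single factor. -/
theorem pow_mul_pow_mul_pow_le {x y z : ℝ≥0∞} {a b c n : ℕ} (h : a + b + c = n) :
    x ^ a * y ^ b * z ^ c ≤ x ^ n + y ^ n + z ^ n := by
  have hM : ∀ w, w ≤ max (max x y) z → ∀ i, w ^ i ≤ max (max x y) z ^ i :=
    fun w hw i => pow_le_pow_left' hw i
  calc x ^ a * y ^ b * z ^ c
      ≤ max (max x y) z ^ a * max (max x y) z ^ b * max (max x y) z ^ c := by
        gcongr <;> simp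
    _ = max (max x y) z ^ n := by rw [← pow_add, ← pow_add, h]
    _ ≤ _ := by
        rcases max_choice (max x y) z with h | h <;> rw [h]
        · rcases max_choice x y with h | h <;> rw [h]
          · rw [add_assoc]; exact le_self_add
          · rw [add_comm (x ^ n), add_assoc]; exact le_self_add
        · exact le_add_self

/-- A product estimate with total weight `κ^5`, that is, `5/3` derivatives. -/
theorem tri_weighted_le {f g k : R3 → ℝ≥0∞} (hf : Measurable f) (hg : Measurable g)
    (hk : Measurable k) {a b c : ℕ} (h : a + b + c = 5) :
    tri (fun ξ => (κe ξ)⁻¹ ^ a * f ξ) (fun ξ => (κe ξ)⁻¹ ^ b * g ξ)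
      (fun ξ => (κe ξ)⁻¹ ^ c * k ξ) ≤ 3 * Kinv * n2 f * n2 g * n2 k := by
  have hm : Measurable fun ξ => (κe ξ)⁻¹ ^ 5 := measurable_κe.inv.pow_const 5
  have h1 := tri_le_left (hm.mul hf) hg hk
  have h2 := tri_le_left (hm.mul hg) hf hk
  have h3 := tri_le_right hf hg (hm.mul hk)
  rw [tri_comm] at h2
  -- The split weight is at most the sum of the three fifth powers. In each summand the factor
  -- carrying `κ^{-5}` is integrable by Cauchy–Schwarz, and the other two stay in `L²`.
  have : tri (fun ξ => (κe ξ)⁻¹ ^ a * f ξ) (fun ξ => (κe ξ)⁻¹ ^ b * g ξ)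
      (fun ξ => (κe ξ)⁻¹ ^ c * k ξ) ≤ tri (fun ξ => (κe ξ)⁻¹ ^ 5 * f ξ) g k +
      tri f (fun ξ => (κe ξ)⁻¹ ^ 5 * g ξ) k + tri f g (fun ξ => (κe ξ)⁻¹ ^ 5 * k ξ) := by
    have hmi : Measurable fun ξ => (κe ξ)⁻¹ := measurable_κe.inv
    unfold tri
    have e1 := measurable_tri_integrand (f := fun ξ => (κe ξ)⁻¹ ^ 5 * f ξ) (by fun_prop) hg hk
    have e2 := measurable_tri_integrand (g := fun ξ => (κe ξ)⁻¹ ^ 5 * g ξ) hf (by fun_prop) hk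
    refine le_of_le_of_eq ?_ ((lintegral_add_left (e1.add e2) _).trans
      (congrArg (· + _) (lintegral_add_left e1 _)))
    refine lintegral_mono fun ζ => ?_
    simp only [Pi.add_apply]
    rw [← lintegral_mul_const _ (by fun_prop), ← lintegral_mul_const _ (by fun_prop),
      ← lintegral_mul_const _ (by fun_prop), ← lintegral_mul_const _ (by fun_prop),
      ← lintegral_add_left (by fun_prop), ← lintegral_add_left (by fun_prop)]
    gcongr with ξ
    calc _ = (κe ξ)⁻¹ ^ a * (κe (ζ - ξ))⁻¹ ^ b * (κe ζ)⁻¹ ^ c * (f ξ * g (ζ - ξ) * k ζ) := by ring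
      _ ≤ ((κe ξ)⁻¹ ^ 5 + (κe (ζ - ξ))⁻¹ ^ 5 + (κe ζ)⁻¹ ^ 5) * (f ξ * g (ζ - ξ) * k ζ) := by
        gcongr; exact pow_mul_pow_mul_pow_le h
      _ = _ := by ring
  refine this.trans ?_
  calc _ ≤ Kinv * n2 f * n2 g * n2 k + Kinv * n2 g * n2 f * n2 k +
        n2 f * n2 g * (Kinv * n2 k) := by
        gcongr
        · exact h1.trans (by gcongr; exact lintegral_κe_inv_mul hf)
        · exact h2.trans (by gcongr; exact lintegral_κe_inv_mul hg)
        · exact h3.trans (by gcongr; exact lintegral_κe_inv_mul hk)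
    _ = _ := by ring

theorem κe_inv_mul_pow (ξ : R3) {a m : ℕ} (h : a ≤ m) (x : ℝ≥0∞) :
    (κe ξ)⁻¹ ^ a * (κe ξ ^ m * x) = κe ξ ^ (m - a) * x := by
  obtain ⟨k, rfl⟩ := Nat.exists_eq_add_of_le h
  rw [pow_add, mul_assoc, ← mul_assoc, ← mul_pow,
    ENNReal.inv_mul_cancel (κe_ne_zero ξ) (κe_ne_top ξ)]
  simp

/-- The weighted product estimate in terms of norms with positive weights. -/
theorem tri_pow_le {f g k : R3 → ℝ≥0∞} (hf : Measurable f) (hg : Measurable g)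
    (hk : Measurable k) {a b c a' b' c' : ℕ} (ha : a' ≤ a) (hb : b' ≤ b) (hc : c' ≤ c)
    (h : (a - a') + (b - b') + (c - c') = 5) :
    tri (fun ξ => κe ξ ^ a' * f ξ) (fun ξ => κe ξ ^ b' * g ξ) (fun ξ => κe ξ ^ c' * k ξ) ≤
      3 * Kinv * n2 (fun ξ => κe ξ ^ a * f ξ) * n2 (fun ξ => κe ξ ^ b * g ξ) *
        n2 (fun ξ => κe ξ ^ c * k ξ) := by
  have hm := measurable_κe
  have := tri_weighted_le (f := fun ξ => κe ξ ^ a * f ξ) (g := fun ξ => κe ξ ^ b * g ξ)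
    (k := fun ξ => κe ξ ^ c * k ξ) (by fun_prop) (by fun_prop) (by fun_prop) h
  refine le_trans (le_of_eq ?_) this
  congr 1 <;> ext ξ <;> rw [κe_inv_mul_pow _ (by omega)] <;> congr <;> omega


/-! ### Test functions and their Fourier transforms -/

/-- The `i`-th basis vector of `ℝ³`. -/
abbrev e3 (i : Fin 3) : R3 := EuclideanSpace.single i 1

theorem IsTest.partialD {ζ : R3 → ℝ} (h : IsTest ζ) (i : Fin 3) : IsTest (partialD i ζ) := by
  refine ⟨?_, ?_⟩
  · exact (h.1.fderiv_right (m := ∞) (by simp)).clm_apply contDiff_const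
  · exact h.2.fderiv_apply (𝕜 := ℝ) _

theorem IsTest.add {F : Type*} [NormedAddCommGroup F] [NormedSpace ℝ F] {ζ η : R3 → F}
    (h : IsTest ζ) (h' : IsTest η) : IsTest (fun x => ζ x + η x) :=
  ⟨h.1.add h'.1, h.2.add h'.2⟩

theorem IsTest.mul_left {ζ η : R3 → ℝ} (h : ContDiff ℝ ∞ ζ) (h' : IsTest η) :
    IsTest (fun x => ζ x * η x) :=
  ⟨h.mul h'.1, h'.2.mul_left⟩

theorem IsTest.const_mul {ζ : R3 → ℝ} (h : IsTest ζ) (c : ℝ) : IsTest (fun x => c * ζ x) :=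
  IsTest.mul_left contDiff_const h

theorem IsTest.neg {ζ : R3 → ℝ} (h : IsTest ζ) : IsTest (fun x => - ζ x) := by
  simpa using h.const_mul (-1)

theorem IsTest.sub {ζ η : R3 → ℝ} (h : IsTest ζ) (h' : IsTest η) :
    IsTest (fun x => ζ x - η x) := by simpa [sub_eq_add_neg] using h.add h'.neg

theorem isTest_zero : IsTest (fun _ : R3 => (0 : ℝ)) :=
  ⟨contDiff_const, HasCompactSupport.zero⟩

theorem IsTest.sum {ι : Type*} (s : Finset ι) {ζ : ι → R3 → ℝ} (h : ∀ i ∈ s, IsTest (ζ i)) :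
    IsTest (fun x => ∑ i ∈ s, ζ i x) := by
  classical
  induction s using Finset.induction_on with
  | empty => simpa using isTest_zero
  | insert a s ha ih =>
    simp only [Finset.sum_insert ha]
    exact (h a (by simp)).add (ih fun i hi => h i (by simp [hi]))

theorem IsTest.comp_sub {ζ : R3 → ℝ} (h : IsTest ζ) (y : R3) : IsTest (fun x => ζ (x - y)) :=
  ⟨h.1.comp (contDiff_id.sub contDiff_const), h.2.comp_homeomorph (Homeomorph.subRight y)⟩

/-- A test function as a complex-valued Schwartz function. -/
def IsTest.schwartz {ζ : R3 → ℝ} (h : IsTest ζ) : 𝓢(R3, ℂ) :=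
  HasCompactSupport.toSchwartzMap (f := fun x => (ζ x : ℂ))
    (h.2.comp_left (g := fun r : ℝ => (r : ℂ)) rfl) (Complex.ofRealCLM.contDiff.comp h.1)

@[simp] theorem IsTest.schwartz_apply {ζ : R3 → ℝ} (h : IsTest ζ) (x : R3) :
    h.schwartz x = (ζ x : ℂ) := rfl

/-- The Fourier transform of a real function, as a complex function. -/
def rft (ζ : R3 → ℝ) : R3 → ℂ := 𝓕 fun x => (ζ x : ℂ)

theorem IsTest.rft_eq {ζ : R3 → ℝ} (h : IsTest ζ) : rft ζ = (𝓕 h.schwartz : 𝓢(R3, ℂ)) := rfl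

theorem IsTest.isFT {ζ : R3 → ℝ} (h : IsTest ζ) : IsFT (fun x => (ζ x : ℂ)) (rft ζ) :=
  isFT_schwartz h.schwartz

theorem fourier_lineDeriv_apply (g : 𝓢(R3, ℂ)) (i : Fin 3) (ξ : R3) :
    𝓕 (LineDeriv.lineDerivOp (e3 i) g) ξ = 2 * Real.pi * Complex.I * ξ i * 𝓕 g ξ := by
  rw [SchwartzMap.fourier_lineDerivOp_eq]
  have : (inner ℝ · (e3 i)).HasTemperateGrowth :=
    ((innerSL ℝ).flip (e3 i)).hasTemperateGrowth
  simp only [_root_.smul_apply, SchwartzMap.smulLeftCLM_apply_apply this, smul_eq_mul]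
  rw [show inner ℝ ξ (e3 i) = ξ i by simp [EuclideanSpace.inner_single_right]]
  simp [mul_assoc]

theorem IsTest.rft_partialD {ζ : R3 → ℝ} (h : IsTest ζ) (i : Fin 3) (ξ : R3) :
    rft (MLANS.partialD i ζ) ξ = 2 * Real.pi * Complex.I * ξ i * rft ζ ξ := by
  rw [h.rft_eq, (h.partialD i).rft_eq, ← fourier_lineDeriv_apply]
  congr 2
  ext x
  rw [SchwartzMap.lineDerivOp_apply_eq_fderiv]
  have : (h.schwartz : R3 → ℂ) = Complex.ofRealCLM ∘ ζ := rfl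
  rw [this, (Complex.ofRealCLM.hasFDerivAt.comp x
    (h.1.differentiable (by simp)).differentiableAt.hasFDerivAt).fderiv]
  simp [MLANS.partialD]

theorem rft_neg_arg (ζ : R3 → ℝ) (ξ : R3) : rft ζ (-ξ) = (starRingEnd ℂ) (rft ζ ξ) := by
  have e2 : (starRingEnd ℂ) 2 = 2 := Complex.conj_ofNat 2
  rw [rft, fourier_apply_integral, fourier_apply_integral, ← integral_conj]
  congr 1; ext y
  simp [← Complex.exp_conj, e2]

theorem rft_comp_sub (ζ : R3 → ℝ) (y ξ : R3) : rft (fun x => ζ (x - y)) ξ =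
    Complex.exp (-(2 * Real.pi * inner ℝ y ξ : ℝ) * Complex.I) * rft ζ ξ := by
  rw [rft, rft, fourier_apply_integral, fourier_apply_integral, ← integral_const_mul,
    ← integral_add_right_eq_self _ y]
  congr 1; ext x
  rw [add_sub_cancel_right, ← mul_assoc, ← Complex.exp_add, inner_add_left]
  congr 2
  push_cast; ring

/-- Since `κ ≥ 1`, the weight `κ^m` is at most `κ^{6m} = (1 + |x|²)^m`, a polynomial. The
derivatives of the fractional power `κ` are thus never needed. -/
theorem schwartz_κ_bound (g : 𝓢(R3, ℂ)) (m : ℕ) : ∃ G : 𝓢(R3, ℂ), ∀ x, κ x ^ m * ‖g x‖ ≤ ‖G x‖ := by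
  have hg : (fun x : R3 => ((1 : ℝ) + ‖x‖ ^ 2) ^ m).HasTemperateGrowth := by fun_prop
  refine ⟨SchwartzMap.smulLeftCLM (𝕜 := ℝ) ℂ (fun x : R3 => ((1 : ℝ) + ‖x‖ ^ 2) ^ m) g, fun x => ?_⟩
  rw [SchwartzMap.smulLeftCLM_apply_apply hg, norm_smul]
  gcongr
  rw [Real.norm_of_nonneg (by positivity), ← κ_pow_six, ← pow_mul]
  exact κ_pow_mono x (by omega)

theorem schwartz_κ_memLp (g : 𝓢(R3, ℂ)) (m : ℕ) (p : ℝ≥0∞) :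
    MemLp (fun x => (κ x : ℂ) ^ m * g x) p volume := by
  obtain ⟨G, hG⟩ := schwartz_κ_bound g m
  refine (G.memLp p volume).of_le (Continuous.aestronglyMeasurable ?_) ?_
  · have := continuous_κ; have := g.continuous; fun_prop
  · filter_upwards with x
    rw [norm_mul, norm_pow, Complex.norm_real, Real.norm_of_nonneg (κ_pos x).le]
    exact hG x

theorem integral_fourier_mul_eq {f g : R3 → ℂ} (hf : Integrable f volume)
    (hg : Integrable g volume) : ∫ ξ, 𝓕 f ξ * g ξ = ∫ x, f x * 𝓕 g x := by
  have := VectorFourier.integral_fourierIntegral_smul_eq_flip (L := innerₗ R3) (μ := volume)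
    (ν := volume) (f := f) (g := g) Real.continuous_fourierChar continuous_inner hf hg
  rw [flip_innerₗ] at this
  exact this

/-- A function with vanishing Fourier transform vanishes. -/
theorem ae_eq_zero_of_fourier_eq_zero {f : R3 → ℂ} (hf : Integrable f volume)
    (h : ∀ ξ, 𝓕 f ξ = 0) : f =ᵐ[volume] 0 := by
  refine ae_eq_of_pair_schwartz hf.locallyIntegrable (locallyIntegrable_zero) fun g => ?_
  have := integral_fourier_mul_eq hf (SchwartzMap.integrable (𝓕⁻ g))
  simp only [h, zero_mul, integral_zero] at this
  have e : 𝓕 (𝓕⁻ g) = g := FourierTransform.fourier_fourierInv_eq g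
  rw [← SchwartzMap.fourier_coe, e] at this
  simp [← this]

/-- Bumps shrinking to the origin do this. If `n > 8 |ξ|`, the `n`-th bump lives where `|x·ξ| ≤
1/8`, so `cos (2π x·ξ)` is positive there and the real part of the transform at `ξ` is the integral
of a nonnegative function that is positive at `0`. A countable family is needed in order to combine
almost everywhere statements. -/
theorem exists_isTest_rft_ne_zero : ∃ ζ : ℕ → R3 → ℝ, (∀ n, IsTest (ζ n)) ∧
    ∀ ξ, ∃ n, rft (ζ n) ξ ≠ 0 := by
  let φ : ℕ → ContDiffBump (0 : R3) := fun n =>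
    ⟨1 / (2 * (n + 1)), 1 / (n + 1), by positivity, by
      rw [div_lt_div_iff₀ (by positivity) (by positivity)]
      have : (0 : ℝ) ≤ n := n.cast_nonneg
      linarith⟩
  refine ⟨fun n => φ n, fun n => ⟨(φ n).contDiff, (φ n).hasCompactSupport⟩, fun ξ => ?_⟩
  obtain ⟨n, hn⟩ := exists_nat_gt (8 * ‖ξ‖)
  refine ⟨n, fun h0 => ?_⟩
  have hn1 : (0 : ℝ) < n + 1 := by positivity
  have hint : Integrable (fun x => Complex.exp (-(2 * Real.pi * inner ℝ x ξ : ℝ) * Complex.I) *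
      ((φ n x : ℝ) : ℂ)) volume := by
    refine Continuous.integrable_of_hasCompactSupport ?_ ?_
    · have := (φ n).continuous; fun_prop
    · exact HasCompactSupport.mul_left ((φ n).hasCompactSupport.comp_left (g := fun r : ℝ => (r : ℂ)) rfl)
  have hre := congrArg Complex.re h0
  rw [rft, fourier_apply_integral, ← RCLike.re_eq_complex_re, ← integral_re hint] at hre
  simp only [RCLike.re_eq_complex_re, Complex.re_mul_ofReal, Complex.zero_re] at hre
  have hcos : ∀ x : R3, (Complex.exp (-(2 * Real.pi * inner ℝ x ξ : ℝ) * Complex.I)).re =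
      Real.cos (2 * Real.pi * inner ℝ x ξ) := fun x => by
    rw [← Complex.ofReal_neg, Complex.exp_ofReal_mul_I_re, Real.cos_neg]
  simp only [hcos] at hre
  have hpos : ∀ x : R3, x ∈ Metric.ball (0 : R3) (1 / (n + 1)) →
      0 < Real.cos (2 * Real.pi * inner ℝ x ξ) := by
    intro x hx
    have h1 : ‖x‖ < 1 / (n + 1) := by simpa using hx
    have h2 : |inner ℝ x ξ| ≤ 1 / 8 := by
      refine (abs_real_inner_le_norm x ξ).trans ?_
      calc ‖x‖ * ‖ξ‖ ≤ 1 / (n + 1) * ((n + 1) / 8) := by gcongr; linarith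
        _ = 1 / 8 := by field_simp
    rw [abs_le] at h2
    apply Real.cos_pos_of_mem_Ioo
    constructor <;> nlinarith [Real.pi_pos]
  have hnn : 0 ≤ fun x => Real.cos (2 * Real.pi * inner ℝ x ξ) * φ n x := by
    intro x
    by_cases hx : x ∈ Metric.ball (0 : R3) (1 / (n + 1))
    · exact mul_nonneg (hpos x hx).le (φ n).nonneg
    · have : φ n x = 0 := by
        rw [← Function.notMem_support, (φ n).support_eq]; exact hx
      simp [this]
  have hc : Continuous fun x => Real.cos (2 * Real.pi * inner ℝ x ξ) * φ n x := by
    have := (φ n).continuous; fun_prop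
  have : 0 < ∫ x, Real.cos (2 * Real.pi * inner ℝ x ξ) * φ n x := by
    refine hc.integral_pos_of_hasCompactSupport_nonneg_nonzero
      ((φ n).hasCompactSupport.mul_left) hnn (x := 0) ?_
    have : φ n 0 = 1 := (φ n).one_of_mem_closedBall (by simp [(φ n).rIn_pos.le])
    simp [this]
  linarith

theorem κ_inv_mul_memLp_integrable {h : R3 → ℂ} {m : ℕ}
    (hh : MemLp (fun ξ => ((κ ξ : ℂ) ^ m)⁻¹ * h ξ) 2 volume) (g : 𝓢(R3, ℂ)) :
    Integrable (fun ξ => h ξ * g ξ) volume := by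
  have := hh.integrable_mul (schwartz_κ_memLp g m 2)
  refine this.congr ?_
  filter_upwards with ξ
  have : (κ ξ : ℂ) ^ m ≠ 0 := pow_ne_zero _ (by exact_mod_cast (κ_pos ξ).ne')
  simp only [Pi.mul_apply]
  field_simp

/-- The Fourier transforms of test functions separate functions of moderate growth. -/
theorem ae_eq_zero_of_integral_rft {h : R3 → ℂ} {m : ℕ}
    (hh : MemLp (fun ξ => ((κ ξ : ℂ) ^ m)⁻¹ * h ξ) 2 volume)
    (h0 : ∀ ζ, IsTest ζ → ∫ ξ, h ξ * rft ζ ξ = 0) : h =ᵐ[volume] 0 := by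
  obtain ⟨ζ, hζ, hne⟩ := exists_isTest_rft_ne_zero
  -- The value at `y` of the Fourier transform of this integrable product is the pairing of `h` with
  -- the transform of the translate of the test function by `y`, which vanishes by hypothesis.
  have key : ∀ n, (fun ξ => h ξ * rft (ζ n) ξ) =ᵐ[volume] 0 := by
    intro n
    refine ae_eq_zero_of_fourier_eq_zero (κ_inv_mul_memLp_integrable hh (𝓕 (hζ n).schwartz))
      fun y => ?_
    rw [fourier_apply_integral, ← h0 _ ((hζ n).comp_sub y)]
    congr 1; ext ξ
    rw [rft_comp_sub, real_inner_comm]; ring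
  filter_upwards [ae_all_iff.2 key] with ξ hξ
  obtain ⟨n, hn⟩ := hne ξ
  simpa [hn] using hξ n

/-- The square integrable function `κ^m ζ̂`. -/
def weightedRft (m : ℕ) {ζ : R3 → ℝ} (h : IsTest ζ) : Lp ℂ 2 (volume : Measure R3) :=
  (schwartz_κ_memLp (𝓕 h.schwartz) m 2).toLp _

theorem coeFn_weightedRft (m : ℕ) {ζ : R3 → ℝ} (h : IsTest ζ) :
    weightedRft m h =ᵐ[volume] fun ξ => (κ ξ : ℂ) ^ m * rft ζ ξ := MemLp.coeFn_toLp _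

/-- Test functions are dense in the weighted space. -/
theorem dense_span_weightedRft (m : ℕ) :
    Dense (Submodule.span ℂ {z | ∃ ζ, ∃ h : IsTest ζ, z = weightedRft m h} :
      Set (Lp ℂ 2 (volume : Measure R3))) := by
  rw [Submodule.dense_iff_topologicalClosure_eq_top, Submodule.topologicalClosure_eq_top_iff,
    Submodule.eq_bot_iff]
  intro g hg
  rw [Submodule.mem_orthogonal] at hg
  have h1 : (fun ξ => (κ ξ : ℂ) ^ m * g ξ) =ᵐ[volume] 0 := by
    apply ae_eq_zero_of_integral_rft (m := m)
    · refine (Lp.memLp g).congr_norm ?_ ?_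
      · have := (Lp.stronglyMeasurable g).measurable
        have := continuous_κ.measurable
        exact Measurable.aestronglyMeasurable (by fun_prop)
      · filter_upwards with ξ
        have : (κ ξ : ℂ) ^ m ≠ 0 := pow_ne_zero _ (by exact_mod_cast (κ_pos ξ).ne')
        rw [← mul_assoc, inv_mul_cancel₀ this, one_mul]
    · intro ζ hζ
      -- Reflecting a real test function conjugates its transform, which turns the sesquilinear
      -- inner product into the bilinear pairing.
      have hneg : IsTest (fun x => ζ (-x)) :=
        ⟨hζ.1.comp contDiff_neg, hζ.2.comp_homeomorph (Homeomorph.neg R3)⟩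
      have := hg _ (Submodule.subset_span ⟨_, hneg, rfl⟩)
      rw [L2.inner_def] at this
      rw [← this]
      apply integral_congr_ae
      filter_upwards [coeFn_weightedRft m hneg] with ξ hξ
      have e : rft (fun x => ζ (-x)) ξ = (starRingEnd ℂ) (rft ζ ξ) := by
        rw [← rft_neg_arg, rft, rft, fourier_apply_integral, fourier_apply_integral,
          ← integral_neg_eq_self]
        simp
      rw [hξ, RCLike.inner_apply, e]
      simp
      ring
  rw [Lp.eq_zero_iff_ae_eq_zero]
  filter_upwards [h1] with ξ hξ
  have : (κ ξ : ℂ) ^ m ≠ 0 := pow_ne_zero _ (by exact_mod_cast (κ_pos ξ).ne')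
  simpa [this] using hξ

section


/-! ### Weakly differentiable curves in a Hilbert space -/

section Hilbert

variable {H : Type*} [NormedAddCommGroup H] [InnerProductSpace ℂ H]
  {a b : ℝ → H} {D : Set H} {t₀ t₁ C : ℝ}

theorem hasDerivAt_inner_of_mem_span
    (hD : ∀ z ∈ D, ∀ t ∈ Ioo t₀ t₁, HasDerivAt (fun τ => inner ℂ z (a τ)) (inner ℂ z (b t)) t)
    {z : H} (hz : z ∈ Submodule.span ℂ D) {t : ℝ} (ht : t ∈ Ioo t₀ t₁) :
    HasDerivAt (fun τ => inner ℂ z (a τ)) (inner ℂ z (b t)) t := by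
  induction hz using Submodule.span_induction with
  | mem z hz => exact hD z hz t ht
  | zero => simpa using hasDerivAt_const t (0 : ℂ)
  | add x y _ _ hx hy => simp only [inner_add_left]; exact hx.add hy
  | smul c x _ hx => simp only [inner_smul_left]; exact hx.const_mul ((starRingEnd ℂ) c)

/-- The mean value inequality applies to each scalar function `⟨z, a⟩` with `z` in the dense span.
By density the estimate extends to all `z`, and the choice `z = a t - a s` gives the norm. No strong
differentiability of the curve is needed. -/
theorem norm_sub_le_of_weak_deriv (hdense : Dense (Submodule.span ℂ D : Set H))
    (hD : ∀ z ∈ D, ∀ t ∈ Ioo t₀ t₁, HasDerivAt (fun τ => inner ℂ z (a τ)) (inner ℂ z (b t)) t)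
    (hb : ∀ t ∈ Ioo t₀ t₁, ‖b t‖ ≤ C) {s t : ℝ} (hs : s ∈ Ioo t₀ t₁) (ht : t ∈ Ioo t₀ t₁) :
    ‖a t - a s‖ ≤ C * |t - s| := by
  have hC : 0 ≤ C := (norm_nonneg _).trans (hb s hs)
  have key : ∀ z : H, ‖inner ℂ z (a t - a s)‖ ≤ C * |t - s| * ‖z‖ := by
    intro z
    refine hdense.induction (P := fun z => ‖inner ℂ z (a t - a s)‖ ≤ C * |t - s| * ‖z‖)
      (fun z hz => ?_) (isClosed_le (by fun_prop) (by fun_prop)) z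
    have := (convex_Ioo t₀ t₁).norm_image_sub_le_of_norm_hasDerivWithin_le
      (f := fun τ => inner ℂ z (a τ)) (f' := fun τ => inner ℂ z (b τ)) (C := C * ‖z‖)
      (fun x hx => (hasDerivAt_inner_of_mem_span hD hz hx).hasDerivWithinAt)
      (fun x hx => (norm_inner_le_norm _ _).trans (by
        rw [mul_comm]; exact mul_le_mul_of_nonneg_right (hb x hx) (norm_nonneg _))) hs ht
    rw [inner_sub_right]
    refine this.trans (le_of_eq ?_)
    rw [Real.norm_eq_abs]; ring
  by_cases h0 : ‖a t - a s‖ = 0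
  · rw [h0]; positivity
  · have := key (a t - a s)
    rw [inner_self_eq_norm_sq_to_K] at this
    simp only [norm_pow, RCLike.norm_ofReal, abs_norm] at this
    have hpos : 0 < ‖a t - a s‖ := lt_of_le_of_ne (norm_nonneg _) (Ne.symm h0)
    nlinarith

/-- When `z` is replaced by a nearby `z'` in the span, the Lipschitz bound makes the error in the
difference quotient at most a small multiple of `|τ - t|`, uniformly in `τ`. -/
theorem hasDerivAt_inner_of_dense (hdense : Dense (Submodule.span ℂ D : Set H))
    (hD : ∀ z ∈ D, ∀ t ∈ Ioo t₀ t₁, HasDerivAt (fun τ => inner ℂ z (a τ)) (inner ℂ z (b t)) t)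
    (hb : ∀ t ∈ Ioo t₀ t₁, ‖b t‖ ≤ C) (z : H) {t : ℝ} (ht : t ∈ Ioo t₀ t₁) :
    HasDerivAt (fun τ => inner ℂ z (a τ)) (inner ℂ z (b t)) t := by
  have hC : 0 ≤ C := (norm_nonneg _).trans (hb t ht)
  rw [hasDerivAt_iff_isLittleO, Asymptotics.isLittleO_iff]
  intro ε hε
  obtain ⟨z', hz', hzz⟩ := Metric.dense_iff.1 hdense z (ε / (4 * (C + 1))) (by positivity)
  have h1 := hasDerivAt_inner_of_mem_span hD hzz ht
  rw [hasDerivAt_iff_isLittleO, Asymptotics.isLittleO_iff] at h1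
  have hz : ‖z - z'‖ ≤ ε / (4 * (C + 1)) := by
    rw [← dist_eq_norm, dist_comm]; exact (Metric.mem_ball.1 hz').le
  filter_upwards [h1 (half_pos hε), Ioo_mem_nhds ht.1 ht.2] with τ hτ hτI
  have e : inner ℂ z (a τ) - inner ℂ z (a t) - (τ - t) • inner ℂ z (b t) =
      (inner ℂ z' (a τ) - inner ℂ z' (a t) - (τ - t) • inner ℂ z' (b t)) +
      (inner ℂ (z - z') (a τ - a t) - (τ - t) • inner ℂ (z - z') (b t)) := by
    simp only [inner_sub_left, inner_sub_right, smul_sub]; ring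
  rw [e]
  have h2 : ‖inner ℂ (z - z') (a τ - a t)‖ ≤ ε / (4 * (C + 1)) * (C * |τ - t|) :=
    (norm_inner_le_norm _ _).trans (mul_le_mul hz (norm_sub_le_of_weak_deriv hdense hD hb ht hτI)
      (norm_nonneg _) (by positivity))
  have h3 : ‖(τ - t) • inner ℂ (z - z') (b t)‖ ≤ |τ - t| * (ε / (4 * (C + 1)) * C) := by
    rw [norm_smul, Real.norm_eq_abs]
    gcongr
    exact (norm_inner_le_norm _ _).trans (mul_le_mul hz (hb t ht) (norm_nonneg _) (by positivity))
  have h4 : ε / (4 * (C + 1)) * C ≤ ε / 4 := by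
    rw [div_mul_eq_mul_div, div_le_div_iff₀ (by positivity) (by positivity)]
    nlinarith
  calc _ ≤ _ := norm_add_le _ _
    _ ≤ ε / 2 * ‖τ - t‖ + (ε / 4 * |τ - t| + ε / 4 * |τ - t|) := by
      refine add_le_add hτ ((norm_sub_le _ _).trans (add_le_add (h2.trans ?_) (h3.trans ?_)))
      · rw [← mul_assoc]; gcongr
      · rw [mul_comm]; gcongr
    _ = ε * ‖τ - t‖ := by rw [Real.norm_eq_abs]; ring

/-- For symmetric `L` the quadratic form at `a τ` is `2 Re ⟨L (a t), a τ⟩ - ⟨L (a t), a t⟩` plus the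
form at `a τ - a t`. The first term has a derivative because it pairs the curve with a fixed vector.
The last one is `O(|τ - t|²)` by the Lipschitz bound. Weak differentiability with a bounded
derivative thus suffices for an energy identity. -/
theorem hasDerivAt_re_inner_self (hdense : Dense (Submodule.span ℂ D : Set H))
    (hD : ∀ z ∈ D, ∀ t ∈ Ioo t₀ t₁, HasDerivAt (fun τ => inner ℂ z (a τ)) (inner ℂ z (b t)) t)
    (hb : ∀ t ∈ Ioo t₀ t₁, ‖b t‖ ≤ C) (L : H →L[ℂ] H)
    (hL : ∀ x y, inner ℂ (L x) y = inner ℂ x (L y)) {t : ℝ} (ht : t ∈ Ioo t₀ t₁) :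
    HasDerivAt (fun τ => (inner ℂ (L (a τ)) (a τ)).re) (2 * (inner ℂ (L (a t)) (b t)).re) t := by
  have hC : 0 ≤ C := (norm_nonneg _).trans (hb t ht)
  have h1 := hasDerivAt_inner_of_dense hdense hD hb (L (a t)) ht
  have h1' : HasDerivAt (fun τ => 2 * (inner ℂ (L (a t)) (a τ)).re)
      (2 * (inner ℂ (L (a t)) (b t)).re) t :=
    ((Complex.reCLM.hasFDerivAt.comp_hasDerivAt t h1)).const_mul 2
  have h2 : HasDerivAt (fun τ => (inner ℂ (L (a τ - a t)) (a τ - a t)).re) 0 t := by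
    rw [hasDerivAt_iff_isLittleO]
    simp only [sub_self, inner_zero_right, Complex.zero_re, sub_zero, smul_zero]
    have : (fun τ => (inner ℂ (L (a τ - a t)) (a τ - a t)).re) =O[𝓝 t] fun τ => ‖τ - t‖ ^ 2 := by
      refine Asymptotics.IsBigO.of_bound (‖L‖ * C ^ 2) ?_
      filter_upwards [Ioo_mem_nhds ht.1 ht.2] with τ hτ
      have h := norm_sub_le_of_weak_deriv hdense hD hb ht hτ
      calc _ ≤ ‖inner ℂ (L (a τ - a t)) (a τ - a t)‖ := by
            rw [Real.norm_eq_abs]; exact Complex.abs_re_le_norm _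
        _ ≤ ‖L‖ * ‖a τ - a t‖ * ‖a τ - a t‖ := (norm_inner_le_norm _ _).trans (by
            gcongr; exact L.le_opNorm _)
        _ ≤ ‖L‖ * (C * |τ - t|) * (C * |τ - t|) := by gcongr
        _ = _ := by rw [Real.norm_of_nonneg (by positivity), Real.norm_eq_abs]; ring
    refine this.trans_isLittleO ?_
    exact Asymptotics.isLittleO_pow_sub_sub t (by norm_num)
  have h3 := (h1'.add h2).sub_const (inner ℂ (L (a t)) (a t)).re
  rw [add_zero] at h3
  refine h3.congr_of_eventuallyEq ?_
  filter_upwards with τ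
  have e1 : inner ℂ (L (a τ)) (a t) = (starRingEnd ℂ) (inner ℂ (L (a t)) (a τ)) := by
    rw [inner_conj_symm, hL]
  simp only [Pi.add_apply, map_sub, inner_sub_left, inner_sub_right, Complex.sub_re, e1,
    Complex.conj_re]
  ring

end Hilbert

end

section


/-! ### Energy identities for weak solutions on the Fourier side -/

theorem memLp_mul_bdd {w : R3 → ℝ} (hw : Measurable w) {M : ℝ} (hM : ∀ ξ, |w ξ| ≤ M)
    {f : R3 → ℂ} (hf : MemLp f 2 volume) : MemLp (fun ξ => (w ξ : ℂ) * f ξ) 2 volume :=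
  hf.of_le_mul (c := M) ((Complex.measurable_ofReal.comp hw).aestronglyMeasurable.mul hf.1)
    (by filter_upwards with ξ
        rw [norm_mul, Complex.norm_real, Real.norm_eq_abs]
        gcongr; exact hM ξ)

/-- Multiplication by a bounded real function on `L²`. -/
def mulL2 (w : R3 → ℝ) (hw : Measurable w) (M : ℝ) (hM : ∀ ξ, |w ξ| ≤ M) :
    Lp ℂ 2 (volume : Measure R3) →L[ℂ] Lp ℂ 2 (volume : Measure R3) :=
  LinearMap.mkContinuous
    { toFun := fun f => (memLp_mul_bdd hw hM (Lp.memLp f)).toLp _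
      map_add' := fun f g => by
        rw [← MemLp.toLp_add]
        apply MemLp.toLp_congr
        filter_upwards [Lp.coeFn_add f g] with ξ h
        simp only [Pi.add_apply, h]; ring
      map_smul' := fun c f => by
        rw [RingHom.id_apply, ← MemLp.toLp_const_smul]
        apply MemLp.toLp_congr
        filter_upwards [Lp.coeFn_smul c f] with ξ h
        simp only [Pi.smul_apply, h, smul_eq_mul]; ring } M
    (fun f => by
      apply Lp.norm_le_mul_norm_of_ae_le_mul
      filter_upwards [(memLp_mul_bdd hw hM (Lp.memLp f)).coeFn_toLp] with ξ h
      simp only [LinearMap.coe_mk, AddHom.coe_mk, h]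
      rw [norm_mul, Complex.norm_real, Real.norm_eq_abs]
      gcongr; exact hM ξ)

theorem coeFn_mulL2 {w : R3 → ℝ} (hw : Measurable w) {M : ℝ} (hM : ∀ ξ, |w ξ| ≤ M)
    (f : Lp ℂ 2 (volume : Measure R3)) :
    mulL2 w hw M hM f =ᵐ[volume] fun ξ => (w ξ : ℂ) * f ξ := by
  exact (memLp_mul_bdd hw hM (Lp.memLp f)).coeFn_toLp

theorem mulL2_symm {w : R3 → ℝ} (hw : Measurable w) {M : ℝ} (hM : ∀ ξ, |w ξ| ≤ M)
    (f g : Lp ℂ 2 (volume : Measure R3)) :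
    inner ℂ (mulL2 w hw M hM f) g = inner ℂ f (mulL2 w hw M hM g) := by
  rw [L2.inner_def, L2.inner_def]
  apply integral_congr_ae
  filter_upwards [coeFn_mulL2 hw hM f, coeFn_mulL2 hw hM g] with ξ h1 h2
  rw [h1, h2, RCLike.inner_apply, RCLike.inner_apply, map_mul, Complex.conj_ofReal]
  ring

/-- The class of a square integrable function in `L²`. -/
def l2 (f : R3 → ℂ) : Lp ℂ 2 (volume : Measure R3) :=
  open scoped Classical in if h : MemLp f 2 volume then h.toLp f else 0

theorem coeFn_l2 {f : R3 → ℂ} (h : MemLp f 2 volume) : l2 f =ᵐ[volume] f := by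
  rw [l2, dif_pos h]; exact h.coeFn_toLp

theorem norm_l2_le {f : R3 → ℂ} (h : MemLp f 2 volume) {C : ℝ} (hC : 0 ≤ C)
    (hf : eLpNorm f 2 volume ≤ ENNReal.ofReal C) : ‖l2 f‖ ≤ C := by
  rw [l2, dif_pos h, Lp.norm_toLp]
  exact ENNReal.toReal_le_of_le_ofReal hC hf

/-- The symbol of `1 - α²Δ`. -/
def hel (α : ℝ) (ξ : R3) : ℝ := 1 + 4 * Real.pi ^ 2 * α ^ 2 * ‖ξ‖ ^ 2

theorem one_le_hel (α : ℝ) (ξ : R3) : 1 ≤ hel α ξ := by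
  unfold hel; have : 0 ≤ 4 * Real.pi ^ 2 * α ^ 2 * ‖ξ‖ ^ 2 := by positivity
  linarith

theorem hel_pos (α : ℝ) (ξ : R3) : 0 < hel α ξ := one_pos.trans_le (one_le_hel α ξ)

@[simp] theorem hel_neg (α : ℝ) (ξ : R3) : hel α (-ξ) = hel α ξ := by simp [hel]

/-- A constant in bounds for the symbol of `1 - α²Δ`. -/
def helC (α : ℝ) : ℝ := 1 + 4 * Real.pi ^ 2 * α ^ 2

theorem helC_pos (α : ℝ) : 0 < helC α := by unfold helC; positivity

theorem hel_le (α : ℝ) (ξ : R3) : hel α ξ ≤ helC α * κ ξ ^ 6 := by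
  rw [κ_pow_six, hel, helC]
  have h1 : 0 ≤ 4 * Real.pi ^ 2 * α ^ 2 := by positivity
  nlinarith [sq_nonneg ‖ξ‖]

@[fun_prop]
theorem continuous_hel (α : ℝ) : Continuous (hel α) := by unfold hel; fun_prop

@[fun_prop]
theorem measurable_hel (α : ℝ) : Measurable (hel α) := (continuous_hel α).measurable

/-- The symbol of `curl curl`, up to the factor `4π²`. -/
def qsym (j l : Fin 3) (ξ : R3) : ℝ := (if j = l then ‖ξ‖ ^ 2 else 0) - ξ j * ξ l

@[fun_prop]
theorem continuous_qsym (j l : Fin 3) : Continuous (qsym j l) := by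
  unfold qsym; split_ifs <;> fun_prop

theorem abs_apply_le_norm (ξ : R3) (i : Fin 3) : |ξ i| ≤ ‖ξ‖ := PiLp.norm_apply_le ξ i

theorem abs_qsym_le (j l : Fin 3) (ξ : R3) : |qsym j l ξ| ≤ 2 * κ ξ ^ 6 := by
  have h0 : ‖ξ‖ ^ 2 ≤ κ ξ ^ 6 := by rw [κ_pow_six]; linarith
  have h1 : |ξ j * ξ l| ≤ ‖ξ‖ ^ 2 := by
    rw [abs_mul, sq]
    exact mul_le_mul (abs_apply_le_norm ξ j) (abs_apply_le_norm ξ l) (abs_nonneg _) (norm_nonneg _)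
  unfold qsym
  refine (abs_sub _ _).trans ?_
  have : |if j = l then ‖ξ‖ ^ 2 else 0| ≤ ‖ξ‖ ^ 2 := by
    split_ifs
    · rw [abs_of_nonneg (by positivity)]
    · simp
  linarith

/-- The matrix `qsym` is `|ξ|²` times the projection orthogonal to `ξ`, so it acts as the scalar
`|ξ|²` on divergence free amplitudes. -/
theorem sum_mul_qsym {V : Fin 3 → ℂ} {ξ : R3} (h : ∑ i, (ξ i : ℂ) * V i = 0) (l : Fin 3) :
    ∑ j, V j * (qsym j l ξ : ℂ) = (‖ξ‖ : ℂ) ^ 2 * V l := by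
  have : ∀ j, V j * (qsym j l ξ : ℂ) =
      (if j = l then (‖ξ‖ : ℂ) ^ 2 * V j else 0) - ξ l * (ξ j * V j) := by
    intro j
    unfold qsym
    split_ifs <;> push_cast <;> ring
  simp only [this, Finset.sum_sub_distrib, ← Finset.mul_sum, h]
  simp

theorem qsym_comm (j l : Fin 3) (ξ : R3) : qsym j l ξ = qsym l j ξ := by
  unfold qsym; simp only [eq_comm (a := j), mul_comm]

/-- A solution on the Fourier side: `U` is the Fourier transform of the velocity and `R` that of the
right-hand side before the projection to divergence free fields. -/
structure SpectralSolution (α t₀ t₁ : ℝ) (U R : ℝ → Fin 3 → R3 → ℂ) : Prop where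
  memLp : ∀ t ∈ Ioo t₀ t₁, ∀ j, MemLp (U t j) 2 volume
  memLp_rhs : ∀ t ∈ Ioo t₀ t₁, ∀ j, MemLp (fun ξ => ((κ ξ : ℂ) ^ 20)⁻¹ * ((κ ξ : ℂ) ^ 6 * R t j ξ)) 2 volume
  bound : ∃ C : ℝ, ∀ t ∈ Ioo t₀ t₁, ∀ j,
    eLpNorm (fun ξ => ((κ ξ : ℂ) ^ 20)⁻¹ * ((κ ξ : ℂ) ^ 6 * R t j ξ)) 2 volume ≤ ENNReal.ofReal C
  divFree : ∀ t ∈ Ioo t₀ t₁, ∀ᵐ ξ, ∑ j, (ξ j : ℂ) * U t j ξ = 0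
  weak : ∀ t ∈ Ioo t₀ t₁, ∀ l, ∀ ζ, IsTest ζ →
    HasDerivAt (fun τ => ∫ ξ, (∑ j, (hel α ξ : ℂ) * U τ j ξ * qsym j l ξ) * rft ζ (-ξ))
      (∫ ξ, (∑ j, R t j ξ * qsym j l ξ) * rft ζ (-ξ)) t

variable {α t₀ t₁ : ℝ} {U R : ℝ → Fin 3 → R3 → ℂ}

theorem κ_ne_zero_complex (ξ : R3) (m : ℕ) : (κ ξ : ℂ) ^ m ≠ 0 :=
  pow_ne_zero _ (by exact_mod_cast (κ_pos ξ).ne')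

theorem norm_κ_pow (ξ : R3) (m : ℕ) : ‖(κ ξ : ℂ) ^ m‖ = κ ξ ^ m := by
  rw [norm_pow, Complex.norm_real, Real.norm_of_nonneg (κ_pos ξ).le]

theorem memLp_lhs {V : Fin 3 → R3 → ℂ} (hV : ∀ j, MemLp (V j) 2 volume) (l : Fin 3) :
    MemLp (fun ξ => ((κ ξ : ℂ) ^ 20)⁻¹ * ∑ j, (hel α ξ : ℂ) * V j ξ * qsym j l ξ) 2 volume := by
  have : (fun ξ => ((κ ξ : ℂ) ^ 20)⁻¹ * ∑ j, (hel α ξ : ℂ) * V j ξ * qsym j l ξ) =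
      fun ξ => ∑ j, (((κ ξ ^ 20)⁻¹ * hel α ξ * qsym j l ξ : ℝ) : ℂ) * V j ξ := by
    ext ξ
    rw [Finset.mul_sum]
    congr 1; ext j; push_cast; ring
  rw [this]
  refine memLp_finsetSum _ fun j _ => (hV j).of_le_mul (c := helC α * 2) ?_ ?_
  · refine (Continuous.aestronglyMeasurable ?_).mul (hV j).1
    have h1 := continuous_κ
    refine Complex.continuous_ofReal.comp (Continuous.mul (Continuous.mul ?_ (by fun_prop)) (by fun_prop))
    exact (h1.pow 20).inv₀ fun ξ => (pow_pos (κ_pos ξ) 20).ne'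
  · filter_upwards with ξ
    rw [norm_mul, Complex.norm_real, Real.norm_eq_abs, abs_mul, abs_mul]
    refine mul_le_mul_of_nonneg_right ?_ (norm_nonneg _)
    have h1 := hel_le α ξ
    have h2 := abs_qsym_le j l ξ
    have hκ := κ_pos ξ
    rw [abs_of_pos (by positivity), abs_of_pos (hel_pos α ξ)]
    calc (κ ξ ^ 20)⁻¹ * hel α ξ * |qsym j l ξ|
        ≤ (κ ξ ^ 20)⁻¹ * (helC α * κ ξ ^ 6) * (2 * κ ξ ^ 6) := by
          have := helC_pos α
          gcongr
      _ = helC α * 2 * ((κ ξ ^ 20)⁻¹ * κ ξ ^ 12) := by ring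
      _ ≤ helC α * 2 * 1 := by
          have := helC_pos α
          gcongr
          rw [inv_mul_le_iff₀ (by positivity), mul_one]
          exact κ_pow_mono ξ (by norm_num)
      _ = _ := mul_one _

theorem memLp_rhs_q {S : Fin 3 → R3 → ℂ}
    (hS : ∀ j, MemLp (fun ξ => ((κ ξ : ℂ) ^ 20)⁻¹ * ((κ ξ : ℂ) ^ 6 * S j ξ)) 2 volume) (l : Fin 3) :
    MemLp (fun ξ => ((κ ξ : ℂ) ^ 20)⁻¹ * ∑ j, S j ξ * qsym j l ξ) 2 volume ∧
    eLpNorm (fun ξ => ((κ ξ : ℂ) ^ 20)⁻¹ * ∑ j, S j ξ * qsym j l ξ) 2 volume ≤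
      ∑ j, 2 * eLpNorm (fun ξ => ((κ ξ : ℂ) ^ 20)⁻¹ * ((κ ξ : ℂ) ^ 6 * S j ξ)) 2 volume := by
  have e : (fun ξ => ((κ ξ : ℂ) ^ 20)⁻¹ * ∑ j, S j ξ * qsym j l ξ) =
      fun ξ => ∑ j, ((qsym j l ξ * (κ ξ ^ 6)⁻¹ : ℝ) : ℂ) *
        (((κ ξ : ℂ) ^ 20)⁻¹ * ((κ ξ : ℂ) ^ 6 * S j ξ)) := by
    ext ξ
    rw [Finset.mul_sum]
    congr 1; ext j; push_cast
    have := κ_ne_zero_complex ξ 6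
    field_simp
  have hb : ∀ j ξ, |qsym j l ξ * (κ ξ ^ 6)⁻¹| ≤ 2 := fun j ξ => by
    have hκ := κ_pos ξ
    rw [abs_mul, abs_of_pos (a := (κ ξ ^ 6)⁻¹) (by positivity), mul_inv_le_iff₀ (by positivity)]
    exact abs_qsym_le j l ξ
  have hn : ∀ j, ∀ᵐ ξ, ‖((qsym j l ξ * (κ ξ ^ 6)⁻¹ : ℝ) : ℂ) *
        (((κ ξ : ℂ) ^ 20)⁻¹ * ((κ ξ : ℂ) ^ 6 * S j ξ))‖ ≤
        2 * ‖((κ ξ : ℂ) ^ 20)⁻¹ * ((κ ξ : ℂ) ^ 6 * S j ξ)‖ := fun j => by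
    filter_upwards with ξ
    rw [norm_mul, Complex.norm_real, Real.norm_eq_abs]
    gcongr
    exact hb j ξ
  have hm : ∀ j, MemLp (fun ξ => ((qsym j l ξ * (κ ξ ^ 6)⁻¹ : ℝ) : ℂ) *
        (((κ ξ : ℂ) ^ 20)⁻¹ * ((κ ξ : ℂ) ^ 6 * S j ξ))) 2 volume := fun j => by
    refine (hS j).of_le_mul (c := 2) ?_ (hn j)
    refine (Continuous.aestronglyMeasurable ?_).mul (hS j).1
    refine Complex.continuous_ofReal.comp (Continuous.mul (by fun_prop) ?_)
    exact (continuous_κ.pow 6).inv₀ fun ξ => (pow_pos (κ_pos ξ) 6).ne'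
  rw [e]
  refine ⟨memLp_finsetSum _ fun j _ => hm j, ?_⟩
  have := eLpNorm_sum_le (s := Finset.univ) (f := fun j ξ => ((qsym j l ξ * (κ ξ ^ 6)⁻¹ : ℝ) : ℂ) *
        (((κ ξ : ℂ) ^ 20)⁻¹ * ((κ ξ : ℂ) ^ 6 * S j ξ))) (μ := volume) (p := 2)
        (fun j _ => (hm j).1) (by norm_num)
  rw [Finset.sum_fn] at this
  refine this.trans (Finset.sum_le_sum fun j _ => ?_)
  refine (eLpNorm_le_mul_eLpNorm_of_ae_le_mul (hn j) 2).trans (by simp)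

/-- In `L²` the curves `a l = κ^{-20} hel |ξ|² U_l` have weak derivatives `κ^{-20} ∑ qsym R_j`
against the dense span of the functions `κ^{20} ζ̂`. The truncated energy is a quadratic form of
these curves with a bounded multiplier, so it can be differentiated. The projection disappears from
the result because it can be moved onto the divergence free `U`. -/
theorem SpectralSolution.hasDerivAt_energy (hS : SpectralSolution α t₀ t₁ U R) {wt : R3 → ℝ}
    (hwt : Measurable wt) {M : ℝ} (hM : ∀ ξ, |wt ξ| ≤ M) {n : ℝ} (hn : 0 < n)
    (hsupp : ∀ ξ, wt ξ ≠ 0 → n⁻¹ < ‖ξ‖ ∧ ‖ξ‖ < n) {t : ℝ} (ht : t ∈ Ioo t₀ t₁) :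
    HasDerivAt (fun τ => ∫ ξ, wt ξ * hel α ξ * ∑ l, ‖U τ l ξ‖ ^ 2)
      (2 * ∫ ξ, wt ξ * ∑ l, ((starRingEnd ℂ) (U t l ξ) * R t l ξ).re) t := by
  -- The multiplier is chosen so that `w |κ^{-20} hel |ξ|² U|² = wt hel |U|²`. It is bounded only
  -- because `wt` vanishes near zero and near infinity.
  let w : R3 → ℝ := fun ξ => wt ξ * κ ξ ^ 40 * (hel α ξ * ‖ξ‖ ^ 4)⁻¹
  have hw : Measurable w := by have := measurable_κ; fun_prop
  have hwb : ∀ ξ, |w ξ| ≤ M * (1 + n ^ 2) ^ 7 * n ^ 4 := by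
    intro ξ
    have hM0 : 0 ≤ M := (abs_nonneg _).trans (hM ξ)
    by_cases h0 : wt ξ = 0
    · simp only [w, h0, zero_mul, abs_zero]; positivity
    obtain ⟨h1, h2⟩ := hsupp ξ h0
    have hκ := κ_pos ξ
    have hh := one_le_hel α ξ
    have hhp := hel_pos α ξ
    have hξ : 0 < ‖ξ‖ := lt_trans (by positivity) h1
    simp only [w]
    rw [abs_mul, abs_mul, abs_of_pos (a := κ ξ ^ 40) (by positivity), abs_of_pos (a := _⁻¹)
      (by positivity)]
    have h3 : κ ξ ^ 40 ≤ (1 + n ^ 2) ^ 7 := by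
      calc κ ξ ^ 40 ≤ κ ξ ^ 42 := κ_pow_mono ξ (by norm_num)
        _ = (κ ξ ^ 6) ^ 7 := by rw [← pow_mul]
        _ ≤ _ := by rw [κ_pow_six]; gcongr
    have h4 : (hel α ξ * ‖ξ‖ ^ 4)⁻¹ ≤ n ^ 4 := by
      rw [inv_le_comm₀ (by positivity) (by positivity), ← inv_pow]
      calc n⁻¹ ^ 4 ≤ ‖ξ‖ ^ 4 := by gcongr
        _ ≤ hel α ξ * ‖ξ‖ ^ 4 := le_mul_of_one_le_left (by positivity) hh
    gcongr
    exact hM ξ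
  let a : Fin 3 → ℝ → Lp ℂ 2 (volume : Measure R3) := fun l τ =>
    l2 fun ξ => ((κ ξ : ℂ) ^ 20)⁻¹ * ∑ j, (hel α ξ : ℂ) * U τ j ξ * qsym j l ξ
  let b : Fin 3 → ℝ → Lp ℂ 2 (volume : Measure R3) := fun l τ =>
    l2 fun ξ => ((κ ξ : ℂ) ^ 20)⁻¹ * ∑ j, R τ j ξ * qsym j l ξ
  have ha : ∀ l, ∀ τ ∈ Ioo t₀ t₁, a l τ =ᵐ[volume]
      fun ξ => ((κ ξ : ℂ) ^ 20)⁻¹ * ∑ j, (hel α ξ : ℂ) * U τ j ξ * qsym j l ξ :=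
    fun l τ hτ => coeFn_l2 (memLp_lhs (hS.memLp τ hτ) l)
  have ha' : ∀ l, ∀ τ ∈ Ioo t₀ t₁, a l τ =ᵐ[volume]
      fun ξ => ((κ ξ : ℂ) ^ 20)⁻¹ * (hel α ξ * (‖ξ‖ : ℂ) ^ 2 * U τ l ξ) := fun l τ hτ => by
    filter_upwards [ha l τ hτ, hS.divFree τ hτ] with ξ h1 h2
    rw [h1]
    congr 1
    rw [sum_mul_qsym (V := fun j => (hel α ξ : ℂ) * U τ j ξ)]
    · ring
    · rw [← mul_zero (hel α ξ : ℂ), ← h2, Finset.mul_sum]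
      congr 1; ext i; ring
  have hbb : ∀ l, ∀ τ ∈ Ioo t₀ t₁, b l τ =ᵐ[volume]
      fun ξ => ((κ ξ : ℂ) ^ 20)⁻¹ * ∑ j, R τ j ξ * qsym j l ξ :=
    fun l τ hτ => coeFn_l2 (memLp_rhs_q (hS.memLp_rhs τ hτ) l).1
  obtain ⟨C, hC⟩ := hS.bound
  have hbnorm : ∀ l, ∀ τ ∈ Ioo t₀ t₁, ‖b l τ‖ ≤ 6 * max C 0 := fun l τ hτ => by
    have := memLp_rhs_q (hS.memLp_rhs τ hτ) l
    refine norm_l2_le this.1 (by positivity) (this.2.trans ?_)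
    calc _ ≤ ∑ j : Fin 3, 2 * ENNReal.ofReal C := by gcongr; exact hC τ hτ _
      _ = 6 * ENNReal.ofReal C := by simp; ring
      _ ≤ _ := by
        rw [ENNReal.ofReal_mul (by norm_num)]
        simp
  have inner_test : ∀ {ζ : R3 → ℝ} (hζ : IsTest ζ) {c : Lp ℂ 2 (volume : Measure R3)}
      {g : R3 → ℂ}, c =ᵐ[volume] (fun ξ => ((κ ξ : ℂ) ^ 20)⁻¹ * g ξ) →
      inner ℂ (weightedRft 20 hζ) c = ∫ ξ, g ξ * rft ζ (-ξ) := by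
    intro ζ hζ c g hc
    rw [L2.inner_def]
    apply integral_congr_ae
    filter_upwards [hc, coeFn_weightedRft 20 hζ] with ξ h1 h2
    rw [h1, h2, RCLike.inner_apply, map_mul, rft_neg_arg, map_pow, Complex.conj_ofReal]
    have := κ_ne_zero_complex ξ 1
    rw [pow_one] at this
    field_simp
  have hD : ∀ l, ∀ z ∈ {z | ∃ ζ, ∃ h : IsTest ζ, z = weightedRft 20 h}, ∀ τ ∈ Ioo t₀ t₁,
      HasDerivAt (fun s => inner ℂ z (a l s)) (inner ℂ z (b l τ)) τ := by
    rintro l z ⟨ζ, hζ, rfl⟩ τ hτ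
    rw [inner_test hζ (hbb l τ hτ)]
    refine (hS.weak τ hτ l ζ hζ).congr_of_eventuallyEq ?_
    filter_upwards [Ioo_mem_nhds hτ.1 hτ.2] with s hs
    exact inner_test hζ (ha l s hs)
  have key := fun l => hasDerivAt_re_inner_self (dense_span_weightedRft 20) (hD l) (hbnorm l)
    (mulL2 w hw _ hwb) (mulL2_symm hw hwb) ht
  have key2 := HasDerivAt.fun_sum (u := Finset.univ) fun l _ => key l
  have inner_w : ∀ c d : Lp ℂ 2 (volume : Measure R3),
      inner ℂ (mulL2 w hw _ hwb c) d = ∫ ξ, (w ξ : ℂ) * ((starRingEnd ℂ) (c ξ) * d ξ) := by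
    intro c d
    rw [L2.inner_def]
    apply integral_congr_ae
    filter_upwards [coeFn_mulL2 hw hwb c] with ξ h1
    rw [h1, RCLike.inner_apply, map_mul, Complex.conj_ofReal]
    ring
  have int_w : ∀ c d : Lp ℂ 2 (volume : Measure R3),
      Integrable (fun ξ => (w ξ : ℂ) * ((starRingEnd ℂ) (c ξ) * d ξ)) volume := by
    intro c d
    refine (L2.integrable_inner (𝕜 := ℂ) (mulL2 w hw _ hwb c) d).congr ?_
    filter_upwards [coeFn_mulL2 hw hwb c] with ξ h1
    rw [h1, RCLike.inner_apply, map_mul, Complex.conj_ofReal]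
    ring
  have sum_re : ∀ c d : Fin 3 → Lp ℂ 2 (volume : Measure R3),
      ∑ l, (inner ℂ (mulL2 w hw _ hwb (c l)) (d l)).re =
      ∫ ξ, w ξ * ∑ l, ((starRingEnd ℂ) (c l ξ) * d l ξ).re := by
    intro c d
    simp only [inner_w]
    rw [← Complex.re_sum, ← integral_finsetSum _ fun l _ => int_w _ _, ← RCLike.re_eq_complex_re,
      ← integral_re (integrable_finsetSum _ fun l _ => int_w _ _)]
    congr 1; ext ξ
    rw [RCLike.re_eq_complex_re, Complex.re_sum, Finset.mul_sum]
    congr 1; ext l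
    rw [Complex.re_ofReal_mul]
  have key3 : HasDerivAt (fun τ => ∫ ξ, wt ξ * hel α ξ * ∑ l, ‖U τ l ξ‖ ^ 2)
      (∑ l, 2 * (inner ℂ (mulL2 w hw _ hwb (a l t)) (b l t)).re) t := by
    refine key2.congr_of_eventuallyEq ?_
    filter_upwards [Ioo_mem_nhds ht.1 ht.2] with τ hτ
    rw [sum_re (fun l => a l τ) (fun l => a l τ)]
    apply integral_congr_ae
    filter_upwards [ae_all_iff.2 fun l => ha' l τ hτ] with ξ hξ
    by_cases h0 : wt ξ = 0
    · simp [w, h0]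
    have hξ0 : ‖ξ‖ ≠ 0 := (lt_trans (by positivity) (hsupp ξ h0).1).ne'
    have hh := (hel_pos α ξ).ne'
    have hκ := (κ_pos ξ).ne'
    rw [Finset.mul_sum, Finset.mul_sum]
    congr 1; ext l
    have : ((starRingEnd ℂ) (a l τ ξ) * a l τ ξ).re =
        ((κ ξ ^ 20)⁻¹ * (hel α ξ * ‖ξ‖ ^ 2)) ^ 2 * ‖U τ l ξ‖ ^ 2 := by
      rw [← Complex.normSq_eq_conj_mul_self, Complex.ofReal_re, Complex.normSq_eq_norm_sq, hξ l,
        norm_mul, norm_mul, norm_mul, norm_inv, norm_κ_pow, Complex.norm_real, norm_pow,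
        Complex.norm_real, norm_norm, Real.norm_of_nonneg (hel_pos α ξ).le]
      ring
    rw [this]
    simp only [w]
    field_simp
  convert key3 using 1
  rw [← Finset.mul_sum, sum_re (fun l => a l t) (fun l => b l t)]
  congr 1
  apply integral_congr_ae
  filter_upwards [ae_all_iff.2 fun l => ha' l t ht, ae_all_iff.2 fun l => hbb l t ht,
    hS.divFree t ht] with ξ hξ hξ' hdiv
  by_cases h0 : wt ξ = 0
  · simp [w, h0]
  have hξ0 : ‖ξ‖ ≠ 0 := (lt_trans (by positivity) (hsupp ξ h0).1).ne'
  have hh := (hel_pos α ξ).ne'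
  have hκ := (κ_pos ξ).ne'
  -- By symmetry of `qsym`, the matrix is applied to the conjugate of `U`, which is still orthogonal
  -- to the real vector `ξ`. This yields the second factor `|ξ|²` needed to cancel the weight.
  have e1 : ∑ l, (starRingEnd ℂ) (a l t ξ) * b l t ξ =
      (((κ ξ ^ 40)⁻¹ * hel α ξ * ‖ξ‖ ^ 2 * ‖ξ‖ ^ 2 : ℝ) : ℂ) *
        ∑ j, (starRingEnd ℂ) (U t j ξ) * R t j ξ := by
    have hdiv' : ∑ j, (ξ j : ℂ) * (starRingEnd ℂ) (U t j ξ) = 0 := by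
      have := congrArg (starRingEnd ℂ) hdiv
      simpa using this
    calc _ = ∑ l, ∑ j, (((κ ξ ^ 40)⁻¹ * hel α ξ * ‖ξ‖ ^ 2 : ℝ) : ℂ) *
          (R t j ξ * ((starRingEnd ℂ) (U t l ξ) * qsym l j ξ)) := by
          congr 1; ext l
          rw [hξ l, hξ' l, Finset.mul_sum, Finset.mul_sum]
          congr 1; ext j
          rw [qsym_comm l j]
          simp only [map_mul, map_inv₀, map_pow, Complex.conj_ofReal]
          push_cast
          have := κ_ne_zero_complex ξ 20
          have := κ_ne_zero_complex ξ 40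
          field_simp
      _ = _ := by
          rw [Finset.sum_comm, Finset.mul_sum]
          congr 1; ext j
          rw [← Finset.mul_sum, ← Finset.mul_sum, sum_mul_qsym hdiv']
          push_cast; ring
  have e2 := congrArg Complex.re e1
  rw [Complex.re_sum, Complex.re_ofReal_mul, Complex.re_sum] at e2
  rw [e2]
  simp only [w]
  field_simp

end

section


/-! ### The weak equation on the Fourier side -/

theorem rft_add {ζ η : R3 → ℝ} (h : IsTest ζ) (h' : IsTest η) (ξ : R3) :
    rft (fun x => ζ x + η x) ξ = rft ζ ξ + rft η ξ := by
  have e : (h.add h').schwartz = h.schwartz + h'.schwartz := by ext x; simp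
  rw [h.rft_eq, h'.rft_eq, (h.add h').rft_eq, e, FourierTransform.fourier_add]; rfl

theorem rft_const_mul (ζ : R3 → ℝ) (c : ℝ) (ξ : R3) :
    rft (fun x => c * ζ x) ξ = c * rft ζ ξ := by
  rw [rft, rft, fourier_apply_integral, fourier_apply_integral, ← integral_const_mul]
  congr 1; ext x; push_cast; ring

theorem rft_sub {ζ η : R3 → ℝ} (h : IsTest ζ) (h' : IsTest η) (ξ : R3) :
    rft (fun x => ζ x - η x) ξ = rft ζ ξ - rft η ξ := by
  have := rft_add h (h'.const_mul (-1)) ξ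
  rw [rft_const_mul] at this
  simpa [sub_eq_add_neg] using this

theorem rft_zero (ξ : R3) : rft (fun _ => 0) ξ = 0 := by
  simp [rft, fourier_apply_integral]

theorem rft_sum {ι : Type*} (s : Finset ι) {ζ : ι → R3 → ℝ} (h : ∀ i ∈ s, IsTest (ζ i)) (ξ : R3) :
    rft (fun x => ∑ i ∈ s, ζ i x) ξ = ∑ i ∈ s, rft (ζ i) ξ := by
  classical
  induction s using Finset.induction_on with
  | empty => simp [rft_zero]
  | insert a s ha ih =>
    simp only [Finset.sum_insert ha]
    rw [rft_add (h a (by simp)) (IsTest.sum s fun i hi => h i (by simp [hi])),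
      ih fun i hi => h i (by simp [hi])]

theorem eq_of_rft_eq {ζ η : R3 → ℝ} (h : IsTest ζ) (h' : IsTest η) (he : ∀ ξ, rft ζ ξ = rft η ξ) :
    ζ = η := by
  have : 𝓕 h.schwartz = 𝓕 h'.schwartz := by
    ext ξ; exact he ξ
  have e := congrArg (fun g => 𝓕⁻ g) this
  simp only [FourierTransform.fourierInv_fourier_eq] at e
  ext x
  have := congrArg (fun g : 𝓢(R3, ℂ) => g x) e
  simpa using this

/-- The Laplacian of a scalar function. -/
def lap (ζ : R3 → ℝ) (x : R3) : ℝ := ∑ k, partialD k (partialD k ζ) x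

theorem IsTest.lap {ζ : R3 → ℝ} (h : IsTest ζ) : IsTest (lap ζ) :=
  IsTest.sum _ fun k _ => (h.partialD k).partialD k

theorem norm_sq_eq_sum (ξ : R3) : (‖ξ‖ : ℂ) ^ 2 = ∑ k, (ξ k : ℂ) ^ 2 := by
  have := EuclideanSpace.norm_sq_eq ξ
  rw [← Complex.ofReal_pow, this]
  simp

theorem IsTest.rft_lap {ζ : R3 → ℝ} (h : IsTest ζ) (ξ : R3) :
    rft (MLANS.lap ζ) ξ = -(4 * Real.pi ^ 2 * ‖ξ‖ ^ 2 : ℝ) * rft ζ ξ := by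
  have : rft (MLANS.lap ζ) ξ = ∑ k, rft (MLANS.partialD k (MLANS.partialD k ζ)) ξ :=
    rft_sum _ (fun k _ => (h.partialD k).partialD k) ξ
  rw [this]
  simp only [(h.partialD _).rft_partialD, h.rft_partialD]
  push_cast
  rw [norm_sq_eq_sum, Finset.mul_sum, ← Finset.sum_neg_distrib, Finset.sum_mul]
  congr 1; ext k
  linear_combination (4 * Real.pi ^ 2 * (ξ k) ^ 2 * rft ζ ξ : ℂ) * Complex.I_sq

/-- The operator `1 - α²Δ` on scalar functions. -/
def helmS (α : ℝ) (ζ : R3 → ℝ) (x : R3) : ℝ := ζ x - α ^ 2 * lap ζ x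

theorem IsTest.helmS {ζ : R3 → ℝ} (h : IsTest ζ) (α : ℝ) : IsTest (helmS α ζ) :=
  h.sub (h.lap.const_mul _)

theorem IsTest.rft_helmS {ζ : R3 → ℝ} (h : IsTest ζ) (α : ℝ) (ξ : R3) :
    rft (MLANS.helmS α ζ) ξ = hel α ξ * rft ζ ξ := by
  have : rft (MLANS.helmS α ζ) ξ = rft ζ ξ - rft (fun x => α ^ 2 * MLANS.lap ζ x) ξ :=
    rft_sub h (h.lap.const_mul _) ξ
  rw [this, rft_const_mul, h.rft_lap, hel]
  push_cast; ring

/-- The components of `curl curl (ζ e_l)`. -/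
def curl2 (ζ : R3 → ℝ) (l j : Fin 3) (x : R3) : ℝ :=
  partialD j (partialD l ζ) x - (if j = l then 1 else 0) * lap ζ x

theorem IsTest.curl2 {ζ : R3 → ℝ} (h : IsTest ζ) (l j : Fin 3) : IsTest (curl2 ζ l j) :=
  ((h.partialD l).partialD j).sub (h.lap.const_mul _)

theorem IsTest.rft_curl2 {ζ : R3 → ℝ} (h : IsTest ζ) (l j : Fin 3) (ξ : R3) :
    rft (MLANS.curl2 ζ l j) ξ = 4 * Real.pi ^ 2 * qsym j l ξ * rft ζ ξ := by
  have : rft (MLANS.curl2 ζ l j) ξ = rft (MLANS.partialD j (MLANS.partialD l ζ)) ξ -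
      rft (fun x => (if j = l then 1 else 0) * MLANS.lap ζ x) ξ :=
    rft_sub ((h.partialD l).partialD j) (h.lap.const_mul _) ξ
  rw [this, rft_const_mul, h.rft_lap, (h.partialD l).rft_partialD, h.rft_partialD, qsym]
  split_ifs <;> push_cast <;>
  linear_combination (4 * Real.pi ^ 2 * ξ j * ξ l * rft ζ ξ : ℂ) * Complex.I_sq

/-- The vector field `curl curl (ζ e_l)`. -/
def curlField (ζ : R3 → ℝ) (l : Fin 3) (x : R3) : R3 := WithLp.toLp 2 fun j => curl2 ζ l j x

theorem IsTest.curlField {ζ : R3 → ℝ} (h : IsTest ζ) (l : Fin 3) : IsTest (curlField ζ l) := by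
  refine ⟨?_, ?_⟩
  · rw [contDiff_euclidean]
    exact fun j => (h.curl2 l j).1
  · have : ∀ j, HasCompactSupport (MLANS.curl2 ζ l j) := fun j => (h.curl2 l j).2
    have h2 : HasCompactSupport (fun x => (fun j => MLANS.curl2 ζ l j x : Fin 3 → ℝ)) := by
      rw [hasCompactSupport_iff_eventuallyEq]
      have h3 := fun j => hasCompactSupport_iff_eventuallyEq.1 (this j)
      filter_upwards [eventually_all.2 h3] with x hx
      ext j; exact hx j
    exact h2.comp_left (g := fun c : Fin 3 → ℝ => (WithLp.toLp 2 c : R3)) rfl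

/-- The divergence is itself a test function whose Fourier transform contains the factor `∑ ξ_i qsym
i l`, which is zero. Injectivity of the transform replaces commuting third order derivatives by
hand. -/
theorem isDivFreeTest_curlField {ζ : R3 → ℝ} (h : IsTest ζ) (l : Fin 3) :
    IsDivFreeTest (curlField ζ l) := by
  refine ⟨h.curlField l, fun x => ?_⟩
  have e : (fun x => ∑ i, partialD i (curl2 ζ l i) x) = fun _ => 0 := by
    refine eq_of_rft_eq (IsTest.sum _ fun i _ => (h.curl2 l i).partialD i) isTest_zero fun ξ => ?_
    rw [rft_sum _ fun i _ => (h.curl2 l i).partialD i, rft_zero]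
    simp only [(h.curl2 _ _).rft_partialD, h.rft_curl2]
    have e1 := norm_sq_eq_sum ξ
    have : ∑ i, (ξ i : ℂ) * qsym i l ξ = 0 := by
      have e2 : ∀ i, (ξ i : ℂ) * qsym i l ξ =
        (if i = l then (ξ i : ℂ) * (‖ξ‖ : ℂ) ^ 2 else 0) - (ξ i : ℂ) ^ 2 * ξ l := by
        intro i; unfold qsym; split_ifs <;> push_cast <;> ring
      simp only [e2, Finset.sum_sub_distrib, ← Finset.sum_mul, ← e1]
      simp [mul_comm]
    calc _ = 2 * Real.pi * Complex.I * (4 * Real.pi ^ 2) * rft ζ ξ *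
          ∑ i, (ξ i : ℂ) * qsym i l ξ := by
          rw [Finset.mul_sum]; congr 1; ext i; ring
      _ = 0 := by rw [this, mul_zero]
  exact congrFun e x

theorem partialD_partialD_eq {ζ : R3 → ℝ} (h : ContDiff ℝ ∞ ζ) (k : Fin 3) (x : R3) :
    partialD k (partialD k ζ) x = iteratedFDeriv ℝ 2 ζ x ![e3 k, e3 k] := by
  rw [iteratedFDeriv_two_apply]
  unfold partialD
  have h1 : DifferentiableAt ℝ (fderiv ℝ ζ) x :=
    ((h.fderiv_right (m := ∞) (by simp)).differentiable (by simp)).differentiableAt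
  rw [fderiv_clm_apply h1 (by fun_prop)]
  simp

theorem laplacian_eq_lap {ζ : R3 → ℝ} (h : ContDiff ℝ ∞ ζ) (x : R3) : Δ ζ x = lap ζ x := by
  rw [InnerProductSpace.laplacian_eq_iteratedFDeriv_orthonormalBasis ζ
    (EuclideanSpace.basisFun (Fin 3) ℝ)]
  unfold lap
  refine Finset.sum_congr rfl fun k _ => ?_
  rw [partialD_partialD_eq h]
  simp

theorem laplacian_apply_eq {φ : R3 → R3} (h : ContDiff ℝ ∞ φ) (x : R3) (j : Fin 3) :
    (Δ φ x) j = lap (fun y => φ y j) x := by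
  rw [← laplacian_eq_lap (contDiff_euclidean.1 h j)]
  have := (contDiff_infty.1 h 2).contDiffAt (x := x)
  exact ((this.laplacian_CLM_comp_left (l := EuclideanSpace.proj (𝕜 := ℝ) j))).symm

theorem helm_apply {φ : R3 → R3} (h : ContDiff ℝ ∞ φ) (α : ℝ) (x : R3) (j : Fin 3) :
    helm α φ x j = helmS α (fun y => φ y j) x := by
  rw [helm, helmS, ← laplacian_apply_eq h]
  simp

theorem IsTest.comp_apply {φ : R3 → R3} (h : IsTest φ) (j : Fin 3) : IsTest fun x => φ x j :=
  ⟨contDiff_euclidean.1 h.1 j, h.2.comp_left (g := fun y : R3 => y j) rfl⟩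

theorem contDiff_helm {φ : R3 → R3} (h : IsTest φ) (α : ℝ) : ContDiff ℝ ∞ (helm α φ) := by
  rw [contDiff_euclidean]
  intro j
  have : (fun x => helm α φ x j) = helmS α fun y => φ y j := by
    ext x; exact helm_apply h.1 α x j
  rw [this]
  exact ((h.comp_apply j).helmS α).1

/-- `F` is the Fourier transform of the locally integrable function `f` in the sense of
distributions. -/
structure IsDFT (f : R3 → ℝ) (F : R3 → ℂ) : Prop where
  integrable : ∀ ζ, IsTest ζ → Integrable (fun x => f x * ζ x) volume
  memLp : MemLp (fun ξ => ((κ ξ : ℂ) ^ 5)⁻¹ * F ξ) 2 volume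
  pair : ∀ ζ, IsTest ζ → ((∫ x, f x * ζ x : ℝ) : ℂ) = ∫ ξ, F ξ * rft ζ (-ξ)

variable {f g : R3 → ℝ} {F G : R3 → ℂ}

theorem κ_inv_memLp {F : R3 → ℂ} (h : MemLp F 2 volume) (m : ℕ) :
    MemLp (fun ξ => ((κ ξ : ℂ) ^ m)⁻¹ * F ξ) 2 volume := by
  refine h.of_le ?_ ?_
  · refine (Continuous.aestronglyMeasurable ?_).mul h.1
    exact ((Complex.continuous_ofReal.comp continuous_κ).pow m).inv₀ fun ξ => κ_ne_zero_complex ξ m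
  · filter_upwards with ξ
    rw [norm_mul, norm_inv, norm_κ_pow]
    exact mul_le_of_le_one_left (norm_nonneg _) (inv_le_one_of_one_le₀ (one_le_κ_pow ξ m))

theorem eLpNorm_κ_inv_le (F : R3 → ℂ) (m : ℕ) :
    eLpNorm (fun ξ => ((κ ξ : ℂ) ^ m)⁻¹ * F ξ) 2 volume ≤ eLpNorm F 2 volume := by
  refine eLpNorm_mono fun ξ => ?_
  rw [norm_mul, norm_inv, norm_κ_pow]
  exact mul_le_of_le_one_left (norm_nonneg _) (inv_le_one_of_one_le₀ (one_le_κ_pow ξ m))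

theorem rft_neg_integrable {m : ℕ} (hF : MemLp (fun ξ => ((κ ξ : ℂ) ^ m)⁻¹ * F ξ) 2 volume)
    {ζ : R3 → ℝ} (h : IsTest ζ) : Integrable (fun ξ => F ξ * rft ζ (-ξ)) volume := by
  have := κ_inv_mul_memLp_integrable hF (sneg (𝓕 h.schwartz))
  simpa [h.rft_eq] using this

theorem IsFT.integral_mul_test (h : IsFT (fun x => (f x : ℂ)) F) {ζ : R3 → ℝ} (hζ : IsTest ζ) :
    ((∫ x, f x * ζ x : ℝ) : ℂ) = ∫ ξ, F ξ * rft ζ (-ξ) := by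
  rw [← integral_complex_ofReal, ← h.integral_mul hζ.isFT]
  congr 1; ext x; push_cast; rfl

theorem IsFT.isDFT (h : IsFT (fun x => (f x : ℂ)) F) : IsDFT f F := by
  refine ⟨fun ζ hζ => ?_, κ_inv_memLp h.memLp_ft 5, fun ζ hζ => h.integral_mul_test hζ⟩
  have := h.memLp.integrable_mul hζ.isFT.memLp
  refine this.re.congr ?_
  filter_upwards with x
  simp

theorem IsDFT.add (hf : IsDFT f F) (hg : IsDFT g G) :
    IsDFT (fun x => f x + g x) (fun ξ => F ξ + G ξ) := by
  refine ⟨fun ζ hζ => ?_, ?_, fun ζ hζ => ?_⟩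
  · simp only [add_mul]; exact (hf.integrable ζ hζ).add (hg.integrable ζ hζ)
  · have := hf.memLp.add hg.memLp
    refine this.ae_eq ?_
    filter_upwards with ξ
    simp [mul_add]
  · simp only [add_mul]
    rw [integral_add (hf.integrable ζ hζ) (hg.integrable ζ hζ), integral_add
      (rft_neg_integrable hf.memLp hζ) (rft_neg_integrable hg.memLp hζ), ← hf.pair ζ hζ,
      ← hg.pair ζ hζ]
    push_cast; rfl

theorem IsDFT.const_mul (hf : IsDFT f F) (c : ℝ) :
    IsDFT (fun x => c * f x) (fun ξ => c * F ξ) := by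
  refine ⟨fun ζ hζ => ?_, ?_, fun ζ hζ => ?_⟩
  · simpa [mul_assoc] using (hf.integrable ζ hζ).const_mul c
  · refine (hf.memLp.const_mul (c : ℂ)).ae_eq ?_
    filter_upwards with ξ
    ring
  · simp only [mul_assoc]
    rw [integral_const_mul, integral_const_mul, ← hf.pair ζ hζ]
    push_cast; rfl

theorem isDFT_zero : IsDFT (fun _ => 0) (fun _ => 0) :=
  ⟨fun _ _ => by simp, by simp, by simp⟩

theorem IsDFT.sum {ι : Type*} (s : Finset ι) {f : ι → R3 → ℝ} {F : ι → R3 → ℂ}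
    (h : ∀ i ∈ s, IsDFT (f i) (F i)) :
    IsDFT (fun x => ∑ i ∈ s, f i x) (fun ξ => ∑ i ∈ s, F i ξ) := by
  classical
  induction s using Finset.induction_on with
  | empty => simpa using isDFT_zero
  | insert a s ha ih =>
    simp only [Finset.sum_insert ha]
    exact (h a (by simp)).add (ih fun i hi => h i (by simp [hi]))

theorem IsDFT.congr (h : IsDFT f F) (hf : f =ᵐ[volume] g) : IsDFT g F := by
  have e : ∀ ζ : R3 → ℝ, (fun x => f x * ζ x) =ᵐ[volume] fun x => g x * ζ x := fun ζ => by
    filter_upwards [hf] with x hx; rw [hx]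
  exact ⟨fun ζ hζ => (h.integrable ζ hζ).congr (e ζ), h.memLp,
    fun ζ hζ => by rw [← h.pair ζ hζ, integral_congr_ae (e ζ)]⟩

theorem norm_fourier_le (f : R3 → ℂ) (ξ : R3) : ‖𝓕 f ξ‖ₑ ≤ ∫⁻ x, ‖f x‖ₑ := by
  rw [fourier_apply_integral]
  refine (enorm_integral_le_lintegral_enorm _).trans (le_of_eq ?_)
  congr 1; ext x
  rw [enorm_mul, ← Complex.ofReal_neg]
  rw [show ‖Complex.exp (((-(2 * Real.pi * inner ℝ x ξ) : ℝ) : ℂ) * Complex.I)‖ₑ = 1 by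
    rw [← ofReal_norm, Complex.norm_exp_ofReal_mul_I, ENNReal.ofReal_one]]
  rw [one_mul]

theorem aestronglyMeasurable_κ_inv_mul (hF : AEStronglyMeasurable F volume) (m : ℕ) :
    AEStronglyMeasurable (fun ξ => ((κ ξ : ℂ) ^ m)⁻¹ * F ξ) volume := by
  refine (Continuous.aestronglyMeasurable ?_).mul hF
  exact ((Complex.continuous_ofReal.comp continuous_κ).pow m).inv₀ fun ξ => κ_ne_zero_complex ξ m

theorem enorm_κ_pow (ξ : R3) (m : ℕ) : ‖(κ ξ : ℂ) ^ m‖ₑ = κe ξ ^ m := by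
  rw [← ofReal_norm, norm_κ_pow, κe_pow]

theorem eLpNorm_κ_inv_of_bounded {c : ℝ≥0∞} (hc : c ≠ ⊤) (hF : ∀ ξ, ‖F ξ‖ₑ ≤ c) :
    eLpNorm (fun ξ => ((κ ξ : ℂ) ^ 5)⁻¹ * F ξ) 2 volume ≤ Kinv * c := by
  rw [← n2_eLpNorm, mul_comm, Kinv, ← n2_const_mul c hc]
  refine n2_mono (ae_of_all _ fun ξ => ?_)
  rw [enorm_mul, mul_comm, enorm_inv (κ_ne_zero_complex ξ 5), enorm_κ_pow, ENNReal.inv_pow]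
  gcongr
  exact hF ξ

/-- The transform of an integrable function is continuous and bounded but need not be square
integrable. The factor `κ^{-5} ∈ L²` supplies the missing decay, and this fixes the weight in
`IsDFT`. -/
theorem isDFT_of_integrable (hf : Integrable f volume) :
    IsDFT f (𝓕 fun x => (f x : ℂ)) := by
  have hfc : Integrable (fun x => (f x : ℂ)) volume := hf.ofReal
  refine ⟨fun ζ hζ => ?_, ⟨?_, ?_⟩, fun ζ hζ => ?_⟩
  · obtain ⟨C, hC⟩ := hζ.2.exists_bound_of_continuous hζ.1.continuous
    exact hf.mul_bdd hζ.1.continuous.aestronglyMeasurable (ae_of_all _ hC)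
  · exact aestronglyMeasurable_κ_inv_mul
      (VectorFourier.fourierIntegral_continuous Real.continuous_fourierChar continuous_inner
        hfc).aestronglyMeasurable 5
  · have hc : ∫⁻ x, ‖(f x : ℂ)‖ₑ ≠ ⊤ := hfc.2.ne
    refine (eLpNorm_κ_inv_of_bounded hc (norm_fourier_le _)).trans_lt ?_
    exact ENNReal.mul_lt_top Kinv_lt_top hc.lt_top
  · have h1 := integral_fourier_mul_eq hfc (SchwartzMap.integrable (𝓕⁻ hζ.schwartz))
    have e : 𝓕 (𝓕⁻ hζ.schwartz) = hζ.schwartz := FourierTransform.fourier_fourierInv_eq _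
    rw [← SchwartzMap.fourier_coe, e] at h1
    rw [← integral_complex_ofReal]
    simp only [IsTest.schwartz_apply] at h1
    push_cast
    rw [← h1]
    congr 1

end


/-! ### The right-hand side in a negative Sobolev space, and the passage from weak to spectral
solutions -/

/-- The Fourier transform of the right-hand side of the weak equation. -/
def rhs (α ν : ℝ) (U : Fin 3 → R3 → ℂ) (Mh Sh : Fin 3 → Fin 3 → R3 → ℂ) (j : Fin 3) (ξ : R3) : ℂ :=
  ∑ i, -(2 * Real.pi * Complex.I * ξ i) * (hel α ξ * Mh i j ξ + Sh i j ξ) -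
    ν * (4 * Real.pi ^ 2 * ‖ξ‖ ^ 2 : ℝ) * hel α ξ * U j ξ

/-- This explains the exponent 20: six powers of `κ` for `qsym`, three for the derivative, six for
the symbol of `1 - α²Δ`, and five because the flux is controlled only after multiplication by
`κ^{-5}`. -/
theorem rhs_term_bound (α : ℝ) (i : Fin 3) (ξ : R3) :
    ‖((κ ξ : ℂ) ^ 20)⁻¹ * ((κ ξ : ℂ) ^ 6 * (-(2 * Real.pi * Complex.I * ξ i) * hel α ξ *
      (κ ξ : ℂ) ^ 5))‖ ≤ 2 * Real.pi * helC α := by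
  have hκ := κ_pos ξ
  have h1 := hel_le α ξ
  have h2 := (abs_apply_le_norm ξ i).trans (norm_le_κ_pow ξ)
  have h3 := helC_pos α
  simp only [norm_mul, norm_inv, norm_κ_pow, norm_neg, Complex.norm_I, Complex.norm_real,
    Complex.norm_ofNat, Real.norm_eq_abs, abs_of_pos Real.pi_pos, abs_of_pos (hel_pos α ξ), mul_one]
  calc (κ ξ ^ 20)⁻¹ * (κ ξ ^ 6 * (2 * Real.pi * |ξ i| * hel α ξ * κ ξ ^ 5))
      ≤ (κ ξ ^ 20)⁻¹ * (κ ξ ^ 6 * (2 * Real.pi * κ ξ ^ 3 * (helC α * κ ξ ^ 6) * κ ξ ^ 5)) := by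
        have := Real.pi_pos
        have := (hel_pos α ξ).le
        gcongr
    _ = _ := by field_simp

theorem rhs_term_bound' (i : Fin 3) (ξ : R3) :
    ‖((κ ξ : ℂ) ^ 20)⁻¹ * ((κ ξ : ℂ) ^ 6 * (-(2 * Real.pi * Complex.I * ξ i) *
      (κ ξ : ℂ) ^ 5))‖ ≤ 2 * Real.pi * helC 0 := by
  have := rhs_term_bound 0 i ξ
  simpa [hel, helC] using this

theorem rhs_visc_bound (α : ℝ) (ξ : R3) :
    ‖((κ ξ : ℂ) ^ 20)⁻¹ * ((κ ξ : ℂ) ^ 6 * ((4 * Real.pi ^ 2 * ‖ξ‖ ^ 2 : ℝ) * hel α ξ))‖ ≤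
      4 * Real.pi ^ 2 * helC α := by
  have hκ := κ_pos ξ
  have h1 := hel_le α ξ
  have h2 : ‖ξ‖ ^ 2 ≤ κ ξ ^ 6 := by rw [κ_pow_six]; linarith
  have h3 := helC_pos α
  rw [norm_mul, norm_mul, norm_mul, norm_inv, norm_κ_pow, norm_κ_pow, Complex.norm_real,
    Complex.norm_real, Real.norm_of_nonneg (hel_pos α ξ).le, Real.norm_of_nonneg (by positivity)]
  calc (κ ξ ^ 20)⁻¹ * (κ ξ ^ 6 * (4 * Real.pi ^ 2 * ‖ξ‖ ^ 2 * hel α ξ))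
      ≤ (κ ξ ^ 20)⁻¹ * (κ ξ ^ 6 * (4 * Real.pi ^ 2 * κ ξ ^ 6 * (helC α * κ ξ ^ 6))) := by
        have := (hel_pos α ξ).le
        gcongr
    _ = 4 * Real.pi ^ 2 * helC α * ((κ ξ ^ 20)⁻¹ * κ ξ ^ 18) := by ring
    _ ≤ 4 * Real.pi ^ 2 * helC α * 1 := by
        gcongr
        rw [inv_mul_le_iff₀ (by positivity), mul_one]
        exact κ_pow_mono ξ (by norm_num)
    _ = _ := mul_one _

theorem memLp_bdd_mul {c F : R3 → ℂ} (hc : Continuous c) {C : ℝ} (hC : ∀ ξ, ‖c ξ‖ ≤ C)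
    (hF : MemLp F 2 volume) : MemLp (fun ξ => c ξ * F ξ) 2 volume ∧
      eLpNorm (fun ξ => c ξ * F ξ) 2 volume ≤ ENNReal.ofReal C * eLpNorm F 2 volume := by
  have h : ∀ᵐ ξ, ‖c ξ * F ξ‖ ≤ C * ‖F ξ‖ := ae_of_all _ fun ξ => by
    rw [norm_mul]; gcongr; exact hC ξ
  exact ⟨hF.of_le_mul (hc.aestronglyMeasurable.mul hF.1) h,
    eLpNorm_le_mul_eLpNorm_of_ae_le_mul h 2⟩

theorem continuous_κ_complex : Continuous fun ξ => (κ ξ : ℂ) :=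
  Complex.continuous_ofReal.comp continuous_κ

theorem continuous_κ_inv (m : ℕ) : Continuous fun ξ => ((κ ξ : ℂ) ^ m)⁻¹ :=
  (continuous_κ_complex.pow m).inv₀ fun ξ => κ_ne_zero_complex ξ m

/-- A bound for the right-hand side in a negative Sobolev norm. -/
theorem memLp_rhs {α ν : ℝ} {U : Fin 3 → R3 → ℂ} {Mh Sh : Fin 3 → Fin 3 → R3 → ℂ}
    (hU : ∀ j, MemLp (U j) 2 volume)
    (hM : ∀ i j, MemLp (fun ξ => ((κ ξ : ℂ) ^ 5)⁻¹ * Mh i j ξ) 2 volume)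
    (hS : ∀ i j, MemLp (fun ξ => ((κ ξ : ℂ) ^ 5)⁻¹ * Sh i j ξ) 2 volume) (j : Fin 3) :
    MemLp (fun ξ => ((κ ξ : ℂ) ^ 20)⁻¹ * ((κ ξ : ℂ) ^ 6 * rhs α ν U Mh Sh j ξ)) 2 volume ∧
    eLpNorm (fun ξ => ((κ ξ : ℂ) ^ 20)⁻¹ * ((κ ξ : ℂ) ^ 6 * rhs α ν U Mh Sh j ξ)) 2 volume ≤
      ∑ i, (ENNReal.ofReal (2 * Real.pi * helC α) *
          eLpNorm (fun ξ => ((κ ξ : ℂ) ^ 5)⁻¹ * Mh i j ξ) 2 volume +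
        ENNReal.ofReal (2 * Real.pi * helC 0) *
          eLpNorm (fun ξ => ((κ ξ : ℂ) ^ 5)⁻¹ * Sh i j ξ) 2 volume) +
      ENNReal.ofReal (|ν| * (4 * Real.pi ^ 2 * helC α)) * eLpNorm (U j) 2 volume := by
  have hi := continuous_κ_inv
  have hk := continuous_κ_complex
  have h1 := fun i => memLp_bdd_mul (by fun_prop) (rhs_term_bound α i) (hM i j)
  have h2 := fun i => memLp_bdd_mul (by fun_prop) (rhs_term_bound' i) (hS i j)
  have h3 := memLp_bdd_mul (c := fun ξ => -ν * (((κ ξ : ℂ) ^ 20)⁻¹ * ((κ ξ : ℂ) ^ 6 *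
      ((4 * Real.pi ^ 2 * ‖ξ‖ ^ 2 : ℝ) * hel α ξ)))) (C := |ν| * (4 * Real.pi ^ 2 * helC α))
      (by fun_prop) (fun ξ => by
        rw [norm_mul, norm_neg, Complex.norm_real, Real.norm_eq_abs]
        gcongr; exact rhs_visc_bound α ξ) (hU j)
  let f₁ : Fin 3 → R3 → ℂ := fun i ξ => ((κ ξ : ℂ) ^ 20)⁻¹ * ((κ ξ : ℂ) ^ 6 *
    (-(2 * Real.pi * Complex.I * ξ i) * hel α ξ * (κ ξ : ℂ) ^ 5)) *
      (((κ ξ : ℂ) ^ 5)⁻¹ * Mh i j ξ)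
  let f₂ : Fin 3 → R3 → ℂ := fun i ξ => ((κ ξ : ℂ) ^ 20)⁻¹ * ((κ ξ : ℂ) ^ 6 *
    (-(2 * Real.pi * Complex.I * ξ i) * (κ ξ : ℂ) ^ 5)) * (((κ ξ : ℂ) ^ 5)⁻¹ * Sh i j ξ)
  have h12 : ∀ i, MemLp (f₁ i + f₂ i) 2 volume := fun i => (h1 i).1.add (h2 i).1
  have hs : MemLp (∑ i, (f₁ i + f₂ i)) 2 volume := memLp_finsetSum' Finset.univ fun i _ => h12 i
  have e : (fun ξ => ((κ ξ : ℂ) ^ 20)⁻¹ * ((κ ξ : ℂ) ^ 6 * rhs α ν U Mh Sh j ξ)) =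
      (∑ i, (f₁ i + f₂ i)) + fun ξ => -ν * (((κ ξ : ℂ) ^ 20)⁻¹ *
        ((κ ξ : ℂ) ^ 6 * ((4 * Real.pi ^ 2 * ‖ξ‖ ^ 2 : ℝ) * hel α ξ))) * U j ξ := by
    ext ξ
    simp only [rhs, Pi.add_apply, Finset.sum_apply, f₁, f₂]
    rw [mul_sub, mul_sub, Finset.mul_sum, Finset.mul_sum, sub_eq_add_neg]
    congr 1
    · congr 1; ext i
      have := κ_ne_zero_complex ξ 5
      field_simp
      ring
    · ring
  rw [e]
  refine ⟨hs.add h3.1, (eLpNorm_add_le hs.1 h3.1.1 (by norm_num)).trans ?_⟩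
  gcongr ?_ + ?_
  · have := eLpNorm_sum_le (s := Finset.univ) (fun i _ => (h12 i).1) (p := 2) (by norm_num)
    refine this.trans (Finset.sum_le_sum fun i _ => ?_)
    refine (eLpNorm_add_le (h1 i).1.1 (h2 i).1.1 (by norm_num)).trans ?_
    gcongr
    exacts [(h1 i).2, (h2 i).2]
  · exact h3.2

theorem inner_R3 (x y : R3) : inner ℝ x y = ∑ j, x j * y j := by
  rw [PiLp.inner_apply]
  simp [mul_comm]

theorem integrable_mul_test {f : R3 → ℝ} (hf : MemLp (fun x => (f x : ℂ)) 2 volume) {ζ : R3 → ℝ}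
    (hζ : IsTest ζ) : Integrable (fun x => f x * ζ x) volume :=
  (isFT_ft hf).isDFT.integrable ζ hζ

theorem integral_inner_test {w : R3 → R3} (hw : ∀ j, MemLp (fun x => (w x j : ℂ)) 2 volume)
    {φ : R3 → R3} {ζ : Fin 3 → R3 → ℝ} (hφ : ∀ x j, φ x j = ζ j x) (hζ : ∀ j, IsTest (ζ j)) :
    Integrable (fun x => inner ℝ (w x) (φ x)) volume ∧
    ((∫ x, inner ℝ (w x) (φ x) : ℝ) : ℂ) =
      ∫ ξ, ∑ j, ft (fun x => (w x j : ℂ)) ξ * rft (ζ j) (-ξ) ∧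
    Integrable (fun ξ => ∑ j, ft (fun x => (w x j : ℂ)) ξ * rft (ζ j) (-ξ)) volume := by
  have hi : ∀ j, Integrable (fun x => w x j * ζ j x) volume := fun j =>
    integrable_mul_test (hw j) (hζ j)
  simp only [inner_R3, hφ]
  refine ⟨integrable_finsetSum _ fun j _ => hi j, ?_, integrable_finsetSum _ fun j _ =>
    rft_neg_integrable (isFT_ft (hw j)).isDFT.memLp (hζ j)⟩
  rw [integral_finsetSum _ fun j _ => hi j, integral_finsetSum _ fun j _ =>
    rft_neg_integrable (isFT_ft (hw j)).isDFT.memLp (hζ j)]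
  push_cast
  congr 1; ext j
  exact (isFT_ft (hw j)).integral_mul_test (hζ j)

theorem integral_contract_test {M : R3 → Mat3} {Mh : Fin 3 → Fin 3 → R3 → ℂ}
    (hM : ∀ i j, IsDFT (fun x => M x i j) (Mh i j)) {φ : R3 → R3} {ζ : Fin 3 → R3 → ℝ}
    (hφ : ∀ x j, φ x j = ζ j x) (hζ : ∀ j, IsTest (ζ j)) :
    Integrable (fun x => contract (M x) (grad φ x)) volume ∧
    ((∫ x, contract (M x) (grad φ x) : ℝ) : ℂ) =
      ∫ ξ, ∑ j, (∑ i, -(2 * Real.pi * Complex.I * ξ i) * Mh i j ξ) * rft (ζ j) (-ξ) ∧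
    Integrable (fun ξ => ∑ j, (∑ i, -(2 * Real.pi * Complex.I * ξ i) * Mh i j ξ) *
      rft (ζ j) (-ξ)) volume := by
  have e : ∀ x, contract (M x) (grad φ x) = ∑ j, ∑ i, M x i j * partialD i (ζ j) x := by
    intro x
    unfold contract
    rw [Finset.sum_comm]
    congr 1; ext j; congr 1; ext i
    have : (fun y => φ y j) = ζ j := by ext y; exact hφ y j
    simp [grad, this]
  have hi : ∀ i j, Integrable (fun x => M x i j * partialD i (ζ j) x) volume := fun i j =>
    (hM i j).integrable _ ((hζ j).partialD i)
  simp only [e]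
  have e2 : ∀ j ξ, (∑ i, -(2 * Real.pi * Complex.I * ξ i) * Mh i j ξ) * rft (ζ j) (-ξ) =
      ∑ i, Mh i j ξ * rft (partialD i (ζ j)) (-ξ) := by
    intro j ξ
    rw [Finset.sum_mul]
    congr 1; ext i
    rw [(hζ j).rft_partialD]
    simp; ring
  refine ⟨integrable_finsetSum _ fun j _ => integrable_finsetSum _ fun i _ => hi i j, ?_⟩
  refine (fun h => ⟨?_, h⟩) ?_
  · simp only [e2]
    exact integrable_finsetSum _ fun j _ => integrable_finsetSum _ fun i _ =>
      rft_neg_integrable (hM i j).memLp ((hζ j).partialD i)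
  simp only [e2]
  rw [integral_finsetSum _ fun j _ => integrable_finsetSum _ fun i _ => hi i j,
    integral_finsetSum _ fun j _ => integrable_finsetSum _ fun i _ =>
    rft_neg_integrable (hM i j).memLp ((hζ j).partialD i)]
  push_cast
  congr 1; ext j
  rw [integral_finsetSum _ fun i _ => hi i j, integral_finsetSum _ fun i _ =>
    rft_neg_integrable (hM i j).memLp ((hζ j).partialD i)]
  push_cast
  congr 1; ext i
  exact (hM i j).pair _ ((hζ j).partialD i)

/-- Divergence free fields on the Fourier side. -/
theorem IsDivFree.sum_mul_ft {f : R3 → R3} (h : IsDivFree f)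
    (hf : ∀ j, MemLp (fun x => (f x j : ℂ)) 2 volume) :
    ∀ᵐ ξ, ∑ j, (ξ j : ℂ) * ft (fun x => (f x j : ℂ)) ξ = 0 := by
  have hU := fun j => isFT_ft (hf j)
  have hc : ∀ j : Fin 3, MemLp (fun ξ => (((κ ξ : ℂ) ^ 3)⁻¹ * (ξ j : ℂ)) *
      ft (fun x => (f x j : ℂ)) ξ) 2 volume := fun j => by
    have := continuous_κ_inv 3
    refine (memLp_bdd_mul (C := 1) (by fun_prop) (fun ξ => ?_) (hU j).memLp_ft).1
    have hκ := κ_pos ξ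
    rw [norm_mul, norm_inv, norm_κ_pow, Complex.norm_real, Real.norm_eq_abs,
      inv_mul_le_iff₀ (by positivity), mul_one]
    exact (abs_apply_le_norm ξ j).trans (norm_le_κ_pow ξ)
  have hm : MemLp (fun ξ => ((κ ξ : ℂ) ^ 3)⁻¹ * ∑ j, (ξ j : ℂ) * ft (fun x => (f x j : ℂ)) ξ) 2
      volume := by
    refine (memLp_finsetSum Finset.univ fun j _ => hc j).ae_eq (ae_of_all _ fun ξ => ?_)
    simp only [Finset.mul_sum, mul_assoc]
  have key : (fun ξ => ∑ j, ((-ξ) j : ℂ) * ft (fun x => (f x j : ℂ)) (-ξ)) =ᵐ[volume] 0 := by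
    refine ae_eq_zero_of_integral_rft (m := 3) ?_ fun ζ hζ => ?_
    · have := MemLp.comp_neg hm
      simpa using this
    · rw [← integral_neg_eq_self]
      simp only [neg_neg]
      have h2 := congrArg (fun r : ℝ => (r : ℂ)) (h.2 ζ hζ)
      simp only at h2
      rw [integral_finsetSum _ fun j _ => integrable_mul_test (hf j) (hζ.partialD j)] at h2
      push_cast at h2
      simp only [(hU _).integral_mul_test (hζ.partialD _)] at h2
      rw [← integral_finsetSum _ fun j _ => rft_neg_integrable (hU j).isDFT.memLp (hζ.partialD j)]
        at h2
      have e : ∀ ξ : R3, ∑ j, ft (fun x => (f x j : ℂ)) ξ * rft (partialD j ζ) (-ξ) =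
          -(2 * Real.pi * Complex.I) *
            ((∑ j, (ξ j : ℂ) * ft (fun x => (f x j : ℂ)) ξ) * rft ζ (-ξ)) := by
        intro ξ
        rw [Finset.sum_mul, Finset.mul_sum]
        congr 1; ext j
        rw [hζ.rft_partialD]; simp; ring
      simp only [e] at h2
      rw [integral_const_mul] at h2
      have hne : -(2 * Real.pi * Complex.I : ℂ) ≠ 0 := by
        simp [Real.pi_ne_zero]
      exact (mul_eq_zero.1 h2).resolve_left hne
  have := (Measure.measurePreserving_neg (volume : Measure R3)).quasiMeasurePreserving.ae key
  filter_upwards [this] with ξ hξ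
  simpa using hξ

/-- A weak solution is a solution on the Fourier side. -/
theorem spectralSolution_of_weakEq {α ν T : ℝ} {w : ℝ → R3 → R3} {M S : ℝ → R3 → Mat3}
    (hweak : WeakEq α ν T w M S) {t₀ t₁ : ℝ} (h₀ : 0 ≤ t₀) (h₁ : t₁ ≤ T)
    (hw : ∀ t ∈ Ioo t₀ t₁, ∀ j, MemLp (fun x => (w t x j : ℂ)) 2 volume)
    (hdiv : ∀ t ∈ Ioo t₀ t₁, IsDivFree (w t))
    {Mh Sh : ℝ → Fin 3 → Fin 3 → R3 → ℂ}
    (hM : ∀ t ∈ Ioo t₀ t₁, ∀ i j, IsDFT (fun x => M t x i j) (Mh t i j))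
    (hS : ∀ t ∈ Ioo t₀ t₁, ∀ i j, IsDFT (fun x => S t x i j) (Sh t i j))
    {C : ℝ≥0∞} (hC : C ≠ ⊤)
    (hwC : ∀ t ∈ Ioo t₀ t₁, ∀ j, eLpNorm (fun x => (w t x j : ℂ)) 2 volume ≤ C)
    (hMC : ∀ t ∈ Ioo t₀ t₁, ∀ i j,
      eLpNorm (fun ξ => ((κ ξ : ℂ) ^ 5)⁻¹ * Mh t i j ξ) 2 volume ≤ C)
    (hSC : ∀ t ∈ Ioo t₀ t₁, ∀ i j,
      eLpNorm (fun ξ => ((κ ξ : ℂ) ^ 5)⁻¹ * Sh t i j ξ) 2 volume ≤ C) :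
    SpectralSolution α t₀ t₁ (fun t j => ft fun x => (w t x j : ℂ))
      (fun t => rhs α ν (fun j => ft fun x => (w t x j : ℂ)) (Mh t) (Sh t)) := by
  have hU := fun t ht j => isFT_ft (hw t ht j)
  have hR := fun t ht j => memLp_rhs (α := α) (ν := ν) (fun j => (hU t ht j).memLp_ft)
    (fun i j => (hM t ht i j).memLp) (fun i j => (hS t ht i j).memLp) j
  refine ⟨fun t ht j => (hU t ht j).memLp_ft, fun t ht j => (hR t ht j).1, ?_,
    fun t ht => (hdiv t ht).sum_mul_ft (hw t ht), ?_⟩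
  · have hB : (∑ _i : Fin 3, (ENNReal.ofReal (2 * Real.pi * helC α) * C +
        ENNReal.ofReal (2 * Real.pi * helC 0) * C) +
        ENNReal.ofReal (|ν| * (4 * Real.pi ^ 2 * helC α)) * C) ≠ ⊤ := by
      have h : ∀ r : ℝ, ENNReal.ofReal r * C ≠ ⊤ := fun r =>
        ENNReal.mul_ne_top ENNReal.ofReal_ne_top hC
      refine ENNReal.add_ne_top.2 ⟨ENNReal.sum_ne_top.2 fun i _ =>
        ENNReal.add_ne_top.2 ⟨h _, h _⟩, h _⟩
    refine ⟨_, fun t ht j => ((hR t ht j).2.trans ?_).trans_eq (ENNReal.ofReal_toReal hB).symm⟩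
    gcongr
    · exact hMC t ht _ _
    · exact hSC t ht _ _
    · rw [(hU t ht j).eLpNorm_eq]; exact hwC t ht j
  · intro t ht l ζ hζ
    -- These fields are the only divergence free test fields that are used. Their symbol is `4π²
    -- qsym`, so they see every divergence free velocity away from zero frequency. The factor `4π²`
    -- is divided out below.
    let φ := curlField ζ l
    have hφ : IsDivFreeTest φ := isDivFreeTest_curlField hζ l
    have hφj : ∀ j, IsTest (curl2 ζ l j) := hζ.curl2 l
    have hφe : ∀ x j, φ x j = curl2 ζ l j x := fun x j => rfl
    have hHe : ∀ x j, helm α φ x j = helmS α (curl2 ζ l j) x := fun x j => helm_apply hφ.1.1 α x j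
    have hHj : ∀ j, IsTest (helmS α (curl2 ζ l j)) := fun j => (hφj j).helmS α
    have hLe : ∀ x j, Δ (helm α φ) x j = lap (helmS α (curl2 ζ l j)) x := fun x j => by
      rw [laplacian_apply_eq (contDiff_helm hφ.1 α)]
      congr 1; ext y; exact hHe y j
    have hLj : ∀ j, IsTest (lap (helmS α (curl2 ζ l j))) := fun j => (hHj j).lap
    have ht' : t ∈ Ioo 0 T := ⟨h₀.trans_lt ht.1, ht.2.trans_le h₁⟩
    have h := (hweak φ hφ t ht').ofReal_comp
    have hpi : (4 * Real.pi ^ 2 : ℂ) ≠ 0 := by simp [Real.pi_ne_zero]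
    have h' := h.const_mul ((4 * Real.pi ^ 2 : ℂ)⁻¹)
    obtain ⟨iM, eM, fM⟩ := integral_contract_test (hM t ht) hHe hHj
    obtain ⟨iS, eS, fS⟩ := integral_contract_test (hS t ht) hφe hφj
    obtain ⟨iL, eL, fL⟩ := integral_inner_test (hw t ht) hLe hLj
    refine HasDerivAt.congr_deriv (h'.congr_of_eventuallyEq ?_) ?_
    · filter_upwards [Ioo_mem_nhds ht.1 ht.2] with τ hτ
      rw [(integral_inner_test (hw τ hτ) hHe hHj).2.1, ← integral_const_mul]
      congr 1; ext ξ
      rw [Finset.sum_mul, Finset.mul_sum]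
      congr 1; ext j
      have hq : qsym j l (-ξ) = qsym j l ξ := by unfold qsym; simp
      rw [(hφj j).rft_helmS, hζ.rft_curl2, hq, hel_neg]
      field_simp
    · rw [integral_add (f := fun x => contract (M t x) (grad (helm α φ) x) +
        contract (S t x) (grad φ x)) (iM.add iS) (iL.const_mul ν), integral_add iM iS, integral_const_mul]
      push_cast
      rw [eM, eS, eL, ← integral_const_mul, ← integral_add, ← integral_add, ← integral_const_mul]
      · congr 1; ext ξ
        simp only [(hφj _).rft_helmS, hζ.rft_curl2, (hHj _).rft_lap, rhs, hel_neg, norm_neg,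
          Finset.mul_sum, Finset.sum_mul, ← Finset.sum_add_distrib]
        congr 1; ext j
        have hq : qsym j l (-ξ) = qsym j l ξ := by unfold qsym; simp
        rw [hq]
        rw [sub_mul, sub_mul, Finset.sum_mul, Finset.sum_mul, mul_add, Finset.mul_sum,
          sub_eq_add_neg]
        congr 1
        · congr 1; ext i; field_simp; ring
        · field_simp
      exacts [fM.add fS, fL.const_mul _, fM, fS]

section


/-! ### Littlewood-Paley kernels -/

/-- The dilate `x ↦ c³ K(c x)` of a Schwartz function, `c ≠ 0`. -/
def dilate (K : 𝓢(R3, ℝ)) (c : ℝ) : 𝓢(R3, ℝ) :=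
  if h : c = 0 then 0 else c ^ 3 • SchwartzMap.compCLMOfContinuousLinearEquiv ℝ
    (ContinuousLinearEquiv.smulLeft (R₁ := ℝ) (M₁ := R3) (Units.mk0 c h)) K

theorem dilate_apply (K : 𝓢(R3, ℝ)) {c : ℝ} (h : c ≠ 0) (x : R3) :
    dilate K c x = c ^ 3 * K (c • x) := by
  rw [dilate, dif_neg h]
  rfl

theorem symbol_dilate (K : 𝓢(R3, ℝ)) {c : ℝ} (h : 0 < c) (ξ : R3) :
    symbol (dilate K c) ξ = symbol K (c⁻¹ • ξ) := by
  rw [symbol, symbol, fourier_apply_integral, fourier_apply_integral]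
  have := Measure.integral_comp_smul (volume : Measure R3) (fun x => Complex.exp
    (-(2 * Real.pi * inner ℝ x (c⁻¹ • ξ) : ℝ) * Complex.I) * (K x : ℂ)) c
  rw [finrank_euclideanSpace_fin, abs_of_pos (by positivity)] at this
  have e : (∫ x, Complex.exp (-(2 * Real.pi * inner ℝ x (c⁻¹ • ξ) : ℝ) * Complex.I) * (K x : ℂ)) =
      (c ^ 3 : ℝ) • ∫ x : R3, Complex.exp (-(2 * Real.pi * inner ℝ (c • x) (c⁻¹ • ξ) : ℝ) *
        Complex.I) * (K (c • x) : ℂ) := by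
    rw [this, smul_smul, mul_inv_cancel₀ (by positivity), one_smul]
  rw [e, ← integral_smul]
  congr 1; ext x
  rw [dilate_apply K h.ne', inner_smul_left, inner_smul_right]
  simp only [conj_trivial, Complex.real_smul]
  rw [mul_inv_cancel_left₀ h.ne']
  push_cast
  ring

theorem dyadicKernel_eq (ψ : 𝓢(R3, ℝ)) (j : ℕ) : dyadicKernel ψ j = dilate ψ (2 ^ j) := by
  ext x
  rw [dilate_apply ψ (by positivity), dyadicKernel, ← pow_mul, mul_comm 3]

theorem continuous_symbol (K : 𝓢(R3, ℝ)) : Continuous (symbol K) :=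
  SchwartzMap.continuous (𝓕 (SchwartzMap.postcompCLM Complex.ofRealCLM K))

theorem contDiff_symbol (K : 𝓢(R3, ℝ)) : ContDiff ℝ ∞ (symbol K) :=
  SchwartzMap.smooth (𝓕 (SchwartzMap.postcompCLM Complex.ofRealCLM K)) ⊤

theorem exists_symbol_bound (K : 𝓢(R3, ℝ)) : ∃ C, 0 < C ∧ ∀ ξ, ‖symbol K ξ‖ ≤ C := by
  obtain ⟨C, hC, h⟩ := (𝓕 (SchwartzMap.postcompCLM Complex.ofRealCLM K) : 𝓢(R3, ℂ)).decay 0 0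
  refine ⟨C, hC, fun ξ => ?_⟩
  have := h ξ
  simp only [pow_zero, one_mul, norm_iteratedFDeriv_zero] at this
  exact this

theorem symbol_neg (K : 𝓢(R3, ℝ)) (ξ : R3) :
    symbol K (-ξ) = (starRingEnd ℂ) (symbol K ξ) := rft_neg_arg _ ξ

variable {ψ : 𝓢(R3, ℝ)}

theorem IsLittlewoodPaley.lt_norm (hψ : IsLittlewoodPaley ψ) {ξ : R3} (h : symbol ψ ξ ≠ 0) :
    1 / 2 < ‖ξ‖ := (hψ.symbol_support (subset_tsupport _ h)).1

theorem IsLittlewoodPaley.norm_lt (hψ : IsLittlewoodPaley ψ) {ξ : R3} (h : symbol ψ ξ ≠ 0) :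
    ‖ξ‖ < 2 := (hψ.symbol_support (subset_tsupport _ h)).2

theorem IsLittlewoodPaley.symbol_eq_zero (hψ : IsLittlewoodPaley ψ) {ξ : R3} {N k : ℕ}
    (h : ‖ξ‖ ≤ 2 ^ N) (hk : N < k) : symbol ψ (((2 : ℝ) ^ k)⁻¹ • ξ) = 0 := by
  by_contra h0
  have h1 := hψ.lt_norm h0
  rw [norm_smul, norm_inv, Real.norm_of_nonneg (by positivity), lt_inv_mul_iff₀ (by positivity)]
    at h1
  have : (2 : ℝ) ^ (N + 1) ≤ 2 ^ k := pow_le_pow_right₀ (by norm_num) hk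
  rw [pow_succ] at this
  linarith

/-- The low frequency symbol. -/
def lowSymbol (ψ : 𝓢(R3, ℝ)) (ξ : R3) : ℂ := 1 - ∑' k : ℕ, symbol ψ (((2 : ℝ) ^ k)⁻¹ • ξ)

theorem IsLittlewoodPaley.lowSymbol_eq (hψ : IsLittlewoodPaley ψ) {ξ : R3} {N : ℕ}
    (h : ‖ξ‖ ≤ 2 ^ N) :
    lowSymbol ψ ξ = 1 - ∑ k ∈ Finset.range (N + 1), symbol ψ (((2 : ℝ) ^ k)⁻¹ • ξ) := by
  rw [lowSymbol, tsum_eq_sum]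
  intro k hk
  exact hψ.symbol_eq_zero h (by simpa using hk)

/-- For negative `j` the argument `2^{-j} ξ` has norm at least `2`, outside the support of the
symbol. The sum over `j ≥ 0` is then already the full partition of unity. -/
theorem IsLittlewoodPaley.lowSymbol_eq_zero (hψ : IsLittlewoodPaley ψ) {ξ : R3} (h : 1 ≤ ‖ξ‖) :
    lowSymbol ψ ξ = 0 := by
  have h0 : ξ ≠ 0 := fun h0 => by simp [h0] at h; linarith
  have h1 := hψ.symbol_sum ξ h0
  have h2 := (Function.Injective.hasSum_iff (g := fun k : ℕ => (k : ℤ)) Nat.cast_injective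
    (fun j hj => ?_)).2 h1
  · rw [lowSymbol, sub_eq_zero]
    refine (HasSum.tsum_eq ?_).symm
    convert h2 using 2 with k
    simp
  · by_contra hne
    have h3 := hψ.norm_lt hne
    have hj' : j < 0 := by
      by_contra hj'
      exact hj ⟨j.toNat, by simp; omega⟩
    rw [norm_smul, norm_zpow, Real.norm_ofNat] at h3
    have : (2 : ℝ) ^ (1 : ℤ) ≤ 2 ^ (-j) := zpow_le_zpow_right₀ (by norm_num) (by omega)
    rw [zpow_one] at this
    nlinarith

theorem IsLittlewoodPaley.contDiff_lowSymbol (hψ : IsLittlewoodPaley ψ) :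
    ContDiff ℝ ∞ (lowSymbol ψ) := by
  rw [contDiff_iff_contDiffAt]
  intro ξ
  obtain ⟨N, hN⟩ := pow_unbounded_of_one_lt ‖ξ‖ (one_lt_two (α := ℝ))
  have hev : lowSymbol ψ =ᶠ[𝓝 ξ]
      fun ξ => 1 - ∑ k ∈ Finset.range (N + 1), symbol ψ (((2 : ℝ) ^ k)⁻¹ • ξ) := by
    have : ∀ᶠ η in 𝓝 ξ, ‖η‖ < 2 ^ N := continuous_norm.continuousAt.eventually_lt_const hN
    filter_upwards [this] with η hη
    exact hψ.lowSymbol_eq hη.le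
  refine ContDiffAt.congr_of_eventuallyEq ?_ hev
  refine ContDiff.contDiffAt (contDiff_const.sub (ContDiff.sum fun k _ => ?_))
  exact (contDiff_symbol ψ).comp (contDiff_const_smul _)

theorem IsLittlewoodPaley.hasCompactSupport_lowSymbol (hψ : IsLittlewoodPaley ψ) :
    HasCompactSupport (lowSymbol ψ) := by
  refine HasCompactSupport.intro (isCompact_closedBall (0 : R3) 1) fun ξ hξ => ?_
  refine hψ.lowSymbol_eq_zero ?_
  simp at hξ
  exact hξ.le

theorem conj_tsum (f : ℕ → ℂ) : (starRingEnd ℂ) (∑' k, f k) = ∑' k, (starRingEnd ℂ) (f k) :=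
  tsum_star (f := f)

theorem lowSymbol_neg (ψ : 𝓢(R3, ℝ)) (ξ : R3) :
    lowSymbol ψ (-ξ) = (starRingEnd ℂ) (lowSymbol ψ ξ) := by
  simp only [lowSymbol, map_sub, map_one, smul_neg, symbol_neg, conj_tsum]

/-- The low frequency kernel is a Schwartz function. -/
theorem IsLittlewoodPaley.exists_lowKernel (hψ : IsLittlewoodPaley ψ) :
    ∃ K : 𝓢(R3, ℝ), lowKernel ψ = K ∧ symbol K = lowSymbol ψ := by
  let m : 𝓢(R3, ℂ) := hψ.hasCompactSupport_lowSymbol.toSchwartzMap hψ.contDiff_lowSymbol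
  have hm : ∀ ξ, m ξ = lowSymbol ψ ξ := fun ξ => rfl
  let G : 𝓢(R3, ℂ) := 𝓕⁻ m
  have hG : ∀ x, (starRingEnd ℂ) (G x) = G x := by
    intro x
    have h1 := fourier_sconj_sneg m (-x)
    have e : sconj (sneg m) = m := by
      ext ξ
      change (starRingEnd ℂ) (m (-ξ)) = m ξ
      rw [hm, hm, lowSymbol_neg, Complex.conj_conj]
    rw [e] at h1
    have e2 : 𝓕 m (-x) = G x := by
      simp only [G, SchwartzMap.fourierInv_coe, SchwartzMap.fourier_coe]
      rw [Real.fourierInv_eq_fourier_neg]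
    rw [e2] at h1
    exact h1.symm
  refine ⟨SchwartzMap.postcompCLM Complex.reCLM G, ?_, ?_⟩
  · ext x
    change _ = (G x).re
    rw [SchwartzMap.fourierInv_coe]
    rfl
  · have e : (fun x => ((SchwartzMap.postcompCLM Complex.reCLM G : 𝓢(R3, ℝ)) x : ℂ)) = G := by
      ext x
      exact Complex.conj_eq_iff_re.1 (hG x)
    ext ξ
    rw [symbol, e]
    have : (𝓕 G : 𝓢(R3, ℂ)) = m := FourierTransform.fourier_fourierInv_eq m
    rw [← SchwartzMap.fourier_coe, this, hm]

theorem IsLittlewoodPaley.sum_eq_one (hψ : IsLittlewoodPaley ψ) {ξ : R3} {N : ℕ}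
    (h : ‖ξ‖ ≤ 2 ^ N) :
    lowSymbol ψ ξ + ∑ k ∈ Finset.range (N + 1), symbol ψ (((2 : ℝ) ^ k)⁻¹ • ξ) = 1 := by
  rw [hψ.lowSymbol_eq h]; ring

/-! ### Convolution with a Schwartz function on `L²` -/

theorem IsFT.inverse {f F : R3 → ℂ} (h : IsFT f F) : IsFT F (fun x => f (-x)) := by
  refine ⟨h.memLp_ft, MemLp.comp_neg h.memLp, fun g => ?_⟩
  rw [h.pair, ← integral_neg_eq_self]
  congr 1; ext x
  have e : 𝓕 (𝓕 g) x = g (-x) := by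
    have := congrArg (fun G : 𝓢(R3, ℂ) => G (-x)) 
      (show 𝓕⁻ (𝓕 g : 𝓢(R3, ℂ)) = g from FourierTransform.fourierInv_fourier_eq g)
    rw [← this, SchwartzMap.fourierInv_coe, SchwartzMap.fourier_coe,
      Real.fourierInv_eq_fourier_neg, neg_neg]
  rw [e, neg_neg]

theorem isFT_fourier_of_integrable {f : R3 → ℂ} (hf : MemLp f 2 volume)
    (hi : Integrable f volume) : IsFT f (𝓕 f) := by
  refine (isFT_ft hf).congr (ae_eq_refl _) ?_
  refine ae_eq_of_pair_schwartz ((isFT_ft hf).memLp_ft.locallyIntegrable (by norm_num)) ?_ ?_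
  · exact (VectorFourier.fourierIntegral_continuous Real.continuous_fourierChar
      (by exact continuous_inner) hi).locallyIntegrable
  · intro g
    rw [(isFT_ft hf).pair]
    exact (integral_fourier_mul_eq hi g.integrable).symm

theorem isFT_symbol (K : 𝓢(R3, ℝ)) : IsFT (fun x => (K x : ℂ)) (symbol K) :=
  isFT_schwartz (SchwartzMap.postcompCLM Complex.ofRealCLM K)

/-- The product of the symbol and `F` is both square integrable and integrable. Its classical
transform is a pointwise convolution by `IsFT.fourier_mul`, and inverting it gives the stated
function at every point. -/
theorem isFT_conv (K : 𝓢(R3, ℝ)) {f F : R3 → ℂ} (h : IsFT f F) :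
    IsFT (fun x => ∫ y, (K y : ℂ) * f (x - y)) (fun ξ => symbol K ξ * F ξ) := by
  obtain ⟨C, -, hC⟩ := exists_symbol_bound K
  have h1 := (memLp_bdd_mul (continuous_symbol K) hC h.memLp_ft).1
  have hi : Integrable (fun ξ => symbol K ξ * F ξ) volume :=
    (isFT_symbol K).memLp_ft.integrable_mul h.memLp_ft
  have h2 := (isFT_fourier_of_integrable h1 hi).inverse.neg_arg
  refine h2.congr (ae_of_all _ fun x => ?_) (ae_of_all _ fun ξ => by simp)
  simp only
  rw [(isFT_symbol K).inverse.fourier_mul h.inverse, ← integral_neg_eq_self]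
  congr 1; ext y
  rw [neg_neg]
  congr 2
  abel

theorem conv_apply (K : 𝓢(R3, ℝ)) {f : R3 → R3} {p : ℝ≥0∞} (hp : 1 ≤ p)
    (hf : MemLp f p volume) (x : R3) (j : Fin 3) :
    Integrable (fun y => K y • f (x - y)) volume ∧
      conv K f x j = ∫ y, K y * f (x - y) j := by
  have h1 : MemLp (fun y => f (x - y)) p volume :=
    hf.comp_measurePreserving (Measure.measurePreserving_sub_left volume x)
  have hi : Integrable (fun y => K y • f (x - y)) volume := by
    obtain ⟨p', hpp⟩ : ∃ p', ENNReal.HolderConjugate p p' :=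
      ⟨ENNReal.conjExponent p, ENNReal.HolderConjugate.conjExponent hp⟩
    have := hpp.symm
    exact memLp_one_iff_integrable.1 (MemLp.smul h1 (K.memLp p' volume))
  refine ⟨hi, ?_⟩
  rw [conv, convolution]
  simp only [ContinuousLinearMap.lsmul_apply]
  have := (EuclideanSpace.proj (𝕜 := ℝ) j).integral_comp_comm hi
  exact this.symm

theorem isFT_conv_apply (K : 𝓢(R3, ℝ)) {f : R3 → R3} (hf : MemLp f 2 volume) (j : Fin 3) :
    IsFT (fun x => (conv K f x j : ℂ))
      (fun ξ => symbol K ξ * ft (fun x => (f x j : ℂ)) ξ) := by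
  have hfj : MemLp (fun x => (f x j : ℂ)) 2 volume :=
    (hf.continuousLinearMap_comp (Complex.ofRealCLM.comp (EuclideanSpace.proj j)))
  refine (isFT_conv K (isFT_ft hfj)).congr (ae_of_all _ fun x => ?_) (ae_eq_refl _)
  simp only
  rw [(conv_apply K (by norm_num) hf x j).2, ← integral_complex_ofReal]
  simp

end

section


/-! ### Besov norms and weighted norms of the Fourier transform -/

/-- Minkowski's inequality for finite sums passes to series by monotone convergence. -/
theorem n2_tsum_le {f : ℕ → R3 → ℝ≥0∞} (hf : ∀ i, Measurable (f i)) :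
    n2 (fun ξ => ∑' i, f i ξ) ≤ ∑' i, n2 (f i) := by
  rw [n2_le_iff]
  have e : ∀ ξ, (∑' i, f i ξ) ^ 2 = ⨆ N : ℕ, (∑ i ∈ Finset.range N, f i ξ) ^ 2 := by
    intro ξ
    rw [ENNReal.tsum_eq_iSup_nat, ← ENNReal.iSup_pow_of_ne_zero (by norm_num)]
  simp only [e]
  rw [lintegral_iSup (fun N => by fun_prop)]
  · refine iSup_le fun N => ?_
    rw [← n2_le_iff]
    exact (n2_sum_le _ fun i => (hf i).aemeasurable).trans (ENNReal.sum_le_tsum _)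
  · intro M N h ξ
    simp only
    gcongr

theorem le_seqNorm {q : ℝ≥0∞} (hq : 1 ≤ q) (c : ℕ → ℝ≥0∞) (j : ℕ) : c j ≤ seqNorm q c := by
  unfold seqNorm
  split_ifs with h
  · exact le_iSup c j
  · have h0 : 0 < q.toReal := ENNReal.toReal_pos (by positivity) h
    calc c j = (c j ^ q.toReal) ^ (1 / q.toReal) := by
          rw [← ENNReal.rpow_mul, mul_one_div_cancel h0.ne', ENNReal.rpow_one]
      _ ≤ _ := by
          gcongr
          exact ENNReal.le_tsum j

/-- For finite `q ≥ 1`, `(r^j)^q ≤ r^j`, so the geometric series bounds the sum. This is where a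
small surplus of derivatives makes the index `q` irrelevant. -/
theorem seqNorm_geometric_le {q : ℝ≥0∞} (hq : 1 ≤ q) {r : ℝ≥0∞} (hr : r < 1) :
    ∃ C : ℝ≥0∞, C ≠ ⊤ ∧ ∀ (X : ℝ≥0∞) (c : ℕ → ℝ≥0∞), (∀ j, c j ≤ r ^ j * X) →
      seqNorm q c ≤ C * X := by
  by_cases h : q = ⊤
  · refine ⟨1, by simp, fun X c hc => ?_⟩
    rw [seqNorm, if_pos h, one_mul]
    refine iSup_le fun j => (hc j).trans ?_
    exact mul_le_of_le_one_left (zero_le) (pow_le_one₀ zero_le hr.le)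
  · have h1 : 1 ≤ q.toReal := by
      rw [← ENNReal.toReal_one]; exact ENNReal.toReal_mono h hq
    have h0 : 0 < q.toReal := by linarith
    refine ⟨((1 - r)⁻¹) ^ (1 / q.toReal), ?_, fun X c hc => ?_⟩
    · refine ENNReal.rpow_ne_top_of_nonneg (by positivity) ?_
      exact ENNReal.inv_ne_top.2 (tsub_pos_of_lt hr).ne'
    · rw [seqNorm, if_neg h]
      have : ∑' j, c j ^ q.toReal ≤ (1 - r)⁻¹ * X ^ q.toReal := by
        rw [← ENNReal.tsum_geometric, ← ENNReal.tsum_mul_right]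
        refine ENNReal.tsum_le_tsum fun j => ?_
        calc c j ^ q.toReal ≤ (r ^ j * X) ^ q.toReal := by gcongr; exact hc j
          _ = (r ^ j) ^ q.toReal * X ^ q.toReal := ENNReal.mul_rpow_of_nonneg _ _ h0.le
          _ ≤ r ^ j * X ^ q.toReal := by
            gcongr
            exact ENNReal.rpow_le_self_of_le_one (pow_le_one₀ zero_le hr.le) h1
      calc _ ≤ ((1 - r)⁻¹ * X ^ q.toReal) ^ (1 / q.toReal) := by gcongr
        _ = _ := by
          rw [ENNReal.mul_rpow_of_nonneg _ _ (by positivity), ← ENNReal.rpow_mul,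
            mul_one_div_cancel h0.ne', ENNReal.rpow_one]

/-- The sixth root of two. -/
def rt : ℝ := 2 ^ (1 / 6 : ℝ)

theorem rt_pow : rt ^ 6 = 2 := by
  rw [rt, ← Real.rpow_natCast, ← Real.rpow_mul (by norm_num)]; norm_num

theorem one_lt_rt : 1 < rt := Real.one_lt_rpow (by norm_num) (by norm_num)

theorem rt_pos : 0 < rt := one_pos.trans one_lt_rt

/-- On the dyadic shell of index `k` the weight `κ` is comparable to `rt^{2k}`. The Besov weight
`rt^{9k}` therefore lies strictly between `κ^4 ~ rt^{8k}` and `κ^5 ~ rt^{10k}`, with a geometric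
gain `rt^{-k}` on either side. -/
theorem rpow_eq_rt (k : ℕ) : (2 : ℝ) ^ ((k : ℝ) * (3 / 2)) = rt ^ (9 * k) := by
  rw [rt, ← Real.rpow_natCast, ← Real.rpow_mul (by norm_num)]
  congr 1
  push_cast
  ring

theorem κ_le_of_norm_lt {ξ : R3} {k : ℕ} (h : ‖ξ‖ < 2 ^ (k + 1)) : κ ξ ≤ 2 * rt ^ (2 * k) := by
  have h2 := rt_pos
  refine le_of_pow_le_pow_left₀ (n := 6) (by norm_num) (by positivity) ?_
  have e : (2 * rt ^ (2 * k)) ^ 6 = 64 * (2 ^ k) ^ 2 := by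
    rw [mul_pow, ← pow_mul, show 2 * k * 6 = 6 * (k * 2) by ring, pow_mul, rt_pow, pow_mul]; norm_num
  rw [κ_pow_six, e]
  have h1 : (1 : ℝ) ≤ 2 ^ k := one_le_pow₀ (by norm_num)
  rw [pow_succ] at h
  nlinarith [norm_nonneg ξ]

theorem le_κ_of_lt_norm {ξ : R3} {k : ℕ} (h : 2 ^ k / 2 < ‖ξ‖) : rt ^ (2 * k) ≤ 2 * κ ξ := by
  have h2 := rt_pos
  have h3 := κ_pos ξ
  refine le_of_pow_le_pow_left₀ (n := 6) (by norm_num) (by positivity) ?_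
  have e : (rt ^ (2 * k)) ^ 6 = (2 ^ k) ^ 2 := by
    rw [← pow_mul, show 2 * k * 6 = 6 * (k * 2) by ring, pow_mul, rt_pow, pow_mul]
  rw [mul_pow, κ_pow_six, e]
  have h1 : (1 : ℝ) ≤ 2 ^ k := one_le_pow₀ (by norm_num)
  nlinarith [norm_nonneg ξ]

/-- The Fourier transform of a vector field. -/
def vft (f : R3 → R3) (j : Fin 3) : R3 → ℂ := ft fun x => (f x j : ℂ)

theorem measurable_vft (f : R3 → R3) (j : Fin 3) : Measurable (vft f j) := measurable_ft _

theorem memLp_coord {f : R3 → R3} {p : ℝ≥0∞} (hf : MemLp f p volume) (j : Fin 3) :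
    MemLp (fun x => (f x j : ℂ)) p volume :=
  hf.continuousLinearMap_comp (Complex.ofRealCLM.comp (EuclideanSpace.proj j))

theorem isFT_vft {f : R3 → R3} (hf : MemLp f 2 volume) (j : Fin 3) :
    IsFT (fun x => (f x j : ℂ)) (vft f j) := isFT_ft (memLp_coord hf j)

/-- The length of a vector of functions, in the `ℓ¹` norm. -/
def vn (U : Fin 3 → R3 → ℂ) (ξ : R3) : ℝ≥0∞ := ∑ j, ‖U j ξ‖ₑ

theorem measurable_vn {U : Fin 3 → R3 → ℂ} (hU : ∀ j, Measurable (U j)) : Measurable (vn U) := by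
  unfold vn
  fun_prop

theorem le_vn (U : Fin 3 → R3 → ℂ) (j : Fin 3) (ξ : R3) : ‖U j ξ‖ₑ ≤ vn U ξ :=
  Finset.single_le_sum (f := fun j => ‖U j ξ‖ₑ) (fun _ _ => zero_le) (Finset.mem_univ j)

/-- The weighted norm `‖κ^m U‖` in `L²`. -/
def sob (m : ℕ) (U : Fin 3 → R3 → ℂ) : ℝ≥0∞ := n2 fun ξ => κe ξ ^ m * vn U ξ

theorem enorm_le_sum_enorm (y : R3) : ‖y‖ₑ ≤ ∑ j, ‖(y j : ℂ)‖ₑ := by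
  have h : ‖y‖ ≤ ∑ j, ‖y j‖ := by
    rw [EuclideanSpace.norm_eq]
    refine Real.sqrt_le_iff.2 ⟨Finset.sum_nonneg fun _ _ => norm_nonneg _, ?_⟩
    exact Finset.sum_sq_le_sq_sum_of_nonneg fun _ _ => norm_nonneg _
  simp only [← ofReal_norm, Complex.norm_real]
  rw [← ENNReal.ofReal_sum_of_nonneg fun _ _ => norm_nonneg _]
  exact ENNReal.ofReal_le_ofReal h

theorem enorm_coord_le (y : R3) (j : Fin 3) : ‖(y j : ℂ)‖ₑ ≤ ‖y‖ₑ := by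
  simp only [← ofReal_norm, Complex.norm_real]
  exact ENNReal.ofReal_le_ofReal (PiLp.norm_apply_le y j)

theorem n2_symbol_le_conv (K : 𝓢(R3, ℝ)) {f : R3 → R3} (hf : MemLp f 2 volume) (j : Fin 3) :
    n2 (fun ξ => ‖symbol K ξ * vft f j ξ‖ₑ) ≤ eLpNorm (conv K f) 2 volume := by
  rw [n2_eLpNorm]
  refine (isFT_conv_apply K hf j).eLpNorm_eq.le.trans ?_
  rw [← n2_eLpNorm, ← n2_eLpNorm]
  exact n2_mono (ae_of_all _ fun x => enorm_coord_le _ j)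

theorem conv_le_n2_symbol (K : 𝓢(R3, ℝ)) {f : R3 → R3} (hf : MemLp f 2 volume) :
    eLpNorm (conv K f) 2 volume ≤ ∑ j, n2 (fun ξ => ‖symbol K ξ * vft f j ξ‖ₑ) := by
  rw [← n2_eLpNorm]
  refine (n2_mono (ae_of_all _ fun x => enorm_le_sum_enorm _)).trans ?_
  refine (n2_sum_le _ fun j => (isFT_conv_apply K hf j).memLp.1.enorm).trans ?_
  refine Finset.sum_le_sum fun j _ => ?_
  rw [n2_eLpNorm, n2_eLpNorm]
  exact (isFT_conv_apply K hf j).eLpNorm_eq.ge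

theorem symbol_dyadic (ψ : 𝓢(R3, ℝ)) (k : ℕ) (ξ : R3) :
    symbol (dilate ψ (2 ^ k)) ξ = symbol ψ (((2 : ℝ) ^ k)⁻¹ • ξ) :=
  symbol_dilate ψ (by positivity) ξ

variable {ψ : 𝓢(R3, ℝ)}

theorem IsLittlewoodPaley.enorm_le_tsum (hψ : IsLittlewoodPaley ψ) (z : ℂ) (ξ : R3) :
    ‖z‖ₑ ≤ ‖lowSymbol ψ ξ * z‖ₑ + ∑' k, ‖symbol (dilate ψ (2 ^ k)) ξ * z‖ₑ := by
  obtain ⟨N, hN⟩ := pow_unbounded_of_one_lt ‖ξ‖ (one_lt_two (α := ℝ))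
  have h := hψ.sum_eq_one hN.le
  calc ‖z‖ₑ = ‖lowSymbol ψ ξ * z + ∑ k ∈ Finset.range (N + 1),
        symbol (dilate ψ (2 ^ k)) ξ * z‖ₑ := by
        simp only [symbol_dyadic]
        rw [← Finset.sum_mul, ← add_mul, h, one_mul]
    _ ≤ ‖lowSymbol ψ ξ * z‖ₑ + ∑ k ∈ Finset.range (N + 1),
        ‖symbol (dilate ψ (2 ^ k)) ξ * z‖ₑ :=
        (enorm_add_le _ _).trans (add_le_add le_rfl (enorm_sum_le _ _))
    _ ≤ _ := by gcongr; exact ENNReal.sum_le_tsum _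

theorem IsLittlewoodPaley.κ_low (hψ : IsLittlewoodPaley ψ) (z : ℂ) (ξ : R3) :
    κe ξ ^ 4 * ‖lowSymbol ψ ξ * z‖ₑ ≤ 16 * ‖lowSymbol ψ ξ * z‖ₑ := by
  by_cases h : 1 ≤ ‖ξ‖
  · simp [hψ.lowSymbol_eq_zero h]
  · gcongr
    rw [κe_pow, show (16 : ℝ≥0∞) = ENNReal.ofReal 16 by simp]
    refine ENNReal.ofReal_le_ofReal ?_
    have := κ_le_of_norm_lt (ξ := ξ) (k := 0) (by simp; linarith [not_le.1 h])
    simp only [mul_zero, pow_zero, mul_one] at this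
    calc κ ξ ^ 4 ≤ 2 ^ 4 := pow_le_pow_left₀ (κ_pos ξ).le this 4
      _ = 16 := by norm_num

theorem IsLittlewoodPaley.κ_dyadic (hψ : IsLittlewoodPaley ψ) (z : ℂ) (k : ℕ) (ξ : R3) :
    κe ξ ^ 4 * ‖symbol (dilate ψ (2 ^ k)) ξ * z‖ₑ ≤
      ENNReal.ofReal (16 * rt ^ (8 * k)) * ‖symbol (dilate ψ (2 ^ k)) ξ * z‖ₑ := by
  by_cases h : symbol (dilate ψ (2 ^ k)) ξ = 0
  · simp [h]
  · gcongr
    rw [κe_pow]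
    refine ENNReal.ofReal_le_ofReal ?_
    rw [symbol_dyadic] at h
    have h1 := hψ.norm_lt h
    rw [norm_smul, norm_inv, Real.norm_of_nonneg (by positivity), inv_mul_lt_iff₀ (by positivity),
      ← pow_succ] at h1
    calc κ ξ ^ 4 ≤ (2 * rt ^ (2 * k)) ^ 4 :=
          pow_le_pow_left₀ (κ_pos ξ).le (κ_le_of_norm_lt h1) 4
      _ = _ := by ring

theorem IsLittlewoodPaley.dyadic_le (hψ : IsLittlewoodPaley ψ) {C : ℝ}
    (hC : ∀ ξ, ‖symbol ψ ξ‖ ≤ C) (z : ℂ) (k : ℕ) (ξ : R3) :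
    ENNReal.ofReal (rt ^ (10 * k)) * ‖symbol (dilate ψ (2 ^ k)) ξ * z‖ₑ ≤
      ENNReal.ofReal (32 * C) * (κe ξ ^ 5 * ‖z‖ₑ) := by
  by_cases h : symbol (dilate ψ (2 ^ k)) ξ = 0
  · simp [h]
  · rw [enorm_mul, ← mul_assoc, ← mul_assoc]
    refine mul_le_mul_left ?_ _
    rw [symbol_dyadic] at h ⊢
    have h1 := hψ.lt_norm h
    have h0 := κ_pos ξ
    have hr := rt_pos
    rw [norm_smul, norm_inv, Real.norm_of_nonneg (by positivity), lt_inv_mul_iff₀ (by positivity),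
      ← div_eq_mul_one_div] at h1
    rw [κe_pow, ← ofReal_norm, ← ENNReal.ofReal_mul (by positivity), ← ENNReal.ofReal_mul]
    · refine ENNReal.ofReal_le_ofReal ?_
      calc rt ^ (10 * k) * ‖symbol ψ (((2 : ℝ) ^ k)⁻¹ • ξ)‖ ≤ rt ^ (10 * k) * C := by
            gcongr; exact hC _
        _ = (rt ^ (2 * k)) ^ 5 * C := by ring
        _ ≤ (2 * κ ξ) ^ 5 * C := by
            gcongr
            · exact (norm_nonneg _).trans (hC 0)
            · exact le_κ_of_lt_norm h1
        _ = _ := by ring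
    · have := (norm_nonneg _).trans (hC 0)
      positivity

/-- The Besov norm controls the weighted norm. -/
theorem IsLittlewoodPaley.sob_le_besovNorm (hψ : IsLittlewoodPaley ψ) {q : ℝ≥0∞} (hq : 1 ≤ q) :
    ∃ C : ℝ≥0∞, C ≠ ⊤ ∧ ∀ f : R3 → R3, MemLp f 2 volume →
      sob 4 (vft f) ≤ C * besovNorm ψ (3 / 2) 2 q f := by
  obtain ⟨K, hK, hKs⟩ := hψ.exists_lowKernel
  have hr := rt_pos
  have hr1 : ENNReal.ofReal rt⁻¹ < 1 := by
    rw [ENNReal.ofReal_lt_one]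
    exact inv_lt_one_of_one_lt₀ one_lt_rt
  refine ⟨∑ _j : Fin 3, (16 + 16 * (1 - ENNReal.ofReal rt⁻¹)⁻¹), ?_, fun f hf => ?_⟩
  · refine ENNReal.sum_ne_top.2 fun _ _ => ENNReal.add_ne_top.2 ⟨by simp, ?_⟩
    exact ENNReal.mul_ne_top (by simp) (ENNReal.inv_ne_top.2 (tsub_pos_of_lt hr1).ne')
  set B := besovNorm ψ (3 / 2) 2 q f with hB
  have hlow : ∀ j, n2 (fun ξ => ‖lowSymbol ψ ξ * vft f j ξ‖ₑ) ≤ B := fun j => by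
    rw [← hKs]
    refine (n2_symbol_le_conv K hf j).trans ?_
    rw [hB, besovNorm, hK]
    exact le_self_add
  have hdy : ∀ j k, ENNReal.ofReal (rt ^ (9 * k)) *
      n2 (fun ξ => ‖symbol (dilate ψ (2 ^ k)) ξ * vft f j ξ‖ₑ) ≤ B := fun j k => by
    calc _ ≤ ENNReal.ofReal (rt ^ (9 * k)) * eLpNorm (conv (dyadicKernel ψ k) f) 2 volume := by
          gcongr
          rw [dyadicKernel_eq]
          exact n2_symbol_le_conv _ hf j
      _ ≤ _ := by
          rw [← rpow_eq_rt, hB, besovNorm]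
          exact (le_seqNorm hq (fun j : ℕ => ENNReal.ofReal ((2 : ℝ) ^ ((j : ℝ) * (3 / 2))) *
            eLpNorm (conv (dyadicKernel ψ j) f) 2 volume) k).trans le_add_self
  have hm : ∀ j k, Measurable fun ξ => ‖symbol (dilate ψ (2 ^ k)) ξ * vft f j ξ‖ₑ := fun j k =>
    ((continuous_symbol _).measurable.mul (measurable_vft f j)).enorm
  have hml : ∀ j, Measurable fun ξ => ‖lowSymbol ψ ξ * vft f j ξ‖ₑ := fun j =>
    (hψ.contDiff_lowSymbol.continuous.measurable.mul (measurable_vft f j)).enorm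
  have key : ∀ j, n2 (fun ξ => κe ξ ^ 4 * ‖vft f j ξ‖ₑ) ≤
      (16 + 16 * (1 - ENNReal.ofReal rt⁻¹)⁻¹) * B := by
    intro j
    calc n2 (fun ξ => κe ξ ^ 4 * ‖vft f j ξ‖ₑ)
        ≤ n2 (fun ξ => 16 * ‖lowSymbol ψ ξ * vft f j ξ‖ₑ + ∑' k, ENNReal.ofReal (16 * rt ^ (8 * k)) *
            ‖symbol (dilate ψ (2 ^ k)) ξ * vft f j ξ‖ₑ) := by
          refine n2_mono (ae_of_all _ fun ξ => ?_)
          calc _ ≤ κe ξ ^ 4 * (‖lowSymbol ψ ξ * vft f j ξ‖ₑ +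
                ∑' k, ‖symbol (dilate ψ (2 ^ k)) ξ * vft f j ξ‖ₑ) := by
                gcongr; exact hψ.enorm_le_tsum _ _
            _ ≤ _ := by
                rw [mul_add, ← ENNReal.tsum_mul_left]
                exact add_le_add (hψ.κ_low _ _) (ENNReal.tsum_le_tsum fun k => hψ.κ_dyadic _ _ _)
      _ ≤ n2 (fun ξ => 16 * ‖lowSymbol ψ ξ * vft f j ξ‖ₑ) + ∑' k, n2 (fun ξ =>
            ENNReal.ofReal (16 * rt ^ (8 * k)) * ‖symbol (dilate ψ (2 ^ k)) ξ * vft f j ξ‖ₑ) := by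
          refine (n2_add_le ((hml j).const_mul _).aemeasurable
            (Measurable.tsum fun k => (hm j k).const_mul _).aemeasurable).trans ?_
          gcongr
          exact n2_tsum_le fun k => (hm j k).const_mul _
      -- Writing `rt^{8k} = rt^{-k} rt^{9k}`, each shell is bounded by the Besov norm times a
      -- geometric factor.
      _ ≤ 16 * B + ∑' k : ℕ, 16 * (ENNReal.ofReal rt⁻¹ ^ k * B) := by
          rw [n2_const_mul _ (by finiteness)]
          refine add_le_add (by gcongr; exact hlow j) (ENNReal.tsum_le_tsum fun k => ?_)
          rw [n2_const_mul _ (by finiteness)]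
          calc _ = ENNReal.ofReal (16 * rt⁻¹ ^ k) * (ENNReal.ofReal (rt ^ (9 * k)) *
              n2 (fun ξ => ‖symbol (dilate ψ (2 ^ k)) ξ * vft f j ξ‖ₑ)) := by
                rw [← mul_assoc, ← ENNReal.ofReal_mul (by positivity)]
                congr 2
                rw [show 9 * k = 8 * k + k by ring, pow_add, inv_pow]
                field_simp
            _ ≤ ENNReal.ofReal (16 * rt⁻¹ ^ k) * B := by gcongr; exact hdy j k
            _ = _ := by
                rw [ENNReal.ofReal_mul (by norm_num), ENNReal.ofReal_pow (by positivity), mul_assoc]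
                simp
      _ = _ := by
          rw [ENNReal.tsum_mul_left, ENNReal.tsum_mul_right, ENNReal.tsum_geometric]
          ring
  calc sob 4 (vft f) = n2 (fun ξ => ∑ j, κe ξ ^ 4 * ‖vft f j ξ‖ₑ) := by
        unfold sob vn
        simp only [Finset.mul_sum]
    _ ≤ ∑ j, n2 (fun ξ => κe ξ ^ 4 * ‖vft f j ξ‖ₑ) :=
        n2_sum_le _ fun j => ((measurable_κe.pow_const 4).mul (measurable_vft f j).enorm).aemeasurable
    _ ≤ _ := by
        rw [Finset.sum_mul]
        exact Finset.sum_le_sum fun j _ => key j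

/-- The weighted norm controls the Besov norm. -/
theorem IsLittlewoodPaley.besovNorm_le_sob (hψ : IsLittlewoodPaley ψ) {q : ℝ≥0∞} (hq : 1 ≤ q) :
    ∃ C : ℝ≥0∞, C ≠ ⊤ ∧ ∀ f : R3 → R3, MemLp f 2 volume →
      besovNorm ψ (3 / 2) 2 q f ≤ C * sob 5 (vft f) := by
  obtain ⟨K, hK, hKs⟩ := hψ.exists_lowKernel
  have hr := rt_pos
  have hr1 : ENNReal.ofReal rt⁻¹ < 1 := by
    rw [ENNReal.ofReal_lt_one]
    exact inv_lt_one_of_one_lt₀ one_lt_rt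
  obtain ⟨C₀, -, hC₀⟩ := exists_symbol_bound K
  obtain ⟨C₁, -, hC₁⟩ := exists_symbol_bound ψ
  obtain ⟨C₂, hC₂, hseq⟩ := seqNorm_geometric_le hq hr1
  refine ⟨3 * ENNReal.ofReal C₀ + C₂ * (3 * ENNReal.ofReal (32 * C₁)), ?_, fun f hf => ?_⟩
  · exact ENNReal.add_ne_top.2 ⟨ENNReal.mul_ne_top (by simp) (by simp),
      ENNReal.mul_ne_top hC₂ (ENNReal.mul_ne_top (by simp) (by finiteness))⟩
  set X := sob 5 (vft f) with hX
  have hj : ∀ j, n2 (fun ξ => κe ξ ^ 5 * ‖vft f j ξ‖ₑ) ≤ X := fun j =>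
    n2_mono (ae_of_all _ fun ξ => by gcongr; exact le_vn _ j ξ)
  have h3 : ∀ a : ℝ≥0∞, ∑ _j : Fin 3, a = 3 * a := fun a => by simp
  rw [besovNorm, add_mul, hK]
  gcongr
  · refine (conv_le_n2_symbol K hf).trans ?_
    rw [mul_assoc, ← h3]
    refine Finset.sum_le_sum fun j _ => ?_
    refine le_trans ?_ (mul_le_mul_right (hj j) (ENNReal.ofReal C₀))
    rw [← n2_const_mul _ (by finiteness)]
    refine n2_mono (ae_of_all _ fun ξ => ?_)
    rw [enorm_mul]
    gcongr
    · rw [← ofReal_norm]; exact ENNReal.ofReal_le_ofReal (hC₀ ξ)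
    · exact le_mul_of_one_le_left zero_le (one_le_κe_pow ξ 5)
  · rw [mul_assoc]
    refine hseq _ _ fun k => ?_
    rw [rpow_eq_rt, dyadicKernel_eq]
    calc _ ≤ ENNReal.ofReal (rt ^ (9 * k)) *
          ∑ j, n2 (fun ξ => ‖symbol (dilate ψ (2 ^ k)) ξ * vft f j ξ‖ₑ) := by
          gcongr; exact conv_le_n2_symbol _ hf
      -- Here `rt^{9k} = rt^{-k} rt^{10k}`, and `rt^{10k}` is comparable to `κ^5` on the shell.
      _ = ∑ j, ENNReal.ofReal (rt⁻¹ ^ k) * n2 (fun ξ => ENNReal.ofReal (rt ^ (10 * k)) *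
          ‖symbol (dilate ψ (2 ^ k)) ξ * vft f j ξ‖ₑ) := by
          rw [Finset.mul_sum]
          refine Finset.sum_congr rfl fun j _ => ?_
          rw [n2_const_mul _ (by finiteness), ← mul_assoc, ← ENNReal.ofReal_mul (by positivity)]
          congr 2
          rw [show 10 * k = 9 * k + k by ring, pow_add, inv_pow]
          field_simp
      _ ≤ ∑ _j : Fin 3, ENNReal.ofReal (rt⁻¹ ^ k) * (ENNReal.ofReal (32 * C₁) * X) := by
          refine Finset.sum_le_sum fun j _ => ?_
          gcongr
          refine le_trans ?_ (mul_le_mul_right (hj j) _)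
          rw [← n2_const_mul _ (by finiteness)]
          exact n2_mono (ae_of_all _ fun ξ => hψ.dyadic_le hC₁ _ k ξ)
      _ = _ := by
          rw [h3, ENNReal.ofReal_pow (by positivity)]
          ring

end

section


/-! ### Regularity of convolutions with Schwartz functions -/

theorem integrable_κ_inv : Integrable (fun x => (κ x ^ 10)⁻¹) volume := by
  refine ⟨(((continuous_κ.pow 10).inv₀ fun x => (pow_pos (κ_pos x) 10).ne')).aestronglyMeasurable,
    lt_of_eq_of_lt (lintegral_congr fun x => ?_)
      (((n2_sq _).symm.trans_lt (ENNReal.pow_lt_top (n := 2) Kinv_lt_top)))⟩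
  rw [κe, ← ENNReal.ofReal_inv_of_pos (κ_pos x), ← ENNReal.ofReal_pow (inv_nonneg.2 (κ_pos x).le),
    ← ENNReal.ofReal_pow (pow_nonneg (inv_nonneg.2 (κ_pos x).le) _), ← pow_mul, ← ofReal_norm,
    Real.norm_of_nonneg (inv_nonneg.2 (pow_nonneg (κ_pos x).le _)), inv_pow]

theorem continuous_κ_inv_real (m : ℕ) : Continuous fun x => (κ x ^ m)⁻¹ :=
  (continuous_κ.pow m).inv₀ fun x => (pow_pos (κ_pos x) m).ne'

theorem memLp_κ_inv {p : ℝ≥0∞} (hp : 1 ≤ p) : MemLp (fun x => (κ x ^ 10)⁻¹) p volume := by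
  have hb : ∀ x, ‖(κ x ^ 10)⁻¹‖ ≤ 1 := fun x => by
    rw [norm_inv, Real.norm_of_nonneg (pow_nonneg (κ_pos x).le _)]
    exact inv_le_one_of_one_le₀ (one_le_κ_pow x 10)
  by_cases h : p = ⊤
  · rw [h]
    exact memLp_top_of_bound (continuous_κ_inv_real 10).aestronglyMeasurable 1 (ae_of_all _ hb)
  · have h1 : 1 ≤ p.toReal := by
      rw [← ENNReal.toReal_one]; exact ENNReal.toReal_mono h hp
    rw [← integrable_norm_rpow_iff (continuous_κ_inv_real 10).aestronglyMeasurable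
      (by positivity) h]
    refine integrable_κ_inv.mono' ?_ (ae_of_all _ fun x => ?_)
    · exact ((continuous_κ_inv_real 10).norm.rpow_const fun x => Or.inr
        (by positivity)).aestronglyMeasurable
    · rw [Real.norm_of_nonneg (by positivity)]
      calc ‖(κ x ^ 10)⁻¹‖ ^ p.toReal ≤ ‖(κ x ^ 10)⁻¹‖ ^ (1 : ℝ) :=
            Real.rpow_le_rpow_of_exponent_ge' (norm_nonneg _) (hb x) (by norm_num) h1
        _ = _ := by
          rw [Real.rpow_one, Real.norm_of_nonneg (inv_nonneg.2 (pow_nonneg (κ_pos x).le _))]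

theorem exists_decay (K : 𝓢(R3, ℝ)) : ∃ A, 0 < A ∧ ∀ x, |K x| ≤ A * (κ x ^ 10)⁻¹ := by
  obtain ⟨G, hG⟩ := schwartz_κ_bound (SchwartzMap.postcompCLM Complex.ofRealCLM K) 10
  obtain ⟨C, hC, h⟩ := G.decay 0 0
  refine ⟨C, hC, fun x => ?_⟩
  have h1 := h x
  simp only [pow_zero, one_mul, norm_iteratedFDeriv_zero] at h1
  have h2 := (hG x).trans h1
  rw [SchwartzMap.postcompCLM_apply] at h2
  simp only [Complex.ofRealCLM_apply, Complex.norm_real, Real.norm_eq_abs] at h2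
  rw [le_mul_inv_iff₀ (pow_pos (κ_pos x) _), mul_comm]
  exact h2

/-- The partial derivatives of a Schwartz function. -/
def dS (i : Fin 3) (K : 𝓢(R3, ℝ)) : 𝓢(R3, ℝ) := LineDeriv.lineDerivOp (e3 i) K

theorem dS_apply (i : Fin 3) (K : 𝓢(R3, ℝ)) (x : R3) : dS i K x = fderiv ℝ K x (e3 i) :=
  SchwartzMap.lineDerivOp_apply_eq_fderiv _ _ _

theorem clm_eq_sum (L : R3 →L[ℝ] ℝ) : L = ∑ i, L (e3 i) • EuclideanSpace.proj (𝕜 := ℝ) i := by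
  ext x
  have := (EuclideanSpace.basisFun (Fin 3) ℝ).sum_repr x
  conv_lhs => rw [← this]
  simp [mul_comm]

/-- The weight at `x - z` is controlled by those at `x - y`, where `κ ≤ 2`, and at `y - z`. The
constant is a rounding of `2^10 (2^10 + 1)`. It provides a dominating function, uniform in a unit
ball, for differentiation under the integral. -/
theorem κ_inv_translate {x y z : R3} (h : ‖x - y‖ < 1) :
    (κ (y - z) ^ 10)⁻¹ ≤ 2 ^ 21 * (κ (x - z) ^ 10)⁻¹ := by
  have h1 : κ (x - y) ≤ 2 := by
    refine le_of_pow_le_pow_left₀ (n := 6) (by norm_num) (by norm_num) ?_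
    rw [κ_pow_six]
    nlinarith [norm_nonneg (x - y)]
  have h2 := κ_add_pow_le (x - y) (y - z) 10
  rw [sub_add_sub_cancel] at h2
  have h3 := pow_le_pow_left₀ (κ_pos _).le h1 10
  have h4 := one_le_κ_pow (y - z) 10
  have h5 := pow_pos (κ_pos (x - z)) 10
  rw [inv_le_iff_one_le_mul₀ (by positivity), mul_assoc, mul_comm, mul_assoc,
    le_inv_mul_iff₀ h5, mul_one]
  nlinarith

variable {f : R3 → R3} {p : ℝ≥0∞}

theorem conv_swap (K : R3 → ℝ) (f : R3 → R3) (x : R3) : conv K f x = ∫ t, K (x - t) • f t := by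
  rw [conv, convolution_lsmul_swap]

theorem integrable_mul_of_decay (hp : 1 ≤ p) (hf : MemLp f p volume) (x : R3) :
    Integrable (fun t => (κ (x - t) ^ 10)⁻¹ * ‖f t‖) volume := by
  have := (ENNReal.HolderConjugate.conjExponent hp).symm
  have h1 : MemLp (fun t => (κ (x - t) ^ 10)⁻¹) (ENNReal.conjExponent p) volume :=
    (memLp_κ_inv (ENNReal.HolderConjugate.one_le _ p)).comp_measurePreserving
      (Measure.measurePreserving_sub_left volume x)
  exact memLp_one_iff_integrable.1 (hf.norm.mul h1)

theorem integrable_conv (hp : 1 ≤ p) (hf : MemLp f p volume) (K : 𝓢(R3, ℝ)) (x : R3) :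
    Integrable (fun t => K (x - t) • f t) volume := by
  obtain ⟨A, hA, h⟩ := exists_decay K
  refine ((integrable_mul_of_decay hp hf x).const_mul A).mono' ?_ (ae_of_all _ fun t => ?_)
  · exact (K.continuous.comp (by fun_prop)).aestronglyMeasurable.smul hf.1
  · rw [norm_smul, Real.norm_eq_abs, ← mul_assoc]
    gcongr
    exact h _

/-- All derivatives fall on the kernel, so nothing but integrability of `f` against `κ^{-10}` is
used. -/
theorem hasFDerivAt_conv (hp : 1 ≤ p) (hf : MemLp f p volume) (K : 𝓢(R3, ℝ)) (x : R3) :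
    HasFDerivAt (conv K f)
      (∑ i, (EuclideanSpace.proj (𝕜 := ℝ) i).smulRight (conv (dS i K) f x)) x := by
  have e : conv K f = fun x => ∫ t, K (x - t) • f t := by ext1 x; exact conv_swap _ _ _
  let L : Fin 3 → R3 →L[ℝ] (R3 →L[ℝ] R3) := fun i =>
    ContinuousLinearMap.smulRightL ℝ R3 R3 (EuclideanSpace.proj (𝕜 := ℝ) i)
  have hL : ∀ i y, L i y = (EuclideanSpace.proj (𝕜 := ℝ) i).smulRight y := fun i y => rfl
  have hi := fun i => integrable_conv hp hf (dS i K) x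
  have e2 : (∑ i, (EuclideanSpace.proj (𝕜 := ℝ) i).smulRight (conv (dS i K) f x)) =
      ∫ t, ∑ i, L i (dS i K (x - t) • f t) := by
    rw [integral_finsetSum _ fun i _ => (L i).integrable_comp (hi i)]
    refine Finset.sum_congr rfl fun i _ => ?_
    rw [(L i).integral_comp_comm (hi i), hL, conv_swap]
  choose A hA hdec using fun i => exists_decay (dS i K)
  rw [e, e2]
  refine hasFDerivAt_integral_of_dominated_of_fderiv_le (Metric.ball_mem_nhds x one_pos)
    (F := fun x t => K (x - t) • f t) (F' := fun x t => ∑ i, L i (dS i K (x - t) • f t))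
    (bound := fun t => ∑ i, ‖L i‖ * (A i * (2 ^ 21 * ((κ (x - t) ^ 10)⁻¹ * ‖f t‖))))
    (Eventually.of_forall fun y => (integrable_conv hp hf K y).1) (integrable_conv hp hf K x)
    (integrable_finsetSum _ fun i _ => (L i).integrable_comp (hi i)).1
    (ae_of_all _ fun t y hy => ?_)
    (integrable_finsetSum _ fun i _ =>
      (((integrable_mul_of_decay hp hf x).const_mul _).const_mul _).const_mul _)
    (ae_of_all _ fun t y _ => ?_)
  · refine (norm_sum_le _ _).trans (Finset.sum_le_sum fun i _ => ?_)
    refine ((L i).le_opNorm _).trans ?_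
    gcongr
    rw [norm_smul, Real.norm_eq_abs, ← mul_assoc (2 ^ 21), ← mul_assoc]
    gcongr
    refine (hdec i _).trans ?_
    gcongr
    · exact (hA i).le
    · refine κ_inv_translate ?_
      rw [← dist_eq_norm, dist_comm]
      exact hy
  · have h1 := ((K.differentiableAt (x := y - t)).hasFDerivAt.comp y
      ((hasFDerivAt_id y).sub_const t)).smul_const (f t)
    refine h1.congr_fderiv ?_
    rw [ContinuousLinearMap.comp_id, clm_eq_sum (fderiv ℝ K (y - t))]
    ext v
    simp [hL, dS_apply, smul_smul, Finset.sum_smul, mul_comm]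

theorem fderiv_conv (hp : 1 ≤ p) (hf : MemLp f p volume) (K : 𝓢(R3, ℝ)) :
    fderiv ℝ (conv K f) = fun x => ∑ i, ContinuousLinearMap.smulRightL ℝ R3 R3
      (EuclideanSpace.proj (𝕜 := ℝ) i) (conv (dS i K) f x) := by
  ext1 x
  exact (hasFDerivAt_conv hp hf K x).fderiv

theorem contDiff_conv (hp : 1 ≤ p) (hf : MemLp f p volume) (K : 𝓢(R3, ℝ)) :
    ContDiff ℝ ∞ (conv K f) := by
  rw [contDiff_infty]
  intro n
  induction n generalizing K with
  | zero =>
    exact contDiff_zero.2 (continuous_iff_continuousAt.2 fun x =>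
      (hasFDerivAt_conv hp hf K x).continuousAt)
  | succ n ih =>
    push_cast
    rw [contDiff_succ_iff_fderiv]
    refine ⟨fun x => (hasFDerivAt_conv hp hf K x).differentiableAt, by simp, ?_⟩
    rw [fderiv_conv hp hf K]
    exact ContDiff.sum fun i _ => ContinuousLinearMap.contDiff _ |>.comp (ih (dS i K))

theorem norm_proj_le (i : Fin 3) :
    ‖ContinuousLinearMap.smulRightL ℝ R3 R3 (EuclideanSpace.proj (𝕜 := ℝ) i)‖ ≤ 1 := by
  refine ContinuousLinearMap.opNorm_le_bound _ zero_le_one fun y => ?_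
  refine ContinuousLinearMap.opNorm_le_bound _ (by positivity) fun z => ?_
  change ‖z i • y‖ ≤ _
  rw [norm_smul, one_mul, mul_comm]
  gcongr
  exact PiLp.norm_apply_le z i

theorem κ_mono {x y : R3} (h : ‖x‖ ≤ ‖y‖) : κ x ≤ κ y := by
  refine le_of_pow_le_pow_left₀ (n := 6) (by norm_num) (κ_pos y).le ?_
  rw [κ_pow_six, κ_pow_six]
  gcongr

theorem dS_dilate (i : Fin 3) (K : 𝓢(R3, ℝ)) {c : ℝ} (hc : c ≠ 0) :
    dS i (dilate K c) = c • dilate (dS i K) c := by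
  ext x
  rw [dS_apply]
  have e : (dilate K c : R3 → ℝ) = fun x => c ^ 3 * K (c • x) := by
    ext1 x; exact dilate_apply K hc x
  have h : HasFDerivAt (fun x : R3 => c ^ 3 * K (c • x))
      (c ^ 3 • (fderiv ℝ K (c • x)).comp (c • ContinuousLinearMap.id ℝ R3)) x :=
    ((K.differentiableAt (x := c • x)).hasFDerivAt.comp x
      ((hasFDerivAt_id x).const_smul c)).const_mul (c ^ 3)
  rw [e, h.fderiv, _root_.smul_apply, _root_.smul_apply, dilate_apply _ hc, dS_apply]
  simp
  ring

/-- The `L^p` norm, as a real number. -/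
def lpn (p : ℝ≥0∞) (f : R3 → R3) : ℝ := (eLpNorm f p volume).toReal

theorem integral_decay_le (hp : 1 ≤ p) (hf : MemLp f p volume) (x : R3) :
    ∫ t, (κ (x - t) ^ 10)⁻¹ * ‖f t‖ ≤
      (eLpNorm (fun x => (κ x ^ 10)⁻¹) (ENNReal.conjExponent p) volume).toReal * lpn p f := by
  have hpp := (ENNReal.HolderConjugate.conjExponent hp).symm
  have hκ := memLp_κ_inv (ENNReal.HolderConjugate.one_le (ENNReal.conjExponent p) p)
  have hmp := Measure.measurePreserving_sub_left (volume : Measure R3) x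
  have h1 := eLpNorm_comp_measurePreserving (p := ENNReal.conjExponent p) hκ.1 hmp
  have h2 : eLpNorm (((fun x => (κ x ^ 10)⁻¹) ∘ fun t => x - t) • fun t => ‖f t‖) 1 volume ≤
      eLpNorm ((fun x => (κ x ^ 10)⁻¹) ∘ fun t => x - t) (ENNReal.conjExponent p) volume *
        eLpNorm (fun t => ‖f t‖) p volume :=
    eLpNorm_smul_le_mul_eLpNorm hf.1.norm (hκ.1.comp_measurePreserving hmp)
  rw [h1, eLpNorm_norm, eLpNorm_one_eq_lintegral_enorm] at h2
  rw [lpn, ← ENNReal.toReal_mul]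
  refine (le_abs_self _).trans ?_
  rw [← Real.norm_eq_abs, ← toReal_enorm]
  exact ENNReal.toReal_mono (ENNReal.mul_ne_top hκ.2.ne hf.2.ne)
    ((enorm_integral_le_lintegral_enorm _).trans h2)

/-- A crude Bernstein inequality: for `c ≥ 1` the dilated kernel is at most `A c³ κ^{-10}`, and
Hölder's inequality concludes. The loss of `c³` instead of `c^{3/p}` is harmless because the
function it is meant for lies in Besov spaces of every high order. -/
theorem exists_norm_conv_le (hp : 1 ≤ p) (K : 𝓢(R3, ℝ)) : ∃ A, 0 ≤ A ∧ ∀ c : ℝ, 1 ≤ c →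
    ∀ f : R3 → R3, MemLp f p volume → ∀ x, ‖conv (dilate K c) f x‖ ≤ A * c ^ 3 * lpn p f := by
  obtain ⟨A, hA, h⟩ := exists_decay K
  refine ⟨A * (eLpNorm (fun x => (κ x ^ 10)⁻¹) (ENNReal.conjExponent p) volume).toReal,
    by positivity, fun c hc f hf x => ?_⟩
  have hc0 : 0 < c := by linarith
  have hd : ∀ y, |dilate K c y| ≤ A * c ^ 3 * (κ y ^ 10)⁻¹ := fun y => by
    rw [dilate_apply K hc0.ne', abs_mul, abs_of_pos (by positivity), mul_comm A, mul_assoc]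
    gcongr
    refine (h _).trans ?_
    have h0 := κ_pos y
    gcongr
    refine κ_mono ?_
    rw [norm_smul, Real.norm_of_nonneg hc0.le]
    exact le_mul_of_one_le_left (norm_nonneg _) hc
  have hi := integrable_mul_of_decay hp hf x
  calc ‖conv (dilate K c) f x‖ ≤ ∫ t, A * c ^ 3 * ((κ (x - t) ^ 10)⁻¹ * ‖f t‖) := by
        rw [conv_swap]
        refine norm_integral_le_of_norm_le (hi.const_mul _) (ae_of_all _ fun t => ?_)
        rw [norm_smul, Real.norm_eq_abs, ← mul_assoc]
        gcongr
        exact hd _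
    _ = A * c ^ 3 * ∫ t, (κ (x - t) ^ 10)⁻¹ * ‖f t‖ := integral_const_mul _ _
    _ ≤ A * c ^ 3 * ((eLpNorm (fun x => (κ x ^ 10)⁻¹) (ENNReal.conjExponent p) volume).toReal *
          lpn p f) := by
        gcongr
        exact integral_decay_le hp hf x
    _ = _ := by ring

/-- Each derivative acts on the dilated kernel and produces one more factor `c`. -/
theorem exists_iteratedFDeriv_conv_le (hp : 1 ≤ p) (k : ℕ) (K : 𝓢(R3, ℝ)) :
    ∃ A, 0 ≤ A ∧ ∀ c : ℝ, 1 ≤ c → ∀ f : R3 → R3, MemLp f p volume →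
      ∀ x, ‖iteratedFDeriv ℝ k (conv (dilate K c) f) x‖ ≤ A * c ^ (3 + k) * lpn p f := by
  induction k generalizing K with
  | zero => simpa using exists_norm_conv_le hp K
  | succ k ih =>
    choose A hA h using fun i => ih (dS i K)
    refine ⟨∑ i, A i, Finset.sum_nonneg fun i _ => hA i, fun c hc f hf x => ?_⟩
    have hc0 : 0 < c := by linarith
    rw [← norm_iteratedFDeriv_fderiv, fderiv_conv hp hf]
    have e : ∀ i, conv (dS i (dilate K c)) f = c • conv (dilate (dS i K) c) f := fun i => by
      rw [dS_dilate i K hc0.ne']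
      exact smul_convolution
    have hcd : ∀ i, ContDiff ℝ ∞ (conv (dilate (dS i K) c) f) := fun i =>
      contDiff_conv hp hf _
    have hcd' : ∀ i, ContDiff ℝ ∞ (conv (dS i (dilate K c)) f) := fun i =>
      contDiff_conv hp hf _
    rw [iteratedFDeriv_fun_sum_apply]
    swap
    · exact fun i _ => ((ContinuousLinearMap.contDiff _).comp (hcd' i)).contDiffAt.of_le
        (by exact_mod_cast le_top)
    rw [Finset.sum_mul, Finset.sum_mul]
    refine (norm_sum_le _ _).trans (Finset.sum_le_sum fun i _ => ?_)
    refine (ContinuousLinearMap.norm_iteratedFDeriv_comp_left _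
      ((hcd' i).contDiffAt.of_le (m := k) (by exact_mod_cast le_top)) le_rfl).trans ?_
    refine (mul_le_of_le_one_left (norm_nonneg _) (norm_proj_le i)).trans ?_
    rw [e, iteratedFDeriv_const_smul_apply ((hcd i).contDiffAt.of_le (by exact_mod_cast le_top)),
      norm_smul, Real.norm_of_nonneg hc0.le]
    calc _ ≤ c * (A i * c ^ (3 + k) * lpn p f) := by gcongr; exact h i c hc f hf x
      _ = _ := by ring

end

section


/-! ### Reproducing kernels and approximate identities -/

variable {f : R3 → R3} {p : ℝ≥0∞}

theorem conv_congr {h h' : R3 → ℝ} (e : h =ᵐ[volume] h') (f : R3 → R3) (x : R3) :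
    conv h f x = conv h' f x := by
  rw [conv, conv, convolution, convolution]
  refine integral_congr_ae ?_
  filter_upwards [e] with t ht
  rw [ht]

/-- The convolution of two real functions. -/
def kk (K L : R3 → ℝ) : R3 → ℝ := convolution K L (ContinuousLinearMap.lsmul ℝ ℝ) volume

theorem isFT_kk (K L : 𝓢(R3, ℝ)) :
    IsFT (fun x => (kk K L x : ℂ)) (fun ξ => symbol K ξ * symbol L ξ) := by
  refine (isFT_conv K (isFT_symbol L)).congr (ae_of_all _ fun x => ?_) (ae_eq_refl _)
  simp only [kk, convolution_def, ContinuousLinearMap.lsmul_apply, smul_eq_mul]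
  rw [← integral_complex_ofReal]
  simp

theorem IsFT.unique_left {f g F : R3 → ℂ} (h : IsFT f F) (h' : IsFT g F) : f =ᵐ[volume] g := by
  have := h.inverse.unique h'.inverse
  have h2 := (Measure.measurePreserving_neg (volume : Measure R3)).quasiMeasurePreserving.ae this
  filter_upwards [h2] with x hx
  simpa using hx

theorem kk_ae_eq {K L M : 𝓢(R3, ℝ)} (h : ∀ ξ, symbol K ξ * symbol L ξ = symbol M ξ) :
    kk K L =ᵐ[volume] M := by
  have h1 := isFT_kk K L
  simp only [h] at h1
  filter_upwards [h1.unique_left (isFT_symbol M)] with x hx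
  exact_mod_cast hx

theorem kk_comm (K L : 𝓢(R3, ℝ)) : kk K L =ᵐ[volume] kk L K := by
  have h1 := isFT_kk K L
  have h2 := isFT_kk L K
  simp only [mul_comm (symbol K _)] at h1
  filter_upwards [h1.unique_left h2] with x hx
  exact_mod_cast hx

theorem integrable_norm_conv (hp : 1 ≤ p) (hf : MemLp f p volume) (L : 𝓢(R3, ℝ)) (x : R3) :
    Integrable (fun t => ‖L t‖ * ‖f (x - t)‖) volume := by
  have := (integrable_conv hp hf L x).norm.comp_sub_left x
  refine this.congr (ae_of_all _ fun t => ?_)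
  simp [norm_smul]

/-- Associativity is Fubini's theorem. The required absolute integrability holds because the
convolution of `|L|` with `‖f‖` is bounded, by decay of `L` and Hölder's inequality. -/
theorem conv_conv (hp : 1 ≤ p) (hf : MemLp f p volume) (K L : 𝓢(R3, ℝ)) (x : R3) :
    conv K (conv L f) x = conv (kk K L) f x := by
  obtain ⟨A, hA, hdec⟩ := exists_decay L
  refine (convolution_assoc (L := ContinuousLinearMap.lsmul ℝ ℝ) _ _ _
    (fun a b c => by simp [smul_smul, mul_comm]) K.continuous.aestronglyMeasurable
    L.continuous.aestronglyMeasurable hf.1 (ae_of_all _ fun y => ?_) (ae_of_all _ fun y => ?_)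
    ?_).symm
  · have h1 : MemLp (fun t => L (y - t)) 2 volume :=
      (L.memLp 2 volume).comp_measurePreserving (Measure.measurePreserving_sub_left volume y)
    exact (K.memLp 2 volume).integrable_mul h1
  · exact integrable_norm_conv hp hf L y
  · have hm : AEStronglyMeasurable (fun y => ∫ t, ‖L t‖ * ‖f (y - t)‖) volume :=
      (AEStronglyMeasurable.convolution_integrand (ContinuousLinearMap.mul ℝ ℝ)
        L.continuous.norm.aestronglyMeasurable hf.1.norm).integral_prod_right'
    have hb : ∀ y, ‖∫ t, ‖L t‖ * ‖f (y - t)‖‖ ≤ A * ((eLpNorm (fun x => (κ x ^ 10)⁻¹)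
        (ENNReal.conjExponent p) volume).toReal * lpn p f) := fun y => by
      rw [Real.norm_of_nonneg (integral_nonneg fun t => by positivity),
        ← integral_sub_left_eq_self _ _ y]
      simp only [sub_sub_cancel]
      refine (integral_mono_of_nonneg (ae_of_all _ fun t => by positivity)
        ((integrable_mul_of_decay hp hf y).const_mul A) (ae_of_all _ fun t => ?_)).trans ?_
      · simp only
        rw [← mul_assoc]
        gcongr
        exact hdec _
      · rw [integral_const_mul]
        gcongr
        exact integral_decay_le hp hf y
    have hm' := hm.comp_measurePreserving (Measure.measurePreserving_sub_left volume x)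
    exact (K.integrable (μ := volume)).norm.mul_bdd hm' (ae_of_all _ fun y => hb _)

theorem conv_add_kernel (hp : 1 ≤ p) (hf : MemLp f p volume) (K L : 𝓢(R3, ℝ)) (x : R3) :
    conv (K + L : 𝓢(R3, ℝ)) f x = conv K f x + conv L f x := by
  simp only [conv_swap]
  rw [← integral_add (integrable_conv hp hf K x) (integrable_conv hp hf L x)]
  simp [add_smul]

theorem symbol_add (K L : 𝓢(R3, ℝ)) (ξ : R3) : symbol (K + L) ξ = symbol K ξ + symbol L ξ := by
  have e : ∀ K : 𝓢(R3, ℝ), symbol K =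
      (𝓕 (SchwartzMap.postcompCLM Complex.ofRealCLM K) : 𝓢(R3, ℂ)) := fun K => rfl
  rw [e, e, e, map_add, FourierTransform.fourier_add]
  rfl

theorem eq_of_symbol_eq {K L : 𝓢(R3, ℝ)} (h : ∀ ξ, symbol K ξ = symbol L ξ) : K = L := by
  have h1 := isFT_symbol K
  simp only [show symbol K = symbol L from funext h] at h1
  have h2 : (K : R3 → ℝ) = L := by
    refine (K.continuous.ae_eq_iff_eq volume L.continuous).1 ?_
    filter_upwards [h1.unique_left (isFT_symbol L)] with x hx
    exact_mod_cast hx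
  ext x
  exact congrFun h2 x

variable {ψ : 𝓢(R3, ℝ)}

/-- On the annulus `1/2 < |ξ| < 2` only the two neighbouring dilates overlap, so the partition of
unity reduces to three terms. -/
theorem IsLittlewoodPaley.sum_three (hψ : IsLittlewoodPaley ψ) {ξ : R3} (h : symbol ψ ξ ≠ 0) :
    symbol ψ ((2 : ℝ) • ξ) + symbol ψ ξ + symbol ψ ((2 : ℝ)⁻¹ • ξ) = 1 := by
  have h1 := hψ.lt_norm h
  have h2 := hψ.norm_lt h
  have h0 : ξ ≠ 0 := fun h0 => by simp [h0] at h1; linarith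
  have h3 : HasSum (fun j : ℤ => symbol ψ ((2 : ℝ) ^ (-j) • ξ))
      (∑ j ∈ ({-1, 0, 1} : Finset ℤ), symbol ψ ((2 : ℝ) ^ (-j) • ξ)) :=
    hasSum_sum_of_ne_finset_zero fun j hj => ?_
  · refine Eq.trans ?_ ((hψ.symbol_sum ξ h0).unique h3).symm
    rw [Finset.sum_insert (by decide), Finset.sum_insert (by decide), Finset.sum_singleton]
    simp [add_assoc]
  · by_contra hne
    have h4 := hψ.norm_lt hne
    have h5 := hψ.lt_norm hne
    rw [norm_smul, norm_zpow, Real.norm_ofNat] at h4 h5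
    simp only [Finset.mem_insert, Finset.mem_singleton, not_or] at hj
    rcases lt_or_ge j 0 with hlt | hge
    · have : (2 : ℝ) ^ (2 : ℤ) ≤ 2 ^ (-j) := zpow_le_zpow_right₀ (by norm_num) (by omega)
      rw [show (2 : ℝ) ^ (2 : ℤ) = 4 by norm_num] at this
      nlinarith
    · have : (2 : ℝ) ^ (-j) ≤ 2 ^ (-2 : ℤ) := zpow_le_zpow_right₀ (by norm_num) (by omega)
      rw [show (2 : ℝ) ^ (-2 : ℤ) = 1 / 4 by norm_num] at this
      nlinarith

/-- A reproducing kernel for the Littlewood-Paley operators. -/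
theorem IsLittlewoodPaley.exists_reproducing (hψ : IsLittlewoodPaley ψ) (hp : 1 ≤ p) :
    ∃ χ : 𝓢(R3, ℝ), ∀ c : ℝ, 0 < c → ∀ f : R3 → R3, MemLp f p volume →
      conv (dilate χ c) (conv (dilate ψ c) f) = conv (dilate ψ c) f := by
  refine ⟨dilate ψ 2⁻¹ + ψ + dilate ψ 2, fun c hc f hf => ?_⟩
  ext1 x
  rw [conv_conv hp hf]
  refine conv_congr (kk_ae_eq fun ξ => ?_) f x
  rw [symbol_dilate _ hc, symbol_dilate _ hc]
  by_cases h : symbol ψ (c⁻¹ • ξ) = 0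
  · simp [h]
  · rw [symbol_add, symbol_add, symbol_dilate _ (by norm_num), symbol_dilate _ (by norm_num),
      inv_inv, hψ.sum_three h, one_mul]

/-- A reproducing kernel for the low frequencies. -/
theorem IsLittlewoodPaley.low_reproducing (hψ : IsLittlewoodPaley ψ) {Λ : 𝓢(R3, ℝ)}
    (hΛ : symbol Λ = lowSymbol ψ) (hp : 1 ≤ p) (hf : MemLp f p volume) :
    conv (dilate Λ 2) (conv Λ f) = conv Λ f := by
  ext1 x
  rw [conv_conv hp hf]
  refine conv_congr (kk_ae_eq fun ξ => ?_) f x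
  rw [symbol_dilate _ (by norm_num), hΛ]
  by_cases h : 1 ≤ ‖ξ‖
  · simp [hψ.lowSymbol_eq_zero h]
  · have h1 : ‖(2 : ℝ)⁻¹ • ξ‖ ≤ 1 / 2 := by
      rw [norm_smul]; norm_num; linarith
    have h2 : symbol ψ ((2 : ℝ)⁻¹ • ξ) = 0 := by
      by_contra h3
      exact absurd (hψ.lt_norm h3) (by linarith)
    rw [hψ.lowSymbol_eq (N := 0) (by rw [pow_zero]; linarith)]
    simp [h2]

theorem IsLittlewoodPaley.lowSymbol_half (hψ : IsLittlewoodPaley ψ) (ξ : R3) :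
    lowSymbol ψ ((2 : ℝ)⁻¹ • ξ) = lowSymbol ψ ξ + symbol ψ ξ := by
  obtain ⟨N, hN⟩ := pow_unbounded_of_one_lt ‖ξ‖ (one_lt_two (α := ℝ))
  have h1 : ‖(2 : ℝ)⁻¹ • ξ‖ ≤ 2 ^ N := by
    rw [norm_smul]; norm_num; linarith [norm_nonneg ξ]
  have h2 : ‖ξ‖ ≤ 2 ^ (N + 1) := by rw [pow_succ]; linarith [norm_nonneg ξ]
  rw [hψ.lowSymbol_eq h1, hψ.lowSymbol_eq h2, Finset.sum_range_succ' _ (N + 1)]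
  simp only [smul_smul, ← mul_inv, pow_zero, inv_one, one_smul, pow_succ]
  ring

/-- The telescoping relation which identifies partial Littlewood–Paley sums with convolutions by
dilates of the low frequency kernel. Those dilates form an approximate identity. -/
theorem IsLittlewoodPaley.dilate_low (hψ : IsLittlewoodPaley ψ) {Λ : 𝓢(R3, ℝ)}
    (hΛ : symbol Λ = lowSymbol ψ) (N : ℕ) :
    dilate Λ (2 ^ (N + 1)) = dilate Λ (2 ^ N) + dilate ψ (2 ^ N) := by
  refine eq_of_symbol_eq fun ξ => ?_
  rw [symbol_add, symbol_dilate _ (by positivity), symbol_dilate _ (by positivity),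
    symbol_dilate _ (by positivity), hΛ, ← hψ.lowSymbol_half, smul_smul, ← mul_inv, pow_succ,
    mul_comm]

theorem IsLittlewoodPaley.conv_dilate_low (hψ : IsLittlewoodPaley ψ) {Λ : 𝓢(R3, ℝ)}
    (hΛ : symbol Λ = lowSymbol ψ) (hp : 1 ≤ p) (hf : MemLp f p volume) (N : ℕ) (x : R3) :
    conv (dilate Λ (2 ^ N)) f x =
      conv Λ f x + ∑ j ∈ Finset.range N, conv (dilate ψ (2 ^ j)) f x := by
  induction N with
  | zero =>
    have : dilate Λ (2 ^ 0) = Λ := by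
      ext x; rw [dilate_apply _ (by norm_num)]; simp
    rw [this]; simp
  | succ N ih => rw [hψ.dilate_low hΛ, conv_add_kernel hp hf, ih, Finset.sum_range_succ, add_assoc]

theorem integral_eq_of_symbol {K : 𝓢(R3, ℝ)} (h : symbol K 0 = 1) : ∫ x, K x = 1 := by
  rw [symbol, fourier_apply_integral] at h
  simp only [inner_zero_right, mul_zero, neg_zero, Complex.ofReal_zero, zero_mul, Complex.exp_zero,
    one_mul] at h
  rw [integral_complex_ofReal] at h
  exact_mod_cast h

theorem exists_bound_conv (hp : 1 ≤ p) (hf : MemLp f p volume) (K : 𝓢(R3, ℝ)) :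
    ∃ B, ∀ x, ‖conv K f x‖ ≤ B := by
  obtain ⟨A, -, h⟩ := exists_norm_conv_le hp K
  refine ⟨A * 1 ^ 3 * lpn p f, fun x => ?_⟩
  have := h 1 le_rfl f hf x
  have e : dilate K 1 = K := by
    ext x; rw [dilate_apply _ (by norm_num)]; simp
  rwa [e] at this

/-- Dilates of a kernel of mass one are an approximate identity. -/
theorem tendsto_integral_conv (hp : 1 ≤ p) (hf : MemLp f p volume) {K : 𝓢(R3, ℝ)}
    (hK : symbol K 0 = 1) {ζ : R3 → ℝ} (hζ : IsTest ζ) :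
    Tendsto (fun N : ℕ => ∫ x, ζ x • conv (dilate K (2 ^ N)) f x) atTop
      (𝓝 (∫ x, ζ x • f x)) := by
  have hζn : IsTest (fun x => ζ (-x)) :=
    ⟨hζ.1.comp contDiff_neg, hζ.2.comp_homeomorph (Homeomorph.neg R3)⟩
  let Z : 𝓢(R3, ℝ) := hζn.2.toSchwartzMap hζn.1
  have hZ : ∀ g : R3 → R3, ∫ x, ζ x • g x = conv Z g 0 := fun g => by
    rw [conv_swap]
    congr 1; ext1 t
    change _ = ζ (-(0 - t)) • g t
    simp
  obtain ⟨B, hB⟩ := exists_bound_conv hp hf Z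
  have hc : Continuous (conv Z f) := (contDiff_conv hp hf Z).continuous
  -- Pairing with `ζ` is convolution with the reflected `ζ` at the origin. Commuting the two kernels
  -- leaves an average of the continuous function `conv Z f` over points shrinking to the origin, so
  -- no continuity of `f` is required.
  have e : ∀ N : ℕ, ∫ x, ζ x • conv (dilate K (2 ^ N)) f x =
      ∫ s, K s • conv Z f (-(((2 : ℝ) ^ N)⁻¹ • s)) := fun N => by
    have h2 : (0 : ℝ) < 2 ^ N := by positivity
    rw [hZ, conv_conv hp hf, conv_congr (kk_comm _ _), ← conv_conv hp hf, conv, convolution]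
    have := Measure.integral_comp_smul (volume : Measure R3)
      (fun s => K s • conv Z f (-(((2 : ℝ) ^ N)⁻¹ • s))) (2 ^ N)
    rw [finrank_euclideanSpace_fin, abs_of_pos (by positivity),
      eq_inv_smul_iff₀ (by positivity), ← integral_smul] at this
    rw [← this]
    congr 1; ext1 t
    rw [dilate_apply _ h2.ne', smul_smul, inv_smul_smul₀ h2.ne']
    simp
  simp only [e]
  have e2 : ∫ x, ζ x • f x = ∫ s, K s • conv Z f 0 := by
    rw [hZ, integral_smul_const, integral_eq_of_symbol hK, one_smul]
  rw [e2]
  refine tendsto_integral_of_dominated_convergence (fun s => ‖K s‖ * B) (fun N => ?_)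
    ((K.integrable (μ := volume)).norm.mul_const B) (fun N => ae_of_all _ fun s => ?_)
    (ae_of_all _ fun s => ?_)
  · exact (K.continuous.smul (hc.comp (by fun_prop))).aestronglyMeasurable
  · rw [norm_smul]; gcongr; exact hB _
  · refine Tendsto.const_smul ?_ _
    refine (hc.tendsto 0).comp ?_
    have h1 : Tendsto (fun N : ℕ => ((2 : ℝ) ^ N)⁻¹) atTop (𝓝 0) :=
      tendsto_inv_atTop_zero.comp (tendsto_pow_atTop_atTop_of_one_lt (by norm_num))
    simpa using (h1.smul_const s).neg

end

section


/-! ### Smooth representatives of elements of Besov spaces -/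

variable {f : R3 → R3} {p q : ℝ≥0∞} {ψ : 𝓢(R3, ℝ)}

theorem memLp_lpn_le {w : R3 → R3} (hw : Continuous w) {B : ℝ} (hB : 0 ≤ B)
    (h : eLpNorm w p volume ≤ ENNReal.ofReal B) : MemLp w p volume ∧ lpn p w ≤ B :=
  ⟨⟨hw.aestronglyMeasurable, h.trans_lt ENNReal.ofReal_lt_top⟩, ENNReal.toReal_le_of_le_ofReal hB h⟩

theorem lpn_dyadic_le (hp : 1 ≤ p) (hq : 1 ≤ q) (hf : MemLp f p volume) {n : ℕ} {B : ℝ}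
    (hB : 0 ≤ B) (h : besovNorm ψ n p q f ≤ ENNReal.ofReal B) (j : ℕ) :
    MemLp (conv (dilate ψ (2 ^ j)) f) p volume ∧
      lpn p (conv (dilate ψ (2 ^ j)) f) ≤ B * ((2 : ℝ) ^ (n * j))⁻¹ := by
  refine memLp_lpn_le (contDiff_conv hp hf _).continuous (by positivity) ?_
  have h1 := ((le_seqNorm hq (fun j : ℕ => ENNReal.ofReal ((2 : ℝ) ^ ((j : ℝ) * n)) *
    eLpNorm (conv (dyadicKernel ψ j) f) p volume) j).trans le_add_self).trans h
  simp only [dyadicKernel_eq] at h1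
  rw [← Nat.cast_mul, Real.rpow_natCast, mul_comm j n] at h1
  rw [ENNReal.ofReal_mul hB, ENNReal.ofReal_inv_of_pos (by positivity), ← div_eq_mul_inv,
    ENNReal.le_div_iff_mul_le (by simp) (by simp), mul_comm]
  exact h1

theorem IsLittlewoodPaley.exists_iteratedFDeriv_dyadic_le (hψ : IsLittlewoodPaley ψ) (hp : 1 ≤ p)
    (hq : 1 ≤ q) (k : ℕ) : ∃ A, 0 ≤ A ∧ ∀ f : R3 → R3, MemLp f p volume → ∀ n : ℕ, 4 + k ≤ n →
      ∀ B, 0 ≤ B → besovNorm ψ n p q f ≤ ENNReal.ofReal B → ∀ j x,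
        ‖iteratedFDeriv ℝ k (conv (dilate ψ (2 ^ j)) f) x‖ ≤ A * B * (1 / 2) ^ j := by
  obtain ⟨χ, hχ⟩ := hψ.exists_reproducing hp
  obtain ⟨A, hA, h⟩ := exists_iteratedFDeriv_conv_le hp k χ
  refine ⟨A, hA, fun f hf n hn B hB hb j x => ?_⟩
  obtain ⟨h1, h2⟩ := lpn_dyadic_le hp hq hf hB hb j
  rw [← hχ _ (by positivity) f hf]
  refine (h _ (one_le_pow₀ (by norm_num)) _ h1 x).trans ?_
  calc A * ((2 : ℝ) ^ j) ^ (3 + k) * lpn p (conv (dilate ψ (2 ^ j)) f)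
      ≤ A * ((2 : ℝ) ^ j) ^ (3 + k) * (B * ((2 : ℝ) ^ (n * j))⁻¹) := by gcongr
    _ = A * B * (((2 : ℝ) ^ j) ^ (3 + k) * ((2 : ℝ) ^ (n * j))⁻¹) := by ring
    _ ≤ A * B * (1 / 2) ^ j := by
      gcongr
      rw [mul_inv_le_iff₀ (by positivity), mul_comm n j, pow_mul, one_div, inv_pow,
        ← div_eq_inv_mul, le_div_iff₀ (by positivity), ← pow_succ]
      exact pow_le_pow_right₀ (one_le_pow₀ (by norm_num)) (by omega)

/-- Elements of `B^6_{p,q}` which are in all the spaces `B^n_{p,q}` have smooth representatives,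
with bounds for the derivatives of order at most two. -/
theorem IsLittlewoodPaley.exists_smooth (hψ : IsLittlewoodPaley ψ) (hp : 1 ≤ p) (hq : 1 ≤ q) :
    ∃ C, 0 ≤ C ∧ ∀ f : R3 → R3, MemLp f p volume →
      (∀ n : ℕ, 4 ≤ n → besovNorm ψ n p q f < ⊤) → ∀ B, 0 ≤ B →
      besovNorm ψ 6 p q f ≤ ENNReal.ofReal B →
      ∃ g : R3 → R3, f =ᵐ[volume] g ∧ ContDiff ℝ ∞ g ∧
        ∀ k ≤ 2, ∀ x, ‖iteratedFDeriv ℝ k g x‖ ≤ C * B := by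
  obtain ⟨Λ, hΛ, hΛs⟩ := hψ.exists_lowKernel
  choose A hA hd using hψ.exists_iteratedFDeriv_dyadic_le hp hq
  choose A' hA' hl using fun k => exists_iteratedFDeriv_conv_le hp k Λ
  refine ⟨∑ k ∈ Finset.range 3, (A' k * 2 ^ (3 + k) + 2 * A k), Finset.sum_nonneg fun k _ =>
    add_nonneg (mul_nonneg (hA' k) (by positivity)) (mul_nonneg (by norm_num) (hA k)),
    fun f hf hn B hB h6 => ?_⟩
  let w : ℕ → R3 → R3 := fun j => conv (dilate ψ (2 ^ j)) f
  have hw : ∀ j, ContDiff ℝ ∞ (w j) := fun j => contDiff_conv hp hf _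
  -- The `k`-th derivatives of the blocks decay geometrically once the norm of order `4 + k` is
  -- finite. These bounds are not uniform in `f` and serve only for smoothness of the sum. The
  -- uniform bounds up to order two use the norm of order `6`.
  choose B' hB' using fun k : ℕ => ENNReal.lt_iff_exists_real_btwn.1 (hn (4 + k) (by omega))
  have hv : ∀ (k j : ℕ) x, ‖iteratedFDeriv ℝ k (w j) x‖ ≤ A k * B' k * (1 / 2) ^ j :=
    fun k j x => hd k f hf (4 + k) le_rfl _ (hB' k).1 (hB' k).2.1.le j x
  have hs : ∀ C : ℝ, Summable fun j : ℕ => C * (1 / 2 : ℝ) ^ j := fun C =>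
    summable_geometric_two.mul_left C
  have hcd := contDiff_tsum (N := (⊤ : ℕ∞)) hw (fun k _ => hs (A k * B' k))
    (fun k j x _ => hv k j x)
  have hlow := contDiff_conv hp hf Λ
  have hwsum : ∀ x, HasSum (fun j => w j x) (∑' j, w j x) := fun x =>
    (Summable.of_norm_bounded (hs (A 0 * B' 0)) fun j => by simpa using hv 0 j x).hasSum
  refine ⟨fun x => conv Λ f x + ∑' j, w j x, ?_, hlow.add hcd, fun k hk x => ?_⟩
  -- The partial sums converge pointwise to the smooth function and, by the approximate identity,
  -- weakly to `f`. Comparing the two limits against test functions identifies them.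
  · refine ae_eq_of_integral_contDiff_smul_eq (hf.locallyIntegrable hp)
      (hlow.add hcd).continuous.locallyIntegrable fun ζ hζ hζc => ?_
    have h1 := tendsto_integral_conv hp hf (K := Λ) (by
      rw [hΛs, hψ.lowSymbol_eq (N := 0) (by simp)]
      have : symbol ψ 0 = 0 := by
        by_contra h0
        have := hψ.lt_norm h0
        simp at this
        linarith
      simp [this]) ⟨hζ, hζc⟩
    refine tendsto_nhds_unique h1 ?_
    obtain ⟨B₀, hB₀⟩ := exists_bound_conv hp hf Λ
    refine tendsto_integral_of_dominated_convergence
      (fun x => ‖ζ x‖ * (B₀ + ∑' j : ℕ, A 0 * B' 0 * (1 / 2) ^ j)) (fun N => ?_)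
      ((hζ.continuous.integrable_of_hasCompactSupport hζc).norm.mul_const _)
      (fun N => ae_of_all _ fun x => ?_) (ae_of_all _ fun x => ?_)
    · exact (hζ.continuous.smul (contDiff_conv hp hf _).continuous).aestronglyMeasurable
    · rw [norm_smul, hψ.conv_dilate_low hΛs hp hf]
      gcongr
      refine (norm_add_le _ _).trans (add_le_add (hB₀ x) ?_)
      refine (norm_sum_le _ _).trans ((Finset.sum_le_sum fun j _ => ?_).trans
        ((hs (A 0 * B' 0)).sum_le_tsum (Finset.range N) fun j _ =>
          mul_nonneg (mul_nonneg (hA 0) (hB' 0).1) (by positivity)))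
      simpa using hv 0 j x
    · simp only [hψ.conv_dilate_low hΛs hp hf]
      exact ((hwsum x).tendsto_sum_nat.const_add _).const_smul _
  · obtain ⟨hm1, hm2⟩ := memLp_lpn_le (p := p) hlow.continuous hB
      ((show eLpNorm (conv Λ f) p volume ≤ besovNorm ψ 6 p q f by
        rw [besovNorm, hΛ]; exact le_self_add).trans h6)
    have e : iteratedFDeriv ℝ k (fun x => conv Λ f x + ∑' j, w j x) x =
        iteratedFDeriv ℝ k (conv Λ f) x + ∑' j, iteratedFDeriv ℝ k (w j) x := by
      have h1 := iteratedFDeriv_add_apply (x := x)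
        (hlow.contDiffAt.of_le (m := k) (by exact_mod_cast le_top))
        (hcd.contDiffAt.of_le (m := k) (by exact_mod_cast le_top))
      have h2 := congrFun (iteratedFDeriv_tsum (N := (⊤ : ℕ∞)) hw (fun k _ => hs (A k * B' k))
        (fun k j x _ => hv k j x) (k := k) le_top) x
      rw [← h2, ← h1]
      rfl
    have h1 : ‖iteratedFDeriv ℝ k (conv Λ f) x‖ ≤ A' k * 2 ^ (3 + k) * B := by
      rw [← hψ.low_reproducing hΛs hp hf]
      refine (hl k 2 (by norm_num) _ hm1 x).trans ?_
      have := hA' k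
      gcongr
    have h2 : ‖∑' j, iteratedFDeriv ℝ k (w j) x‖ ≤ A k * B * 2 := by
      refine tsum_of_norm_bounded (hasSum_geometric_two.mul_left (A k * B)) fun j => ?_
      exact hd k f hf 6 (by omega) B hB h6 j x
    rw [e]
    calc _ ≤ A' k * 2 ^ (3 + k) * B + A k * B * 2 := (norm_add_le _ _).trans (add_le_add h1 h2)
      _ = (A' k * 2 ^ (3 + k) + 2 * A k) * B := by ring
      _ ≤ _ := by
        gcongr
        refine Finset.single_le_sum (f := fun k => A' k * 2 ^ (3 + k) + 2 * A k) (fun k _ =>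
          add_nonneg (mul_nonneg (hA' k) (by positivity)) (mul_nonneg (by norm_num) (hA k))) ?_
        simp; omega

/-- The smooth representatives of the solution `v`, with uniform bounds away from the initial
time. -/
theorem IsLittlewoodPaley.exists_smooth_weighted (hψ : IsLittlewoodPaley ψ) {p : ℝ} (hp : 3 < p)
    (hq : 1 ≤ q) {T a₀ : ℝ} (ha : 0 < a₀) {v : ℝ → R3 → R3}
    (hv : ∀ r : ℝ, 3 / p < r →
      WeightedBesov ψ ((r - 3 / p) / 2) r (ENNReal.ofReal p) q T v) :
    ∃ C, 0 ≤ C ∧ ∀ t ∈ Ico a₀ T, ∃ g : R3 → R3, v t =ᵐ[volume] g ∧ ContDiff ℝ ∞ g ∧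
        ∀ k ≤ 2, ∀ x, ‖iteratedFDeriv ℝ k g x‖ ≤ C := by
  have hp1 : (1 : ℝ≥0∞) ≤ ENNReal.ofReal p := by
    rw [← ENNReal.ofReal_one]; exact ENNReal.ofReal_le_ofReal (by linarith)
  have h3p : 3 / p < 1 := by rw [div_lt_one (by linarith)]; exact hp
  obtain ⟨C, hC, h⟩ := hψ.exists_smooth hp1 hq
  -- Six is the order needed for two bounded derivatives. The weight in time is at least its value
  -- at `a₀`, so the weighted bound becomes a uniform one.
  obtain ⟨hc, hb, -⟩ := hv 6 (by linarith)
  set S := ⨆ t ∈ Ioo (0 : ℝ) T, ENNReal.ofReal (t ^ ((6 - 3 / p) / 2)) *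
    besovNorm ψ 6 (ENNReal.ofReal p) q (v t)
  have he : 0 ≤ (6 - 3 / p) / 2 := by linarith
  have ha' : 0 < a₀ ^ ((6 - 3 / p) / 2) := Real.rpow_pos_of_pos ha _
  refine ⟨C * (S.toReal / a₀ ^ ((6 - 3 / p) / 2)), by positivity, fun t ht => ?_⟩
  have ht' : t ∈ Ioo 0 T := ⟨ha.trans_le ht.1, ht.2⟩
  refine h (v t) (hc.1 t ht').1 (fun n hn => ?_) _ (by positivity) ?_
  · have hn' : (4 : ℝ) ≤ n := by exact_mod_cast hn
    exact ((hv n (by linarith)).1.1 t ht').2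
  · rw [ENNReal.ofReal_div_of_pos ha', ENNReal.ofReal_toReal hb.ne,
      ENNReal.le_div_iff_mul_le (by simp [ha']) (by simp), mul_comm]
    refine le_trans ?_ (le_iSup₂ (f := fun t (_ : t ∈ Ioo (0 : ℝ) T) =>
      ENNReal.ofReal (t ^ ((6 - 3 / p) / 2)) * besovNorm ψ 6 (ENNReal.ofReal p) q (v t)) t ht')
    gcongr
    exact ht.1

end

section


/-! ### Weak derivatives and products on the Fourier side -/

/-- The symbol of the `i`-th partial derivative. -/
def dsym (i : Fin 3) (ξ : R3) : ℂ := 2 * Real.pi * Complex.I * ξ i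

@[fun_prop]
theorem continuous_dsym (i : Fin 3) : Continuous (dsym i) := by unfold dsym; fun_prop

theorem enorm_dsym (i : Fin 3) (ξ : R3) :
    ‖dsym i ξ‖ₑ = ENNReal.ofReal (2 * Real.pi) * ‖(ξ i : ℂ)‖ₑ := by
  rw [dsym, enorm_mul]
  congr 1
  rw [← ofReal_norm]
  simp [abs_of_pos Real.pi_pos]

theorem enorm_coord_le_κe (i : Fin 3) (ξ : R3) : ‖(ξ i : ℂ)‖ₑ ≤ κe ξ ^ 3 :=
  (enorm_coord_le ξ i).trans (enorm_le_κe_pow ξ)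

theorem two_pi_le : ENNReal.ofReal (2 * Real.pi) ≤ 7 := by
  rw [show (7 : ℝ≥0∞) = ENNReal.ofReal 7 by simp]
  exact ENNReal.ofReal_le_ofReal (by linarith [Real.pi_lt_d2])

theorem enorm_dsym_le (i : Fin 3) (ξ : R3) : ‖dsym i ξ‖ₑ ≤ 7 * κe ξ ^ 3 := by
  rw [enorm_dsym]
  exact mul_le_mul' two_pi_le (enorm_coord_le_κe i ξ)

theorem coord_le_dsym (i : Fin 3) (ξ : R3) : ‖(ξ i : ℂ)‖ₑ ≤ ‖dsym i ξ‖ₑ := by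
  rw [enorm_dsym]
  refine le_mul_of_one_le_left zero_le ?_
  rw [← ENNReal.ofReal_one]
  exact ENNReal.ofReal_le_ofReal (by linarith [Real.pi_gt_three])

theorem κe_pow_three_le (ξ : R3) : κe ξ ^ 3 ≤ 1 + ∑ i, ‖(ξ i : ℂ)‖ₑ := by
  have h : κ ξ ^ 3 ≤ 1 + ‖ξ‖ := by
    refine le_of_pow_le_pow_left₀ (n := 2) (by norm_num) (by positivity) ?_
    rw [← pow_mul, κ_pow_six]
    nlinarith [norm_nonneg ξ]
  rw [κe_pow]
  refine (ENNReal.ofReal_le_ofReal h).trans ?_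
  rw [ENNReal.ofReal_add (by norm_num) (norm_nonneg _), ENNReal.ofReal_one, ofReal_norm]
  gcongr
  exact enorm_le_sum_enorm ξ

variable {f f' F F' : R3 → ℂ}

theorem IsFT.n2_eq (h : IsFT f F) : n2 (fun ξ => ‖F ξ‖ₑ) = eLpNorm f 2 volume := by
  rw [n2_eLpNorm, h.eLpNorm_eq]

theorem IsFT.integral_mul_test_complex (h : IsFT f F) {ζ : R3 → ℝ} (hζ : IsTest ζ) :
    ∫ x, f x * ζ x = ∫ ξ, F ξ * rft ζ (-ξ) := h.integral_mul hζ.isFT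

/-- The Fourier transform of a weak derivative. -/
theorem IsFT.weak_deriv (h : IsFT f F) (h' : IsFT f' F') (i : Fin 3)
    (hw : ∀ ζ : R3 → ℝ, IsTest ζ → ∫ x, f x * partialD i ζ x = -∫ x, f' x * ζ x) :
    F' =ᵐ[volume] fun ξ => dsym i ξ * F ξ := by
  have hF0 : MemLp (fun ξ => ((κ ξ : ℂ) ^ 0)⁻¹ * F ξ) 2 volume := by simpa using h.memLp_ft
  have hF0' : MemLp (fun ξ => ((κ ξ : ℂ) ^ 0)⁻¹ * F' ξ) 2 volume := by simpa using h'.memLp_ft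
  have hc : MemLp (fun ξ => (((κ ξ : ℂ) ^ 3)⁻¹ * dsym i ξ) * F ξ) 2 volume := by
    have := continuous_κ_inv 3
    refine (memLp_bdd_mul (C := 2 * Real.pi) (by fun_prop) (fun ξ => ?_) h.memLp_ft).1
    have hκ := κ_pos ξ
    rw [norm_mul, norm_inv, norm_κ_pow, inv_mul_le_iff₀ (by positivity), dsym]
    simp only [norm_mul, Complex.norm_I, Complex.norm_real, Complex.norm_ofNat, mul_one,
      Real.norm_eq_abs, abs_of_pos Real.pi_pos]
    rw [mul_comm]
    gcongr
    exact (abs_apply_le_norm ξ i).trans (norm_le_κ_pow ξ)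
  have hm : MemLp (fun ξ => ((κ ξ : ℂ) ^ 3)⁻¹ * (F' ξ - dsym i ξ * F ξ)) 2 volume := by
    refine ((κ_inv_memLp h'.memLp_ft 3).sub hc).ae_eq (ae_of_all _ fun ξ => ?_)
    simp only [Pi.sub_apply]
    ring
  have key : (fun ξ => F' (-ξ) - dsym i (-ξ) * F (-ξ)) =ᵐ[volume] 0 := by
    refine ae_eq_zero_of_integral_rft (m := 3) ?_ fun ζ hζ => ?_
    · have := MemLp.comp_neg hm
      simpa using this
    · rw [← integral_neg_eq_self]
      simp only [neg_neg]
      have h1 := hw ζ hζ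
      rw [h.integral_mul_test_complex (hζ.partialD i), h'.integral_mul_test_complex hζ] at h1
      have e : ∀ ξ, (F' ξ - dsym i ξ * F ξ) * rft ζ (-ξ) =
          F' ξ * rft ζ (-ξ) + F ξ * rft (partialD i ζ) (-ξ) := fun ξ => by
        rw [hζ.rft_partialD, dsym]; simp; ring
      simp only [e]
      rw [integral_add (rft_neg_integrable hF0' hζ) (rft_neg_integrable hF0 (hζ.partialD i)), h1]
      ring
  have := (Measure.measurePreserving_neg (volume : Measure R3)).quasiMeasurePreserving.ae key
  filter_upwards [this] with ξ hξ
  simpa [sub_eq_zero] using hξ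

theorem IsFT.integral_partialD (h : IsFT f F) (i : Fin 3)
    (h' : IsFT f' fun ξ => dsym i ξ * F ξ) {ζ : R3 → ℝ} (hζ : IsTest ζ) :
    ∫ x, f x * partialD i ζ x = -∫ x, f' x * ζ x := by
  rw [h.integral_mul_test_complex (hζ.partialD i), h'.integral_mul_test_complex hζ, ← integral_neg]
  congr 1; ext ξ
  rw [hζ.rft_partialD, dsym]; simp; ring

/-! ### Multiplication by functions with bounded derivatives -/

/-- A function all of whose derivatives of order at most `n` are bounded by `B`. -/
structure SmoothBdd (n : ℕ) (B : ℝ) (g : R3 → ℝ) : Prop where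
  contDiff : ContDiff ℝ ∞ g
  bound : ∀ k ≤ n, ∀ x, ‖iteratedFDeriv ℝ k g x‖ ≤ B

theorem SmoothBdd.le {n : ℕ} {B : ℝ} {g : R3 → ℝ} (h : SmoothBdd n B g) (x : R3) : |g x| ≤ B := by
  simpa using h.bound 0 (by omega) x

theorem SmoothBdd.mono {m n : ℕ} {B : ℝ} {g : R3 → ℝ} (h : SmoothBdd n B g) (hm : m ≤ n) :
    SmoothBdd m B g := ⟨h.contDiff, fun k hk => h.bound k (hk.trans hm)⟩

theorem SmoothBdd.partialD {n : ℕ} {B : ℝ} {g : R3 → ℝ} (h : SmoothBdd (n + 1) B g) (i : Fin 3) :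
    SmoothBdd n B (MLANS.partialD i g) := by
  have hd : ContDiff ℝ ∞ (fderiv ℝ g) := h.contDiff.fderiv_right (m := ∞) (by simp)
  refine ⟨hd.clm_apply contDiff_const, fun k hk x => ?_⟩
  have h1 := norm_iteratedFDeriv_clm_apply_const (c := e3 i) (x := x) (n := k)
    (hd.contDiffAt.of_le (by exact_mod_cast le_top)) le_rfl
  rw [norm_iteratedFDeriv_fderiv] at h1
  refine h1.trans ?_
  have h2 := h.bound (k + 1) (by omega) x
  simpa using h2

theorem partialD_mul {g ζ : R3 → ℝ} (hg : ContDiff ℝ ∞ g) (hζ : IsTest ζ) (i : Fin 3) (x : R3) :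
    partialD i (fun y => g y * ζ y) x = g x * partialD i ζ x + partialD i g x * ζ x := by
  unfold partialD
  rw [fderiv_fun_mul (hg.contDiffAt.differentiableAt (by simp))
    (hζ.1.contDiffAt.differentiableAt (by simp))]
  simp
  ring

theorem memLp_mul_bddfun {g : R3 → ℝ} (hg : Continuous g) {B : ℝ} (hB : ∀ x, |g x| ≤ B)
    (hf : MemLp f 2 volume) : MemLp (fun x => f x * g x) 2 volume ∧
      eLpNorm (fun x => f x * g x) 2 volume ≤ ENNReal.ofReal B * eLpNorm f 2 volume := by
  have := memLp_bdd_mul (c := fun x => (g x : ℂ)) (Complex.continuous_ofReal.comp hg)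
    (fun x => by simpa using hB x) hf
  simpa [mul_comm] using this

theorem memLp_of_n2 {G : R3 → ℂ} (hG : AEStronglyMeasurable G volume)
    (h : n2 (fun ξ => ‖G ξ‖ₑ) < ⊤) : MemLp G 2 volume := ⟨hG, by rwa [← n2_eLpNorm]⟩

theorem n2_κ_mono {G : R3 → ℂ} {m n : ℕ} (h : m ≤ n) :
    n2 (fun ξ => κe ξ ^ m * ‖G ξ‖ₑ) ≤ n2 (fun ξ => κe ξ ^ n * ‖G ξ‖ₑ) :=
  n2_mono (ae_of_all _ fun ξ => mul_le_mul_left (κe_pow_mono ξ h) _)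

theorem n2_dsym_le (G : R3 → ℂ) (n : ℕ) (i : Fin 3) :
    n2 (fun ξ => κe ξ ^ n * ‖dsym i ξ * G ξ‖ₑ) ≤ 7 * n2 (fun ξ => κe ξ ^ (n + 3) * ‖G ξ‖ₑ) := by
  rw [← n2_const_mul _ (by simp)]
  refine n2_mono (ae_of_all _ fun ξ => ?_)
  rw [enorm_mul]
  calc κe ξ ^ n * (‖dsym i ξ‖ₑ * ‖G ξ‖ₑ) ≤ κe ξ ^ n * (7 * κe ξ ^ 3 * ‖G ξ‖ₑ) := by
        gcongr; exact enorm_dsym_le i ξ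
    _ = _ := by ring

theorem memLp_dsym (hF : AEStronglyMeasurable F volume)
    (h : n2 (fun ξ => κe ξ ^ 3 * ‖F ξ‖ₑ) < ⊤) (i : Fin 3) :
    MemLp (fun ξ => dsym i ξ * F ξ) 2 volume := by
  refine memLp_of_n2 ((continuous_dsym i).aestronglyMeasurable.mul hF) ?_
  have := n2_dsym_le F 0 i
  simp only [pow_zero, one_mul, zero_add] at this
  exact this.trans_lt (ENNReal.mul_lt_top (by simp) h)

/-- The weak product rule on the Fourier side. -/
theorem IsFT.dsym_mul (h : IsFT f F) {i : Fin 3} (h' : IsFT f' fun ξ => dsym i ξ * F ξ)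
    {g : R3 → ℝ} {B : ℝ} (hg : SmoothBdd 1 B g) :
    (fun ξ => ft (fun x => f' x * g x) ξ + ft (fun x => f x * partialD i g x) ξ) =ᵐ[volume]
      fun ξ => dsym i ξ * ft (fun x => f x * g x) ξ := by
  have hd := hg.partialD (n := 0) i
  have m1 := (memLp_mul_bddfun hg.contDiff.continuous hg.le h'.memLp).1
  have m2 := (memLp_mul_bddfun hd.contDiff.continuous hd.le h.memLp).1
  have m3 := (memLp_mul_bddfun hg.contDiff.continuous hg.le h.memLp).1
  refine (isFT_ft m3).weak_deriv ((isFT_ft m1).add (isFT_ft m2)) i fun ζ hζ => ?_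
  have hgζ := IsTest.mul_left hg.contDiff hζ
  have h1 := h.integral_partialD i h' hgζ
  have e1 : ∀ x, f x * g x * (partialD i ζ x : ℂ) =
      f x * (partialD i (fun y => g y * ζ y) x : ℝ) - f x * partialD i g x * ζ x := fun x => by
    rw [partialD_mul hg.contDiff hζ]; push_cast; ring
  have i1 : Integrable (fun x => f x * (partialD i (fun y => g y * ζ y) x : ℝ)) volume :=
    h.memLp.integrable_mul (hgζ.partialD i).isFT.memLp
  have i2 : Integrable (fun x => f x * partialD i g x * ζ x) volume :=
    m2.integrable_mul hζ.isFT.memLp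
  have i3 : Integrable (fun x => f' x * g x * ζ x) volume := m1.integrable_mul hζ.isFT.memLp
  simp only [e1]
  rw [integral_sub i1 i2, h1]
  have e2 : ∀ x, (f' x * g x + f x * partialD i g x) * (ζ x : ℂ) =
    f' x * g x * ζ x + f x * partialD i g x * ζ x := fun x => by ring
  simp only [e2]
  rw [integral_add i3 i2, neg_add, sub_eq_add_neg]
  congr 3
  ext x
  push_cast
  ring

/-- Multiplication by functions with bounded derivatives preserves weighted spaces. -/
theorem n2_mul_smooth_le (n : ℕ) : ∀ {f F : R3 → ℂ}, IsFT f F → ∀ {g : R3 → ℝ} {B : ℝ},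
    SmoothBdd n B g → n2 (fun ξ => κe ξ ^ (3 * n) * ‖F ξ‖ₑ) < ⊤ →
    n2 (fun ξ => κe ξ ^ (3 * n) * ‖ft (fun x => f x * g x) ξ‖ₑ) ≤
      25 ^ n * ENNReal.ofReal B * n2 (fun ξ => κe ξ ^ (3 * n) * ‖F ξ‖ₑ) := by
  induction n with
  | zero =>
    intro f F h g B hg _
    have := memLp_mul_bddfun hg.contDiff.continuous hg.le h.memLp
    simp only [mul_zero, pow_zero, one_mul]
    rw [(isFT_ft this.1).n2_eq, h.n2_eq]
    exact this.2
  | succ n ih =>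
    intro f F h g B hg hfin
    set X := n2 (fun ξ => κe ξ ^ (3 * (n + 1)) * ‖F ξ‖ₑ) with hX
    have hFm := h.memLp_ft.1
    have hX3 : n2 (fun ξ => κe ξ ^ (3 * n) * ‖F ξ‖ₑ) ≤ X := n2_κ_mono (by omega)
    have hmem : ∀ i, MemLp (fun ξ => dsym i ξ * F ξ) 2 volume := fun i =>
      memLp_dsym hFm ((n2_κ_mono (by omega)).trans_lt hfin) i
    choose f' hf' using fun i => exists_isFT (hmem i)
    have hg' := hg.mono (show n ≤ n + 1 by omega)
    have b0 := (ih h hg' (hX3.trans_lt hfin)).trans (mul_le_mul_right hX3 _)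
    have hdX : ∀ i, n2 (fun ξ => κe ξ ^ (3 * n) * ‖dsym i ξ * F ξ‖ₑ) ≤ 7 * X := fun i =>
      n2_dsym_le F (3 * n) i
    have b1 := fun i => (ih (hf' i) hg' ((hdX i).trans_lt (ENNReal.mul_lt_top (by simp)
      hfin))).trans (mul_le_mul_right (hdX i) _)
    have b2 := fun i => (ih h (hg.partialD i) (hX3.trans_lt hfin)).trans (mul_le_mul_right hX3 _)
    set Y := 25 ^ n * ENNReal.ofReal B * X with hY
    have hm : ∀ G : R3 → ℂ, AEMeasurable (fun ξ => κe ξ ^ (3 * n) * ‖ft G ξ‖ₑ) volume := fun G =>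
      ((measurable_κe.pow_const _).mul (measurable_ft G).enorm).aemeasurable
    -- Three powers of `κ` are worth one derivative, since `κ³ ≤ 1 + ∑ |ξ_i|`. The product rule then
    -- reduces to products carrying the weight of the previous step.
    calc n2 (fun ξ => κe ξ ^ (3 * (n + 1)) * ‖ft (fun x => f x * g x) ξ‖ₑ)
        ≤ n2 (fun ξ => κe ξ ^ (3 * n) * ‖ft (fun x => f x * g x) ξ‖ₑ +
            ∑ i, (κe ξ ^ (3 * n) * ‖ft (fun x => f' i x * g x) ξ‖ₑ +
              κe ξ ^ (3 * n) * ‖ft (fun x => f x * partialD i g x) ξ‖ₑ)) := by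
          have hae := fun i => h.dsym_mul (hf' i) (hg.mono (show 1 ≤ n + 1 by omega))
          refine n2_mono ?_
          filter_upwards [ae_all_iff.2 hae] with ξ hξ
          calc _ = κe ξ ^ (3 * n) * (κe ξ ^ 3 * ‖ft (fun x => f x * g x) ξ‖ₑ) := by ring
            _ ≤ κe ξ ^ (3 * n) * ((1 + ∑ i, ‖(ξ i : ℂ)‖ₑ) * ‖ft (fun x => f x * g x) ξ‖ₑ) := by
              gcongr; exact κe_pow_three_le ξ
            _ ≤ κe ξ ^ (3 * n) * ((1 + ∑ i, ‖dsym i ξ‖ₑ) * ‖ft (fun x => f x * g x) ξ‖ₑ) := by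
              gcongr; exact coord_le_dsym _ ξ
            _ = κe ξ ^ (3 * n) * ‖ft (fun x => f x * g x) ξ‖ₑ +
                ∑ i, κe ξ ^ (3 * n) * ‖dsym i ξ * ft (fun x => f x * g x) ξ‖ₑ := by
              simp only [enorm_mul]
              rw [add_mul, one_mul, mul_add, Finset.sum_mul, Finset.mul_sum]
            _ ≤ _ := by
              gcongr with i
              rw [← hξ i, ← mul_add]
              gcongr
              exact enorm_add_le _ _
      _ ≤ Y + ∑ i : Fin 3, (25 ^ n * ENNReal.ofReal B * (7 * X) + Y) := by
          refine (n2_add_le (hm _) (Finset.aemeasurable_fun_sum _ fun i _ =>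
            (hm _).add (hm _))).trans (add_le_add b0 ?_)
          refine (n2_sum_le _ fun i => (hm _).add (hm _)).trans (Finset.sum_le_sum fun i _ => ?_)
          exact (n2_add_le (hm _) (hm _)).trans (add_le_add (b1 i) (b2 i))
      -- The constant is `25 = 1 + 3 (7 + 1)`: the function itself, and for each coordinate a
      -- derivative of `f`, costing `2π ≤ 7`, and a derivative of `g`.
      _ = _ := by
          rw [Finset.sum_const, Finset.card_univ, Fintype.card_fin, hY]
          ring

/-- Weak gradients on the Fourier side. -/
theorem IsWeakGrad.isFT {u : R3 → R3} {Du : R3 → Mat3} (h : IsWeakGrad u Du)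
    (hu : MemLp u 2 volume) (hs : sob 3 (vft u) < ⊤) (i j : Fin 3) :
    IsFT (fun x => (Du x i j : ℂ)) (fun ξ => dsym i ξ * vft u j ξ) := by
  have hU := isFT_vft hu j
  have hfin : n2 (fun ξ => κe ξ ^ 3 * ‖vft u j ξ‖ₑ) < ⊤ :=
    (n2_mono (ae_of_all _ fun ξ => by gcongr; exact le_vn _ j ξ)).trans_lt hs
  obtain ⟨f', hf'⟩ := exists_isFT (memLp_dsym hU.memLp_ft.1 hfin i)
  refine hf'.congr ?_ (ae_eq_refl _)
  obtain ⟨-, h2, h3⟩ := h i j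
  refine ae_eq_of_integral_contDiff_smul_eq (hf'.memLp.locallyIntegrable (by norm_num))
    (fun x => (h2 x).imp fun s hs => ⟨hs.1, hs.2.ofReal⟩) fun ζ hζ hc => ?_
  have h4 := hU.integral_partialD i hf' ⟨hζ, hc⟩
  have h5 := congrArg (fun r : ℝ => (r : ℂ)) (h3 ζ ⟨hζ, hc⟩)
  simp only [Complex.ofReal_neg, ← integral_complex_ofReal] at h5
  push_cast at h5
  rw [h4, neg_inj] at h5
  simpa [mul_comm] using h5

/-- The weak gradient of a smooth function is its gradient. -/
theorem IsWeakGrad.ae_eq {v g : R3 → R3} {Dv : R3 → Mat3} (h : IsWeakGrad v Dv)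
    (hvg : v =ᵐ[volume] g) (hg : ContDiff ℝ ∞ g) (i j : Fin 3) :
    (fun x => Dv x i j) =ᵐ[volume] partialD i (fun y => g y j) := by
  have hgj : ContDiff ℝ ∞ fun y => g y j :=
    (EuclideanSpace.proj (𝕜 := ℝ) j).contDiff.comp hg
  have hgd : ContDiff ℝ ∞ (partialD i fun y => g y j) :=
    (hgj.fderiv_right (m := ∞) (by simp)).clm_apply contDiff_const
  obtain ⟨-, h2, h3⟩ := h i j
  refine ae_eq_of_integral_contDiff_smul_eq h2 hgd.continuous.locallyIntegrable
    fun ζ hζ hc => ?_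
  have h4 := h3 ζ ⟨hζ, hc⟩
  have e : ∫ x, v x j * partialD i ζ x = ∫ x, g x j * partialD i ζ x := by
    refine integral_congr_ae ?_
    filter_upwards [hvg] with x hx
    rw [hx]
  rw [e] at h4
  have h5 := integral_mul_fderiv_eq_neg_fderiv_mul_of_integrable (μ := (volume : Measure R3))
    (f := fun y => g y j) (g := ζ) (v := e3 i) ?_ ?_ ?_
    (fun x _ => hgj.differentiable (by simp) x) (fun x _ => hζ.differentiable (by simp) x)
  · have h6 : ∫ x, Dv x i j * ζ x = ∫ x, partialD i (fun y => g y j) x * ζ x := by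
      have := h4.symm.trans h5
      exact neg_inj.1 this
    simpa [mul_comm] using h6
  · exact (hgd.continuous.mul hζ.continuous).integrable_of_hasCompactSupport hc.mul_left
  · exact (hgj.continuous.mul (IsTest.partialD ⟨hζ, hc⟩ i).1.continuous).integrable_of_hasCompactSupport
      (IsTest.partialD ⟨hζ, hc⟩ i).2.mul_left
  · exact (hgj.continuous.mul hζ.continuous).integrable_of_hasCompactSupport hc.mul_left

end

section


/-! ### The nonlinear terms on the Fourier side -/

/-- Convolution of two complex functions. -/
def cnv (F G : R3 → ℂ) (ζ : R3) : ℂ := ∫ ξ, F ξ * G (ζ - ξ)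

theorem enorm_cnv_le (F G : R3 → ℂ) (ζ : R3) :
    ‖cnv F G ζ‖ₑ ≤ ∫⁻ ξ, ‖F ξ‖ₑ * ‖G (ζ - ξ)‖ₑ := by
  refine (enorm_integral_le_lintegral_enorm _).trans_eq ?_
  simp only [enorm_mul]

theorem enorm_cnv_le_n2 {F G : R3 → ℂ} (hF : AEMeasurable F volume) (hG : AEMeasurable G volume)
    (ζ : R3) : ‖cnv F G ζ‖ₑ ≤ n2 (fun ξ => ‖F ξ‖ₑ) * n2 (fun ξ => ‖G ξ‖ₑ) := by
  refine (enorm_cnv_le F G ζ).trans ?_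
  refine (lintegral_mul_le_n2 hF.enorm (AEMeasurable.enorm (hG.comp_quasiMeasurePreserving
    (Measure.measurePreserving_sub_left volume ζ).quasiMeasurePreserving))).trans_eq ?_
  congr 1
  exact n2_comp_sub_left (fun ξ => ‖G ξ‖ₑ) ζ

/-- A product of square integrable functions is only integrable, so it has a transform in the sense
of `IsDFT`. That transform is the convolution at every frequency, which makes later pointwise
identities possible. -/
theorem isDFT_mul {f g : R3 → ℝ} {F G : R3 → ℂ} (hf : IsFT (fun x => (f x : ℂ)) F)
    (hg : IsFT (fun x => (g x : ℂ)) G) : IsDFT (fun x => f x * g x) (cnv F G) := by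
  have hi : Integrable (fun x => f x * g x) volume := by
    refine (hf.memLp.integrable_mul hg.memLp).re.congr (ae_of_all _ fun x => ?_)
    simp
  have := isDFT_of_integrable hi
  have e : (𝓕 fun x => ((f x * g x : ℝ) : ℂ)) = cnv F G := by
    ext ζ
    rw [cnv, ← hf.fourier_mul hg]
    simp only [Complex.ofReal_mul]
  rwa [e] at this

/-- The Fourier transform of `∂_i u_j`. -/
def dft (U : Fin 3 → R3 → ℂ) (i j : Fin 3) (ξ : R3) : ℂ := dsym i ξ * U j ξ

/-- The Fourier transform of `(α²/2) (2 Def u Rot u)`. -/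
def quadS (α : ℝ) (U : Fin 3 → R3 → ℂ) (i j : Fin 3) (ζ : R3) : ℂ :=
  (α ^ 2 : ℝ) * ∑ k, cnv (fun ξ => dft U i k ξ + dft U k i ξ)
    (fun ξ => dft U k j ξ - dft U j k ξ) ζ

theorem stress_self (α : ℝ) (A : Mat3) (i j : Fin 3) :
    stress α A A i j = α ^ 2 * ∑ k, (A i k + A k i) * (A k j - A j k) := by
  simp [stress, Matrix.mul_apply, Deform, Rot, Fin.sum_univ_three]
  ring

theorem two_stress (α : ℝ) (A B : Mat3) (i j : Fin 3) :
    ((2 : ℝ) • stress α A B) i j =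
      α ^ 2 * ∑ k, ((A i k + A k i) * (B k j - B j k) + (B i k + B k i) * (A k j - A j k)) := by
  simp [stress, Matrix.mul_apply, Deform, Rot, Fin.sum_univ_three]
  ring

theorem abs_two_stress_le (α : ℝ) {A B : Mat3} {b : ℝ} (hb : ∀ i j, |B i j| ≤ b) (i j : Fin 3) :
    |((2 : ℝ) • stress α A B) i j| ≤ 8 * α ^ 2 * b * ∑ a, ∑ c, |A a c| := by
  have h0 : 0 ≤ b := (abs_nonneg _).trans (hb 0 0)
  have h1 : ∀ k l c d, |B k l + B c d| ≤ 2 * b := fun k l c d =>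
    (abs_add_le _ _).trans (by linarith [hb k l, hb c d])
  have h2 : ∀ k l c d, |B k l - B c d| ≤ 2 * b := fun k l c d =>
    (abs_sub _ _).trans (by linarith [hb k l, hb c d])
  have r1 : ∀ a, ∑ k, |A a k| ≤ ∑ a, ∑ c, |A a c| := fun a =>
    Finset.single_le_sum (f := fun a => ∑ c, |A a c|)
      (fun _ _ => Finset.sum_nonneg fun _ _ => abs_nonneg _) (Finset.mem_univ a)
  have r2 : ∀ c, ∑ k, |A k c| ≤ ∑ a, ∑ c, |A a c| := fun c =>
    Finset.sum_le_sum fun a _ => Finset.single_le_sum (f := fun c => |A a c|)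
      (fun _ _ => abs_nonneg _) (Finset.mem_univ c)
  rw [two_stress, abs_mul, abs_of_nonneg (sq_nonneg α)]
  calc α ^ 2 * |∑ k, ((A i k + A k i) * (B k j - B j k) + (B i k + B k i) * (A k j - A j k))|
      ≤ α ^ 2 * ∑ k, 2 * b * (|A i k| + |A k i| + (|A k j| + |A j k|)) := by
        gcongr
        refine (Finset.abs_sum_le_sum_abs _ _).trans (Finset.sum_le_sum fun k _ => ?_)
        refine (abs_add_le _ _).trans ?_
        rw [abs_mul, abs_mul, mul_add (2 * b)]
        refine add_le_add ?_ ?_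
        · rw [mul_comm]
          exact mul_le_mul (h2 _ _ _ _) (abs_add_le _ _) (abs_nonneg _) (by positivity)
        · exact mul_le_mul (h1 _ _ _ _) (abs_sub _ _) (abs_nonneg _) (by positivity)
    _ = α ^ 2 * (2 * b * (∑ k, |A i k| + ∑ k, |A k i| + (∑ k, |A k j| + ∑ k, |A j k|))) := by
        rw [← Finset.mul_sum]
        simp only [Finset.sum_add_distrib]
    _ ≤ α ^ 2 * (2 * b * (∑ a, ∑ c, |A a c| + ∑ a, ∑ c, |A a c| +
          (∑ a, ∑ c, |A a c| + ∑ a, ∑ c, |A a c|))) := by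
        exact mul_le_mul_of_nonneg_left (mul_le_mul_of_nonneg_left (add_le_add
          (add_le_add (r1 i) (r2 i)) (add_le_add (r2 j) (r1 j))) (by positivity)) (sq_nonneg α)
    _ = _ := by ring

theorem IsFT.ofReal_add {f g : R3 → ℝ} {F G : R3 → ℂ} (hf : IsFT (fun x => (f x : ℂ)) F)
    (hg : IsFT (fun x => (g x : ℂ)) G) :
    IsFT (fun x => ((f x + g x : ℝ) : ℂ)) (fun ξ => F ξ + G ξ) := by
  simpa using hf.add hg

theorem IsFT.ofReal_sub {f g : R3 → ℝ} {F G : R3 → ℂ} (hf : IsFT (fun x => (f x : ℂ)) F)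
    (hg : IsFT (fun x => (g x : ℂ)) G) :
    IsFT (fun x => ((f x - g x : ℝ) : ℂ)) (fun ξ => F ξ - G ξ) := by
  simpa using hf.sub hg

theorem n2_coord_le_sob (U : Fin 3 → R3 → ℂ) (m : ℕ) (j : Fin 3) :
    n2 (fun ξ => κe ξ ^ m * ‖U j ξ‖ₑ) ≤ sob m U :=
  n2_mono (ae_of_all _ fun ξ => by gcongr; exact le_vn _ j ξ)

theorem sob_mono (U : Fin 3 → R3 → ℂ) {m n : ℕ} (h : m ≤ n) : sob m U ≤ sob n U :=
  n2_mono (ae_of_all _ fun ξ => mul_le_mul_left (κe_pow_mono ξ h) _)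

theorem n2_dft_le (U : Fin 3 → R3 → ℂ) (i j : Fin 3) :
    n2 (fun ξ => ‖dft U i j ξ‖ₑ) ≤ 7 * sob 3 U := by
  have := n2_dsym_le (U j) 0 i
  simp only [pow_zero, one_mul, zero_add] at this
  exact this.trans (mul_le_mul_right (n2_coord_le_sob U 3 j) _)

/-- The terms of the momentum flux which are linear in `u`. -/
def linM (u v : R3 → R3) (i j : Fin 3) : R3 → ℂ := ft fun x => ((u x i * v x j + v x i * u x j : ℝ) : ℂ)

/-- The terms of the stress which are linear in `u`. -/
def linS (α : ℝ) (A B : R3 → Mat3) (i j : Fin 3) : R3 → ℂ :=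
  ft fun x => ((((2 : ℝ) • stress α (A x) (B x)) i j : ℝ) : ℂ)

section

variable {u v g : R3 → R3} {Du Dv : R3 → Mat3} {α B : ℝ}

theorem smoothBdd_coord {n : ℕ} (hg : ContDiff ℝ ∞ g)
    (hB : ∀ k ≤ n, ∀ x, ‖iteratedFDeriv ℝ k g x‖ ≤ B) (j : Fin 3) :
    SmoothBdd n B fun x => g x j := by
  refine ⟨(EuclideanSpace.proj (𝕜 := ℝ) j).contDiff.comp hg, fun k hk x => ?_⟩
  have h1 := (EuclideanSpace.proj (𝕜 := ℝ) j).norm_iteratedFDeriv_comp_left (x := x) (n := k)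
    (hg.contDiffAt.of_le (m := k) (by exact_mod_cast le_top)) le_rfl
  refine h1.trans ((mul_le_of_le_one_left (norm_nonneg _) ?_).trans (hB k hk x))
  refine ContinuousLinearMap.opNorm_le_bound _ zero_le_one fun y => ?_
  rw [one_mul]
  exact PiLp.norm_apply_le y j

theorem memLp_mul_coord (hu : MemLp u 2 volume) (hg : ContDiff ℝ ∞ g)
    (hB : ∀ k ≤ 2, ∀ x, ‖iteratedFDeriv ℝ k g x‖ ≤ B) (i j : Fin 3) :
    MemLp (fun x => (u x i : ℂ) * ((g x j : ℝ) : ℂ)) 2 volume :=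
  have h := smoothBdd_coord hg hB j
  (memLp_mul_bddfun h.contDiff.continuous h.le (memLp_coord hu i)).1

theorem isFT_linM (hu : MemLp u 2 volume) (hvg : v =ᵐ[volume] g) (hg : ContDiff ℝ ∞ g)
    (hB : ∀ k ≤ 2, ∀ x, ‖iteratedFDeriv ℝ k g x‖ ≤ B) (i j : Fin 3) :
    IsFT (fun x => ((u x i * v x j + v x i * u x j : ℝ) : ℂ)) (linM u v i j) ∧
    linM u v i j =ᵐ[volume] fun ξ => ft (fun x => (u x i : ℂ) * ((g x j : ℝ) : ℂ)) ξ +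
      ft (fun x => (u x j : ℂ) * ((g x i : ℝ) : ℂ)) ξ := by
  have h := (isFT_ft (memLp_mul_coord hu hg hB i j)).add (isFT_ft (memLp_mul_coord hu hg hB j i))
  have h' := h.congr (g := fun x => ((u x i * v x j + v x i * u x j : ℝ) : ℂ)) (by
    filter_upwards [hvg] with x hx
    rw [hx]; push_cast; ring) (ae_eq_refl _)
  have h2 := isFT_ft h'.memLp
  exact ⟨h2, h2.unique h'⟩

/-- These terms are multiplied by the symbol of `1 - α²Δ` in the energy balance. They are therefore
needed with as many derivatives as `u` itself has: one for the first energy and two for the second.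
This is why two derivatives of `v` must be bounded. -/
theorem n2_linM_le (hu : MemLp u 2 volume) (hvg : v =ᵐ[volume] g) (hg : ContDiff ℝ ∞ g)
    (hB : ∀ k ≤ 2, ∀ x, ‖iteratedFDeriv ℝ k g x‖ ≤ B) (i j : Fin 3) {n : ℕ} (hn : n ≤ 2)
    (hs : sob (3 * n) (vft u) < ⊤) :
    n2 (fun ξ => κe ξ ^ (3 * n) * ‖linM u v i j ξ‖ₑ) ≤
      2 * (25 ^ n * ENNReal.ofReal B) * sob (3 * n) (vft u) := by
  have h : ∀ i j, n2 (fun ξ => κe ξ ^ (3 * n) *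
      ‖ft (fun x => (u x i : ℂ) * ((g x j : ℝ) : ℂ)) ξ‖ₑ) ≤
      25 ^ n * ENNReal.ofReal B * sob (3 * n) (vft u) := fun i j =>
    (n2_mul_smooth_le n (isFT_vft hu i) ((smoothBdd_coord hg hB j).mono hn)
      ((n2_coord_le_sob _ _ i).trans_lt hs)).trans (mul_le_mul_right (n2_coord_le_sob _ _ i) _)
  have hm : ∀ G : R3 → ℂ, AEMeasurable (fun ξ => κe ξ ^ (3 * n) * ‖ft G ξ‖ₑ) volume := fun G =>
    ((measurable_κe.pow_const _).mul (measurable_ft G).enorm).aemeasurable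
  refine (n2_mono (g := fun ξ => κe ξ ^ (3 * n) *
      ‖ft (fun x => (u x i : ℂ) * ((g x j : ℝ) : ℂ)) ξ‖ₑ + κe ξ ^ (3 * n) *
      ‖ft (fun x => (u x j : ℂ) * ((g x i : ℝ) : ℂ)) ξ‖ₑ) ?_).trans ?_
  · filter_upwards [(isFT_linM hu hvg hg hB i j).2] with ξ hξ
    rw [hξ, ← mul_add]
    gcongr
    exact enorm_add_le _ _
  · refine (n2_add_le (hm _) (hm _)).trans ((add_le_add (h i j) (h j i)).trans_eq ?_)
    ring

/-- The stress enters without the factor `1 - α²Δ`, so a plain `L²` bound suffices, and the bounded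
gradient of `v` can be taken out pointwise. The constant is `504 = 8 · 9 · 7`: `8` from
`abs_two_stress_le`, nine entries of `∇u`, and `2π ≤ 7` for each derivative. -/
theorem isFT_linS (hu : MemLp u 2 volume) (hs : sob 3 (vft u) < ⊤) (hDu : IsWeakGrad u Du)
    (hDv : IsWeakGrad v Dv) (hvg : v =ᵐ[volume] g) (hg : ContDiff ℝ ∞ g) (hB0 : 0 ≤ B)
    (hB : ∀ k ≤ 2, ∀ x, ‖iteratedFDeriv ℝ k g x‖ ≤ B) (i j : Fin 3) :
    IsFT (fun x => ((((2 : ℝ) • stress α (Du x) (Dv x)) i j : ℝ) : ℂ)) (linS α Du Dv i j) ∧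
    n2 (fun ξ => ‖linS α Du Dv i j ξ‖ₑ) ≤ ENNReal.ofReal (504 * α ^ 2 * B) * sob 3 (vft u) := by
  have hD := fun a c => hDu.isFT hu hs a c
  have hDr : ∀ a c, MemLp (fun x => Du x a c) 2 volume := fun a c => by
    refine (hD a c).memLp.re.ae_eq (ae_of_all _ fun x => ?_)
    simp
  have hbd : ∀ᵐ x, ∀ a c, |Dv x a c| ≤ B := by
    rw [ae_all_iff]; intro a
    rw [ae_all_iff]; intro c
    filter_upwards [hDv.ae_eq hvg hg a c] with x hx
    rw [hx]
    exact (((smoothBdd_coord hg hB c).mono (show 1 ≤ 2 by norm_num)).partialD (n := 0) a).le x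
  have hDm : ∀ a c, AEStronglyMeasurable (fun x => Dv x a c) volume := fun a c =>
    (hDv a c).2.1.aestronglyMeasurable
  have hb2 : ∀ᵐ x, ‖((((2 : ℝ) • stress α (Du x) (Dv x)) i j : ℝ) : ℂ)‖ ≤
      ‖8 * α ^ 2 * B * ∑ a, ∑ c, |Du x a c|‖ := by
    filter_upwards [hbd] with x hx
    rw [Complex.norm_real]
    exact (abs_two_stress_le α hx i j).trans (le_abs_self _)
  have hsum : MemLp (fun x => 8 * α ^ 2 * B * ∑ a, ∑ c, |Du x a c|) 2 volume :=
    (memLp_finsetSum _ fun a _ => memLp_finsetSum _ fun c _ => (hDr a c).norm).const_mul _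
  have hmeas : AEStronglyMeasurable
      (fun x => ((((2 : ℝ) • stress α (Du x) (Dv x)) i j : ℝ) : ℂ)) volume := by
    simp only [two_stress]
    have h1 := fun a c => (hDr a c).1
    refine Complex.continuous_ofReal.comp_aestronglyMeasurable ?_
    fun_prop
  have hmem : MemLp (fun x => ((((2 : ℝ) • stress α (Du x) (Dv x)) i j : ℝ) : ℂ)) 2 volume :=
    hsum.of_le hmeas hb2
  refine ⟨isFT_ft hmem, ?_⟩
  refine (isFT_ft hmem).n2_eq.le.trans ?_
  refine (eLpNorm_mono_ae hb2).trans ?_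
  have e : eLpNorm (fun x => 8 * α ^ 2 * B * ∑ a, ∑ c, |Du x a c|) 2 volume =
      ENNReal.ofReal (8 * α ^ 2 * B) * eLpNorm (fun x => ∑ a, ∑ c, |Du x a c|) 2 volume := by
    have := eLpNorm_const_smul (8 * α ^ 2 * B) (fun x => ∑ a, ∑ c, |Du x a c|) 2
      (volume : Measure R3)
    rw [← ofReal_norm, Real.norm_of_nonneg (by positivity)] at this
    exact this
  have hn : ∀ a c, n2 (fun x => ‖|Du x a c|‖ₑ) ≤ 7 * sob 3 (vft u) := fun a c => by
    have h1 := (hD a c).n2_eq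
    have h2 : n2 (fun x => ‖|Du x a c|‖ₑ) = eLpNorm (fun x => (Du x a c : ℂ)) 2 volume := by
      rw [← n2_eLpNorm]
      congr 1; ext x
      simp [← ofReal_norm]
    rw [h2, ← h1]
    exact n2_dft_le (vft u) a c
  have hm : ∀ a c, AEMeasurable (fun x => ‖|Du x a c|‖ₑ) volume := fun a c =>
    (hDr a c).1.norm.enorm
  have h63 : eLpNorm (fun x => ∑ a, ∑ c, |Du x a c|) 2 volume ≤ 63 * sob 3 (vft u) := by
    rw [← n2_eLpNorm]
    calc _ ≤ n2 (fun x => ∑ a, ∑ c, ‖|Du x a c|‖ₑ) := n2_mono (ae_of_all _ fun x =>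
          (enorm_sum_le _ _).trans (Finset.sum_le_sum fun a _ => enorm_sum_le _ _))
      _ ≤ ∑ a, ∑ c, n2 (fun x => ‖|Du x a c|‖ₑ) :=
          (n2_sum_le _ fun a => Finset.aemeasurable_fun_sum _ fun c _ => hm a c).trans
            (Finset.sum_le_sum fun a _ => n2_sum_le _ fun c => hm a c)
      _ ≤ ∑ _a : Fin 3, ∑ _c : Fin 3, 7 * sob 3 (vft u) :=
          Finset.sum_le_sum fun a _ => Finset.sum_le_sum fun c _ => hn a c
      _ = _ := by
          simp only [Finset.sum_const, Finset.card_univ, Fintype.card_fin]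
          ring
  rw [e]
  calc _ ≤ ENNReal.ofReal (8 * α ^ 2 * B) * (63 * sob 3 (vft u)) := by gcongr
    _ = _ := by
      rw [show 504 * α ^ 2 * B = 8 * α ^ 2 * B * 63 by ring, ENNReal.ofReal_mul (p := 8 * α ^ 2 * B)
        (by positivity), ENNReal.ofReal_ofNat]
      exact (mul_assoc _ _ _).symm

theorem isDFT_flux (hu : MemLp u 2 volume) (hvg : v =ᵐ[volume] g) (hg : ContDiff ℝ ∞ g)
    (hB : ∀ k ≤ 2, ∀ x, ‖iteratedFDeriv ℝ k g x‖ ≤ B) (i j : Fin 3) :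
    IsDFT (fun x => (tensor (u x) (u x) + tensor (u x) (v x) + tensor (v x) (u x)) i j)
      (fun ζ => cnv (vft u i) (vft u j) ζ + linM u v i j ζ) := by
  refine ((isDFT_mul (isFT_vft hu i) (isFT_vft hu j)).add
    (isFT_linM hu hvg hg hB i j).1.isDFT).congr (ae_of_all _ fun x => ?_)
  simp [tensor, add_assoc]

theorem isDFT_stress (hu : MemLp u 2 volume) (hs : sob 3 (vft u) < ⊤) (hDu : IsWeakGrad u Du)
    (hDv : IsWeakGrad v Dv) (hvg : v =ᵐ[volume] g) (hg : ContDiff ℝ ∞ g) (hB0 : 0 ≤ B)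
    (hB : ∀ k ≤ 2, ∀ x, ‖iteratedFDeriv ℝ k g x‖ ≤ B) (i j : Fin 3) :
    IsDFT (fun x => (stress α (Du x) (Du x) + (2 : ℝ) • stress α (Du x) (Dv x)) i j)
      (fun ζ => quadS α (vft u) i j ζ + linS α Du Dv i j ζ) := by
  have hD := fun a c => hDu.isFT hu hs a c
  have h1 := (IsDFT.sum Finset.univ fun k _ => isDFT_mul ((hD i k).ofReal_add (hD k i))
    ((hD k j).ofReal_sub (hD j k))).const_mul (α ^ 2)
  refine (h1.add (isFT_linS (α := α) hu hs hDu hDv hvg hg hB0 hB i j).1.isDFT).congr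
    (ae_of_all _ fun x => ?_)
  change _ = (stress α (Du x) (Du x) + (2 : ℝ) • stress α (Du x) (Dv x)) i j
  rw [Matrix.add_apply, stress_self]

/-- A bound in a weak norm, used only to make the time derivative bounded on compact time intervals.
It may grow with the size of `u` without harming the final estimate. -/
theorem eLpNorm_flux_le (hu : MemLp u 2 volume) (hvg : v =ᵐ[volume] g) (hg : ContDiff ℝ ∞ g)
    (hB : ∀ k ≤ 2, ∀ x, ‖iteratedFDeriv ℝ k g x‖ ≤ B) (hs : sob 0 (vft u) < ⊤) (i j : Fin 3) :
    eLpNorm (fun ζ => ((κ ζ : ℂ) ^ 5)⁻¹ * (cnv (vft u i) (vft u j) ζ + linM u v i j ζ)) 2 volume ≤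
      Kinv * (sob 0 (vft u) * sob 0 (vft u)) + 2 * ENNReal.ofReal B * sob 0 (vft u) := by
  have h0 : ∀ j, n2 (fun ξ => ‖vft u j ξ‖ₑ) ≤ sob 0 (vft u) := fun j => by
    simpa using n2_coord_le_sob (vft u) 0 j
  have hc := isDFT_mul (isFT_vft hu i) (isFT_vft hu j)
  have hl := isFT_linM hu hvg hg hB i j
  have hfin : sob 0 (vft u) * sob 0 (vft u) ≠ ⊤ := ENNReal.mul_ne_top hs.ne hs.ne
  simp only [mul_add]
  refine (eLpNorm_add_le hc.memLp.1 hl.1.isDFT.memLp.1 (by norm_num)).trans (add_le_add ?_ ?_)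
  · refine eLpNorm_κ_inv_of_bounded hfin fun ξ => ?_
    refine (enorm_cnv_le_n2 (measurable_vft u i).aemeasurable
      (measurable_vft u j).aemeasurable ξ).trans (mul_le_mul' (h0 i) (h0 j))
  · refine (eLpNorm_κ_inv_le _ _).trans ?_
    have := n2_linM_le hu hvg hg hB i j (n := 0) (by norm_num) hs
    simpa [n2_eLpNorm] using this

theorem eLpNorm_stress_le (hu : MemLp u 2 volume) (hs : sob 3 (vft u) < ⊤) (hDu : IsWeakGrad u Du)
    (hDv : IsWeakGrad v Dv) (hvg : v =ᵐ[volume] g) (hg : ContDiff ℝ ∞ g) (hB0 : 0 ≤ B)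
    (hB : ∀ k ≤ 2, ∀ x, ‖iteratedFDeriv ℝ k g x‖ ≤ B) (i j : Fin 3) :
    eLpNorm (fun ζ => ((κ ζ : ℂ) ^ 5)⁻¹ * (quadS α (vft u) i j ζ + linS α Du Dv i j ζ)) 2 volume ≤
      Kinv * (ENNReal.ofReal (α ^ 2) * (3 * ((14 * sob 3 (vft u)) * (14 * sob 3 (vft u))))) +
        ENNReal.ofReal (504 * α ^ 2 * B) * sob 3 (vft u) := by
  have hU : ∀ j, Measurable (vft u j) := measurable_vft u
  have hd : ∀ a c, Measurable (dft (vft u) a c) := fun a c =>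
    (continuous_dsym a).measurable.mul (hU c)
  have h14 : ∀ G H : R3 → ℂ, Measurable G → Measurable H → n2 (fun ξ => ‖G ξ‖ₑ) ≤ 7 * sob 3 (vft u) →
      n2 (fun ξ => ‖H ξ‖ₑ) ≤ 7 * sob 3 (vft u) →
      n2 (fun ξ => ‖G ξ + H ξ‖ₑ) ≤ 14 * sob 3 (vft u) := fun G H hG hH h1 h2 => by
    refine (n2_mono (ae_of_all _ fun ξ => enorm_add_le _ _)).trans
      ((n2_add_le hG.enorm.aemeasurable hH.enorm.aemeasurable).trans
      ((add_le_add h1 h2).trans_eq ?_))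
    ring
  have hl := isFT_linS (α := α) hu hs hDu hDv hvg hg hB0 hB i j
  have hfin : ENNReal.ofReal (α ^ 2) * (3 * ((14 * sob 3 (vft u)) * (14 * sob 3 (vft u)))) ≠ ⊤ := by
    have := hs.ne
    finiteness
  have hb : ∀ ζ, ‖quadS α (vft u) i j ζ‖ₑ ≤
      ENNReal.ofReal (α ^ 2) * (3 * ((14 * sob 3 (vft u)) * (14 * sob 3 (vft u)))) := fun ζ => by
    rw [quadS, enorm_mul]
    refine mul_le_mul' ?_ ?_
    · rw [← ofReal_norm, Complex.norm_real, Real.norm_of_nonneg (sq_nonneg α)]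
    · have hk : ∀ k, ‖cnv (fun ξ => dft (vft u) i k ξ + dft (vft u) k i ξ)
          (fun ξ => dft (vft u) k j ξ - dft (vft u) j k ξ) ζ‖ₑ ≤
          (14 * sob 3 (vft u)) * (14 * sob 3 (vft u)) := fun k => by
        refine (enorm_cnv_le_n2 ((hd i k).add (hd k i)).aemeasurable
          ((hd k j).sub (hd j k)).aemeasurable ζ).trans (mul_le_mul' ?_ ?_)
        · exact h14 _ _ (hd i k) (hd k i) (n2_dft_le _ _ _) (n2_dft_le _ _ _)
        · have := h14 _ (fun ξ => -dft (vft u) j k ξ) (hd k j) (hd j k).neg (n2_dft_le _ _ _)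
            (by simpa using n2_dft_le _ _ _)
          simpa [sub_eq_add_neg] using this
      refine (enorm_sum_le _ _).trans ((Finset.sum_le_sum fun k _ => hk k).trans_eq ?_)
      simp
  have hD := isDFT_stress (α := α) hu hs hDu hDv hvg hg hB0 hB i j
  have hq : AEStronglyMeasurable (fun ζ => ((κ ζ : ℂ) ^ 5)⁻¹ * quadS α (vft u) i j ζ) volume := by
    refine (hD.memLp.1.sub hl.1.isDFT.memLp.1).congr (ae_of_all _ fun ζ => ?_)
    simp only [Pi.sub_apply]
    ring
  simp only [mul_add]
  refine (eLpNorm_add_le hq hl.1.isDFT.memLp.1 (by norm_num)).trans (add_le_add ?_ ?_)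
  · exact eLpNorm_κ_inv_of_bounded hfin hb
  · refine (eLpNorm_κ_inv_le _ _).trans ?_
    rw [← n2_eLpNorm]
    exact hl.2

end

end

section


/-! ### The cancellation property of the quadratic terms -/

/-- The bilinear product `∑ x_i y_i`. -/
def bdot (x y : Fin 3 → ℂ) : ℂ := ∑ i, x i * y i

theorem bdot_comm (x y : Fin 3 → ℂ) : bdot x y = bdot y x := by simp [bdot, mul_comm]

theorem bdot_neg_sub (x y z : Fin 3 → ℂ) : bdot (fun i => -x i - y i) z = -bdot x z - bdot y z := by
  simp [bdot, Fin.sum_univ_three]; ring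

/-- The symbol of the trilinear form `∫ (div (u ⊗ u) + div τ(u, u)) · u` in terms of three frequencies
with sum zero and the amplitudes of the three waves. -/
def triSym (c : ℂ) (ξ X η Y θ Z : Fin 3 → ℂ) : ℂ :=
  (1 + c * bdot θ θ) * bdot θ X * bdot Y Z -
    c * (bdot θ ξ * bdot X η * bdot Y Z - bdot θ ξ * bdot X Y * bdot η Z +
      bdot θ X * bdot ξ η * bdot Y Z - bdot θ X * bdot ξ Y * bdot η Z)

/-- The algebraic core: conservation of `∫ |u|² + α² |∇u|²` by the nonlinearity, read off three
interacting waves. Eliminating `θ` and using the three divergence conditions, the last of which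
becomes `η·Z = -ξ·Z`, leaves a polynomial in the remaining dot products that cancels identically
over the six permutations. -/
theorem triSym_sum_eq_zero (c : ℂ) {ξ X η Y θ Z : Fin 3 → ℂ} (h : θ = fun i => -ξ i - η i)
    (hX : bdot ξ X = 0) (hY : bdot η Y = 0) (hZ : bdot θ Z = 0) :
    triSym c ξ X η Y θ Z + triSym c η Y ξ X θ Z + triSym c θ Z η Y ξ X + triSym c ξ X θ Z η Y +
      triSym c η Y θ Z ξ X + triSym c θ Z ξ X η Y = 0 := by
  subst h
  rw [bdot_neg_sub] at hZ
  have hZ' : bdot η Z = -bdot ξ Z := by linear_combination -hZ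
  have r : ∀ z, bdot z (fun i => -ξ i - η i) = -bdot ξ z - bdot η z := fun z => by
    rw [bdot_comm, bdot_neg_sub]
  simp only [triSym, bdot_neg_sub, r, bdot_comm X η, bdot_comm Y ξ,
    bdot_comm Z ξ, bdot_comm Z η, bdot_comm Z Y, bdot_comm Z X, bdot_comm η ξ, bdot_comm Y X]
  simp only [hX, hY, hZ']
  ring

theorem triSym_eq (c : ℂ) (ξ X η Y θ Z : Fin 3 → ℂ) :
    triSym c ξ X η Y θ Z = ∑ l, Z l * ∑ i, θ i * ((1 + c * bdot θ θ) * (X i * Y l) -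
      c * ∑ k, (ξ i * X k + ξ k * X i) * (η k * Y l - η l * Y k)) := by
  simp only [triSym, bdot, Fin.sum_univ_three]
  ring

section

variable (α : ℝ) (U : Fin 3 → R3 → ℂ)

/-- The Fourier transform of the quadratic terms of the equation. -/
def quadR (l : Fin 3) (ζ : R3) : ℂ :=
  ∑ i, -dsym i ζ * (hel α ζ * cnv (U i) (U l) ζ + quadS α U i l ζ)

/-- The density of the contribution of the quadratic terms to the energy balance. -/
def quadE (ζ : R3) : ℂ := ∑ l, (starRingEnd ℂ) (U l ζ) * quadR α U l ζ

/-- The kernel of `quadE`. -/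
def triKer (p : R3 × R3) : ℂ :=
  ∑ l, (starRingEnd ℂ) (U l p.1) * ∑ i, -dsym i p.1 * (hel α p.1 * (U i p.2 * U l (p.1 - p.2)) +
    (α ^ 2 : ℝ) * ∑ k, (dft U i k p.2 + dft U k i p.2) *
      (dft U k l (p.1 - p.2) - dft U l k (p.1 - p.2)))

end

section

variable {α : ℝ} {U : Fin 3 → R3 → ℂ}

@[fun_prop]
theorem measurable_dsym (i : Fin 3) : Measurable (dsym i) := (continuous_dsym i).measurable

theorem measurable_dft (hU : ∀ j, Measurable (U j)) (i j : Fin 3) : Measurable (dft U i j) :=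
  (measurable_dsym i).mul (hU j)

theorem measurable_triKer (hU : ∀ j, Measurable (U j)) : Measurable (triKer α U) := by
  unfold triKer
  have := measurable_dft hU
  have := measurable_hel α
  fun_prop

theorem memLp_of_sob_zero (hU : ∀ j, Measurable (U j)) (hs : sob 0 U < ⊤) (j : Fin 3) :
    MemLp (U j) 2 volume := by
  refine memLp_of_n2 (hU j).aestronglyMeasurable (lt_of_le_of_lt ?_ hs)
  simpa using n2_coord_le_sob U 0 j

theorem memLp_dft (hU : ∀ j, Measurable (U j)) (hs : sob 3 U < ⊤) (i j : Fin 3) :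
    MemLp (dft U i j) 2 volume :=
  memLp_dsym (hU j).aestronglyMeasurable ((n2_coord_le_sob U 3 j).trans_lt hs) i

theorem memLp_comp_sub_left {F : R3 → ℂ} (hF : MemLp F 2 volume) (ζ : R3) :
    MemLp (fun ξ => F (ζ - ξ)) 2 volume :=
  hF.comp_measurePreserving (Measure.measurePreserving_sub_left volume ζ)

theorem quadE_eq (hU : ∀ j, Measurable (U j)) (hs : sob 3 U < ⊤) (ζ : R3) :
    quadE α U ζ = ∫ ξ, triKer α U (ζ, ξ) := by
  have hM := memLp_of_sob_zero hU ((sob_mono U (Nat.zero_le 3)).trans_lt hs)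
  have hD := memLp_dft hU hs
  have h1 : ∀ i l, Integrable (fun ξ => U i ξ * U l (ζ - ξ)) volume := fun i l =>
    (hM i).integrable_mul (memLp_comp_sub_left (hM l) ζ)
  have h2 : ∀ i l k, Integrable (fun ξ => (dft U i k ξ + dft U k i ξ) *
      (dft U k l (ζ - ξ) - dft U l k (ζ - ξ))) volume := fun i l k =>
    ((hD i k).add (hD k i)).integrable_mul
      ((memLp_comp_sub_left (hD k l) ζ).sub (memLp_comp_sub_left (hD l k) ζ))
  have h3 := fun i l => integrable_finsetSum Finset.univ fun k _ => h2 i l k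
  have h4 : ∀ i l, Integrable (fun ξ => hel α ζ * (U i ξ * U l (ζ - ξ)) + (α ^ 2 : ℝ) *
      ∑ k, (dft U i k ξ + dft U k i ξ) * (dft U k l (ζ - ξ) - dft U l k (ζ - ξ))) volume :=
    fun i l => ((h1 i l).const_mul (hel α ζ : ℂ)).add ((h3 i l).const_mul ((α ^ 2 : ℝ) : ℂ))
  have h5 := fun i l => (h4 i l).const_mul (-dsym i ζ)
  have h6 := fun l => (integrable_finsetSum Finset.univ fun i _ => h5 i l).const_mul
    ((starRingEnd ℂ) (U l ζ))
  unfold quadE triKer quadR quadS cnv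
  refine Eq.trans ?_ (integral_finsetSum Finset.univ fun l _ => h6 l).symm
  congr 1; ext l
  rw [integral_const_mul, integral_finsetSum _ fun i _ => h5 i l]
  congr 2; ext i
  rw [integral_const_mul]
  congr 1
  refine Eq.trans ?_ (integral_add ((h1 i l).const_mul (hel α ζ : ℂ))
    ((h3 i l).const_mul ((α ^ 2 : ℝ) : ℂ))).symm
  rw [integral_const_mul, integral_const_mul, integral_finsetSum _ fun k _ => h2 i l k]

/-- The constant in the bounds for the quadratic terms. -/
def quadC (α : ℝ) : ℝ≥0∞ := 21 * (ENNReal.ofReal (helC α) + ENNReal.ofReal (α ^ 2) * 588)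

theorem quadC_ne_top (α : ℝ) : quadC α ≠ ⊤ := by unfold quadC; finiteness

theorem enorm_hel_le (α : ℝ) (ξ : R3) : ‖(hel α ξ : ℂ)‖ₑ ≤ ENNReal.ofReal (helC α) * κe ξ ^ 6 := by
  rw [← ofReal_norm, Complex.norm_real, Real.norm_of_nonneg (hel_pos α ξ).le, κe_pow,
    ← ENNReal.ofReal_mul (helC_pos α).le]
  exact ENNReal.ofReal_le_ofReal (hel_le α ξ)

theorem enorm_dft_le (U : Fin 3 → R3 → ℂ) (i j : Fin 3) (ξ : R3) :
    ‖dft U i j ξ‖ₑ ≤ 7 * (κe ξ ^ 3 * vn U ξ) := by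
  rw [dft, enorm_mul, ← mul_assoc]
  exact mul_le_mul' (enorm_dsym_le i ξ) (le_vn U j ξ)

/-- The flux carries one derivative and the symbol of `1 - α²Δ`, nine powers of `κ` in all, on the
output frequency. The stress spreads one derivative, three powers, over each of the three
frequencies. -/
theorem enorm_triKer_le (U : Fin 3 → R3 → ℂ) (ζ ξ : R3) :
    ‖triKer α U (ζ, ξ)‖ₑ ≤ quadC α * (vn U ξ * vn U (ζ - ξ) * (κe ζ ^ 9 * vn U ζ) +
      (κe ξ ^ 3 * vn U ξ) * (κe (ζ - ξ) ^ 3 * vn U (ζ - ξ)) * (κe ζ ^ 3 * vn U ζ)) := by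
  set x := κe ξ ^ 3 * vn U ξ
  set y := κe (ζ - ξ) ^ 3 * vn U (ζ - ξ)
  have hk : ∀ i l k, ‖(dft U i k ξ + dft U k i ξ) * (dft U k l (ζ - ξ) - dft U l k (ζ - ξ))‖ₑ ≤
      196 * (x * y) := fun i l k => by
    rw [enorm_mul]
    calc _ ≤ (7 * x + 7 * x) * (7 * y + 7 * y) := by
          refine mul_le_mul' ((enorm_add_le _ _).trans (add_le_add (enorm_dft_le _ _ _ _)
            (enorm_dft_le _ _ _ _))) ((enorm_sub_le).trans (add_le_add (enorm_dft_le _ _ _ _)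
            (enorm_dft_le _ _ _ _)))
      _ = _ := by ring
  have hi : ∀ i l, ‖-dsym i ζ * (hel α ζ * (U i ξ * U l (ζ - ξ)) +
      (α ^ 2 : ℝ) * ∑ k, (dft U i k ξ + dft U k i ξ) * (dft U k l (ζ - ξ) - dft U l k (ζ - ξ)))‖ₑ ≤
      7 * κe ζ ^ 3 * (ENNReal.ofReal (helC α) * κe ζ ^ 6 * (vn U ξ * vn U (ζ - ξ)) +
        ENNReal.ofReal (α ^ 2) * (588 * (x * y))) := fun i l => by
    rw [enorm_mul, enorm_neg]
    refine mul_le_mul' (enorm_dsym_le i ζ) ((enorm_add_le _ _).trans (add_le_add ?_ ?_))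
    · rw [enorm_mul, enorm_mul]
      exact mul_le_mul' (enorm_hel_le α ζ) (mul_le_mul' (le_vn U i _) (le_vn U l _))
    · rw [enorm_mul]
      refine mul_le_mul' ?_ ((enorm_sum_le _ _).trans ((Finset.sum_le_sum fun k _ => hk i l k).trans_eq ?_))
      · rw [← ofReal_norm, Complex.norm_real, Real.norm_of_nonneg (sq_nonneg α)]
      · simp only [Finset.sum_const, Finset.card_univ, Fintype.card_fin]
        ring
  calc _ ≤ ∑ l, ‖U l ζ‖ₑ * ∑ _i : Fin 3, 7 * κe ζ ^ 3 * (ENNReal.ofReal (helC α) * κe ζ ^ 6 *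
        (vn U ξ * vn U (ζ - ξ)) + ENNReal.ofReal (α ^ 2) * (588 * (x * y))) := by
        refine (enorm_sum_le _ _).trans (Finset.sum_le_sum fun l _ => ?_)
        rw [enorm_mul]
        refine mul_le_mul' (by simp) ((enorm_sum_le _ _).trans (Finset.sum_le_sum fun i _ => hi i l))
    _ = 21 * ENNReal.ofReal (helC α) * (vn U ξ * vn U (ζ - ξ) * (κe ζ ^ 9 * vn U ζ)) +
        21 * (ENNReal.ofReal (α ^ 2) * 588) * (x * y * (κe ζ ^ 3 * vn U ζ)) := by
        rw [← Finset.sum_mul]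
        simp only [Finset.sum_const, Finset.card_univ, Fintype.card_fin]
        change vn U ζ * _ = _
        ring
    _ ≤ _ := by
        rw [mul_add]
        exact add_le_add (mul_le_mul_left (mul_le_mul_right le_self_add _) _)
          (mul_le_mul_left (mul_le_mul_right le_add_self _) _)

/-- The output frequency is the sum of the two input frequencies, so powers of its weight can be
transferred to the inputs. -/
theorem tri_pow_add_le {f g k : R3 → ℝ≥0∞} (hf : Measurable f) (hg : Measurable g)
    (hk : Measurable k) (n : ℕ) : tri f g (fun ζ => κe ζ ^ n * k ζ) ≤
      2 ^ n * (tri (fun ξ => κe ξ ^ n * f ξ) g k + tri f (fun ξ => κe ξ ^ n * g ξ) k) := by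
  have hm1 : Measurable fun ξ => κe ξ ^ n * f ξ := by fun_prop
  have hm2 : Measurable fun ξ => κe ξ ^ n * g ξ := by fun_prop
  unfold tri
  rw [← lintegral_add_left (measurable_tri_integrand hm1 hg hk), ← lintegral_const_mul' _ _
    (by finiteness)]
  refine lintegral_mono fun ζ => ?_
  rw [← add_mul, ← lintegral_add_left (by fun_prop), ← mul_assoc, ← mul_assoc,
    ← lintegral_const_mul _ (by fun_prop), ← lintegral_mul_const _ (by fun_prop)]
  refine mul_le_mul_left (lintegral_mono fun ξ => ?_) _
  have := κe_add_pow_le ξ (ζ - ξ) n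
  rw [add_sub_cancel] at this
  calc f ξ * g (ζ - ξ) * κe ζ ^ n
      ≤ f ξ * g (ζ - ξ) * (2 ^ n * (κe ξ ^ n + κe (ζ - ξ) ^ n)) := mul_le_mul_right this _
    _ = _ := by ring

/-- Bookkeeping of weights. The energy has the extra weight `κ^e`. Of the `9 + e` powers on the
output frequency, `c` stay there and `s` are moved to the inputs, which are measured with weight
`κ^a`. The equations `h3` and `h6` say that five powers are left over for the product estimate, in
the flux and in the stress respectively. The cases used are `(e, s, a, c) = (0, 3, 4, 6)` and `(4,
5, 5, 8)`. -/
theorem lintegral_triKer_le (hU : ∀ j, Measurable (U j)) {w : R3 → ℝ≥0∞} (hw : Measurable w)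
    {e s a c : ℕ} (h1 : s + c = 9 + e) (h2 : s ≤ a) (h3 : (a - s) + a = 5) (h4 : 3 ≤ a)
    (h5 : 3 + e ≤ c) (h6 : (a - 3) + (a - 3) + (c - (3 + e)) = 5) :
    ∫⁻ ζ, κe ζ ^ e * w ζ * ∫⁻ ξ, ‖triKer α U (ζ, ξ)‖ₑ ≤
      quadC α * (2 ^ s * 6 + 3) * Kinv * sob a U ^ 2 * n2 (fun ζ => κe ζ ^ c * (w ζ * vn U ζ)) := by
  have hv := measurable_vn hU
  have hwv : Measurable fun ζ => w ζ * vn U ζ := hw.mul hv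
  set N := n2 fun ζ => κe ζ ^ c * (w ζ * vn U ζ)
  have t1 : tri (fun ξ => κe ξ ^ s * vn U ξ) (vn U) (fun ζ => κe ζ ^ c * (w ζ * vn U ζ)) ≤
      3 * Kinv * sob a U * sob a U * N := by
    have := tri_pow_le hv hv hwv (a := a) (b := a) (c := c) (a' := s) (b' := 0) (c' := c) h2
      (Nat.zero_le _) le_rfl (by omega)
    simp only [pow_zero, one_mul] at this
    exact this
  have t2 : tri (vn U) (fun ξ => κe ξ ^ s * vn U ξ) (fun ζ => κe ζ ^ c * (w ζ * vn U ζ)) ≤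
      3 * Kinv * sob a U * sob a U * N := by
    rw [tri_comm]; exact t1
  have t3 : tri (fun ξ => κe ξ ^ 3 * vn U ξ) (fun ξ => κe ξ ^ 3 * vn U ξ)
      (fun ζ => κe ζ ^ (3 + e) * (w ζ * vn U ζ)) ≤ 3 * Kinv * sob a U * sob a U * N :=
    tri_pow_le hv hv hwv h4 h4 h5 h6
  have t4 := tri_pow_add_le hv hv (k := fun ζ => κe ζ ^ c * (w ζ * vn U ζ)) (by fun_prop) s
  have m1 : Measurable fun ζ => (∫⁻ ξ, vn U ξ * vn U (ζ - ξ)) *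
      (κe ζ ^ s * (κe ζ ^ c * (w ζ * vn U ζ))) := measurable_tri_integrand hv hv (by fun_prop)
  have m2 : Measurable fun ζ => (∫⁻ ξ, (κe ξ ^ 3 * vn U ξ) * (κe (ζ - ξ) ^ 3 * vn U (ζ - ξ))) *
      (κe ζ ^ (3 + e) * (w ζ * vn U ζ)) :=
    measurable_tri_integrand (f := fun ξ => κe ξ ^ 3 * vn U ξ) (g := fun ξ => κe ξ ^ 3 * vn U ξ)
      (by fun_prop) (by fun_prop) (by fun_prop)
  calc ∫⁻ ζ, κe ζ ^ e * w ζ * ∫⁻ ξ, ‖triKer α U (ζ, ξ)‖ₑ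
      ≤ ∫⁻ ζ, quadC α * ((∫⁻ ξ, vn U ξ * vn U (ζ - ξ)) * (κe ζ ^ s * (κe ζ ^ c * (w ζ * vn U ζ))) +
        (∫⁻ ξ, (κe ξ ^ 3 * vn U ξ) * (κe (ζ - ξ) ^ 3 * vn U (ζ - ξ))) *
          (κe ζ ^ (3 + e) * (w ζ * vn U ζ))) := by
        refine lintegral_mono fun ζ => ?_
        refine (mul_le_mul_right (lintegral_mono fun ξ => enorm_triKer_le U ζ ξ) _).trans_eq ?_
        rw [lintegral_const_mul _ (by fun_prop), lintegral_add_left (by fun_prop),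
          lintegral_mul_const _ (by fun_prop), lintegral_mul_const _ (by fun_prop),
          ← mul_assoc (κe ζ ^ s), ← pow_add, h1, pow_add, pow_add]
        ring
    _ = quadC α * (tri (vn U) (vn U) (fun ζ => κe ζ ^ s * (κe ζ ^ c * (w ζ * vn U ζ))) +
        tri (fun ξ => κe ξ ^ 3 * vn U ξ) (fun ξ => κe ξ ^ 3 * vn U ξ)
          (fun ζ => κe ζ ^ (3 + e) * (w ζ * vn U ζ))) := by
        rw [lintegral_const_mul' _ _ (quadC_ne_top α), lintegral_add_left m1]
        rfl
    _ ≤ quadC α * (2 ^ s * (3 * Kinv * sob a U * sob a U * N + 3 * Kinv * sob a U * sob a U * N) +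
        3 * Kinv * sob a U * sob a U * N) := by
        refine mul_le_mul_right (add_le_add (t4.trans ?_) t3) _
        exact mul_le_mul_right (add_le_add t1 t2) _
    _ = _ := by ring

theorem stronglyMeasurable_quadE (hU : ∀ j, Measurable (U j)) (hs : sob 3 U < ⊤) :
    StronglyMeasurable (quadE α U) := by
  rw [funext (quadE_eq (α := α) hU hs)]
  exact (measurable_triKer hU).stronglyMeasurable.integral_prod_right'

theorem lintegral_quadE_le (hU : ∀ j, Measurable (U j)) (hs : sob 3 U < ⊤) {w : R3 → ℝ≥0∞}
    (hw : Measurable w)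
    {e s a c : ℕ} (h1 : s + c = 9 + e) (h2 : s ≤ a) (h3 : (a - s) + a = 5) (h4 : 3 ≤ a)
    (h5 : 3 + e ≤ c) (h6 : (a - 3) + (a - 3) + (c - (3 + e)) = 5) :
    ∫⁻ ζ, κe ζ ^ e * w ζ * ‖quadE α U ζ‖ₑ ≤
      quadC α * (2 ^ s * 6 + 3) * Kinv * sob a U ^ 2 * n2 (fun ζ => κe ζ ^ c * (w ζ * vn U ζ)) := by
  refine (lintegral_mono fun ζ => ?_).trans (lintegral_triKer_le (α := α) hU hw h1 h2 h3 h4 h5 h6)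
  rw [quadE_eq hU hs]
  exact mul_le_mul_right (enorm_integral_le_lintegral_enorm _) _

theorem integrable_triKer (hU : ∀ j, Measurable (U j)) (h4 : sob 4 U < ⊤) (h6 : sob 6 U < ⊤) :
    Integrable (triKer α U) (volume.prod volume) := by
  refine ⟨(measurable_triKer hU).aestronglyMeasurable, ?_⟩
  rw [hasFiniteIntegral_iff_enorm, lintegral_prod _ (measurable_triKer hU).enorm.aemeasurable]
  have := lintegral_triKer_le (α := α) hU (w := fun _ => 1) measurable_const (e := 0) (s := 3) (a := 4)
    (c := 6) (by norm_num) (by norm_num) (by norm_num) (by norm_num) (by norm_num) (by norm_num)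
  simp only [pow_zero, one_mul] at this
  refine this.trans_lt ?_
  have h := quadC_ne_top α
  have h' := Kinv_lt_top.ne
  have h6' := h6.ne
  change _ * sob 6 U < ⊤
  finiteness

/-- The amplitude vector of a complex field. -/
def amp (U : Fin 3 → R3 → ℂ) (ξ : R3) (j : Fin 3) : ℂ := U j ξ

/-- A real vector as a complex one. -/
def cvec (ξ : R3) (j : Fin 3) : ℂ := ξ j

/-- As the field is real, the conjugate amplitude at `ζ` is the amplitude at `-ζ`. The kernel then
depends on three waves of frequencies `ξ`, `ζ - ξ` and `-ζ`, which add up to zero. -/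
theorem triKer_eq {p : R3 × R3} (h : ∀ l, U l (-p.1) = (starRingEnd ℂ) (U l p.1)) :
    triKer α U p = 2 * Real.pi * Complex.I * triSym (4 * Real.pi ^ 2 * α ^ 2 : ℝ)
      (cvec p.2) (amp U p.2) (cvec (p.1 - p.2)) (amp U (p.1 - p.2)) (cvec (-p.1)) (amp U (-p.1)) := by
  have hh : (hel α p.1 : ℂ) = 1 + (4 * Real.pi ^ 2 * α ^ 2 : ℝ) *
      bdot (cvec (-p.1)) (cvec (-p.1)) := by
    rw [hel, EuclideanSpace.norm_sq_eq]
    simp only [bdot, cvec, Fin.sum_univ_three, Real.norm_eq_abs, sq_abs, PiLp.neg_apply]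
    push_cast
    ring
  rw [triSym_eq, triKer, Finset.mul_sum]
  congr 1; ext l
  rw [← h l, ← hh, mul_left_comm]
  congr 1
  rw [Finset.mul_sum]
  congr 1; ext i
  simp only [mul_sub, mul_add, dsym, dft, cvec, amp, PiLp.neg_apply, Fin.sum_univ_three]
  push_cast
  ring_nf
  simp only [Complex.I_pow_three]
  ring

theorem quasiMeasurePreserving_freq :
    (∀ c : R3 × R3 → R3, c = Prod.fst ∨ c = Prod.snd ∨ c = (fun p => p.1 - p.2) →
      Measure.QuasiMeasurePreserving c (volume.prod volume) volume) := by
  rintro c (rfl | rfl | rfl)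
  · exact Measure.quasiMeasurePreserving_fst
  · exact Measure.quasiMeasurePreserving_snd
  · exact quasiMeasurePreserving_sub volume volume

/-- Exchanges the frequencies `ξ` and `ζ - ξ`. Together with `measurePreserving_swapB`, which
exchanges `ξ` and `-ζ`, it generates all permutations of the three waves. -/
theorem measurePreserving_swapA :
    MeasurePreserving (fun p : R3 × R3 => (p.1, p.1 - p.2)) (volume.prod volume)
      (volume.prod volume) :=
  (MeasurePreserving.id volume).skew_product (g := fun ζ ξ => ζ - ξ) (by fun_prop)
    (ae_of_all _ fun ζ => (Measure.measurePreserving_sub_left volume ζ).map_eq)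

theorem measurePreserving_swapB :
    MeasurePreserving (fun p : R3 × R3 => (-p.2, -p.1)) (volume.prod volume)
      (volume.prod volume) :=
  ((Measure.measurePreserving_neg volume).prod (Measure.measurePreserving_neg volume)).comp
    Measure.measurePreserving_swap

/-- The six permutations of the waves preserve the measure, so the six permuted kernels have the
same integral, while their sum vanishes almost everywhere. Absolute integrability of the kernel is
what requires `H²`. -/
theorem integral_quadE_eq_zero (hU : ∀ j, Measurable (U j)) (h4 : sob 4 U < ⊤) (h6 : sob 6 U < ⊤)
    (hdiv : ∀ᵐ ξ, ∑ j, (ξ j : ℂ) * U j ξ = 0)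
    (hherm : ∀ᵐ ξ, ∀ l, U l (-ξ) = (starRingEnd ℂ) (U l ξ)) : ∫ ζ, quadE α U ζ = 0 := by
  let μ : Measure (R3 × R3) := volume.prod volume
  let Φ := triKer α U
  have hΦ : Measurable Φ := measurable_triKer hU
  have hi : Integrable Φ μ := integrable_triKer hU h4 h6
  let A : R3 × R3 → R3 × R3 := fun p => (p.1, p.1 - p.2)
  let B : R3 × R3 → R3 × R3 := fun p => (-p.2, -p.1)
  have hA : MeasurePreserving A μ μ := measurePreserving_swapA
  have hB : MeasurePreserving B μ μ := measurePreserving_swapB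
  have hint : ∀ {P : R3 × R3 → R3 × R3}, MeasurePreserving P μ μ →
      Integrable (fun p => Φ (P p)) μ ∧ ∫ p, Φ (P p) ∂μ = ∫ p, Φ p ∂μ := fun {P} hP =>
    ⟨hP.integrable_comp_of_integrable hi, by
      conv_rhs => rw [← hP.map_eq]
      rw [integral_map hP.measurable.aemeasurable hΦ.aestronglyMeasurable]⟩
  have e : ∀ᵐ p ∂μ, Φ p = 2 * Real.pi * Complex.I * triSym (4 * Real.pi ^ 2 * α ^ 2 : ℝ)
      (cvec p.2) (amp U p.2) (cvec (p.1 - p.2)) (amp U (p.1 - p.2)) (cvec (-p.1)) (amp U (-p.1)) := by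
    filter_upwards [(quasiMeasurePreserving_freq _ (Or.inl rfl)).ae hherm] with p hp
    exact triKer_eq hp
  have d1 : ∀ᵐ p ∂μ, bdot (cvec p.2) (amp U p.2) = 0 :=
    (quasiMeasurePreserving_freq _ (Or.inr (Or.inl rfl))).ae hdiv
  have d2 : ∀ᵐ p ∂μ, bdot (cvec (p.1 - p.2)) (amp U (p.1 - p.2)) = 0 :=
    (quasiMeasurePreserving_freq _ (Or.inr (Or.inr rfl))).ae hdiv
  have d3 : ∀ᵐ p ∂μ, bdot (cvec (-p.1)) (amp U (-p.1)) = 0 :=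
    ((Measure.measurePreserving_neg volume).quasiMeasurePreserving.comp
      (quasiMeasurePreserving_freq _ (Or.inl rfl))).ae hdiv
  have hsum : ∀ᵐ p ∂μ, Φ p + Φ (A p) + Φ (B p) + Φ (B (A p)) + Φ (A (B p)) + Φ (A (B (A p))) = 0 := by
    have q := fun {P : R3 × R3 → R3 × R3} (hP : MeasurePreserving P μ μ) =>
      hP.quasiMeasurePreserving.ae e
    filter_upwards [e, q hA, q hB, q (hB.comp hA), q (hA.comp hB), q (hA.comp (hB.comp hA)),
      d1, d2, d3] with p e1 e2 e3 e4 e5 e6 h1 h2 h3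
    simp only [Function.comp_apply] at e4 e5 e6
    rw [e1, e2, e3, e4, e5, e6]
    have hs : cvec (-p.1) = fun i => -cvec p.2 i - cvec (p.1 - p.2) i := by
      ext i; simp [cvec]; ring
    have key := triSym_sum_eq_zero (4 * Real.pi ^ 2 * α ^ 2 : ℝ) hs h1 h2 h3
    have a2 : ∀ p, (A p).1 - (A p).2 = p.2 := fun p => sub_sub_cancel _ _
    have b2 : ∀ p, (B p).1 - (B p).2 = p.1 - p.2 := fun p => by
      change -p.2 - -p.1 = _
      abel
    have b3 : ∀ p, -(B p).1 = p.2 := fun p => neg_neg p.2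
    have a1 : ∀ p, (A p).2 = p.1 - p.2 := fun p => rfl
    have a3 : ∀ p, (A p).1 = p.1 := fun p => rfl
    have b1 : ∀ p, (B p).2 = -p.1 := fun p => rfl
    simp only [a2, b2, b3]
    simp only [a1, a3]
    simp only [a2, b2, b3]
    simp only [b1, a3]
    linear_combination (2 * Real.pi * Complex.I) * key
  have h0 : ∫ p, Φ p ∂μ = 0 := by
    have i1 := hint hA
    have i2 := hint hB
    have i3 := hint (hB.comp hA)
    have i4 := hint (hA.comp hB)
    have i5 := hint (hA.comp (hB.comp hA))
    simp only [Function.comp_apply] at i3 i4 i5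
    have := integral_congr_ae hsum
    have j1 : Integrable (fun p => Φ p + Φ (A p)) μ := hi.add i1.1
    have j2 : Integrable (fun p => Φ p + Φ (A p) + Φ (B p)) μ := j1.add i2.1
    have j3 : Integrable (fun p => Φ p + Φ (A p) + Φ (B p) + Φ (B (A p))) μ := j2.add i3.1
    have j4 : Integrable (fun p => Φ p + Φ (A p) + Φ (B p) + Φ (B (A p)) + Φ (A (B p))) μ :=
      j3.add i4.1
    rw [integral_zero, integral_add j4 i5.1, integral_add j3 i4.1, integral_add j2 i3.1,
      integral_add j1 i2.1, integral_add hi i1.1, i1.2, i2.2, i3.2, i4.2, i5.2] at this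
    linear_combination this / 6
  rw [funext (quadE_eq (α := α) hU ((sob_mono U (by norm_num)).trans_lt h4)), ← h0]
  exact (integral_prod Φ hi).symm

end

end

section


/-! ### Truncated moments of the energy density -/

/-- The annulus `1/(n+1) < |ξ| < n+1`. -/
def ann (n : ℕ) : Set R3 := {ξ | ((n : ℝ) + 1)⁻¹ < ‖ξ‖ ∧ ‖ξ‖ < n + 1}

theorem measurableSet_ann (n : ℕ) : MeasurableSet (ann n) :=
  ((isOpen_lt continuous_const continuous_norm).inter
    (isOpen_lt continuous_norm continuous_const)).measurableSet

theorem ann_mono {m n : ℕ} (h : m ≤ n) : ann m ⊆ ann n := fun ξ hξ => by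
  have h' : (m : ℝ) ≤ n := by exact_mod_cast h
  refine ⟨lt_of_le_of_lt ?_ hξ.1, hξ.2.trans_le (by linarith)⟩
  exact inv_anti₀ (by positivity) (by linarith)

theorem mem_ann_of_ne {ξ : R3} (h : ξ ≠ 0) : ∃ n, ξ ∈ ann n := by
  obtain ⟨n, hn⟩ := exists_nat_gt (max ‖ξ‖ ‖ξ‖⁻¹)
  have h0 : 0 < ‖ξ‖ := norm_pos_iff.2 h
  refine ⟨n, ?_, (le_max_left _ _).trans_lt (hn.trans (by linarith))⟩
  rw [inv_lt_comm₀ (by positivity) h0]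
  exact (le_max_right _ _).trans_lt (hn.trans (by linarith))

/-- A weight cut off to an annulus. -/
def cut (n : ℕ) (g : R3 → ℝ) : R3 → ℝ := (ann n).indicator g

theorem measurable_cut (n : ℕ) {g : R3 → ℝ} (hg : Continuous g) : Measurable (cut n g) :=
  hg.measurable.indicator (measurableSet_ann n)

theorem cut_nonneg {g : R3 → ℝ} (hg : ∀ ξ, 0 ≤ g ξ) (n : ℕ) (ξ : R3) : 0 ≤ cut n g ξ :=
  indicator_nonneg (fun ξ _ => hg ξ) ξ

theorem exists_abs_cut_le (n : ℕ) {g : R3 → ℝ} (hg : Continuous g) : ∃ M, ∀ ξ, |cut n g ξ| ≤ M := by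
  obtain ⟨M, hM⟩ := (isCompact_closedBall (0 : R3) (n + 1)).exists_bound_of_continuousOn
    hg.continuousOn
  refine ⟨M, fun ξ => ?_⟩
  by_cases h : ξ ∈ ann n
  · rw [cut, indicator_of_mem h]
    exact hM ξ (by simpa using h.2.le)
  · rw [cut, indicator_of_notMem h, abs_zero]
    exact (norm_nonneg _).trans (hM 0 (by simp; positivity))

theorem cut_mul (n : ℕ) (g : R3 → ℝ) (f : R3 → ℝ) (ξ : R3) :
    cut n (fun ξ => g ξ * f ξ) ξ = cut n g ξ * f ξ := by
  by_cases h : ξ ∈ ann n <;> simp [cut, h]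

/-- The energy density `∑ |U_l|²`. -/
def esq (U : Fin 3 → R3 → ℂ) (ξ : R3) : ℝ := ∑ l, ‖U l ξ‖ ^ 2

theorem esq_nonneg (U : Fin 3 → R3 → ℂ) (ξ : R3) : 0 ≤ esq U ξ :=
  Finset.sum_nonneg fun _ _ => sq_nonneg _

/-- The moment of the energy density with weight `g` over an annulus. -/
def mom (g : R3 → ℝ) (U : Fin 3 → R3 → ℂ) (n : ℕ) : ℝ := ∫ ξ, cut n g ξ * esq U ξ

/-- The moment of the energy density with weight `g`. -/
def fullMom (g : R3 → ℝ) (U : Fin 3 → R3 → ℂ) : ℝ≥0∞ := ∫⁻ ξ, ENNReal.ofReal (g ξ * esq U ξ)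

theorem ofReal_esq (U : Fin 3 → R3 → ℂ) (ξ : R3) : ENNReal.ofReal (esq U ξ) = ∑ l, ‖U l ξ‖ₑ ^ 2 := by
  rw [esq, ENNReal.ofReal_sum_of_nonneg fun _ _ => sq_nonneg _]
  simp only [ENNReal.ofReal_pow (norm_nonneg _), ofReal_norm]

theorem ofReal_esq_le (U : Fin 3 → R3 → ℂ) (ξ : R3) : ENNReal.ofReal (esq U ξ) ≤ vn U ξ ^ 2 := by
  rw [ofReal_esq, vn, Fin.sum_univ_three, Fin.sum_univ_three]
  calc _ ≤ ‖U 0 ξ‖ₑ ^ 2 + ‖U 1 ξ‖ₑ ^ 2 + ‖U 2 ξ‖ₑ ^ 2 + (2 * ‖U 0 ξ‖ₑ * ‖U 1 ξ‖ₑ +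
        2 * ‖U 0 ξ‖ₑ * ‖U 2 ξ‖ₑ + 2 * ‖U 1 ξ‖ₑ * ‖U 2 ξ‖ₑ) := le_self_add
    _ = _ := by ring

theorem vn_sq_le (U : Fin 3 → R3 → ℂ) (ξ : R3) : vn U ξ ^ 2 ≤ 3 * ENNReal.ofReal (esq U ξ) := by
  have h : vn U ξ = ENNReal.ofReal (∑ l, ‖U l ξ‖) := by
    rw [ENNReal.ofReal_sum_of_nonneg fun _ _ => norm_nonneg _]
    simp only [ofReal_norm]; rfl
  rw [h, ← ENNReal.ofReal_pow (Finset.sum_nonneg fun _ _ => norm_nonneg _),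
    ← ENNReal.ofReal_ofNat 3, ← ENNReal.ofReal_mul (by norm_num)]
  apply ENNReal.ofReal_le_ofReal
  have := sq_sum_le_card_mul_sum_sq (s := Finset.univ) (f := fun l => ‖U l ξ‖)
  simpa [esq] using this

theorem measurable_esq {U : Fin 3 → R3 → ℂ} (hU : ∀ j, Measurable (U j)) : Measurable (esq U) := by
  unfold esq; fun_prop

theorem integrable_esq {U : Fin 3 → R3 → ℂ} (hM : ∀ j, MemLp (U j) 2 volume) :
    Integrable (esq U) volume :=
  integrable_finsetSum _ fun l _ => (hM l).integrable_norm_pow (by norm_num)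

section

variable {U : Fin 3 → R3 → ℂ} {g h : R3 → ℝ}

theorem integrable_cut_mul (hg : Continuous g) (hM : ∀ j, MemLp (U j) 2 volume) (n : ℕ) :
    Integrable (fun ξ => cut n g ξ * esq U ξ) volume := by
  obtain ⟨M, hb⟩ := exists_abs_cut_le n hg
  exact (integrable_esq hM).bdd_mul (measurable_cut n hg).aestronglyMeasurable (ae_of_all _ hb)

theorem mom_nonneg (hg : ∀ ξ, 0 ≤ g ξ) (n : ℕ) : 0 ≤ mom g U n :=
  integral_nonneg fun ξ => mul_nonneg (cut_nonneg hg n ξ) (esq_nonneg U ξ)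

theorem ofReal_mom (hg : Continuous g) (h0 : ∀ ξ, 0 ≤ g ξ) (hM : ∀ j, MemLp (U j) 2 volume)
    (n : ℕ) : ENNReal.ofReal (mom g U n) =
      ∫⁻ ξ, (ann n).indicator (fun ξ => ENNReal.ofReal (g ξ * esq U ξ)) ξ := by
  rw [mom, ofReal_integral_eq_lintegral_ofReal (integrable_cut_mul hg hM n)
    (ae_of_all _ fun ξ => mul_nonneg (cut_nonneg h0 n ξ) (esq_nonneg U ξ))]
  congr 1; ext ξ
  by_cases h : ξ ∈ ann n <;> simp [cut, h]

theorem ofReal_mom_le (hg : Continuous g) (h0 : ∀ ξ, 0 ≤ g ξ) (hM : ∀ j, MemLp (U j) 2 volume)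
    (n : ℕ) : ENNReal.ofReal (mom g U n) ≤ fullMom g U := by
  rw [ofReal_mom hg h0 hM]
  exact lintegral_mono fun ξ => indicator_le_self _ _ ξ

theorem monotone_mom (hg : Continuous g) (h0 : ∀ ξ, 0 ≤ g ξ) (hM : ∀ j, MemLp (U j) 2 volume) :
    Monotone (mom g U) := fun m n hmn =>
  integral_mono (integrable_cut_mul hg hM m) (integrable_cut_mul hg hM n) fun ξ =>
    mul_le_mul_of_nonneg_right (indicator_le_indicator_of_subset (ann_mono hmn) h0 ξ)
      (esq_nonneg U ξ)

/-- The annuli increase to the complement of the origin, a null set, and monotone convergence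
applies. No finiteness is assumed, so bounds on truncated moments prove finiteness of the full ones.
-/
theorem iSup_mom (hg : Continuous g) (h0 : ∀ ξ, 0 ≤ g ξ) (hU : ∀ j, Measurable (U j))
    (hM : ∀ j, MemLp (U j) 2 volume) :
    ⨆ n, ENNReal.ofReal (mom g U n) = fullMom g U := by
  simp only [ofReal_mom hg h0 hM]
  rw [← lintegral_iSup]
  · refine lintegral_congr_ae ?_
    have h : ∀ᵐ ξ : R3, ξ ≠ 0 := by simp [ae_iff]
    filter_upwards [h] with ξ hξ
    obtain ⟨n, hn⟩ := mem_ann_of_ne hξ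
    refine le_antisymm (iSup_le fun n => indicator_le_self _ _ ξ) ?_
    refine le_iSup_of_le n ?_
    rw [indicator_of_mem hn]
  · intro n
    exact ((hg.measurable.mul (measurable_esq hU)).ennreal_ofReal).indicator (measurableSet_ann n)
  · intro m n hmn ξ
    exact indicator_le_indicator_of_subset (ann_mono hmn) (fun _ => zero_le) ξ

theorem fullMom_mono {c : ℝ} (hc : 0 ≤ c) (H : ∀ ξ, g ξ ≤ c * h ξ) :
    fullMom g U ≤ ENNReal.ofReal c * fullMom h U := by
  rw [fullMom, fullMom, ← lintegral_const_mul' _ _ ENNReal.ofReal_ne_top]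
  refine lintegral_mono fun ξ => ?_
  rw [← ENNReal.ofReal_mul hc, ← mul_assoc]
  exact ENNReal.ofReal_le_ofReal (mul_le_mul_of_nonneg_right (H ξ) (esq_nonneg U ξ))

theorem fullMom_pow_le (U : Fin 3 → R3 → ℂ) (m : ℕ) :
    fullMom (fun ξ => κ ξ ^ (2 * m)) U ≤ sob m U ^ 2 := by
  rw [fullMom, sob, n2_sq]
  refine lintegral_mono fun ξ => ?_
  rw [ENNReal.ofReal_mul (pow_nonneg (κ_pos ξ).le _), ← κe_pow, mul_pow, ← pow_mul, mul_comm m]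
  exact mul_le_mul_right (ofReal_esq_le U ξ) _

theorem sob_sq_le (U : Fin 3 → R3 → ℂ) (m : ℕ) :
    sob m U ^ 2 ≤ 3 * fullMom (fun ξ => κ ξ ^ (2 * m)) U := by
  rw [fullMom, sob, n2_sq, ← lintegral_const_mul' _ _ (by norm_num)]
  refine lintegral_mono fun ξ => ?_
  rw [ENNReal.ofReal_mul (pow_nonneg (κ_pos ξ).le _), ← κe_pow, mul_pow, ← pow_mul, mul_comm m,
    mul_left_comm]
  exact mul_le_mul_right (vn_sq_le U ξ) _

/-- The indicator function of an annulus with values in `[0, ∞]`. -/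
def cute (n : ℕ) : R3 → ℝ≥0∞ := (ann n).indicator 1

@[fun_prop]
theorem measurable_cute (n : ℕ) : Measurable (cute n) := measurable_one.indicator (measurableSet_ann n)

theorem enorm_cut_pow (n e : ℕ) (ξ : R3) : ‖cut n (fun ξ => κ ξ ^ e) ξ‖ₑ = κe ξ ^ e * cute n ξ := by
  by_cases h : ξ ∈ ann n
  · rw [cut, cute, indicator_of_mem h, indicator_of_mem h, Pi.one_apply, mul_one, κe_pow,
      ← ofReal_norm, Real.norm_of_nonneg (pow_nonneg (κ_pos ξ).le e)]
  · simp [cut, cute, h]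

theorem n2_cute_sq_le (hM : ∀ j, MemLp (U j) 2 volume) (n c : ℕ) :
    n2 (fun ξ => κe ξ ^ c * (cute n ξ * vn U ξ)) ^ 2 ≤
      ENNReal.ofReal (3 * mom (fun ξ => κ ξ ^ (2 * c)) U n) := by
  rw [ENNReal.ofReal_mul (by norm_num), ofReal_mom (by fun_prop)
    (fun ξ => pow_nonneg (κ_pos ξ).le _) hM, n2_sq, ← lintegral_const_mul' _ _ (by norm_num)]
  refine lintegral_mono fun ξ => ?_
  by_cases h : ξ ∈ ann n
  · rw [cute, indicator_of_mem h, indicator_of_mem h, Pi.one_apply, one_mul,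
      ENNReal.ofReal_mul (pow_nonneg (κ_pos ξ).le _), ← κe_pow, mul_pow, ← pow_mul, mul_comm c,
      mul_left_comm, ENNReal.ofReal_ofNat]
    exact mul_le_mul_right (vn_sq_le U ξ) _
  · simp [cute, h]

end

/-! ### The energy inequality at a fixed time -/

/-- A lower bound for the Helmholtz symbol relative to `κ⁶`. -/
def helc (α : ℝ) : ℝ := min 1 (4 * Real.pi ^ 2 * α ^ 2)

theorem helc_pos {α : ℝ} (hα : 0 < α) : 0 < helc α := lt_min one_pos (by positivity)

theorem helc_mul_le (α : ℝ) (ξ : R3) : helc α * κ ξ ^ 6 ≤ hel α ξ := by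
  rw [κ_pow_six, hel]
  have h1 : helc α ≤ 1 := min_le_left _ _
  have h2 : helc α ≤ 4 * Real.pi ^ 2 * α ^ 2 := min_le_right _ _
  nlinarith [sq_nonneg ‖ξ‖]

section

variable {α ν : ℝ} {U : Fin 3 → R3 → ℂ} {m r : Fin 3 → Fin 3 → R3 → ℂ}

/-- The density of the contribution of the linear terms to the energy balance. -/
def linE (α : ℝ) (U : Fin 3 → R3 → ℂ) (m r : Fin 3 → Fin 3 → R3 → ℂ) (ζ : R3) : ℂ :=
  ∑ l, (starRingEnd ℂ) (U l ζ) * ∑ i, -dsym i ζ * (hel α ζ * m i l ζ + r i l ζ)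

theorem sum_conj_rhs (ζ : R3) :
    ∑ l, ((starRingEnd ℂ) (U l ζ) * rhs α ν U (fun i j ζ => cnv (U i) (U j) ζ + m i j ζ)
      (fun i j ζ => quadS α U i j ζ + r i j ζ) l ζ).re =
      (quadE α U ζ).re + (linE α U m r ζ).re - ν * (4 * Real.pi ^ 2 * ‖ζ‖ ^ 2) * hel α ζ * esq U ζ := by
  have h : ∑ l, (starRingEnd ℂ) (U l ζ) * rhs α ν U (fun i j ζ => cnv (U i) (U j) ζ + m i j ζ)
      (fun i j ζ => quadS α U i j ζ + r i j ζ) l ζ = quadE α U ζ + linE α U m r ζ -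
      (ν * (4 * Real.pi ^ 2 * ‖ζ‖ ^ 2) * hel α ζ * esq U ζ : ℝ) := by
    have h2 : ((esq U ζ : ℝ) : ℂ) = ∑ l, (starRingEnd ℂ) (U l ζ) * U l ζ := by
      rw [esq]; push_cast
      simp only [Complex.conj_mul']
    push_cast
    rw [h2, quadE, linE, Finset.mul_sum, ← Finset.sum_add_distrib, ← Finset.sum_sub_distrib]
    congr 1; ext l
    simp only [rhs, quadR, dsym, Fin.sum_univ_three]
    push_cast
    ring
  rw [← Complex.re_sum, h, Complex.sub_re, Complex.add_re, Complex.ofReal_re]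

/-- Cauchy–Schwarz after splitting the `9 + e` powers of `κ` on the flux into `c` for the truncated
velocity and `d` for `m`. The stress needs only `3 + e ≤ c` powers, all placed on the velocity. -/
theorem lintegral_linE_le (hU : ∀ j, Measurable (U j)) (hm : ∀ i j, Measurable (m i j))
    (hr : ∀ i j, Measurable (r i j)) {w : R3 → ℝ≥0∞} (hw : Measurable w) {c d e : ℕ}
    (h1 : c + d = 9 + e) (h2 : 3 + e ≤ c) {Rm Rr : ℝ≥0∞}
    (hRm : ∀ i j, n2 (fun ξ => κe ξ ^ d * ‖m i j ξ‖ₑ) ≤ Rm)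
    (hRr : ∀ i j, n2 (fun ξ => ‖r i j ξ‖ₑ) ≤ Rr) :
    ∫⁻ ζ, κe ζ ^ e * w ζ * ‖linE α U m r ζ‖ₑ ≤
      63 * (ENNReal.ofReal (helC α) * Rm + Rr) * n2 (fun ζ => κe ζ ^ c * (w ζ * vn U ζ)) := by
  have hv := measurable_vn hU
  set N := n2 (fun ζ => κe ζ ^ c * (w ζ * vn U ζ))
  have p : ∀ ζ, κe ζ ^ e * w ζ * ‖linE α U m r ζ‖ₑ ≤ ∑ l, ∑ i, 7 * (ENNReal.ofReal (helC α) *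
      ((κe ζ ^ c * (w ζ * vn U ζ)) * (κe ζ ^ d * ‖m i l ζ‖ₑ)) +
      (κe ζ ^ c * (w ζ * vn U ζ)) * ‖r i l ζ‖ₑ) := fun ζ => by
    calc _ ≤ κe ζ ^ e * w ζ * ∑ l, vn U ζ * ∑ i, 7 * κe ζ ^ 3 *
          (ENNReal.ofReal (helC α) * κe ζ ^ 6 * ‖m i l ζ‖ₑ + ‖r i l ζ‖ₑ) := by
          refine mul_le_mul_right ((enorm_sum_le _ _).trans (Finset.sum_le_sum fun l _ => ?_)) _
          rw [enorm_mul]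
          refine mul_le_mul' (by simpa using le_vn U l ζ)
            ((enorm_sum_le _ _).trans (Finset.sum_le_sum fun i _ => ?_))
          rw [enorm_mul, enorm_neg]
          refine mul_le_mul' (enorm_dsym_le i ζ) ((enorm_add_le _ _).trans (add_le_add ?_ le_rfl))
          rw [enorm_mul]
          exact mul_le_mul_left (enorm_hel_le α ζ) _
      _ ≤ _ := by
          rw [Finset.mul_sum]
          refine Finset.sum_le_sum fun l _ => ?_
          rw [Finset.mul_sum, Finset.mul_sum]
          refine Finset.sum_le_sum fun i _ => ?_
          calc κe ζ ^ e * w ζ * (vn U ζ * (7 * κe ζ ^ 3 *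
                (ENNReal.ofReal (helC α) * κe ζ ^ 6 * ‖m i l ζ‖ₑ + ‖r i l ζ‖ₑ)))
              = 7 * (ENNReal.ofReal (helC α) * (κe ζ ^ (9 + e) * (w ζ * vn U ζ * ‖m i l ζ‖ₑ)) +
                (κe ζ ^ (3 + e) * (w ζ * vn U ζ)) * ‖r i l ζ‖ₑ) := by
                rw [pow_add, pow_add]; ring
            _ ≤ 7 * (ENNReal.ofReal (helC α) * (κe ζ ^ (9 + e) * (w ζ * vn U ζ * ‖m i l ζ‖ₑ)) +
                (κe ζ ^ c * (w ζ * vn U ζ)) * ‖r i l ζ‖ₑ) :=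
                mul_le_mul_right (add_le_add le_rfl (mul_le_mul_left (mul_le_mul_left
                  (κe_pow_mono ζ h2) _) _)) _
            _ = _ := by rw [← h1, pow_add]; ring
  have t1 : ∀ i l, ∫⁻ ζ, 7 * (ENNReal.ofReal (helC α) *
      ((κe ζ ^ c * (w ζ * vn U ζ)) * (κe ζ ^ d * ‖m i l ζ‖ₑ)) +
      (κe ζ ^ c * (w ζ * vn U ζ)) * ‖r i l ζ‖ₑ) ≤
      7 * (ENNReal.ofReal (helC α) * (N * Rm) + N * Rr) := fun i l => by
    have := hm i l
    have := hr i l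
    rw [lintegral_const_mul _ (by fun_prop), lintegral_add_left (by fun_prop),
      lintegral_const_mul _ (by fun_prop)]
    refine mul_le_mul_right (add_le_add (mul_le_mul_right ?_ _) ?_) _
    · exact (lintegral_mul_le_n2 (by fun_prop) (by fun_prop)).trans (mul_le_mul_right (hRm i l) _)
    · exact (lintegral_mul_le_n2 (by fun_prop) (by fun_prop)).trans (mul_le_mul_right (hRr i l) _)
  calc _ ≤ ∫⁻ ζ, ∑ l, ∑ i, 7 * (ENNReal.ofReal (helC α) *
      ((κe ζ ^ c * (w ζ * vn U ζ)) * (κe ζ ^ d * ‖m i l ζ‖ₑ)) +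
      (κe ζ ^ c * (w ζ * vn U ζ)) * ‖r i l ζ‖ₑ) := lintegral_mono p
    _ = ∑ l, ∑ i, ∫⁻ ζ, 7 * (ENNReal.ofReal (helC α) *
      ((κe ζ ^ c * (w ζ * vn U ζ)) * (κe ζ ^ d * ‖m i l ζ‖ₑ)) +
      (κe ζ ^ c * (w ζ * vn U ζ)) * ‖r i l ζ‖ₑ) := by
        rw [lintegral_finsetSum _ fun l _ => by fun_prop]
        congr 1; ext l
        rw [lintegral_finsetSum _ fun i _ => by fun_prop]
    _ ≤ ∑ _l : Fin 3, ∑ _i : Fin 3, 7 * (ENNReal.ofReal (helC α) * (N * Rm) + N * Rr) :=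
        Finset.sum_le_sum fun l _ => Finset.sum_le_sum fun i _ => t1 i l
    _ = _ := by
        simp only [Finset.sum_const, Finset.card_univ, Fintype.card_fin]
        ring

theorem measurable_linE (hU : ∀ j, Measurable (U j)) (hm : ∀ i j, Measurable (m i j))
    (hr : ∀ i j, Measurable (r i j)) : Measurable (linE α U m r) := by
  have := measurable_hel α
  unfold linE
  fun_prop

theorem integrable_cut_re {F : R3 → ℂ} (hF : AEStronglyMeasurable F volume) {n e : ℕ}
    (h : ∫⁻ ζ, κe ζ ^ e * cute n ζ * ‖F ζ‖ₑ < ⊤) :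
    Integrable (fun ζ => cut n (fun ξ => κ ξ ^ e) ζ * (F ζ).re) volume ∧
    |∫ ζ, cut n (fun ξ => κ ξ ^ e) ζ * (F ζ).re| ≤
      (∫⁻ ζ, κe ζ ^ e * cute n ζ * ‖F ζ‖ₑ).toReal := by
  have hb : ∀ ζ, ‖cut n (fun ξ => κ ξ ^ e) ζ * (F ζ).re‖ₑ ≤ κe ζ ^ e * cute n ζ * ‖F ζ‖ₑ := fun ζ => by
    rw [enorm_mul, enorm_cut_pow]
    refine mul_le_mul_right ?_ _
    rw [← ofReal_norm, ← ofReal_norm]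
    exact ENNReal.ofReal_le_ofReal (Complex.abs_re_le_norm _)
  refine ⟨⟨(measurable_cut n (by fun_prop)).aestronglyMeasurable.mul
    (Complex.continuous_re.comp_aestronglyMeasurable hF), ?_⟩, ?_⟩
  · rw [hasFiniteIntegral_iff_enorm]
    exact (lintegral_mono hb).trans_lt h
  · rw [← Real.norm_eq_abs, ← toReal_enorm]
    exact ENNReal.toReal_mono h.ne ((enorm_integral_le_lintegral_enorm _).trans (lintegral_mono hb))

/-- Viscosity contributes the weight `κ^e hel |ξ|²`. Since `|ξ|² = κ^6 - 1`, it dominates a multiple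
of `κ^{12+e} = κ^{2c}` at the price of one copy of the energy. The linear terms are bounded, and the
quadratic term is left as it stands so that each application can treat it in its own way. -/
theorem energy_rate_le (hν : 0 < ν) (hU : ∀ j, Measurable (U j)) (hs : sob 3 U < ⊤)
    (hm : ∀ i j, Measurable (m i j)) (hr : ∀ i j, Measurable (r i j)) {c d e n : ℕ}
    (h1 : c + d = 9 + e) (h2 : 3 + e ≤ c) (h3 : 2 * c = 12 + e) {Rm Rr : ℝ} (hRm0 : 0 ≤ Rm)
    (hRr0 : 0 ≤ Rr)
    (hRm : ∀ i j, n2 (fun ξ => κe ξ ^ d * ‖m i j ξ‖ₑ) ≤ ENNReal.ofReal Rm)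
    (hRr : ∀ i j, n2 (fun ξ => ‖r i j ξ‖ₑ) ≤ ENNReal.ofReal Rr)
    (hq : ∫⁻ ζ, κe ζ ^ e * cute n ζ * ‖quadE α U ζ‖ₑ < ⊤) :
    2 * ∫ ξ, cut n (fun ξ => κ ξ ^ e) ξ * ∑ l, ((starRingEnd ℂ) (U l ξ) *
      rhs α ν U (fun i j ζ => cnv (U i) (U j) ζ + m i j ζ)
        (fun i j ζ => quadS α U i j ζ + r i j ζ) l ξ).re ≤
    -(8 * Real.pi ^ 2 * ν * helc α) * mom (fun ξ => κ ξ ^ (2 * c)) U n +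
      8 * Real.pi ^ 2 * ν * mom (fun ξ => κ ξ ^ e * hel α ξ) U n +
      126 * (helC α * Rm + Rr) * (n2 fun ξ => κe ξ ^ c * (cute n ξ * vn U ξ)).toReal +
      2 * ∫ ξ, cut n (fun ξ => κ ξ ^ e) ξ * (quadE α U ξ).re := by
  have hM := memLp_of_sob_zero hU ((sob_mono U (Nat.zero_le 3)).trans_lt hs)
  have hN : n2 (fun ξ => κe ξ ^ c * (cute n ξ * vn U ξ)) < ⊤ := by
    have := (n2_cute_sq_le hM n c).trans_lt ENNReal.ofReal_lt_top
    by_contra hcon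
    rw [not_lt_top_iff.1 hcon] at this
    simp at this
  have hl := lintegral_linE_le (α := α) hU hm hr (measurable_cute n) h1 h2 hRm hRr
  have hlt : 63 * (ENNReal.ofReal (helC α) * ENNReal.ofReal Rm + ENNReal.ofReal Rr) *
      n2 (fun ζ => κe ζ ^ c * (cute n ζ * vn U ζ)) < ⊤ := by
    have := hN.ne
    finiteness
  obtain ⟨i1, -⟩ := integrable_cut_re (stronglyMeasurable_quadE hU hs).aestronglyMeasurable hq
  obtain ⟨i2, b2⟩ := integrable_cut_re (measurable_linE (α := α) hU hm hr).aestronglyMeasurable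
    (hl.trans_lt hlt)
  have b2' := (le_abs_self _).trans (b2.trans (ENNReal.toReal_mono hlt.ne hl))
  rw [ENNReal.toReal_mul, ENNReal.toReal_mul, ENNReal.toReal_add (by finiteness) (by finiteness),
    ENNReal.toReal_mul, ENNReal.toReal_ofReal (helC_pos α).le, ENNReal.toReal_ofReal hRm0,
    ENNReal.toReal_ofReal hRr0, ENNReal.toReal_ofNat] at b2'
  let v : R3 → ℝ := fun ξ => κ ξ ^ e * (ν * (4 * Real.pi ^ 2 * ‖ξ‖ ^ 2) * hel α ξ)
  have hvc : Continuous v := by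
    have := continuous_hel α
    fun_prop
  have i3 := integrable_cut_mul hvc hM n
  have hc1 : Continuous fun ξ => κ ξ ^ e * hel α ξ := by
    have := continuous_hel α
    fun_prop
  have hc2 : Continuous fun ξ => κ ξ ^ (2 * c) := by fun_prop
  have j1 := integrable_cut_mul hc1 hM n
  have j2 := integrable_cut_mul hc2 hM n
  have e3 : 2 * ∫ ξ, cut n v ξ * esq U ξ ≥ 8 * Real.pi ^ 2 * ν * helc α *
      mom (fun ξ => κ ξ ^ (2 * c)) U n - 8 * Real.pi ^ 2 * ν * mom (fun ξ => κ ξ ^ e * hel α ξ) U n := by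
    rw [mom, mom, ← integral_const_mul, ← integral_const_mul, ← integral_const_mul,
      ← integral_sub (j2.const_mul _) (j1.const_mul _)]
    refine integral_mono ((j2.const_mul _).sub (j1.const_mul _)) (i3.const_mul 2) fun ξ => ?_
    by_cases h : ξ ∈ ann n
    · simp only [cut, indicator_of_mem h, v]
      have hk := helc_mul_le α ξ
      have h6 := κ_pow_six ξ
      have hkp := pow_pos (κ_pos ξ) e
      have he := esq_nonneg U ξ
      have hpow : κ ξ ^ (2 * c) = κ ξ ^ e * (κ ξ ^ 6 * κ ξ ^ 6) := by
        rw [h3, ← pow_add, ← pow_add]; congr 1; omega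
      have hx : ‖ξ‖ ^ 2 = κ ξ ^ 6 - 1 := by linarith
      rw [hpow, hx]
      have hp : 0 ≤ 8 * Real.pi ^ 2 * ν * κ ξ ^ e * esq U ξ * κ ξ ^ 6 := by
        have := pow_pos (κ_pos ξ) 6
        positivity
      have := mul_le_mul_of_nonneg_left hk hp
      linarith
    · simp [cut, h]
  have split : ∫ ξ, cut n (fun ξ => κ ξ ^ e) ξ * ∑ l, ((starRingEnd ℂ) (U l ξ) *
      rhs α ν U (fun i j ζ => cnv (U i) (U j) ζ + m i j ζ)
        (fun i j ζ => quadS α U i j ζ + r i j ζ) l ξ).re =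
      (∫ ξ, cut n (fun ξ => κ ξ ^ e) ξ * (quadE α U ξ).re) +
      (∫ ξ, cut n (fun ξ => κ ξ ^ e) ξ * (linE α U m r ξ).re) - ∫ ξ, cut n v ξ * esq U ξ := by
    have i12 : Integrable (fun ξ => cut n (fun ξ => κ ξ ^ e) ξ * (quadE α U ξ).re +
      cut n (fun ξ => κ ξ ^ e) ξ * (linE α U m r ξ).re) volume := i1.add i2
    rw [← integral_add i1 i2, ← integral_sub i12 i3]
    congr 1; ext ξ
    rw [sum_conj_rhs, show cut n v ξ = cut n (fun ξ => κ ξ ^ e) ξ *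
      (ν * (4 * Real.pi ^ 2 * ‖ξ‖ ^ 2) * hel α ξ) from cut_mul n _ _ ξ]
    ring
  rw [split]
  linarith

end

end

section


/-! ### Differential inequalities -/

/-- The derivative exists everywhere and is bounded, hence integrable, and the fundamental theorem
of calculus holds without continuity of `f'`. The upper bound may then fail on a null set of times,
such as those of infinite dissipation. -/
theorem ftc_le_of_ae {f f' φ : ℝ → ℝ} {t₀ t₁ b₀ b₁ C : ℝ}
    (hf : ∀ t ∈ Ioo t₀ t₁, HasDerivAt f (f' t) t) (hC : ∀ t ∈ Ioo t₀ t₁, |f' t| ≤ C)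
    (h₀ : t₀ < b₀) (h : b₀ ≤ b₁) (h₁ : b₁ < t₁) (hφ : IntervalIntegrable φ volume b₀ b₁)
    (hle : ∀ᵐ t, t ∈ Ioo b₀ b₁ → f' t ≤ φ t) : f b₁ - f b₀ ≤ ∫ t in b₀..b₁, φ t := by
  have hsub : ∀ t ∈ Icc b₀ b₁, t ∈ Ioo t₀ t₁ := fun t ht => ⟨h₀.trans_le ht.1, ht.2.trans_lt h₁⟩
  have hd : ∀ t ∈ Icc b₀ b₁, deriv f t = f' t := fun t ht => (hf t (hsub t ht)).deriv
  have hi : IntervalIntegrable (deriv f) volume b₀ b₁ := by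
    rw [intervalIntegrable_iff_integrableOn_Icc_of_le h]
    refine Measure.integrableOn_of_bounded (M := C) (by simp)
      (measurable_deriv f).aestronglyMeasurable ?_
    refine (ae_restrict_iff' measurableSet_Icc).2 (ae_of_all _ fun t ht => ?_)
    rw [hd t ht]
    exact hC t (hsub t ht)
  have key : ∫ t in b₀..b₁, deriv f t = f b₁ - f b₀ :=
    intervalIntegral.integral_eq_sub_of_hasDerivAt (fun t ht => by
      rw [uIcc_of_le h] at ht
      rw [hd t ht]
      exact hf t (hsub t ht)) hi
  rw [← key]
  refine intervalIntegral.integral_mono_ae_restrict h hi hφ ?_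
  refine (ae_restrict_iff' measurableSet_Icc).2 ?_
  have hne : ∀ᵐ t : ℝ, t ≠ b₀ ∧ t ≠ b₁ := by
    rw [eventually_and]
    exact ⟨by simp [ae_iff], by simp [ae_iff]⟩
  filter_upwards [hle, hne] with t ht hn hmem
  rw [hd t hmem]
  exact ht ⟨lt_of_le_of_ne hmem.1 hn.1.symm, lt_of_le_of_ne hmem.2 hn.2⟩

/-- A form of Grönwall's inequality for functions which need not be continuous. -/
theorem gronwall_integral {Z k : ℝ → ℝ} {b₀ b₁ Z₀ : ℝ} (h : b₀ ≤ b₁)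
    (hk0 : ∀ t, 0 ≤ k t) (hZ0 : ∀ t, 0 ≤ Z t)
    (hk : IntervalIntegrable k volume b₀ b₁)
    (hZk : IntervalIntegrable (fun t => Z t * k t) volume b₀ b₁)
    (H : ∀ b ∈ Icc b₀ b₁, Z b ≤ Z₀ + ∫ t in b₀..b, Z t * k t) {N : ℕ}
    (hN : ∫ t in b₀..b₁, k t ≤ N / 2) : Z b₁ ≤ 2 ^ N * Z₀ := by
  have sub : ∀ {f : ℝ → ℝ} {c d : ℝ}, IntervalIntegrable f volume b₀ b₁ → c ∈ Icc b₀ b₁ →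
      d ∈ Icc b₀ b₁ → IntervalIntegrable f volume c d := fun hf hc hd =>
    hf.mono_set (by rw [uIcc_of_le h]; exact uIcc_subset_Icc hc hd)
  have hl : b₀ ∈ Icc b₀ b₁ := ⟨le_rfl, h⟩
  set G : ℝ → ℝ := fun b => Z₀ + ∫ t in b₀..b, Z t * k t with hG
  have hZ₀ : 0 ≤ Z₀ := by simpa using (hZ0 b₀).trans (H b₀ hl)
  have hGmono : ∀ c ∈ Icc b₀ b₁, ∀ d ∈ Icc b₀ b₁, c ≤ d → G c ≤ G d := fun c hc d hd hcd => by
    have := intervalIntegral.integral_add_adjacent_intervals (sub hZk hl hc) (sub hZk hc hd)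
    have h0 : 0 ≤ ∫ t in c..d, Z t * k t :=
      intervalIntegral.integral_nonneg hcd fun t _ => mul_nonneg (hZ0 t) (hk0 t)
    simp only [hG]
    linarith
  -- The monotone majorant `G` at most doubles while the integral of `k` grows by `1/2`. Only
  -- continuity of that integral is used, to find the cutting point `c`. On `[c, b]` the increment
  -- of `G` is at most `G b / 2`.
  have claim : ∀ N : ℕ, ∀ b ∈ Icc b₀ b₁, ∫ t in b₀..b, k t ≤ N / 2 → G b ≤ 2 ^ N * Z₀ := by
    intro N
    induction N with
    | zero =>
      intro b hb hle
      have hz : ∫ t in b₀..b, Z t * k t ≤ G b * ∫ t in b₀..b, k t := by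
        rw [← intervalIntegral.integral_const_mul]
        refine intervalIntegral.integral_mono_on hb.1 (sub hZk hl hb) ((sub hk hl hb).const_mul _)
          fun t ht => mul_le_mul_of_nonneg_right ?_ (hk0 t)
        exact (H t ⟨ht.1, ht.2.trans hb.2⟩).trans (hGmono t ⟨ht.1, ht.2.trans hb.2⟩ b hb ht.2)
      have h0 : ∫ t in b₀..b, k t = 0 :=
        le_antisymm (by simpa using hle) (intervalIntegral.integral_nonneg hb.1 fun t _ => hk0 t)
      rw [h0, mul_zero] at hz
      simp only [hG, pow_zero, one_mul]
      linarith
    | succ N ih =>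
      intro b hb hle
      by_cases hc : ∫ t in b₀..b, k t ≤ N / 2
      · refine (ih b hb hc).trans ?_
        rw [pow_succ]
        nlinarith [pow_pos (two_pos (α := ℝ)) N, mul_nonneg (pow_pos (two_pos (α := ℝ)) N).le hZ₀]
      · push Not at hc
        have hcont : ContinuousOn (fun c => ∫ t in b₀..c, k t) (Icc b₀ b) := by
          have := intervalIntegral.continuousOn_primitive_interval' (sub hk hl hb)
            (left_mem_uIcc)
          rwa [uIcc_of_le hb.1] at this
        obtain ⟨c, hcm, hce⟩ := intermediate_value_Icc hb.1 hcont
          (show (N / 2 : ℝ) ∈ Icc _ _ from ⟨by simp; positivity, hc.le⟩)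
        have hcm' : c ∈ Icc b₀ b₁ := ⟨hcm.1, hcm.2.trans hb.2⟩
        have h1 := ih c hcm' hce.le
        have h2 := intervalIntegral.integral_add_adjacent_intervals (sub hZk hl hcm') (sub hZk hcm' hb)
        have h3 := intervalIntegral.integral_add_adjacent_intervals (sub hk hl hcm') (sub hk hcm' hb)
        have hz : ∫ t in c..b, Z t * k t ≤ G b * ∫ t in c..b, k t := by
          rw [← intervalIntegral.integral_const_mul]
          refine intervalIntegral.integral_mono_on hcm.2 (sub hZk hcm' hb)
            ((sub hk hcm' hb).const_mul _) fun t ht => mul_le_mul_of_nonneg_right ?_ (hk0 t)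
          have ht' : t ∈ Icc b₀ b₁ := ⟨hcm.1.trans ht.1, ht.2.trans hb.2⟩
          exact (H t ht').trans (hGmono t ht' b hb ht.2)
        have hGb : 0 ≤ G b := hZ₀.trans (by simpa [hG] using hGmono b₀ hl b hb hb.1)
        have hle' : ∫ t in c..b, k t ≤ 1 / 2 := by
          simp only at hce
          push_cast at hle
          linarith
        have h4 : G b * ∫ t in c..b, k t ≤ G b * (1 / 2) := mul_le_mul_of_nonneg_left hle' hGb
        have h5 : G b = G c + ∫ t in c..b, Z t * k t := by
          simp only [hG]; linarith
        rw [pow_succ]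
        linarith
  exact (H b₁ ⟨h, le_rfl⟩).trans (claim N b₁ ⟨h, le_rfl⟩ hN)

/-! ### Solutions with controlled linear terms and their truncated energies -/

/-- A solution on the Fourier side, together with bounds for the linear terms. -/
structure EnergySolution (α ν t₀ t₁ B : ℝ) (U : ℝ → Fin 3 → R3 → ℂ)
    (m r : ℝ → Fin 3 → Fin 3 → R3 → ℂ) : Prop where
  meas : ∀ t j, Measurable (U t j)
  meas_m : ∀ t i j, Measurable (m t i j)
  meas_r : ∀ t i j, Measurable (r t i j)
  spec : SpectralSolution α t₀ t₁ U fun t => rhs α ν (U t)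
    (fun i j ζ => cnv (U t i) (U t j) ζ + m t i j ζ) (fun i j ζ => quadS α (U t) i j ζ + r t i j ζ)
  herm : ∀ t ∈ Ioo t₀ t₁, ∀ᵐ ξ, ∀ l, U t l (-ξ) = (starRingEnd ℂ) (U t l ξ)
  bound : ∃ M : ℝ, 0 ≤ M ∧ ∀ t ∈ Ioo t₀ t₁, sob 4 (U t) ≤ ENNReal.ofReal M
  m_three : ∀ t ∈ Ioo t₀ t₁, ∀ i j,
    n2 (fun ξ => κe ξ ^ 3 * ‖m t i j ξ‖ₑ) ≤ ENNReal.ofReal B * sob 3 (U t)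
  m_six : ∀ t ∈ Ioo t₀ t₁, sob 6 (U t) < ⊤ → ∀ i j,
    n2 (fun ξ => κe ξ ^ 6 * ‖m t i j ξ‖ₑ) ≤ ENNReal.ofReal B * sob 6 (U t)
  r_zero : ∀ t ∈ Ioo t₀ t₁, ∀ i j,
    n2 (fun ξ => ‖r t i j ξ‖ₑ) ≤ ENNReal.ofReal B * sob 3 (U t)

/-- The time derivative of the truncated energy with weight `κ^e`. -/
def rate (α ν : ℝ) (U : Fin 3 → R3 → ℂ) (m r : Fin 3 → Fin 3 → R3 → ℂ) (e n : ℕ) : ℝ :=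
  2 * ∫ ξ, cut n (fun ξ => κ ξ ^ e) ξ * ∑ l, ((starRingEnd ℂ) (U l ξ) *
    rhs α ν U (fun i j ζ => cnv (U i) (U j) ζ + m i j ζ)
      (fun i j ζ => quadS α U i j ζ + r i j ζ) l ξ).re

namespace EnergySolution

variable {α ν t₀ t₁ B : ℝ} {U : ℝ → Fin 3 → R3 → ℂ} {m r : ℝ → Fin 3 → Fin 3 → R3 → ℂ}

theorem hasDerivAt_mom (h : EnergySolution α ν t₀ t₁ B U m r) (e n : ℕ) {t : ℝ}
    (ht : t ∈ Ioo t₀ t₁) :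
    HasDerivAt (fun τ => mom (fun ξ => κ ξ ^ e * hel α ξ) (U τ) n) (rate α ν (U t) (m t) (r t) e n) t := by
  have hc : Continuous fun ξ => κ ξ ^ e := by fun_prop
  obtain ⟨M, hM⟩ := exists_abs_cut_le n hc
  have := h.spec.hasDerivAt_energy (measurable_cut n hc) hM (n := n + 1) (by positivity)
    (fun ξ hξ => by
      by_contra hcon
      exact hξ (indicator_of_notMem (s := ann n) hcon _)) ht
  refine this.congr_of_eventuallyEq (Eventually.of_forall fun τ => ?_)
  simp only [mom, cut_mul]
  rfl

/-- The weight `g / hel` in the energy identity turns the energy into this moment. -/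
theorem continuousOn_mom (h : EnergySolution α ν t₀ t₁ B U m r) {g : R3 → ℝ} (hg : Continuous g)
    (n : ℕ) : ContinuousOn (fun t => mom g (U t) n) (Ioo t₀ t₁) := by
  intro t ht
  have hc : Continuous fun ξ => g ξ * (hel α ξ)⁻¹ :=
    hg.mul ((continuous_hel α).inv₀ fun ξ => (hel_pos α ξ).ne')
  obtain ⟨M, hM⟩ := exists_abs_cut_le n hc
  have := h.spec.hasDerivAt_energy (measurable_cut n hc) hM (n := n + 1) (by positivity)
    (fun ξ hξ => by
      by_contra hcon
      exact hξ (indicator_of_notMem (s := ann n) hcon _)) ht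
  refine (this.continuousAt.congr (Eventually.of_forall fun τ => ?_)).continuousWithinAt
  simp only [mom, cut_mul]
  congr 1; ext ξ
  rw [mul_assoc (cut n g ξ), inv_mul_cancel₀ (hel_pos α ξ).ne', mul_one]
  rfl

theorem sob_lt_top (h : EnergySolution α ν t₀ t₁ B U m r) {t : ℝ} (ht : t ∈ Ioo t₀ t₁) {k : ℕ}
    (hk : k ≤ 4) : sob k (U t) < ⊤ := by
  obtain ⟨M, -, hM⟩ := h.bound
  exact ((sob_mono _ hk).trans (hM t ht)).trans_lt ENNReal.ofReal_lt_top

theorem memLp (h : EnergySolution α ν t₀ t₁ B U m r) {t : ℝ} (ht : t ∈ Ioo t₀ t₁) (j : Fin 3) :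
    MemLp (U t j) 2 volume := h.spec.memLp t ht j

/-- On a fixed annulus all powers of `κ` are bounded, in particular the `14 = 20 - 6` needed to undo
the negative weight on the right-hand side. The bound depends on `n` and serves only to justify
integration in time. -/
theorem exists_abs_rate_le (h : EnergySolution α ν t₀ t₁ B U m r) (e n : ℕ) :
    ∃ C, ∀ t ∈ Ioo t₀ t₁, |rate α ν (U t) (m t) (r t) e n| ≤ C := by
  obtain ⟨M, hM0, hM⟩ := h.bound
  obtain ⟨C, hC⟩ := h.spec.bound
  have hc : Continuous fun ξ => κ ξ ^ (e + 14) := by fun_prop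
  obtain ⟨M', hM'⟩ := exists_abs_cut_le n hc
  let K : ℝ≥0∞ := 3 * (ENNReal.ofReal M' * (ENNReal.ofReal M * ENNReal.ofReal C))
  refine ⟨2 * K.toReal, fun t ht => ?_⟩
  rw [rate, abs_mul, abs_two]
  refine mul_le_mul_of_nonneg_left ?_ zero_le_two
  rw [← Real.norm_eq_abs, ← toReal_enorm]
  refine ENNReal.toReal_mono (by finiteness) ((enorm_integral_le_lintegral_enorm _).trans ?_)
  set R := rhs α ν (U t) (fun i j ζ => cnv (U t i) (U t j) ζ + m t i j ζ)
    (fun i j ζ => quadS α (U t) i j ζ + r t i j ζ)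
  have hR := fun l => h.spec.memLp_rhs t ht l
  have hRC := fun l => hC t ht l
  have hp : ∀ ξ, ‖cut n (fun ξ => κ ξ ^ e) ξ * ∑ l, ((starRingEnd ℂ) (U t l ξ) * R l ξ).re‖ₑ ≤
      ∑ l, ENNReal.ofReal M' * (‖U t l ξ‖ₑ * ‖((κ ξ : ℂ) ^ 20)⁻¹ * ((κ ξ : ℂ) ^ 6 * R l ξ)‖ₑ) := by
    intro ξ
    rw [enorm_mul, ← Finset.mul_sum]
    have hκ := κ_ne_zero_complex ξ 1
    rw [pow_one] at hκ
    have h1 : ∀ l, ‖((starRingEnd ℂ) (U t l ξ) * R l ξ).re‖ₑ ≤ ‖(κ ξ : ℂ) ^ 14‖ₑ *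
        (‖U t l ξ‖ₑ * ‖((κ ξ : ℂ) ^ 20)⁻¹ * ((κ ξ : ℂ) ^ 6 * R l ξ)‖ₑ) := fun l => by
      refine le_trans (b := ‖(starRingEnd ℂ) (U t l ξ) * R l ξ‖ₑ) ?_ (le_of_eq ?_)
      · rw [← ofReal_norm, ← ofReal_norm]
        exact ENNReal.ofReal_le_ofReal (Complex.abs_re_le_norm _)
      · rw [← enorm_mul, ← enorm_mul, ← ofReal_norm, ← ofReal_norm]
        congr 1
        rw [norm_mul, RCLike.norm_conj, ← norm_mul]
        congr 1
        field_simp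
    calc _ ≤ ‖cut n (fun ξ => κ ξ ^ e) ξ‖ₑ * ∑ l, ‖(κ ξ : ℂ) ^ 14‖ₑ *
        (‖U t l ξ‖ₑ * ‖((κ ξ : ℂ) ^ 20)⁻¹ * ((κ ξ : ℂ) ^ 6 * R l ξ)‖ₑ) :=
          mul_le_mul_right ((enorm_sum_le _ _).trans (Finset.sum_le_sum fun l _ => h1 l)) _
      _ = ‖cut n (fun ξ => κ ξ ^ (e + 14)) ξ‖ₑ * ∑ l,
        (‖U t l ξ‖ₑ * ‖((κ ξ : ℂ) ^ 20)⁻¹ * ((κ ξ : ℂ) ^ 6 * R l ξ)‖ₑ) := by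
          rw [← Finset.mul_sum, ← mul_assoc]
          congr 1
          rw [enorm_cut_pow, enorm_cut_pow, pow_add, ← ofReal_norm, norm_κ_pow, ← κe_pow]
          ring
      _ ≤ _ := by
          refine mul_le_mul_left ?_ _
          rw [← ofReal_norm]
          exact ENNReal.ofReal_le_ofReal (hM' ξ)
  have hmeas : ∀ l, AEMeasurable (fun ξ => ENNReal.ofReal M' * (‖U t l ξ‖ₑ *
      ‖((κ ξ : ℂ) ^ 20)⁻¹ * ((κ ξ : ℂ) ^ 6 * R l ξ)‖ₑ)) volume := fun l =>
    (((h.meas t l).enorm.aemeasurable).mul (hR l).1.enorm).const_mul _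
  calc _ ≤ ∫⁻ ξ, ∑ l, ENNReal.ofReal M' * (‖U t l ξ‖ₑ *
        ‖((κ ξ : ℂ) ^ 20)⁻¹ * ((κ ξ : ℂ) ^ 6 * R l ξ)‖ₑ) := lintegral_mono hp
    _ = ∑ l, ∫⁻ ξ, ENNReal.ofReal M' * (‖U t l ξ‖ₑ *
        ‖((κ ξ : ℂ) ^ 20)⁻¹ * ((κ ξ : ℂ) ^ 6 * R l ξ)‖ₑ) := lintegral_finsetSum' _ fun l _ => hmeas l
    _ ≤ ∑ _l : Fin 3, ENNReal.ofReal M' * (ENNReal.ofReal M * ENNReal.ofReal C) := by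
        refine Finset.sum_le_sum fun l _ => ?_
        rw [lintegral_const_mul' _ _ ENNReal.ofReal_ne_top]
        refine mul_le_mul_right ((lintegral_mul_le_n2 (h.meas t l).enorm.aemeasurable
          (hR l).1.enorm).trans (mul_le_mul' ?_ ?_)) _
        · have := n2_coord_le_sob (U t) 0 l
          simp only [pow_zero, one_mul] at this
          exact this.trans ((sob_mono _ (Nat.zero_le 4)).trans (hM t ht))
        · rw [n2_eLpNorm]
          exact hRC l
    _ = K := by simp [K]

end EnergySolution

end

/-! ### Differential inequality for the first energy, and a first bound for the dissipation -/

section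


/-- The energy with weight `κ^e (1 + 4π²α²|ξ|²)`. -/
def En (α : ℝ) (e : ℕ) (U : Fin 3 → R3 → ℂ) : ℝ≥0∞ := fullMom (fun ξ => κ ξ ^ e * hel α ξ) U

theorem continuous_κ_mul_hel (α : ℝ) (e : ℕ) : Continuous fun ξ => κ ξ ^ e * hel α ξ := by
  have := continuous_hel α
  fun_prop

theorem κ_mul_hel_nonneg (α : ℝ) (e : ℕ) (ξ : R3) : 0 ≤ κ ξ ^ e * hel α ξ :=
  mul_nonneg (pow_nonneg (κ_pos ξ).le e) (hel_pos α ξ).le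

theorem En_le (α : ℝ) (U : Fin 3 → R3 → ℂ) {e k : ℕ} (h : 2 * k = e + 6) :
    En α e U ≤ ENNReal.ofReal (helC α) * sob k U ^ 2 := by
  refine (fullMom_mono (h := fun ξ => κ ξ ^ (2 * k)) (helC_pos α).le fun ξ => ?_).trans
    (mul_le_mul_right (fullMom_pow_le U k) _)
  rw [h, pow_add, mul_left_comm]
  exact mul_le_mul_of_nonneg_left (hel_le α ξ) (pow_nonneg (κ_pos ξ).le e)

theorem sob_sq_le_En {α : ℝ} (hα : 0 < α) (U : Fin 3 → R3 → ℂ) {e k : ℕ} (h : 2 * k = e + 6) :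
    sob k U ^ 2 ≤ ENNReal.ofReal (3 / helc α) * En α e U := by
  have hp := helc_pos hα
  refine (sob_sq_le U k).trans ?_
  rw [div_eq_mul_inv, ENNReal.ofReal_mul (by norm_num), ENNReal.ofReal_ofNat, mul_assoc]
  refine mul_le_mul_right (fullMom_mono (inv_nonneg.2 hp.le) fun ξ => ?_) _
  rw [h, pow_add, le_inv_mul_iff₀ hp, mul_left_comm]
  exact mul_le_mul_of_nonneg_left (helc_mul_le α ξ) (pow_nonneg (κ_pos ξ).le e)

section

variable {α : ℝ} {U : Fin 3 → R3 → ℂ} {g : R3 → ℝ}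

theorem tendsto_mom (hg : Continuous g) (h0 : ∀ ξ, 0 ≤ g ξ) (hU : ∀ j, Measurable (U j))
    (hM : ∀ j, MemLp (U j) 2 volume) (hf : fullMom g U < ⊤) :
    Tendsto (mom g U) atTop (𝓝 (fullMom g U).toReal) := by
  have h1 : Tendsto (fun n => ENNReal.ofReal (mom g U n)) atTop (𝓝 (fullMom g U)) := by
    rw [← iSup_mom hg h0 hU hM]
    exact tendsto_atTop_iSup fun a b hab => ENNReal.ofReal_le_ofReal (monotone_mom hg h0 hM hab)
  have h2 := (ENNReal.tendsto_toReal hf.ne).comp h1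
  refine h2.congr fun n => ?_
  exact ENNReal.toReal_ofReal (mom_nonneg h0 n)

theorem mom_le_toReal (hg : Continuous g) (h0 : ∀ ξ, 0 ≤ g ξ) (hM : ∀ j, MemLp (U j) 2 volume)
    (hf : fullMom g U < ⊤) (n : ℕ) : mom g U n ≤ (fullMom g U).toReal := by
  rw [← ENNReal.ofReal_le_iff_le_toReal hf.ne]
  exact ofReal_mom_le hg h0 hM n

/-- The truncated norm entering the estimates of the quadratic terms. -/
def cutN (U : Fin 3 → R3 → ℂ) (c n : ℕ) : ℝ := (n2 fun ξ => κe ξ ^ c * (cute n ξ * vn U ξ)).toReal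

theorem cutN_nonneg (U : Fin 3 → R3 → ℂ) (c n : ℕ) : 0 ≤ cutN U c n := ENNReal.toReal_nonneg

theorem cutN_sq_le (hM : ∀ j, MemLp (U j) 2 volume) (c n : ℕ) :
    cutN U c n ^ 2 ≤ 3 * mom (fun ξ => κ ξ ^ (2 * c)) U n := by
  have h := ENNReal.toReal_mono ENNReal.ofReal_ne_top (n2_cute_sq_le hM n c)
  rwa [ENNReal.toReal_pow, ENNReal.toReal_ofReal (mul_nonneg (by norm_num)
    (mom_nonneg (fun ξ => pow_nonneg (κ_pos ξ).le _) n))] at h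

theorem n2_cute_lt_top (hM : ∀ j, MemLp (U j) 2 volume) (c n : ℕ) :
    n2 (fun ξ => κe ξ ^ c * (cute n ξ * vn U ξ)) < ⊤ := by
  have := (n2_cute_sq_le hM n c).trans_lt ENNReal.ofReal_lt_top
  by_contra hcon
  rw [not_lt_top_iff.1 hcon] at this
  simp at this

/-- The constant in the trilinear estimates. -/
def triC (α : ℝ) : ℝ := (quadC α * (2 ^ 5 * 6 + 3) * Kinv).toReal

theorem triC_nonneg (α : ℝ) : 0 ≤ triC α := ENNReal.toReal_nonneg

/-- A bound by a truncated norm that is finite whatever the regularity of the field, and which the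
truncated dissipation can absorb. The condition `s ≤ 5` only serves to have one constant for both
energies. -/
theorem abs_integral_quadE_le (hU : ∀ j, Measurable (U j)) {n e s a c : ℕ} (hs : s ≤ 5)
    (ha : sob a U < ⊤)
    (h1 : s + c = 9 + e) (h2 : s ≤ a) (h3 : (a - s) + a = 5) (h4 : 3 ≤ a)
    (h5 : 3 + e ≤ c) (h6 : (a - 3) + (a - 3) + (c - (3 + e)) = 5) :
    ∫⁻ ζ, κe ζ ^ e * cute n ζ * ‖quadE α U ζ‖ₑ < ⊤ ∧
    |∫ ζ, cut n (fun ξ => κ ξ ^ e) ζ * (quadE α U ζ).re| ≤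
      triC α * (sob a U).toReal ^ 2 * cutN U c n := by
  have hs3 := (sob_mono U h4).trans_lt ha
  have hM := memLp_of_sob_zero hU ((sob_mono U (Nat.zero_le a)).trans_lt ha)
  have hC : quadC α * (2 ^ 5 * 6 + 3) * Kinv ≠ ⊤ := by
    have := quadC_ne_top α
    have := Kinv_lt_top.ne
    finiteness
  have key : ∫⁻ ζ, κe ζ ^ e * cute n ζ * ‖quadE α U ζ‖ₑ ≤
      quadC α * (2 ^ 5 * 6 + 3) * Kinv * sob a U ^ 2 *
        n2 (fun ζ => κe ζ ^ c * (cute n ζ * vn U ζ)) := by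
    refine (lintegral_quadE_le (α := α) hU hs3 (measurable_cute n) h1 h2 h3 h4 h5 h6).trans ?_
    have h26 : (2 : ℝ≥0∞) ^ s ≤ 2 ^ 5 := pow_le_pow_right₀ (by norm_num) hs
    refine mul_le_mul_left (mul_le_mul_left (mul_le_mul_left (mul_le_mul_right ?_ _) _) _) _
    exact add_le_add (mul_le_mul_left h26 _) le_rfl
  have hN := (n2_cute_lt_top hM c n).ne
  have hlt : quadC α * (2 ^ 5 * 6 + 3) * Kinv * sob a U ^ 2 *
        n2 (fun ζ => κe ζ ^ c * (cute n ζ * vn U ζ)) < ⊤ :=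
    ENNReal.mul_lt_top (ENNReal.mul_lt_top hC.lt_top (ENNReal.pow_lt_top ha)) hN.lt_top
  refine ⟨key.trans_lt hlt, ?_⟩
  refine (integrable_cut_re (stronglyMeasurable_quadE hU hs3).aestronglyMeasurable
    (key.trans_lt hlt)).2.trans ((ENNReal.toReal_mono hlt.ne key).trans_eq ?_)
  rw [ENNReal.toReal_mul, ENNReal.toReal_mul, ENNReal.toReal_pow]
  rfl

/-- The truncation destroys the cancellation, which is recovered in the limit by dominated
convergence whenever the field is in `H²`. -/
theorem tendsto_integral_quadE (hU : ∀ j, Measurable (U j)) (h6 : sob 6 U < ⊤)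
    (hdiv : ∀ᵐ ξ, ∑ j, (ξ j : ℂ) * U j ξ = 0)
    (hherm : ∀ᵐ ξ, ∀ l, U l (-ξ) = (starRingEnd ℂ) (U l ξ)) :
    Tendsto (fun n => ∫ ζ, cut n (fun ξ => κ ξ ^ 0) ζ * (quadE α U ζ).re) atTop (𝓝 0) := by
  have h3 := (sob_mono U (show 3 ≤ 6 by norm_num)).trans_lt h6
  have h4 := (sob_mono U (show 4 ≤ 6 by norm_num)).trans_lt h6
  have hm := stronglyMeasurable_quadE (α := α) hU h3
  have hi : Integrable (quadE α U) volume := by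
    refine ⟨hm.aestronglyMeasurable, ?_⟩
    rw [hasFiniteIntegral_iff_enorm]
    have := lintegral_quadE_le (α := α) hU h3 (w := fun _ => 1) measurable_const (e := 0) (s := 3)
      (a := 4) (c := 6) (by norm_num) (by norm_num) (by norm_num) (by norm_num) (by norm_num)
      (by norm_num)
    simp only [pow_zero, one_mul] at this
    refine this.trans_lt ?_
    have h := quadC_ne_top α
    have h' := Kinv_lt_top.ne
    have h6' := h6.ne
    change _ * sob 6 U < ⊤
    finiteness
  have hlim : ∫ ζ, (quadE α U ζ).re = 0 := by
    have := integral_re hi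
    rw [integral_quadE_eq_zero hU h4 h6 hdiv hherm] at this
    simpa using this
  rw [← hlim]
  refine tendsto_integral_of_dominated_convergence (fun ζ => ‖quadE α U ζ‖) (fun n => ?_) hi.norm
    (fun n => ae_of_all _ fun ζ => ?_) ?_
  · exact (measurable_cut n (by fun_prop)).aestronglyMeasurable.mul
      (Complex.continuous_re.comp_aestronglyMeasurable hm.aestronglyMeasurable)
  · rw [norm_mul]
    refine (mul_le_of_le_one_left (norm_nonneg _) ?_).trans (Complex.abs_re_le_norm _)
    by_cases h : ζ ∈ ann n <;> simp [cut, h]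
  · have h : ∀ᵐ ξ : R3, ξ ≠ 0 := by simp [ae_iff]
    filter_upwards [h] with ζ hζ
    obtain ⟨N, hN⟩ := mem_ann_of_ne hζ
    refine tendsto_const_nhds.congr' ?_
    filter_upwards [eventually_ge_atTop N] with n hn
    simp [cut, ann_mono hn hN]

end

namespace EnergySolution

variable {α ν t₀ t₁ B : ℝ} {U : ℝ → Fin 3 → R3 → ℂ} {m r : ℝ → Fin 3 → Fin 3 → R3 → ℂ}

/-- The dissipation rate. -/
def dis (U : ℝ → Fin 3 → R3 → ℂ) (t : ℝ) : ℝ := (fullMom (fun ξ => κ ξ ^ (2 * 6)) (U t)).toReal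

theorem dis_nonneg (U : ℝ → Fin 3 → R3 → ℂ) (t : ℝ) : 0 ≤ dis U t := ENNReal.toReal_nonneg

theorem κ_pow_nonneg (ξ : R3) (k : ℕ) : 0 ≤ κ ξ ^ k := pow_nonneg (κ_pos ξ).le k

theorem m_le (h : EnergySolution α ν t₀ t₁ B U m r) (hB : 0 ≤ B) {t : ℝ} (ht : t ∈ Ioo t₀ t₁)
    (i j : Fin 3) : n2 (fun ξ => κe ξ ^ 3 * ‖m t i j ξ‖ₑ) ≤
      ENNReal.ofReal (B * (sob 3 (U t)).toReal) := by
  rw [ENNReal.ofReal_mul hB, ENNReal.ofReal_toReal (h.sob_lt_top ht (by norm_num)).ne]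
  exact h.m_three t ht i j

theorem r_le (h : EnergySolution α ν t₀ t₁ B U m r) (hB : 0 ≤ B) {t : ℝ} (ht : t ∈ Ioo t₀ t₁)
    (i j : Fin 3) : n2 (fun ξ => ‖r t i j ξ‖ₑ) ≤ ENNReal.ofReal (B * (sob 3 (U t)).toReal) := by
  rw [ENNReal.ofReal_mul hB, ENNReal.ofReal_toReal (h.sob_lt_top ht (by norm_num)).ne]
  exact h.r_zero t ht i j

theorem En_zero_lt_top (h : EnergySolution α ν t₀ t₁ B U m r) {t : ℝ} (ht : t ∈ Ioo t₀ t₁) :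
    En α 0 (U t) < ⊤ :=
  (En_le α (U t) (k := 3) (by norm_num)).trans_lt (ENNReal.mul_lt_top ENNReal.ofReal_lt_top
    (ENNReal.pow_lt_top (h.sob_lt_top ht (by norm_num))))

/-- The constant of the dissipative term. -/
def cdis (α ν : ℝ) : ℝ := 8 * Real.pi ^ 2 * ν * helc α

/-- The constant of the energy term. -/
def cen (α ν B : ℝ) : ℝ :=
  8 * Real.pi ^ 2 * ν + 9 * (126 * B * (helC α + 1)) ^ 2 / (2 * cdis α ν * helc α)

theorem cdis_pos (hα : 0 < α) (hν : 0 < ν) : 0 < cdis α ν := by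
  have := helc_pos hα
  unfold cdis; positivity

theorem cen_nonneg (hα : 0 < α) (hν : 0 < ν) : 0 ≤ cen α ν B := by
  have := helc_pos hα
  have := cdis_pos hα hν
  unfold cen; positivity

/-- Half of the dissipation absorbs the linear terms by Young's inequality. The constants involve
`α`, `ν` and `B` only, because the quadratic term is kept exactly. -/
theorem rate_zero_le (h : EnergySolution α ν t₀ t₁ B U m r) (hα : 0 < α) (hν : 0 < ν) (hB : 0 ≤ B)
    {t : ℝ} (ht : t ∈ Ioo t₀ t₁) (n : ℕ) :
    rate α ν (U t) (m t) (r t) 0 n ≤ -(cdis α ν / 2) * mom (fun ξ => κ ξ ^ (2 * 6)) (U t) n +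
      cen α ν B * (En α 0 (U t)).toReal +
      2 * ∫ ζ, cut n (fun ξ => κ ξ ^ 0) ζ * (quadE α (U t) ζ).re := by
  have hs3 := h.sob_lt_top ht (show 3 ≤ 4 by norm_num)
  have hs0 : 0 ≤ (sob 3 (U t)).toReal := ENNReal.toReal_nonneg
  have hq := (abs_integral_quadE_le (α := α) (n := n) (e := 0) (s := 3) (c := 6) (h.meas t) (by norm_num)
    (h.sob_lt_top ht (le_refl 4)) (by norm_num) (by norm_num) (by norm_num) (by norm_num)
    (by norm_num) (by norm_num)).1
  have key := energy_rate_le (α := α) hν (h.meas t) hs3 (h.meas_m t) (h.meas_r t) (c := 6) (d := 3)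
    (e := 0) (n := n) (by norm_num) (by norm_num) (by norm_num) (mul_nonneg hB hs0)
    (mul_nonneg hB hs0) (h.m_le hB ht) (h.r_le hB ht) hq
  have hE := mom_le_toReal (continuous_κ_mul_hel α 0) (κ_mul_hel_nonneg α 0) (h.memLp ht)
    (h.En_zero_lt_top ht) n
  have hN := cutN_sq_le (h.memLp ht) 6 n
  have hN0 := cutN_nonneg (U t) 6 n
  have hs := ENNReal.toReal_mono (ENNReal.mul_lt_top ENNReal.ofReal_lt_top (h.En_zero_lt_top ht)).ne
    (sob_sq_le_En hα (U t) (e := 0) (k := 3) (by norm_num))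
  have hc := helc_pos hα
  have hd := cdis_pos hα hν
  rw [ENNReal.toReal_pow, ENNReal.toReal_mul, ENNReal.toReal_ofReal (by positivity)] at hs
  change _ ≤ -cdis α ν * _ + _ + 126 * _ * cutN (U t) 6 n + _ at key
  change mom _ _ _ ≤ (En α 0 (U t)).toReal at hE
  refine key.trans ?_
  set s := (sob 3 (U t)).toReal
  set N := cutN (U t) 6 n
  set E := (En α 0 (U t)).toReal
  set G := 126 * B * (helC α + 1) with hG
  have y1 : 126 * (helC α * (B * s) + B * s) * N = G * s * N := by rw [hG]; ring
  -- The coefficient `cdis / 6` is chosen because `N²` is at most three times the truncated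
  -- dissipation, so exactly half of the latter is spent.
  have y2 : G * s * N ≤ cdis α ν / 6 * N ^ 2 + 3 * G ^ 2 / (2 * cdis α ν) * s ^ 2 := by
    have := sq_nonneg (cdis α ν / 6 * N - G * s / 2)
    have e : cdis α ν / 6 * N ^ 2 + 3 * G ^ 2 / (2 * cdis α ν) * s ^ 2 - G * s * N =
      (6 / cdis α ν) * (cdis α ν / 6 * N - G * s / 2) ^ 2 := by field_simp; ring
    have : 0 ≤ (6 / cdis α ν) * (cdis α ν / 6 * N - G * s / 2) ^ 2 := by positivity
    linarith
  have y3 : 3 * G ^ 2 / (2 * cdis α ν) * s ^ 2 ≤ 3 * G ^ 2 / (2 * cdis α ν) * (3 / helc α * E) :=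
    mul_le_mul_of_nonneg_left hs (by positivity)
  have y4 : 3 * G ^ 2 / (2 * cdis α ν) * (3 / helc α * E) = 9 * G ^ 2 / (2 * cdis α ν * helc α) * E := by
    field_simp; ring
  have y5 : cdis α ν / 6 * N ^ 2 ≤ cdis α ν / 2 * mom (fun ξ => κ ξ ^ (2 * 6)) (U t) n := by
    have := mul_le_mul_of_nonneg_left hN (show 0 ≤ cdis α ν / 6 by positivity)
    linarith
  have y6 : 8 * Real.pi ^ 2 * ν * mom (fun ξ => κ ξ ^ 0 * hel α ξ) (U t) n ≤ 8 * Real.pi ^ 2 * ν * E :=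
    mul_le_mul_of_nonneg_left hE (by positivity)
  rw [y1, cen]
  linarith

theorem aemeasurable_fullMom (h : EnergySolution α ν t₀ t₁ B U m r) {g : R3 → ℝ} (hg : Continuous g)
    (h0 : ∀ ξ, 0 ≤ g ξ) : AEMeasurable (fun t => fullMom g (U t)) (volume.restrict (Ioo t₀ t₁)) := by
  have h1 : AEMeasurable (fun t => ⨆ n, ENNReal.ofReal (mom g (U t) n)) (volume.restrict (Ioo t₀ t₁)) :=
    AEMeasurable.iSup fun n => ((h.continuousOn_mom hg n).aemeasurable measurableSet_Ioo).ennreal_ofReal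
  refine h1.congr ((ae_restrict_iff' measurableSet_Ioo).2 (ae_of_all _ fun t ht => ?_))
  exact iSup_mom hg h0 (h.meas t) (h.memLp ht)

/-- A preliminary bound that ignores the cancellation: the quadratic term is estimated by the
supremum of the `H^{4/3}` norm and absorbed into another quarter of the dissipation. The result is
uniform in the truncation but not in the time interval. It is needed only to know that the
dissipation is integrable. -/
theorem exists_integral_mom_le (h : EnergySolution α ν t₀ t₁ B U m r) (hα : 0 < α) (hν : 0 < ν)
    (hB : 0 ≤ B) : ∃ K, ∀ b₀ b₁, t₀ < b₀ → b₀ ≤ b₁ → b₁ < t₁ → ∀ n,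
      ∫ t in b₀..b₁, mom (fun ξ => κ ξ ^ (2 * 6)) (U t) n ≤ K := by
  obtain ⟨M, hM0, hM⟩ := h.bound
  have hd := cdis_pos hα hν
  have hcen : 0 ≤ cen α ν B := cen_nonneg hα hν
  have hC := helC_pos α
  have hs : ∀ t ∈ Ioo t₀ t₁, ∀ k ≤ 4, (sob k (U t)).toReal ≤ M := fun t ht k hk =>
    ENNReal.toReal_le_of_le_ofReal hM0 ((sob_mono _ hk).trans (hM t ht))
  have hE : ∀ t ∈ Ioo t₀ t₁, (En α 0 (U t)).toReal ≤ helC α * M ^ 2 := fun t ht => by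
    have := ENNReal.toReal_mono (ENNReal.mul_lt_top ENNReal.ofReal_lt_top
      (ENNReal.pow_lt_top (h.sob_lt_top ht (show 3 ≤ 4 by norm_num)))).ne
      (En_le α (U t) (e := 0) (k := 3) (by norm_num))
    rw [ENNReal.toReal_mul, ENNReal.toReal_ofReal hC.le, ENNReal.toReal_pow] at this
    refine this.trans (mul_le_mul_of_nonneg_left ?_ hC.le)
    exact pow_le_pow_left₀ ENNReal.toReal_nonneg (hs t ht 3 (by norm_num)) 2
  set K := cen α ν B * (helC α * M ^ 2) + 12 / cdis α ν * (triC α * M ^ 2) ^ 2 with hK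
  have hr : ∀ t ∈ Ioo t₀ t₁, ∀ n, rate α ν (U t) (m t) (r t) 0 n ≤
      K - cdis α ν / 4 * mom (fun ξ => κ ξ ^ (2 * 6)) (U t) n := fun t ht n => by
    have h1 := h.rate_zero_le hα hν hB ht n
    have h2 := (abs_integral_quadE_le (α := α) (n := n) (e := 0) (s := 3) (c := 6) (h.meas t)
      (by norm_num) (h.sob_lt_top ht (le_refl 4)) (by norm_num) (by norm_num) (by norm_num)
      (by norm_num) (by norm_num) (by norm_num)).2
    have h3 := (le_abs_self _).trans h2
    have h4 : triC α * (sob 4 (U t)).toReal ^ 2 * cutN (U t) 6 n ≤ triC α * M ^ 2 * cutN (U t) 6 n := by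
      refine mul_le_mul_of_nonneg_right (mul_le_mul_of_nonneg_left ?_ (triC_nonneg α)) (cutN_nonneg _ _ _)
      exact pow_le_pow_left₀ ENNReal.toReal_nonneg (hs t ht 4 le_rfl) 2
    have hN := cutN_sq_le (h.memLp ht) 6 n
    set N := cutN (U t) 6 n
    set Q := triC α * M ^ 2
    have h5 : 2 * (Q * N) ≤ cdis α ν / 12 * N ^ 2 + 12 / cdis α ν * Q ^ 2 := by
      have e : cdis α ν / 12 * N ^ 2 + 12 / cdis α ν * Q ^ 2 - 2 * (Q * N) =
        (12 / cdis α ν) * (cdis α ν / 12 * N - Q) ^ 2 := by field_simp; ring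
      have : 0 ≤ (12 / cdis α ν) * (cdis α ν / 12 * N - Q) ^ 2 := by positivity
      linarith
    have h6 : cdis α ν / 12 * N ^ 2 ≤ cdis α ν / 4 * mom (fun ξ => κ ξ ^ (2 * 6)) (U t) n := by
      have := mul_le_mul_of_nonneg_left hN (show 0 ≤ cdis α ν / 12 by positivity)
      linarith
    have h7 := mul_le_mul_of_nonneg_left (hE t ht) hcen
    rw [hK]
    linarith
  refine ⟨4 / cdis α ν * (helC α * M ^ 2 + K * (t₁ - t₀)), fun b₀ b₁ h₀ h₀₁ h₁ n => ?_⟩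
  obtain ⟨C, hCr⟩ := h.exists_abs_rate_le 0 n
  have hsub : Icc b₀ b₁ ⊆ Ioo t₀ t₁ := fun t ht => ⟨h₀.trans_le ht.1, ht.2.trans_lt h₁⟩
  have hi : IntervalIntegrable (fun t => mom (fun ξ => κ ξ ^ (2 * 6)) (U t) n) volume b₀ b₁ :=
    ContinuousOn.intervalIntegrable (by
      rw [uIcc_of_le h₀₁]
      exact (h.continuousOn_mom (by fun_prop) n).mono hsub)
  have key := ftc_le_of_ae (fun t ht => h.hasDerivAt_mom 0 n ht) hCr h₀ h₀₁ h₁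
    (intervalIntegrable_const.sub (hi.const_mul (cdis α ν / 4)))
    (ae_of_all _ fun t ht => hr t (hsub (Ioo_subset_Icc_self ht)) n)
  rw [intervalIntegral.integral_sub intervalIntegrable_const (hi.const_mul _),
    intervalIntegral.integral_const, intervalIntegral.integral_const_mul, smul_eq_mul] at key
  have hb0 : b₀ ∈ Ioo t₀ t₁ := hsub ⟨le_rfl, h₀₁⟩
  have e1 : mom (fun ξ => κ ξ ^ 0 * hel α ξ) (U b₀) n ≤ helC α * M ^ 2 :=
    (mom_le_toReal (continuous_κ_mul_hel α 0) (κ_mul_hel_nonneg α 0) (h.memLp hb0)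
      (h.En_zero_lt_top hb0) n).trans (hE b₀ hb0)
  have e2 : 0 ≤ mom (fun ξ => κ ξ ^ 0 * hel α ξ) (U b₁) n := mom_nonneg (κ_mul_hel_nonneg α 0) n
  have hK0 : 0 ≤ K := by
    rw [hK]; positivity
  have e3 : (b₁ - b₀) * K ≤ (t₁ - t₀) * K := mul_le_mul_of_nonneg_right (by linarith) hK0
  rw [div_mul_eq_mul_div, le_div_iff₀ hd]
  linarith

end EnergySolution

end

/-! ### Integrability of the dissipation and the first energy inequality -/

section

namespace EnergySolution

variable {α ν t₀ t₁ B b₀ b₁ : ℝ} {U : ℝ → Fin 3 → R3 → ℂ} {m r : ℝ → Fin 3 → Fin 3 → R3 → ℂ}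

theorem continuous_κ_pow (k : ℕ) : Continuous fun ξ => κ ξ ^ k := by fun_prop

theorem aemeasurable_fullMom_Ioc (h : EnergySolution α ν t₀ t₁ B U m r) {g : R3 → ℝ}
    (hg : Continuous g) (h0 : ∀ ξ, 0 ≤ g ξ) (h₀ : t₀ < b₀) (h₁ : b₁ < t₁) :
    AEMeasurable (fun t => fullMom g (U t)) (volume.restrict (Ioc b₀ b₁)) :=
  have hs : Ioc b₀ b₁ ⊆ Ioo t₀ t₁ := fun _ ht => ⟨h₀.trans ht.1, ht.2.trans_lt h₁⟩
  (h.aemeasurable_fullMom hg h0).mono_measure (Measure.restrict_mono hs le_rfl)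

theorem lintegral_fullMom_lt_top (h : EnergySolution α ν t₀ t₁ B U m r) (hα : 0 < α) (hν : 0 < ν)
    (hB : 0 ≤ B) (h₀ : t₀ < b₀) (h₀₁ : b₀ ≤ b₁) (h₁ : b₁ < t₁) :
    ∫⁻ t in Ioc b₀ b₁, fullMom (fun ξ => κ ξ ^ (2 * 6)) (U t) < ⊤ := by
  obtain ⟨K, hK⟩ := h.exists_integral_mom_le hα hν hB
  have hsub : Icc b₀ b₁ ⊆ Ioo t₀ t₁ := fun t ht => ⟨h₀.trans_le ht.1, ht.2.trans_lt h₁⟩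
  have hcont := fun n => (h.continuousOn_mom (continuous_κ_pow (2 * 6)) n).mono hsub
  have e : ∫⁻ t in Ioc b₀ b₁, fullMom (fun ξ => κ ξ ^ (2 * 6)) (U t) =
      ∫⁻ t in Ioc b₀ b₁, ⨆ n, ENNReal.ofReal (mom (fun ξ => κ ξ ^ (2 * 6)) (U t) n) := by
    refine setLIntegral_congr_fun measurableSet_Ioc fun t ht => ?_
    exact (iSup_mom (continuous_κ_pow _) (fun ξ => κ_pow_nonneg ξ _) (h.meas t)
      (h.memLp (hsub (Ioc_subset_Icc_self ht)))).symm
  rw [e, lintegral_iSup' (fun n => (((hcont n).mono Ioc_subset_Icc_self).aemeasurable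
    measurableSet_Ioc).ennreal_ofReal)]
  · refine lt_of_le_of_lt (iSup_le fun n => ?_) (ENNReal.ofReal_lt_top (r := K))
    rw [← ofReal_integral_eq_lintegral_ofReal]
    · rw [← intervalIntegral.integral_of_le h₀₁]
      exact ENNReal.ofReal_le_ofReal (hK b₀ b₁ h₀ h₀₁ h₁ n)
    · exact ((hcont n).integrableOn_Icc).mono_set Ioc_subset_Icc_self
    · exact ae_of_all _ fun t => mom_nonneg (fun ξ => κ_pow_nonneg ξ _) n
  · refine (ae_restrict_iff' measurableSet_Ioc).2 (ae_of_all _ fun t ht a b hab => ?_)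
    exact ENNReal.ofReal_le_ofReal (monotone_mom (continuous_κ_pow _) (fun ξ => κ_pow_nonneg ξ _)
      (h.memLp (hsub (Ioc_subset_Icc_self ht))) hab)

theorem ae_fullMom_lt_top (h : EnergySolution α ν t₀ t₁ B U m r) (hα : 0 < α) (hν : 0 < ν)
    (hB : 0 ≤ B) (h₀ : t₀ < b₀) (h₀₁ : b₀ ≤ b₁) (h₁ : b₁ < t₁) :
    ∀ᵐ t, t ∈ Ioc b₀ b₁ → fullMom (fun ξ => κ ξ ^ (2 * 6)) (U t) < ⊤ :=
  (ae_restrict_iff' measurableSet_Ioc).1 (ae_lt_top' (h.aemeasurable_fullMom_Ioc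
    (continuous_κ_pow _) (fun ξ => κ_pow_nonneg ξ _) h₀ h₁)
    (h.lintegral_fullMom_lt_top hα hν hB h₀ h₀₁ h₁).ne)

theorem sob_six_lt_top {U : Fin 3 → R3 → ℂ} (hf : fullMom (fun ξ => κ ξ ^ (2 * 6)) U < ⊤) :
    sob 6 U < ⊤ := by
  have := (sob_sq_le U 6).trans_lt (ENNReal.mul_lt_top (by norm_num) hf)
  by_contra hcon
  rw [not_lt_top_iff.1 hcon] at this
  simp at this

theorem integrableOn_dis (h : EnergySolution α ν t₀ t₁ B U m r) (hα : 0 < α) (hν : 0 < ν)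
    (hB : 0 ≤ B) (h₀ : t₀ < b₀) (h₀₁ : b₀ ≤ b₁) (h₁ : b₁ < t₁) :
    IntegrableOn (dis U) (Ioc b₀ b₁) :=
  integrable_toReal_of_lintegral_ne_top (h.aemeasurable_fullMom_Ioc
    (continuous_κ_pow _) (fun ξ => κ_pow_nonneg ξ _) h₀ h₁)
    (h.lintegral_fullMom_lt_top hα hν hB h₀ h₀₁ h₁).ne

theorem integrableOn_En_zero (h : EnergySolution α ν t₀ t₁ B U m r) (h₀ : t₀ < b₀) (h₁ : b₁ < t₁) :
    IntegrableOn (fun t => (En α 0 (U t)).toReal) (Ioc b₀ b₁) := by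
  obtain ⟨M, hM0, hM⟩ := h.bound
  refine Integrable.of_bound (h.aemeasurable_fullMom_Ioc (continuous_κ_mul_hel α 0)
    (κ_mul_hel_nonneg α 0) h₀ h₁).ennreal_toReal.aestronglyMeasurable (helC α * M ^ 2) ?_
  refine (ae_restrict_iff' measurableSet_Ioc).2 (ae_of_all _ fun t ht => ?_)
  have ht' : t ∈ Ioo t₀ t₁ := ⟨h₀.trans ht.1, ht.2.trans_lt h₁⟩
  rw [Real.norm_of_nonneg ENNReal.toReal_nonneg]
  refine ENNReal.toReal_le_of_le_ofReal (by have := helC_pos α; positivity) ?_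
  rw [ENNReal.ofReal_mul (helC_pos α).le, ENNReal.ofReal_pow hM0]
  refine (En_le α (U t) (e := 0) (k := 3) (by norm_num)).trans (mul_le_mul_right ?_ _)
  exact pow_le_pow_left' ((sob_mono _ (by norm_num)).trans (hM t ht')) 2

/-- The truncated inequality is integrated in time before `n → ∞`. At almost every time the field is
in `H²` and the quadratic remainder tends to zero. The non-uniform constant `Q` occurs only in the
dominating function `2 Q (1 + 3 dis)` and is gone in the limit. -/
theorem energy_le (h : EnergySolution α ν t₀ t₁ B U m r) (hα : 0 < α) (hν : 0 < ν)
    (hB : 0 ≤ B) (h₀ : t₀ < b₀) (h₀₁ : b₀ ≤ b₁) (h₁ : b₁ < t₁) :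
    (En α 0 (U b₁)).toReal + cdis α ν / 2 * ∫ t in b₀..b₁, dis U t ≤
      (En α 0 (U b₀)).toReal + cen α ν B * ∫ t in b₀..b₁, (En α 0 (U t)).toReal := by
  obtain ⟨M, hM0, hM⟩ := h.bound
  have hsub : Icc b₀ b₁ ⊆ Ioo t₀ t₁ := fun t ht => ⟨h₀.trans_le ht.1, ht.2.trans_lt h₁⟩
  have hsub' : Ioc b₀ b₁ ⊆ Ioo t₀ t₁ := Ioc_subset_Icc_self.trans hsub
  have hk := continuous_κ_pow (2 * 6)
  have hk0 : ∀ ξ, 0 ≤ κ ξ ^ (2 * 6) := fun ξ => κ_pow_nonneg ξ _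
  have hcont := fun n => (h.continuousOn_mom hk n).mono hsub
  have hfin := h.ae_fullMom_lt_top hα hν hB h₀ h₀₁ h₁
  have hdis := h.integrableOn_dis hα hν hB h₀ h₀₁ h₁
  have hEi := h.integrableOn_En_zero (b₀ := b₀) h₀ h₁
  let f : ℕ → ℝ → ℝ := fun n t => mom (fun ξ => κ ξ ^ 0 * hel α ξ) (U t) n
  let d : ℕ → ℝ → ℝ := fun n t => mom (fun ξ => κ ξ ^ (2 * 6)) (U t) n
  -- The positive part of the excess of the actual rate over the desired one. Expressing the rate by
  -- `deriv` makes measurability in time automatic, and `g n` is squeezed between zero and the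
  -- quadratic remainder.
  let g : ℕ → ℝ → ℝ := fun n t =>
    max 0 (deriv (f n) t + cdis α ν / 2 * d n t - cen α ν B * (En α 0 (U t)).toReal)
  let Q : ℝ := triC α * M ^ 2
  have hQ : 0 ≤ Q := mul_nonneg (triC_nonneg α) (sq_nonneg M)
  have hdm : ∀ n, AEStronglyMeasurable (d n) (volume.restrict (Ioc b₀ b₁)) := fun n =>
    ((hcont n).mono Ioc_subset_Icc_self).aestronglyMeasurable measurableSet_Ioc
  have hd_le : ∀ n, ∀ᵐ t ∂(volume.restrict (Ioc b₀ b₁)), ‖d n t‖ ≤ dis U t := fun n => by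
    refine (ae_restrict_iff' measurableSet_Ioc).2 ?_
    filter_upwards [hfin] with t ht hmem
    rw [Real.norm_of_nonneg (mom_nonneg hk0 n)]
    exact mom_le_toReal hk hk0 (h.memLp (hsub' hmem)) (ht hmem) n
  have hdi : ∀ n, IntegrableOn (d n) (Ioc b₀ b₁) := fun n => hdis.mono' (hdm n) (hd_le n)
  have hgm : ∀ n, AEStronglyMeasurable (g n) (volume.restrict (Ioc b₀ b₁)) := fun n => by
    refine aestronglyMeasurable_const.sup ?_
    exact ((measurable_deriv (f n)).aestronglyMeasurable.add ((hdm n).const_mul _)).sub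
      (hEi.1.const_mul _)
  have hgle : ∀ n, ∀ t ∈ Ioc b₀ b₁, g n t ≤
      2 * |∫ ζ, cut n (fun ξ => κ ξ ^ 0) ζ * (quadE α (U t) ζ).re| := fun n t ht => by
    refine max_le (by positivity) ?_
    rw [(h.hasDerivAt_mom 0 n (hsub' ht)).deriv]
    have := h.rate_zero_le hα hν hB (hsub' ht) n
    have h2 := le_abs_self (∫ ζ, cut n (fun ξ => κ ξ ^ 0) ζ * (quadE α (U t) ζ).re)
    simp only [d]
    linarith
  have hgb : ∀ n, ∀ᵐ t ∂(volume.restrict (Ioc b₀ b₁)), ‖g n t‖ ≤ 2 * Q * (1 + 3 * dis U t) := fun n => by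
    filter_upwards [ae_restrict_mem measurableSet_Ioc, hd_le n] with t ht hdt
    rw [Real.norm_of_nonneg (le_max_left _ _)]
    refine (hgle n t ht).trans ?_
    have h2 := (abs_integral_quadE_le (α := α) (n := n) (e := 0) (s := 3) (c := 6) (h.meas t)
      (by norm_num) (h.sob_lt_top (hsub' ht) (le_refl 4)) (by norm_num) (by norm_num) (by norm_num)
      (by norm_num) (by norm_num) (by norm_num)).2
    have hs : (sob 4 (U t)).toReal ≤ M := ENNReal.toReal_le_of_le_ofReal hM0 (hM t (hsub' ht))
    have h4 : triC α * (sob 4 (U t)).toReal ^ 2 * cutN (U t) 6 n ≤ Q * cutN (U t) 6 n := by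
      refine mul_le_mul_of_nonneg_right (mul_le_mul_of_nonneg_left ?_ (triC_nonneg α)) (cutN_nonneg _ _ _)
      exact pow_le_pow_left₀ ENNReal.toReal_nonneg hs 2
    have hN := cutN_sq_le (h.memLp (hsub' ht)) 6 n
    rw [Real.norm_of_nonneg (mom_nonneg hk0 n)] at hdt
    have h5 : cutN (U t) 6 n ≤ 1 + 3 * dis U t := by
      have h6 : cutN (U t) 6 n ^ 2 ≤ 3 * dis U t := by linarith
      nlinarith [sq_nonneg (cutN (U t) 6 n - 1), cutN_nonneg (U t) 6 n]
    have h7 := mul_le_mul_of_nonneg_left h5 hQ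
    linarith
  have hdom : IntegrableOn (fun t => 2 * Q * (1 + 3 * dis U t)) (Ioc b₀ b₁) :=
    ((integrable_const _).add (hdis.const_mul 3)).const_mul _
  have hgi : ∀ n, IntegrableOn (g n) (Ioc b₀ b₁) := fun n => hdom.mono' (hgm n) (hgb n)
  have hglim : Tendsto (fun n => ∫ t in Ioc b₀ b₁, g n t) atTop (𝓝 0) := by
    have := tendsto_integral_of_dominated_convergence (F := g) (f := fun _ => (0 : ℝ)) _ hgm hdom hgb (by
      refine (ae_restrict_iff' measurableSet_Ioc).2 ?_
      filter_upwards [hfin] with t ht hmem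
      have h6 := sob_six_lt_top (ht hmem)
      have hT := tendsto_integral_quadE (α := α) (h.meas t) h6 (h.spec.divFree t (hsub' hmem))
        (h.herm t (hsub' hmem))
      have hT2 := hT.abs.const_mul 2
      rw [abs_zero, mul_zero] at hT2
      exact squeeze_zero (fun n => le_max_left _ _) (fun n => hgle n t hmem) hT2)
    simpa using this
  have hdlim : Tendsto (fun n => ∫ t in Ioc b₀ b₁, d n t) atTop (𝓝 (∫ t in Ioc b₀ b₁, dis U t)) := by
    refine tendsto_integral_of_dominated_convergence _ hdm hdis hd_le ?_
    refine (ae_restrict_iff' measurableSet_Ioc).2 ?_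
    filter_upwards [hfin] with t ht hmem
    exact tendsto_mom hk hk0 (h.meas t) (h.memLp (hsub' hmem)) (ht hmem)
  have hflim : ∀ t ∈ Icc b₀ b₁, Tendsto (fun n => f n t) atTop (𝓝 (En α 0 (U t)).toReal) :=
    fun t ht => tendsto_mom (continuous_κ_mul_hel α 0) (κ_mul_hel_nonneg α 0) (h.meas t)
      (h.memLp (hsub ht)) (h.En_zero_lt_top (hsub ht))
  have hineq : ∀ n, f n b₁ - f n b₀ ≤ cen α ν B * (∫ t in Ioc b₀ b₁, (En α 0 (U t)).toReal) -
      cdis α ν / 2 * (∫ t in Ioc b₀ b₁, d n t) + ∫ t in Ioc b₀ b₁, g n t := fun n => by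
    obtain ⟨C, hC⟩ := h.exists_abs_rate_le 0 n
    have j1 := hEi.const_mul (cen α ν B)
    have j2 := (hdi n).const_mul (cdis α ν / 2)
    have j3 : IntegrableOn (fun t => cen α ν B * (En α 0 (U t)).toReal - cdis α ν / 2 * d n t)
      (Ioc b₀ b₁) := j1.sub j2
    have j4 : IntegrableOn (fun t => cen α ν B * (En α 0 (U t)).toReal - cdis α ν / 2 * d n t + g n t)
      (Ioc b₀ b₁) := j3.add (hgi n)
    have key := ftc_le_of_ae (φ := fun t => cen α ν B * (En α 0 (U t)).toReal -
      cdis α ν / 2 * d n t + g n t) (fun t ht => h.hasDerivAt_mom 0 n ht) hC h₀ h₀₁ h₁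
      ((intervalIntegrable_iff_integrableOn_Ioc_of_le h₀₁).2 j4)
      (ae_of_all _ fun t ht => by
        have h1 := le_max_right 0 (deriv (f n) t + cdis α ν / 2 * d n t - cen α ν B * (En α 0 (U t)).toReal)
        rw [(h.hasDerivAt_mom 0 n (hsub (Ioo_subset_Icc_self ht))).deriv] at h1
        simp only [g]
        rw [(h.hasDerivAt_mom 0 n (hsub (Ioo_subset_Icc_self ht))).deriv]
        linarith)
    rw [intervalIntegral.integral_of_le h₀₁, integral_add j3 (hgi n), integral_sub j1 j2,
      integral_const_mul, integral_const_mul] at key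
    exact key
  have hl := (hflim b₁ ⟨h₀₁, le_rfl⟩).sub (hflim b₀ ⟨le_rfl, h₀₁⟩)
  have hr := ((tendsto_const_nhds (x := cen α ν B * (∫ t in Ioc b₀ b₁, (En α 0 (U t)).toReal))).sub
    (hdlim.const_mul (cdis α ν / 2))).add hglim
  have := le_of_tendsto_of_tendsto' hl hr hineq
  rw [intervalIntegral.integral_of_le h₀₁, intervalIntegral.integral_of_le h₀₁]
  linarith

end EnergySolution

end

/-! ### Uniform energy bounds by interpolation and Grönwall's inequality -/

section


theorem sob_interpolation {U : Fin 3 → R3 → ℂ} (hU : ∀ j, Measurable (U j)) (k : ℕ) :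
    sob (k + 1) U ^ 2 ≤ sob k U * sob (k + 2) U := by
  have hv := measurable_vn hU
  refine le_trans (le_of_eq ?_) (lintegral_mul_le_n2 (f := fun ξ => κe ξ ^ k * vn U ξ)
    (g := fun ξ => κe ξ ^ (k + 2) * vn U ξ) (by fun_prop) (by fun_prop))
  rw [sob, n2_sq]
  congr 1; ext ξ
  ring

theorem toReal_sob_interpolation {U : Fin 3 → R3 → ℂ} (hU : ∀ j, Measurable (U j)) {k : ℕ}
    (h : sob (k + 2) U < ⊤) :
    (sob (k + 1) U).toReal ^ 2 ≤ (sob k U).toReal * (sob (k + 2) U).toReal := by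
  have hk := (sob_mono U (show k ≤ k + 2 by omega)).trans_lt h
  have := ENNReal.toReal_mono (ENNReal.mul_lt_top hk h).ne (sob_interpolation hU k)
  rwa [ENNReal.toReal_pow, ENNReal.toReal_mul] at this

theorem toReal_sob_sq_le {α : ℝ} (hα : 0 < α) {U : Fin 3 → R3 → ℂ} {e k : ℕ} (h : 2 * k = e + 6)
    (hf : En α e U < ⊤) : (sob k U).toReal ^ 2 ≤ 3 / helc α * (En α e U).toReal := by
  have hc := helc_pos hα
  have := ENNReal.toReal_mono (ENNReal.mul_lt_top ENNReal.ofReal_lt_top hf).ne (sob_sq_le_En hα U h)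
  rwa [ENNReal.toReal_pow, ENNReal.toReal_mul, ENNReal.toReal_ofReal (by positivity)] at this

theorem toReal_En_le (α : ℝ) {U : Fin 3 → R3 → ℂ} {e k : ℕ} (h : 2 * k = e + 6)
    (hf : sob k U < ⊤) : (En α e U).toReal ≤ helC α * (sob k U).toReal ^ 2 := by
  have := ENNReal.toReal_mono (ENNReal.mul_lt_top ENNReal.ofReal_lt_top
    (ENNReal.pow_lt_top hf)).ne (En_le α U h)
  rwa [ENNReal.toReal_mul, ENNReal.toReal_ofReal (helC_pos α).le, ENNReal.toReal_pow] at this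

theorem sob_lt_top_of_En {α : ℝ} (hα : 0 < α) {U : Fin 3 → R3 → ℂ} {e k : ℕ} (h : 2 * k = e + 6)
    (hf : En α e U < ⊤) : sob k U < ⊤ := by
  have := (sob_sq_le_En hα U h).trans_lt (ENNReal.mul_lt_top ENNReal.ofReal_lt_top hf)
  by_contra hcon
  rw [not_lt_top_iff.1 hcon] at this
  simp at this

namespace EnergySolution

variable {α ν B : ℝ}

/-- Grönwall's inequality applied to `energy_le`. The order of the quantifiers matters: `K` is fixed
before the time interval and the solution, and is unaffected by the bound on the `H^{4/3}` norm, so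
it survives as the final time approaches `T*`. -/
theorem exists_energy_bound (hα : 0 < α) (hν : 0 < ν) (hB : 0 ≤ B) {L E₀ : ℝ} (hL : 0 ≤ L)
    (hE₀ : 0 ≤ E₀) : ∃ K, 0 ≤ K ∧ ∀ {t₀ t₁ : ℝ} {U : ℝ → Fin 3 → R3 → ℂ}
    {m r : ℝ → Fin 3 → Fin 3 → R3 → ℂ}, EnergySolution α ν t₀ t₁ B U m r →
    ∀ {b₀ b₁}, t₀ < b₀ → b₀ ≤ b₁ → b₁ < t₁ → b₁ - b₀ ≤ L → (En α 0 (U b₀)).toReal ≤ E₀ →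
      (En α 0 (U b₁)).toReal ≤ K ∧ ∫ t in b₀..b₁, dis U t ≤ K := by
  have hd := cdis_pos hα hν
  have hc : 0 ≤ cen α ν B := cen_nonneg hα hν
  obtain ⟨N, hN⟩ := exists_nat_ge (2 * (cen α ν B * L))
  have h1 : ∀ {t₀ t₁ : ℝ} {U : ℝ → Fin 3 → R3 → ℂ}
    {m r : ℝ → Fin 3 → Fin 3 → R3 → ℂ}, EnergySolution α ν t₀ t₁ B U m r →
    ∀ {b₀ b₁}, t₀ < b₀ → b₀ ≤ b₁ → b₁ < t₁ → b₁ - b₀ ≤ L → (En α 0 (U b₀)).toReal ≤ E₀ →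
      (En α 0 (U b₁)).toReal ≤ 2 ^ N * E₀ := by
    intro t₀ t₁ U m r h b₀ b₁ h₀ h₀₁ h₁ hbL hE
    have hi := (intervalIntegrable_iff_integrableOn_Ioc_of_le h₀₁).2 (h.integrableOn_En_zero h₀ h₁)
    refine gronwall_integral (Z := fun t => (En α 0 (U t)).toReal) (k := fun _ => cen α ν B) h₀₁
      (fun _ => hc) (fun _ => ENNReal.toReal_nonneg) intervalIntegrable_const (hi.mul_const _)
      (fun b hb => ?_) ?_
    · have := h.energy_le hα hν hB h₀ hb.1 (hb.2.trans_lt h₁)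
      have h2 : 0 ≤ ∫ t in b₀..b, dis U t :=
        intervalIntegral.integral_nonneg hb.1 fun t _ => dis_nonneg U t
      rw [intervalIntegral.integral_mul_const]
      nlinarith [mul_nonneg hd.le h2]
    · rw [intervalIntegral.integral_const, smul_eq_mul]
      have := mul_le_mul_of_nonneg_left hbL hc
      linarith
  refine ⟨2 ^ N * E₀ + 2 / cdis α ν * (E₀ + cen α ν B * (L * (2 ^ N * E₀))), by positivity,
    fun {t₀ t₁ U m r} h {b₀ b₁} h₀ h₀₁ h₁ hbL hE => ⟨?_, ?_⟩⟩
  · exact (h1 h h₀ h₀₁ h₁ hbL hE).trans (le_add_of_nonneg_right (by positivity))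
  · have hi := (intervalIntegrable_iff_integrableOn_Ioc_of_le h₀₁).2 (h.integrableOn_En_zero h₀ h₁)
    have h2 := h.energy_le hα hν hB h₀ h₀₁ h₁
    have h3 : ∫ t in b₀..b₁, (En α 0 (U t)).toReal ≤ ∫ _t in b₀..b₁, 2 ^ N * E₀ :=
      intervalIntegral.integral_mono_on h₀₁ hi intervalIntegrable_const fun t ht =>
        h1 h h₀ ht.1 (ht.2.trans_lt h₁) (by linarith [ht.2]) hE
    rw [intervalIntegral.integral_const, smul_eq_mul] at h3
    have h4 : (b₁ - b₀) * (2 ^ N * E₀) ≤ L * (2 ^ N * E₀) :=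
      mul_le_mul_of_nonneg_right hbL (by positivity)
    have h5 := mul_le_mul_of_nonneg_left (h3.trans h4) hc
    have h6 : 0 ≤ (En α 0 (U b₁)).toReal := ENNReal.toReal_nonneg
    have h7 : ∫ t in b₀..b₁, dis U t ≤ 2 / cdis α ν * (E₀ + cen α ν B * (L * (2 ^ N * E₀))) := by
      rw [div_mul_eq_mul_div, le_div_iff₀ hd]
      linarith
    exact h7.trans (le_add_of_nonneg_left (by positivity))

/-- The constant in the higher order energy inequality. -/
def chigh (α ν B : ℝ) : ℝ := 3 * (8 * Real.pi ^ 2 * ν * helC α +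
  3 * (126 * B * (helC α + 1)) ^ 2 / (2 * cdis α ν) + 6 * triC α ^ 2 / cdis α ν)

theorem chigh_nonneg (hα : 0 < α) (hν : 0 < ν) : 0 ≤ chigh α ν B := by
  have := helC_pos α
  have := cdis_pos hα hν
  unfold chigh; positivity

section

variable {t₀ t₁ b₀ b₁ : ℝ} {U : ℝ → Fin 3 → R3 → ℂ} {m r : ℝ → Fin 3 → Fin 3 → R3 → ℂ}

/-- The quadratic term is at most `C ‖u‖²_{H^{5/3}}` times the square root of the `H^{8/3}`
dissipation. Young's inequality absorbs the latter and leaves `‖u‖⁴_{H^{5/3}}`, which interpolation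
between `H^{4/3}` and `H²` bounds by `‖u‖²_{H^{4/3}} ‖u‖²_{H²}`. The last factor is integrable in
time by the first energy inequality. -/
theorem rate_four_le (h : EnergySolution α ν t₀ t₁ B U m r) (hα : 0 < α) (hν : 0 < ν) (hB : 0 ≤ B)
    {t : ℝ} (ht : t ∈ Ioo t₀ t₁) (hf : fullMom (fun ξ => κ ξ ^ (2 * 6)) (U t) < ⊤) (n : ℕ) :
    rate α ν (U t) (m t) (r t) 4 n ≤ chigh α ν B * (1 + (sob 4 (U t)).toReal ^ 2) * dis U t := by
  have h6 := sob_six_lt_top hf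
  have h5 := (sob_mono (U t) (show 5 ≤ 6 by norm_num)).trans_lt h6
  have hs3 := h.sob_lt_top ht (show 3 ≤ 4 by norm_num)
  obtain ⟨hq, hqb⟩ := abs_integral_quadE_le (α := α) (n := n) (e := 4) (s := 5) (c := 8) (a := 5)
    (h.meas t) le_rfl h5 (by norm_num) (by norm_num) (by norm_num) (by norm_num) (by norm_num)
    (by norm_num)
  have key := energy_rate_le (α := α) hν (h.meas t) hs3 (h.meas_m t) (h.meas_r t) (c := 8) (d := 5)
    (e := 4) (n := n) (Rm := B * (sob 6 (U t)).toReal) (by norm_num) (by norm_num) (by norm_num)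
    (mul_nonneg hB ENNReal.toReal_nonneg) (mul_nonneg hB ENNReal.toReal_nonneg) (fun i j => by
      rw [ENNReal.ofReal_mul hB, ENNReal.ofReal_toReal h6.ne]
      exact (n2_κ_mono (by norm_num)).trans (h.m_six t ht h6 i j)) (h.r_le hB ht) hq
  have hE4 : En α 4 (U t) < ⊤ := (En_le α (U t) (k := 5) (by norm_num)).trans_lt
    (ENNReal.mul_lt_top ENNReal.ofReal_lt_top (ENNReal.pow_lt_top h5))
  have hE := (mom_le_toReal (continuous_κ_mul_hel α 4) (κ_mul_hel_nonneg α 4) (h.memLp ht)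
    hE4 n).trans (toReal_En_le α (k := 5) (by norm_num) h5)
  have hN := cutN_sq_le (h.memLp ht) 8 n
  have hN0 := cutN_nonneg (U t) 8 n
  have hc := helc_pos hα
  have hC := helC_pos α
  have hd := cdis_pos hα hν
  have hT := triC_nonneg α
  have h56 : (sob 5 (U t)).toReal ≤ (sob 6 (U t)).toReal :=
    ENNReal.toReal_mono h6.ne (sob_mono _ (by norm_num))
  have h36 : (sob 3 (U t)).toReal ≤ (sob 6 (U t)).toReal :=
    ENNReal.toReal_mono h6.ne (sob_mono _ (by norm_num))
  have hint := toReal_sob_interpolation (h.meas t) (k := 4) h6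
  have hdis : (sob 6 (U t)).toReal ^ 2 ≤ 3 * dis U t := by
    have := ENNReal.toReal_mono (ENNReal.mul_lt_top (by norm_num) hf).ne (sob_sq_le (U t) 6)
    rwa [ENNReal.toReal_pow, ENNReal.toReal_mul, ENNReal.toReal_ofNat] at this
  have hQ := (le_abs_self _).trans hqb
  have z3 : 0 ≤ (sob 3 (U t)).toReal := ENNReal.toReal_nonneg
  have z4 : 0 ≤ (sob 4 (U t)).toReal := ENNReal.toReal_nonneg
  have z5 : 0 ≤ (sob 5 (U t)).toReal := ENNReal.toReal_nonneg
  have z6 : 0 ≤ (sob 6 (U t)).toReal := ENNReal.toReal_nonneg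
  change rate α ν (U t) (m t) (r t) 4 n ≤ -cdis α ν * _ + _ + 126 * _ * cutN (U t) 8 n + _ at key
  refine key.trans ?_
  set s3 := (sob 3 (U t)).toReal
  set s4 := (sob 4 (U t)).toReal
  set s5 := (sob 5 (U t)).toReal
  set s6 := (sob 6 (U t)).toReal
  set N := cutN (U t) 8 n
  set G := 126 * B * (helC α + 1) with hG
  have y1 : 126 * (helC α * (B * s6) + B * s3) * N ≤ G * s6 * N := by
    refine mul_le_mul_of_nonneg_right ?_ hN0
    have := mul_le_mul_of_nonneg_left h36 hB
    rw [hG]; linarith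
  have y2 : G * s6 * N ≤ cdis α ν / 6 * N ^ 2 + 3 * G ^ 2 / (2 * cdis α ν) * s6 ^ 2 := by
    have e : cdis α ν / 6 * N ^ 2 + 3 * G ^ 2 / (2 * cdis α ν) * s6 ^ 2 - G * s6 * N =
      (6 / cdis α ν) * (cdis α ν / 6 * N - G * s6 / 2) ^ 2 := by field_simp; ring
    have : 0 ≤ (6 / cdis α ν) * (cdis α ν / 6 * N - G * s6 / 2) ^ 2 := by positivity
    linarith
  -- With `y2` this spends `cdis / 3` of `N²`, which is exactly the whole truncated dissipation.
  have y3 : 2 * (triC α * s5 ^ 2 * N) ≤ cdis α ν / 6 * N ^ 2 + 6 * triC α ^ 2 / cdis α ν * (s5 ^ 2) ^ 2 := by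
    have e : cdis α ν / 6 * N ^ 2 + 6 * triC α ^ 2 / cdis α ν * (s5 ^ 2) ^ 2 - 2 * (triC α * s5 ^ 2 * N) =
      (6 / cdis α ν) * (cdis α ν / 6 * N - triC α * s5 ^ 2) ^ 2 := by field_simp; ring
    have : 0 ≤ (6 / cdis α ν) * (cdis α ν / 6 * N - triC α * s5 ^ 2) ^ 2 := by positivity
    linarith
  have y4 : (s5 ^ 2) ^ 2 ≤ s4 ^ 2 * s6 ^ 2 := by
    rw [← mul_pow]
    exact pow_le_pow_left₀ (by positivity) hint 2
  have y5 : cdis α ν / 3 * N ^ 2 ≤ cdis α ν * mom (fun ξ => κ ξ ^ (2 * 8)) (U t) n := by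
    have := mul_le_mul_of_nonneg_left hN (show 0 ≤ cdis α ν / 3 by positivity)
    linarith
  have y6 : 8 * Real.pi ^ 2 * ν * mom (fun ξ => κ ξ ^ 4 * hel α ξ) (U t) n ≤
      8 * Real.pi ^ 2 * ν * helC α * s6 ^ 2 := by
    rw [mul_assoc (8 * Real.pi ^ 2 * ν)]
    refine mul_le_mul_of_nonneg_left (hE.trans ?_) (by positivity)
    exact mul_le_mul_of_nonneg_left (pow_le_pow_left₀ z5 h56 2) hC.le
  have y7 := mul_le_mul_of_nonneg_left y4 (show 0 ≤ 6 * triC α ^ 2 / cdis α ν by positivity)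
  set A1 := 8 * Real.pi ^ 2 * ν * helC α + 3 * G ^ 2 / (2 * cdis α ν) with hA1
  set A2 := 6 * triC α ^ 2 / cdis α ν with hA2
  have hA1' : 0 ≤ A1 := by positivity
  have hA2' : 0 ≤ A2 := by positivity
  have y8 : A1 * s6 ^ 2 + A2 * (s4 ^ 2 * s6 ^ 2) ≤ (A1 + A2) * (1 + s4 ^ 2) * s6 ^ 2 := by
    nlinarith [mul_nonneg hA1' (mul_nonneg (sq_nonneg s4) (sq_nonneg s6)), mul_nonneg hA2' (sq_nonneg s6)]
  have y9 : (A1 + A2) * (1 + s4 ^ 2) * s6 ^ 2 ≤ (A1 + A2) * (1 + s4 ^ 2) * (3 * dis U t) :=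
    mul_le_mul_of_nonneg_left hdis (by positivity)
  have y10 : (A1 + A2) * (1 + s4 ^ 2) * (3 * dis U t) = chigh α ν B * (1 + s4 ^ 2) * dis U t := by
    rw [chigh, ← hG, ← hA1, ← hA2]; ring
  rw [← y10]
  have y11 : A1 * s6 ^ 2 = 8 * Real.pi ^ 2 * ν * helC α * s6 ^ 2 + 3 * G ^ 2 / (2 * cdis α ν) * s6 ^ 2 := by
    rw [hA1]; ring
  linarith

theorem mom_four_le (h : EnergySolution α ν t₀ t₁ B U m r) (hα : 0 < α) (hν : 0 < ν) (hB : 0 ≤ B)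
    (h₀ : t₀ < b₀) (h₀₁ : b₀ ≤ b₁) (h₁ : b₁ < t₁) (hf : En α 4 (U b₀) < ⊤) {φ : ℝ → ℝ}
    (hφ : IntegrableOn φ (Ioc b₀ b₁))
    (hle : ∀ t ∈ Ioc b₀ b₁, fullMom (fun ξ => κ ξ ^ (2 * 6)) (U t) < ⊤ →
      chigh α ν B * (1 + (sob 4 (U t)).toReal ^ 2) * dis U t ≤ φ t) (n : ℕ) :
    mom (fun ξ => κ ξ ^ 4 * hel α ξ) (U b₁) n ≤ (En α 4 (U b₀)).toReal + ∫ t in b₀..b₁, φ t := by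
  have hsub' : Ioc b₀ b₁ ⊆ Ioo t₀ t₁ := fun t ht => ⟨h₀.trans ht.1, ht.2.trans_lt h₁⟩
  obtain ⟨C, hC⟩ := h.exists_abs_rate_le 4 n
  have key := ftc_le_of_ae (φ := φ) (fun t ht => h.hasDerivAt_mom 4 n ht) hC h₀ h₀₁ h₁
    ((intervalIntegrable_iff_integrableOn_Ioc_of_le h₀₁).2 hφ) (by
      filter_upwards [h.ae_fullMom_lt_top hα hν hB h₀ h₀₁ h₁] with t ht hmem
      have hmem' := Ioo_subset_Ioc_self hmem
      exact (h.rate_four_le hα hν hB (hsub' hmem') (ht hmem') n).trans (hle t hmem' (ht hmem')))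
  have := mom_le_toReal (continuous_κ_mul_hel α 4) (κ_mul_hel_nonneg α 4)
    (h.memLp ⟨h₀, h₀₁.trans_lt h₁⟩) hf n
  change _ ≤ (En α 4 (U b₀)).toReal at this
  linarith

theorem En_four_le_of_mom (h : EnergySolution α ν t₀ t₁ B U m r) (hb : b₁ ∈ Ioo t₀ t₁) {K : ℝ}
    (hK : ∀ n, mom (fun ξ => κ ξ ^ 4 * hel α ξ) (U b₁) n ≤ K) : En α 4 (U b₁) ≤ ENNReal.ofReal K := by
  rw [En, ← iSup_mom (continuous_κ_mul_hel α 4) (κ_mul_hel_nonneg α 4) (h.meas b₁) (h.memLp hb)]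
  exact iSup_le fun n => ENNReal.ofReal_le_ofReal (hK n)

end

/-- The same differential inequality is used twice. With the non-uniform bound on `H^{4/3}` it shows
that the energy stays finite and bounded, which makes Grönwall's inequality applicable. With
interpolation it yields the coefficient `k = K' dis`, whose integral is bounded uniformly by the
first energy. -/
theorem exists_high_energy_bound (hα : 0 < α) (hν : 0 < ν) (hB : 0 ≤ B) {L E₀ Y₀ : ℝ} (hL : 0 ≤ L)
    (hE₀ : 0 ≤ E₀) : ∃ K, ∀ {t₀ t₁ : ℝ} {U : ℝ → Fin 3 → R3 → ℂ}
    {m r : ℝ → Fin 3 → Fin 3 → R3 → ℂ}, EnergySolution α ν t₀ t₁ B U m r →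
    ∀ {b₀ b₁}, t₀ < b₀ → b₀ ≤ b₁ → b₁ < t₁ → b₁ - b₀ ≤ L → (En α 0 (U b₀)).toReal ≤ E₀ →
      En α 4 (U b₀) < ⊤ → (En α 4 (U b₀)).toReal ≤ Y₀ → En α 4 (U b₁) ≤ ENNReal.ofReal K := by
  obtain ⟨Es, hEs0, hEs⟩ := exists_energy_bound (B := B) hα hν hB hL hE₀
  have hch : 0 ≤ chigh α ν B := chigh_nonneg hα hν
  have hcc := helc_pos hα
  set K' := chigh α ν B * (1 + 3 / (2 * helc α)) with hK'
  have hK'0 : 0 ≤ K' := by positivity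
  obtain ⟨N, hN⟩ := exists_nat_ge (2 * (K' * Es))
  refine ⟨2 ^ N * (1 + Es + Y₀), fun {t₀ t₁ U m r} h {b₀ b₁} h₀ h₀₁ h₁ hbL hE hf hY => ?_⟩
  have hsub : Icc b₀ b₁ ⊆ Ioo t₀ t₁ := fun t ht => ⟨h₀.trans_le ht.1, ht.2.trans_lt h₁⟩
  have hdis := h.integrableOn_dis hα hν hB h₀ h₀₁ h₁
  obtain ⟨M, hM0, hM⟩ := h.bound
  -- First pass: `M` may depend on the time interval, and the resulting bound `W` is used only
  -- qualitatively.
  let φ : ℝ → ℝ := fun t => chigh α ν B * (1 + M ^ 2) * dis U t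
  have hφ : IntegrableOn φ (Ioc b₀ b₁) := hdis.const_mul _
  have hφ0 : ∀ t, 0 ≤ φ t := fun t => mul_nonneg (by positivity) (dis_nonneg U t)
  set W := (En α 4 (U b₀)).toReal + ∫ t in b₀..b₁, φ t with hW
  have hbd : ∀ b ∈ Icc b₀ b₁, En α 4 (U b) ≤ ENNReal.ofReal W := fun b hb => by
    refine h.En_four_le_of_mom (hsub hb) fun n => ?_
    refine (h.mom_four_le hα hν hB h₀ hb.1 (hb.2.trans_lt h₁) hf
      (hφ.mono_set (Ioc_subset_Ioc_right hb.2)) (fun t ht _ => ?_) n).trans ?_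
    · have hs : (sob 4 (U t)).toReal ≤ M := ENNReal.toReal_le_of_le_ofReal hM0
        (hM t (hsub ⟨ht.1.le, ht.2.trans hb.2⟩))
      have := pow_le_pow_left₀ ENNReal.toReal_nonneg hs 2
      refine mul_le_mul_of_nonneg_right (mul_le_mul_of_nonneg_left (by linarith) hch) (dis_nonneg U t)
    · rw [hW, intervalIntegral.integral_of_le hb.1, intervalIntegral.integral_of_le h₀₁]
      refine add_le_add le_rfl (setIntegral_mono_set hφ (ae_of_all _ hφ0) ?_)
      exact (Ioc_subset_Ioc_right hb.2).eventuallyLE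
  have hfin : ∀ b ∈ Icc b₀ b₁, En α 4 (U b) < ⊤ := fun b hb =>
    (hbd b hb).trans_lt ENNReal.ofReal_lt_top
  have hW0 : 0 ≤ W := add_nonneg ENNReal.toReal_nonneg
    (intervalIntegral.integral_nonneg h₀₁ fun t _ => hφ0 t)
  -- The constant `1 + Es` is included so that `1 + ‖u‖²_{H^{4/3}}`, bounded through interpolation
  -- by `H¹` and `H^{5/3}`, is at most a fixed multiple of `Z`.
  let Z : ℝ → ℝ := fun t => 1 + Es + (En α 4 (U t)).toReal
  let k : ℝ → ℝ := fun t => K' * dis U t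
  have hk : IntegrableOn k (Ioc b₀ b₁) := hdis.const_mul K'
  have hZm : AEStronglyMeasurable Z (volume.restrict (Ioc b₀ b₁)) :=
    aestronglyMeasurable_const.add (h.aemeasurable_fullMom_Ioc (continuous_κ_mul_hel α 4)
      (κ_mul_hel_nonneg α 4) h₀ h₁).ennreal_toReal.aestronglyMeasurable
  have hZk : IntegrableOn (fun t => Z t * k t) (Ioc b₀ b₁) := by
    refine Integrable.bdd_mul (c := 1 + Es + W) hk hZm ?_
    refine (ae_restrict_iff' measurableSet_Ioc).2 (ae_of_all _ fun t ht => ?_)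
    rw [Real.norm_of_nonneg (add_nonneg (by linarith) ENNReal.toReal_nonneg)]
    exact add_le_add le_rfl (ENNReal.toReal_le_of_le_ofReal hW0 (hbd t (Ioc_subset_Icc_self ht)))
  have hle : ∀ t ∈ Ioc b₀ b₁, chigh α ν B * (1 + (sob 4 (U t)).toReal ^ 2) * dis U t ≤ Z t * k t := by
    intro t ht
    have ht' := Ioc_subset_Icc_self ht
    have e3 := toReal_sob_sq_le hα (U := U t) (e := 0) (k := 3) (by norm_num)
      (h.En_zero_lt_top (hsub ht'))
    have e5 := toReal_sob_sq_le hα (U := U t) (e := 4) (k := 5) (by norm_num) (hfin t ht')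
    have e4 := toReal_sob_interpolation (h.meas t) (k := 3)
      (sob_lt_top_of_En hα (k := 5) (by norm_num) (hfin t ht'))
    have eE := (hEs h h₀ ht'.1 (ht'.2.trans_lt h₁) (by linarith [ht'.2]) hE).1
    have eE' := mul_le_mul_of_nonneg_left eE (show 0 ≤ 3 / helc α by positivity)
    have e6 : (sob 4 (U t)).toReal ^ 2 ≤ 3 / (2 * helc α) * (Es + (En α 4 (U t)).toReal) := by
      have e7 : 3 / (2 * helc α) * (Es + (En α 4 (U t)).toReal) =
        (3 / helc α * Es + 3 / helc α * (En α 4 (U t)).toReal) / 2 := by field_simp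
      rw [e7]
      nlinarith [sq_nonneg ((sob 3 (U t)).toReal - (sob 5 (U t)).toReal)]
    have hY0 : 0 ≤ (En α 4 (U t)).toReal := ENNReal.toReal_nonneg
    have e8 : 1 + (sob 4 (U t)).toReal ^ 2 ≤ (1 + 3 / (2 * helc α)) * Z t := by
      have : 0 ≤ 3 / (2 * helc α) := by positivity
      simp only [Z]
      nlinarith
    calc _ ≤ chigh α ν B * ((1 + 3 / (2 * helc α)) * Z t) * dis U t :=
          mul_le_mul_of_nonneg_right (mul_le_mul_of_nonneg_left e8 hch) (dis_nonneg U t)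
      _ = _ := by simp only [k, hK']; ring
  have hZ1 : Z b₁ ≤ 2 ^ N * (1 + Es + Y₀) := by
    refine gronwall_integral (Z := Z) (k := k) h₀₁ (fun t => mul_nonneg hK'0 (dis_nonneg U t))
      (fun t => add_nonneg (by linarith) ENNReal.toReal_nonneg)
      ((intervalIntegrable_iff_integrableOn_Ioc_of_le h₀₁).2 hk)
      ((intervalIntegrable_iff_integrableOn_Ioc_of_le h₀₁).2 hZk) (fun b hb => ?_) ?_
    · have hlim := tendsto_mom (continuous_κ_mul_hel α 4) (κ_mul_hel_nonneg α 4) (h.meas b)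
        (h.memLp (hsub hb)) (hfin b hb)
      have := le_of_tendsto' hlim (h.mom_four_le hα hν hB h₀ hb.1 (hb.2.trans_lt h₁) hf
        (hZk.mono_set (Ioc_subset_Ioc_right hb.2)) fun t ht _ => hle t ⟨ht.1, ht.2.trans hb.2⟩)
      change (En α 4 (U b)).toReal ≤ _ at this
      simp only [Z] at this ⊢
      linarith
    · have := (hEs h h₀ h₀₁ h₁ hbL hE).2
      simp only [k]
      rw [intervalIntegral.integral_const_mul]
      have := mul_le_mul_of_nonneg_left this hK'0
      linarith
  rw [← ENNReal.ofReal_toReal (hfin b₁ ⟨h₀₁, le_rfl⟩).ne]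
  refine ENNReal.ofReal_le_ofReal (le_trans ?_ hZ1)
  simp only [Z]
  linarith

end EnergySolution

end

/-! ### From the modified LANS equation to the energy estimates -/

section


variable {ψ : 𝓢(R3, ℝ)} {α ν p : ℝ} {q : ℝ≥0∞} {a₀ Tstar : ℝ} {v u : ℝ → R3 → R3}

/-- A solution of the modified LANS equation is a solution on the Fourier side, with bounds for the
linear terms which are uniform in time. -/
theorem IsMLANSSolution.exists_energySolution (hu : IsMLANSSolution α ν Tstar v u)
    (hψ : IsLittlewoodPaley ψ) (hp : 3 < p) (hq : 1 ≤ q) (ha : 0 < a₀)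
    (hv : ∀ r : ℝ, 3 / p < r →
      WeightedBesov ψ ((r - 3 / p) / 2) r (ENNReal.ofReal p) q Tstar v)
    (huB : ∀ T : ℝ, T < Tstar → BCBesov ψ (3 / 2) 2 q T u) :
    ∃ B, 0 ≤ B ∧ ∃ m r : ℝ → Fin 3 → Fin 3 → R3 → ℂ, ∀ T < Tstar,
      EnergySolution α ν a₀ T B (fun t => vft (u t)) m r := by
  obtain ⟨hdiv, Du, Dv, hDu, hDv, hweak⟩ := hu
  obtain ⟨C₀, hC₀, hg⟩ := hψ.exists_smooth_weighted hp hq ha hv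
  obtain ⟨C₁, hC₁, hs4⟩ := hψ.sob_le_besovNorm hq
  have hα2 := sq_nonneg α
  -- Here `1250 = 2 · 25²` comes from two products with `v` in `H²`, and the second summand from the
  -- stress. The constant depends on `v` alone and is chosen before `T`.
  refine ⟨1250 * C₀ + 504 * α ^ 2 * C₀, by positivity, fun t => linM (u t) (v t),
    fun t => linS α (Du t) (Dv t), fun T hT => ?_⟩
  obtain ⟨⟨hmem, -⟩, hsup⟩ := huB T hT
  have hin : ∀ t ∈ Ioo a₀ T, t ∈ Ico 0 T := fun t ht => ⟨(ha.trans ht.1).le, ht.2⟩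
  have hin' : ∀ t ∈ Ioo a₀ T, t ∈ Ioo 0 Tstar := fun t ht => ⟨ha.trans ht.1, ht.2.trans hT⟩
  have hgt : ∀ t ∈ Ioo a₀ T, t ∈ Ico a₀ Tstar := fun t ht => ⟨ht.1.le, ht.2.trans hT⟩
  have hL : ∀ t ∈ Ioo a₀ T, MemLp (u t) 2 volume := fun t ht => (hmem t (hin t ht)).1
  -- This bound depends on `T`. It enters only the qualitative fields of the structure and not the
  -- constant `B`.
  set S : ℝ≥0∞ := C₁ * ⨆ t ∈ Ico (0 : ℝ) T, besovNorm ψ (3 / 2) 2 q (u t) with hS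
  have hSt : S < ⊤ := ENNReal.mul_lt_top hC₁.lt_top hsup
  have hsS : ∀ t ∈ Ioo a₀ T, ∀ k ≤ 4, sob k (vft (u t)) ≤ S := fun t ht k hk =>
    (sob_mono _ hk).trans ((hs4 (u t) (hL t ht)).trans (mul_le_mul_right
      (le_iSup₂ (f := fun t (_ : t ∈ Ico (0 : ℝ) T) => besovNorm ψ (3 / 2) 2 q (u t)) t (hin t ht)) _))
  have hst : ∀ t ∈ Ioo a₀ T, ∀ k ≤ 4, sob k (vft (u t)) < ⊤ := fun t ht k hk =>
    (hsS t ht k hk).trans_lt hSt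
  have hB1 : (2 * (25 ^ 1 * ENNReal.ofReal C₀)) ≤ ENNReal.ofReal (1250 * C₀ + 504 * α ^ 2 * C₀) := by
    rw [show (2 * (25 ^ 1 * ENNReal.ofReal C₀) : ℝ≥0∞) = ENNReal.ofReal (50 * C₀) by
      rw [ENNReal.ofReal_mul (by norm_num), ENNReal.ofReal_ofNat]; ring]
    refine ENNReal.ofReal_le_ofReal ?_
    nlinarith [mul_nonneg hα2 hC₀]
  have hB2 : (2 * (25 ^ 2 * ENNReal.ofReal C₀)) ≤ ENNReal.ofReal (1250 * C₀ + 504 * α ^ 2 * C₀) := by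
    rw [show (2 * (25 ^ 2 * ENNReal.ofReal C₀) : ℝ≥0∞) = ENNReal.ofReal (1250 * C₀) by
      rw [ENNReal.ofReal_mul (by norm_num), ENNReal.ofReal_ofNat]; ring]
    refine ENNReal.ofReal_le_ofReal ?_
    nlinarith [mul_nonneg hα2 hC₀]
  have hB3 : ENNReal.ofReal (504 * α ^ 2 * C₀) ≤ ENNReal.ofReal (1250 * C₀ + 504 * α ^ 2 * C₀) :=
    ENNReal.ofReal_le_ofReal (by linarith)
  let F : ℝ≥0∞ := Kinv * (S * S) + 2 * ENNReal.ofReal C₀ * S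
  let G : ℝ≥0∞ := Kinv * (ENNReal.ofReal (α ^ 2) * (3 * ((14 * S) * (14 * S)))) +
    ENNReal.ofReal (504 * α ^ 2 * C₀) * S
  have hK := Kinv_lt_top.ne
  have hS' := hSt.ne
  refine ⟨fun t => measurable_vft (u t), fun t i j => measurable_ft _, fun t i j => measurable_ft _,
    ?_, fun t ht => ?_, ⟨S.toReal, ENNReal.toReal_nonneg, fun t ht => ?_⟩, fun t ht i j => ?_,
    fun t ht h6 i j => ?_, fun t ht i j => ?_⟩
  · refine spectralSolution_of_weakEq hweak ha.le hT.le (fun t ht j => memLp_coord (hL t ht) j)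
      (fun t ht => hdiv t ⟨(ha.trans ht.1).le, ht.2.trans hT⟩)
      (fun t ht i j => ?_) (fun t ht i j => ?_) (C := S + F + G) (by finiteness)
      (fun t ht j => ?_) (fun t ht i j => ?_) (fun t ht i j => ?_)
    · obtain ⟨g, hvg, hgs, hgb⟩ := hg t (hgt t ht)
      exact isDFT_flux (hL t ht) hvg hgs hgb i j
    · obtain ⟨g, hvg, hgs, hgb⟩ := hg t (hgt t ht)
      exact isDFT_stress (hL t ht) (hst t ht 3 (by norm_num)) (hDu t (hin' t ht)) (hDv t (hin' t ht))
        hvg hgs hC₀ hgb i j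
    · have h1 := (isFT_vft (hL t ht) j).n2_eq
      have h2 := n2_coord_le_sob (vft (u t)) 0 j
      simp only [pow_zero, one_mul] at h2
      rw [← h1, add_assoc]
      exact (h2.trans (hsS t ht 0 (by norm_num))).trans le_self_add
    · obtain ⟨g, hvg, hgs, hgb⟩ := hg t (hgt t ht)
      have h0 := hsS t ht 0 (by norm_num)
      refine (eLpNorm_flux_le (hL t ht) hvg hgs hgb (hst t ht 0 (by norm_num)) i j).trans
        (le_trans (b := F) ?_ (le_add_left le_rfl |>.trans le_self_add))
      exact add_le_add (mul_le_mul_right (mul_le_mul' h0 h0) _) (mul_le_mul_right h0 _)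
    · obtain ⟨g, hvg, hgs, hgb⟩ := hg t (hgt t ht)
      have h3 := hsS t ht 3 (by norm_num)
      have h14 : 14 * sob 3 (vft (u t)) ≤ 14 * S := mul_le_mul_right h3 _
      refine (eLpNorm_stress_le (hL t ht) (hst t ht 3 (by norm_num)) (hDu t (hin' t ht))
        (hDv t (hin' t ht)) hvg hgs hC₀ hgb i j).trans (le_trans (b := G) ?_ (le_add_left le_rfl))
      exact add_le_add (mul_le_mul_right (mul_le_mul_right (mul_le_mul_right
        (mul_le_mul' h14 h14) _) _) _) (mul_le_mul_right h3 _)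
  · rw [ae_all_iff]
    exact fun l => (isFT_vft (hL t ht) l).hermitian
  · rw [ENNReal.ofReal_toReal hS']
    exact hsS t ht 4 le_rfl
  · obtain ⟨g, hvg, hgs, hgb⟩ := hg t (hgt t ht)
    exact (n2_linM_le (hL t ht) hvg hgs hgb i j (n := 1) (by norm_num)
      (hst t ht 3 (by norm_num))).trans (mul_le_mul_left hB1 _)
  · obtain ⟨g, hvg, hgs, hgb⟩ := hg t (hgt t ht)
    exact (n2_linM_le (hL t ht) hvg hgs hgb i j (n := 2) le_rfl h6).trans (mul_le_mul_left hB2 _)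
  · obtain ⟨g, hvg, hgs, hgb⟩ := hg t (hgt t ht)
    exact (isFT_linS (hL t ht) (hst t ht 3 (by norm_num)) (hDu t (hin' t ht)) (hDv t (hin' t ht))
      hvg hgs hC₀ hgb i j).2.trans (mul_le_mul_left hB3 _)

/-- There is a time in any short interval at which the solution has two more derivatives. -/
theorem EnergySolution.exists_regular_time {t₀ t₁ B : ℝ} {U : ℝ → Fin 3 → R3 → ℂ}
    {m r : ℝ → Fin 3 → Fin 3 → R3 → ℂ} (h : EnergySolution α ν t₀ t₁ B U m r) (hα : 0 < α)
    (hν : 0 < ν) (hB : 0 ≤ B) {b₀ b₁ : ℝ} (h₀ : t₀ < b₀) (h₀₁ : b₀ < b₁) (h₁ : b₁ < t₁) :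
    ∃ b ∈ Ioc b₀ b₁, En α 4 (U b) < ⊤ := by
  by_contra! hcon
  have hae := h.ae_fullMom_lt_top hα hν hB h₀ h₀₁.le h₁
  -- Finite dissipation at almost every time means `H²` regularity there, which is more than the
  -- second energy needs. An interval on which that energy is always infinite would therefore be
  -- null.
  have hnull : ∀ᵐ t, t ∉ Ioc b₀ b₁ := by
    filter_upwards [hae] with t ht hmem
    have h6 := EnergySolution.sob_six_lt_top (ht hmem)
    have h5 := (sob_mono (U t) (show 5 ≤ 6 by norm_num)).trans_lt h6
    have := (En_le α (U t) (e := 4) (k := 5) (by norm_num)).trans_lt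
      (ENNReal.mul_lt_top ENNReal.ofReal_lt_top (ENNReal.pow_lt_top h5))
    exact this.not_ge (hcon t hmem)
  rw [ae_iff] at hnull
  simp only [not_not, ofPred_mem_eq, Real.volume_Ioc, ENNReal.ofReal_eq_zero] at hnull
  linarith

end

end MLANS

end

/-! ### Conclusion -/

theorem mainTheorem5
    (ψ : 𝓢(R3, ℝ)) (hψ : IsLittlewoodPaley ψ)
    (α ν : ℝ) (hα : 0 < α) (hν : 0 < ν)
    (p : ℝ) (hp : 3 < p) (q : ℝ≥0∞) (hq : 1 ≤ q)
    (a Tstar : ℝ) (ha : 0 < a) (haT : a < Tstar)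
    (v : ℝ → R3 → R3)
    (hv : IsLANSSolution α ν Tstar v)
    (hv_BC : BCBesov ψ (3 / p) (ENNReal.ofReal p) q Tstar v)
    (hv_weighted : ∀ r : ℝ, 3 / p < r →
      WeightedBesov ψ ((r - 3 / p) / 2) r (ENNReal.ofReal p) q Tstar v)
    (u : ℝ → R3 → R3)
    (hu : IsMLANSSolution α ν Tstar v u)
    (hu_BC : ∀ T : ℝ, T < Tstar → BCBesov ψ (3 / 2) 2 q T u)
    (hu_H3 : ∀ t ∈ Ico a Tstar, MemH 3 (u t)) :
    ∃ K : ℝ, ∀ t ∈ Ico a Tstar, besovNorm ψ (3 / 2) 2 q (u t) ≤ ENNReal.ofReal K := by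
  have ha2 : 0 < a / 2 := by linarith
  obtain ⟨B, hB, m, r, hsol⟩ := hu.exists_energySolution hψ hp hq ha2 hv_weighted hu_BC
  obtain ⟨C, hC, hbes⟩ := hψ.besovNorm_le_sob hq
  -- The initial time is sought strictly between `a / 2`, where the estimates for `v` begin, and
  -- `a`, so that the bound holds on all of `[a, T*)`.
  obtain ⟨b, hb, hfin⟩ := (hsol ((a + Tstar) / 2) (by linarith)).exists_regular_time hα hν hB
    (b₀ := 2 * a / 3) (b₁ := a) (by linarith) (by linarith) (by linarith)
  obtain ⟨K, hK⟩ := EnergySolution.exists_high_energy_bound (B := B) hα hν hB (L := Tstar)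
    (E₀ := (En α 0 (vft (u b))).toReal) (Y₀ := (En α 4 (vft (u b))).toReal) (by linarith)
    ENNReal.toReal_nonneg
  have hfinal : ∀ t ∈ Ico a Tstar, sob 5 (vft (u t)) ^ 2 ≤
      ENNReal.ofReal (3 / helc α) * ENNReal.ofReal K := fun t ht => by
    -- The solution is restricted to a time interval ending between `t` and `T*`. As `K` does not
    -- depend on this interval, the bound is uniform in `t`.
    have h1 := hK (hsol ((t + Tstar) / 2) (by linarith [ht.2])) (b₀ := b) (b₁ := t)
      (by linarith [hb.1]) (hb.2.trans ht.1) (by linarith [ht.2]) (by linarith [ht.2, hb.1])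
      le_rfl hfin le_rfl
    exact (sob_sq_le_En hα (vft (u t)) (e := 4) (k := 5) (by norm_num)).trans
      (mul_le_mul_right h1 _)
  -- The summand `1` comes from `x ≤ 1 + x²`, which avoids taking a square root of the bound for the
  -- squared norm.
  have hlt : C * (1 + ENNReal.ofReal (3 / helc α) * ENNReal.ofReal K) ≠ ⊤ := by finiteness
  refine ⟨(C * (1 + ENNReal.ofReal (3 / helc α) * ENNReal.ofReal K)).toReal, fun t ht => ?_⟩
  rw [ENNReal.ofReal_toReal hlt]
  obtain ⟨⟨hmem, -⟩, -⟩ := hu_BC ((t + Tstar) / 2) (by linarith [ht.2])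
  refine (hbes (u t) (hmem t ⟨by linarith [ht.1], by linarith [ht.2]⟩).1).trans
    (mul_le_mul_right ?_ C)
  refine le_trans ?_ (add_le_add_right (hfinal t ht) 1)
  rcases le_total (sob 5 (vft (u t))) 1 with h | h
  · exact h.trans le_self_add
  · exact (le_self_pow₀ h two_ne_zero).trans le_add_self
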